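/- Let $n\in\mathbb N_0$ and $d,\nu\in\mathbb R$. Write $z=(x,\xi)\in\mathbb R^{2n}$, $\langle z\rangle=(1+|z|^2)^{1/2}$, $\langle z,\mu\rangle=(1+|z|^2+\mu^2)^{1/2}$, $\overline{\mathbb R}_+=[0,\infty)$. Fix a smooth positive function $[z,\mu]$ on $\mathbb R^{2n}\times\overline{\mathbb R}_+$ with $[z,\mu]=|(z,\mu)|$ whenever $|(z,\mu)|\ge1$, and a zero-excision function $\chi(z)$ (smooth, real-valued, $0$ near $z=0$ and $1$ outside a compact set). **Symbol classes.** $\Gamma^{\nu}_{1,0}(\mathbb R^{2n})$ consists of the smooth $p:\mathbb R^{2n}\to\mathbb C$ with $|\partial_z^\alpha p(z)|\le C_\alpha\langle z\rangle^{\nu-|\alpha|}$ for all $\alpha$. $\widetilde\Gamma^{d,\nu}_{1,0}$ consists of the smooth $a:\mathbb R^{2n}\times\overline{\mathbb R}_+\to\mathbb C$ with $|\partial_z^\alpha\partial_\mu^j a(z,\mu)|\le C_{\alpha j}\langle z\rangle^{\nu-|\alpha|}\langle z,\mu\rangle^{d-\nu-j}$ for all $\alpha,j$. $\mathbf{\widetilde\Gamma}^{d,\nu}_{1,0}$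 consists of those $a\in\widetilde\Gamma^{d,\nu}_{1,0}$ for which there are $a^\infty_{[d,\nu+j]}\in\Gamma^{\nu+j}_{1,0}(\mathbb R^{2n})$, $j\in\mathbb N_0$, with $$a(z,\mu)-\sum_{j=0}^{N-1}a^\infty_{[d,\nu+j]}(z)\,[z,\mu]^{d-\nu-j}\in\widetilde\Gamma^{d,\nu+N}_{1,0}\qquad\text{for all }N\in\mathbb N_0;$$ $a^\infty_{[d,\nu]}$ is the principal limit symbol of $a$. **Poly-homogeneous symbols.** $\mathbf{\widetilde\Gamma}^{d,\nu}_{\mathrm{hom}}$ consists of the functions $h(z,\mu)$, smooth on $\{z\ne0,\ \mu\ge0\}$, with $h(tz,t\mu)=t^d h(z,\mu)$ for $t>0$, such that $(r,\phi)\mapsto r^{-\nu}h(r\phi,\sqrt{1-r^2})$ extends from $(0,1)\times\mathbb S^{2n-1}$ to a smooth function on $[0,1)\times\mathbb S^{2n-1}$; the angular symbol of $h$ is $h_{\langle\nu\rangle}(z)=|z|^\nu\lim_{r\to0+}r^{-\nu}h(rz/|z|,\sqrt{1-r^2})$, $z\ne0$. A symbol $a\in\mathbf{\widetilde\Gamma}^{d,\nu}_{1,0}$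 is poly-homogeneous, $a\in\mathbf{\widetilde\Gamma}^{d,\nu}$, if there are $a^{(d-j,\nu-j)}\in\mathbf{\widetilde\Gamma}^{d-j,\nu-j}_{\mathrm{hom}}$ with $a-\chi\sum_{j=0}^{N-1}a^{(d-j,\nu-j)}\in\mathbf{\widetilde\Gamma}^{d-N,\nu-N}_{1,0}$ for all $N\in\mathbb N_0$. Then $a^{(d,\nu)}$ is its homogeneous principal symbol and $a_{\langle\nu\rangle}:=(a^{(d,\nu)})_{\langle\nu\rangle}$ its principal angular symbol. **Formal adjoint.** For $p:\mathbb R^{2n}\to\mathbb C$ and Schwartz functions $u$ let $[p(x,D)u](x)=(2\pi)^{-n}\int e^{ix\xi}p(x,\xi)\widehat u(\xi)\,d\xi$ with $\widehat u(\xi)=\int e^{-iy\xi}u(y)\,dy$, and let $$p^{(*)}(x,\xi)=(2\pi)^{-n}\iint e^{-iy\eta}\,\overline{p(x+y,\xi+\eta)}\,dy\,d\eta$$ as an oscillatory integral, i.e. the limit for $\varepsilon\to0+$ of the integrals with the additional factor $\varphi(\varepsilon y,\varepsilon\eta)$, which has to exist and be the same for all Schwartz functions $\varphi$ with $\varphi(0,0)=1$.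 For $\mu$-dependent symbols, $a^{(*)}$ is formed for each $\mu$ separately. **Theorem.** Let $a\in\mathbf{\widetilde\Gamma}^{d,\nu}_{1,0}$. 1. For each $\mu\ge0$ the oscillatory integral defining $a^{(*)}(\cdot,\mu)$ converges everywhere, and $a^{(*)}(x,D,\mu)$ is the formal adjoint of $a(x,D,\mu)$: $(a(x,D,\mu)u,v)_{L^2}=(u,a^{(*)}(x,D,\mu)v)_{L^2}$ for all Schwartz functions $u,v$ on $\mathbb R^n$. 2. $a^{(*)}\in\mathbf{\widetilde\Gamma}^{d,\nu}_{1,0}$. 3. $(a^{(*)})^\infty_{[d,\nu]}=(a^\infty_{[d,\nu]})^{(*)}$, where again the oscillatory integral converges everywhere and $(a^\infty_{[d,\nu]})^{(*)}(x,D)$ is the formal adjoint of $a^\infty_{[d,\nu]}(x,D)$. 4. If $a$ is poly-homogeneous, then so is $a^{(*)}$, with $(a^{(*)})^{(d,\nu)}=\overline{a^{(d,\nu)}}$ on $\{z\ne0,\ \mu\ge0\}$ and $(a^{(*)})_{\langle\nu\rangle}=\overline{a_{\langle\nu\rangle}}$ on $\{z\neq0\}$. -/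

import Mathlib

open MeasureTheory Set Filter Topology
open scoped ContDiff SchwartzMap ComplexConjugate

noncomputable section

namespace Shubin

section SymbolClasses

variable {E : Type*} [NormedAddCommGroup E] [InnerProductSpace ℝ E]

/-- The Japanese bracket `⟨z⟩ = (1 + |z|²)^{1/2}`. -/
def jap (z : E) : ℝ := Real.sqrt (1 + ‖z‖ ^ 2)

/-- The Euclidean length `|(z, μ)|`. -/
def len (z : E) (μ : ℝ) : ℝ := Real.sqrt (‖z‖ ^ 2 + μ ^ 2)

/-- The parameter-dependent Japanese bracket `⟨z, μ⟩ = (1 + |z|² + μ²)^{1/2}`. -/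
def japPar (z : E) (μ : ℝ) : ℝ := Real.sqrt (1 + ‖z‖ ^ 2 + μ ^ 2)

/-- The class `S^d_{1,0}(E)`; the norm of the `k`-th derivative controls all partial derivatives
of order `k`. -/
def MemS (d : ℝ) (a : E → ℂ) : Prop :=
  ContDiff ℝ ∞ a ∧
    ∀ k : ℕ, ∃ C : ℝ, ∀ z : E, ‖iteratedFDeriv ℝ k a z‖ ≤ C * jap z ^ (d - k)

/-- The class `S̃^{d,ν}_{1,0}(E × [0,∞))` of symbols with regularity number `ν`. A symbol is a
function `a z μ`, of which only the values for `μ ≥ 0` matter; it is smooth up to `μ = 0`. -/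
def MemSTilde (d ν : ℝ) (a : E → ℝ → ℂ) : Prop :=
  ContDiffOn ℝ ∞ (fun p : E × ℝ => a p.1 p.2) (univ ×ˢ Ici 0) ∧
    ∀ k j : ℕ, ∃ C : ℝ, ∀ z : E, ∀ μ : ℝ, 0 ≤ μ →
      ‖iteratedFDeriv ℝ k (fun z' => iteratedDerivWithin j (a z') (Ici 0) μ) z‖
        ≤ C * jap z ^ (ν - k) * japPar z μ ^ (d - ν - j)

/-- `br z μ` is a function `[z, μ]`: smooth, positive and equal to `|(z, μ)|` wherever the latter is
at least one. -/
structure IsSmoothedLength (br : E → ℝ → ℝ) : Prop where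
  smooth : ContDiffOn ℝ ∞ (fun p : E × ℝ => br p.1 p.2) (univ ×ˢ Ici 0)
  pos : ∀ z : E, ∀ μ : ℝ, 0 ≤ μ → 0 < br z μ
  eq_len : ∀ z : E, ∀ μ : ℝ, 0 ≤ μ → 1 ≤ len z μ → br z μ = len z μ

/-- A zero-excision function: smooth, zero near the origin, one near infinity. -/
structure IsZeroExcision (χ : E → ℝ) : Prop where
  smooth : ContDiff ℝ ∞ χ
  zero_near : ∀ᶠ z in 𝓝 (0 : E), χ z = 0
  one_far : ∀ᶠ z in cocompact E, χ z = 1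

/-- `c j` is the coefficient symbol `a^∞_{[d,ν+j]}` of an expansion at infinity of `a`. -/
def IsExpansionAtInfinity (br : E → ℝ → ℝ) (d ν : ℝ) (a : E → ℝ → ℂ) (c : ℕ → E → ℂ) : Prop :=
  (∀ j : ℕ, MemS (ν + j) (c j)) ∧
    ∀ N : ℕ, MemSTilde d (ν + N) fun z μ =>
      a z μ - ∑ j ∈ Finset.range N, c j z * ((br z μ ^ (d - ν - j) : ℝ) : ℂ)

/-- The class (bold) `S̃^{d,ν}_{1,0}(E × [0,∞))` of symbols with expansion at infinity. -/
def MemBold (br : E → ℝ → ℝ) (d ν : ℝ) (a : E → ℝ → ℂ) : Prop :=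
  MemSTilde d ν a ∧ ∃ c : ℕ → E → ℂ, IsExpansionAtInfinity br d ν a c

/-- `p` is the principal limit symbol `a^∞_{[d,ν]}` of `a`. -/
def IsLimitSymbol (br : E → ℝ → ℝ) (d ν : ℝ) (a : E → ℝ → ℂ) (p : E → ℂ) : Prop :=
  ∃ c : ℕ → E → ℂ, IsExpansionAtInfinity br d ν a c ∧ c 0 = p

/-- The class (bold) `S̃^{d,ν}_hom(E × [0,∞))`: functions, smooth and homogeneous of degree `d` on
`{z ≠ 0, μ ≥ 0}`, for which `r^{-ν} h(rφ, √(1-r²))`, with `0 < r < 1` and `|φ| = 1`, extends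
smoothly to `r = 0`. Smoothness on `[0,1) × S^{m-1}` means being the restriction of a smooth
function of `(r, w)`, `0 ≤ r < 1`, `w ≠ 0`. -/
structure MemBoldHom (d ν : ℝ) (h : E → ℝ → ℂ) : Prop where
  smooth : ContDiffOn ℝ ∞ (fun p : E × ℝ => h p.1 p.2) ({0}ᶜ ×ˢ Ici 0)
  homogeneous : ∀ t : ℝ, 0 < t → ∀ z : E, z ≠ 0 → ∀ μ : ℝ, 0 ≤ μ →
    h (t • z) (t * μ) = ((t ^ d : ℝ) : ℂ) * h z μ
  taylor : ∃ g : ℝ × E → ℂ, ContDiffOn ℝ ∞ g (Ico 0 1 ×ˢ {0}ᶜ) ∧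
    ∀ r : ℝ, 0 < r → r < 1 → ∀ φ : E, ‖φ‖ = 1 →
      g (r, φ) = ((r ^ (-ν) : ℝ) : ℂ) * h (r • φ) (Real.sqrt (1 - r ^ 2))

/-- `s` is the angular symbol of the homogeneous symbol `h`:
`s(z) = |z|^ν lim_{r → 0+} r^{-ν} h(r z/|z|, √(1-r²))` for `z ≠ 0`. -/
def IsAngularSymbol (ν : ℝ) (h : E → ℝ → ℂ) (s : E → ℂ) : Prop :=
  ∀ z : E, z ≠ 0 →
    Tendsto (fun r : ℝ => ((‖z‖ ^ ν : ℝ) : ℂ) *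
        (((r ^ (-ν) : ℝ) : ℂ) * h (r • (‖z‖⁻¹ • z)) (Real.sqrt (1 - r ^ 2))))
      (𝓝[>] 0) (𝓝 (s z))

/-- `h j` is the homogeneous component `a^{(d-j,ν-j)}` of `a`. -/
def IsHomExpansion (χ : E → ℝ) (br : E → ℝ → ℝ) (d ν : ℝ) (a : E → ℝ → ℂ)
    (h : ℕ → E → ℝ → ℂ) : Prop :=
  (∀ j : ℕ, MemBoldHom (d - j) (ν - j) (h j)) ∧
    ∀ N : ℕ, MemBold br (d - N) (ν - N) fun z μ =>
      a z μ - (χ z : ℂ) * ∑ j ∈ Finset.range N, h j z μ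

/-- The class (bold) `S̃^{d,ν}(E × [0,∞))` of poly-homogeneous symbols. -/
def MemBoldPoly (χ : E → ℝ) (br : E → ℝ → ℝ) (d ν : ℝ) (a : E → ℝ → ℂ) : Prop :=
  MemBold br d ν a ∧ ∃ h : ℕ → E → ℝ → ℂ, IsHomExpansion χ br d ν a h

/-- `h₀` is the homogeneous principal symbol `a^{(d,ν)}` of `a`. It is determined by `a` on
`{z ≠ 0, μ ≥ 0}` only. -/
def IsHomPrincipalSymbol (χ : E → ℝ) (br : E → ℝ → ℝ) (d ν : ℝ) (a : E → ℝ → ℂ)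
    (h₀ : E → ℝ → ℂ) : Prop :=
  ∃ h : ℕ → E → ℝ → ℂ, IsHomExpansion χ br d ν a h ∧ h 0 = h₀

/-- `s` is the principal angular symbol `a_{⟨ν⟩}` of `a`. It is determined by `a` for `z ≠ 0`. -/
def IsPrincipalAngularSymbol (χ : E → ℝ) (br : E → ℝ → ℝ) (d ν : ℝ) (a : E → ℝ → ℂ)
    (s : E → ℂ) : Prop :=
  ∃ h₀ : E → ℝ → ℂ, IsHomPrincipalSymbol χ br d ν a h₀ ∧ IsAngularSymbol ν h₀ s

end SymbolClasses

section Operators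

/-- The space `ℝⁿ` with the Euclidean norm. -/
abbrev Space (n : ℕ) : Type := EuclideanSpace ℝ (Fin n)

/-- The phase space `ℝ²ⁿ` of points `z = (x, ξ)`, with the Euclidean norm. The `Γ`-classes are the
symbol classes above over `E = Phase n`. -/
abbrev Phase (n : ℕ) : Type := WithLp 2 (Space n × Space n)

/-- The point `(x, ξ)` of phase space. -/
def pt {n : ℕ} (x ξ : Space n) : Phase n := WithLp.toLp 2 (x, ξ)

/-- The Fourier transform `û(ξ) = ∫ e^{-iyξ} u(y) dy`. -/
def fourierHat {n : ℕ} (u : 𝓢(Space n, ℂ)) (ξ : Space n) : ℂ :=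
  ∫ y : Space n, Complex.exp (-(Complex.I * ((inner ℝ y ξ : ℝ) : ℂ))) * u y

/-- The operator `[p(x,D)u](x) = (2π)^{-n} ∫ e^{ixξ} p(x,ξ) û(ξ) dξ`. -/
def op {n : ℕ} (p : Phase n → ℂ) (u : 𝓢(Space n, ℂ)) (x : Space n) : ℂ :=
  ((2 * Real.pi : ℝ) : ℂ)⁻¹ ^ n *
    ∫ ξ : Space n, Complex.exp (Complex.I * ((inner ℝ x ξ : ℝ) : ℂ)) * p (pt x ξ) * fourierHat u ξ

/-- The oscillatory integral `(2π)^{-n} ∬ e^{-iyη} f(y,η) dy dη` exists and equals `I`: for every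
Schwartz function `φ` with `φ(0,0) = 1` the integrals regularized by `φ(εy, εη)` converge to `I`
as `ε → 0+`. -/
def HasOscIntegral {n : ℕ} (f : Space n → Space n → ℂ) (I : ℂ) : Prop :=
  ∀ φ : 𝓢(Space n × Space n, ℂ), φ 0 = 1 →
    Tendsto (fun ε : ℝ => ((2 * Real.pi : ℝ) : ℂ)⁻¹ ^ n *
        ∫ w : Space n × Space n,
          Complex.exp (-(Complex.I * ((inner ℝ w.1 w.2 : ℝ) : ℂ))) * φ (ε • w) * f w.1 w.2)
      (𝓝[>] 0) (𝓝 I)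

/-- `I` is the value at `(x, ξ)` of the symbol of the formal adjoint of `p(x,D)`, that is, of the
oscillatory integral of `e^{-iyη}` times the complex conjugate of `p(x+y, ξ+η)`. -/
def IsAdjointValue {n : ℕ} (p : Phase n → ℂ) (z : Phase n) (I : ℂ) : Prop :=
  HasOscIntegral (fun y η => conj (p (pt (z.fst + y) (z.snd + η)))) I

open Classical in
/-- The adjoint symbol `p^{(*)}`; it has the value `0` where the oscillatory integral does not
exist. -/
def adj {n : ℕ} (p : Phase n → ℂ) (z : Phase n) : ℂ :=
  if h : ∃ I : ℂ, IsAdjointValue p z I then h.choose else 0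

/-- The adjoint symbol, taken for each value of the parameter `μ`. -/
def adjPar {n : ℕ} (a : Phase n → ℝ → ℂ) (z : Phase n) (μ : ℝ) : ℂ :=
  adj (fun z' => a z' μ) z

/-- `q` is the symbol of the formal adjoint of `p(x,D)`: it is given everywhere by a convergent
oscillatory integral, and `(p(x,D)u, v) = (u, q(x,D)v)` in `L²` for all Schwartz functions. -/
def IsFormalAdjointSymbol {n : ℕ} (p q : Phase n → ℂ) : Prop :=
  (∀ z : Phase n, IsAdjointValue p z (q z)) ∧
    ∀ u v : 𝓢(Space n, ℂ),
      ∫ x : Space n, op p u x * conj (v x) = ∫ x : Space n, u x * conj (op q v x)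

end Operators

end Shubin

end

/-! The adjoint symbol at (z, μ) is the oscillatory integral over w = (y, η) of the amplitude conj
a(z + w, μ). The phase satisfies (1 - Δ_w) e^{-iyη} = ⟨w⟩² e^{-iyη}, so one integration by parts
replaces an amplitude F by (1 - Δ_w)(⟨w⟩⁻² F) and lowers its growth in w by two. After finitely many
steps the integral converges absolutely and may be differentiated in (z, μ). This gives existence,
independence of the cut-off (`osc_main`) and symbol estimates (`SymF.oscI_sym`); polynomial factors
in w cost nothing. By Peetre's inequality a translation by w costs only such factors.

Expand the amplitude in a Taylor series at w = 0. A factor w_i under the integral becomes a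
derivative in the dual variable, so the term of degree m contributes a differential operator `Qop m`
of order m: it is zero for odd m and (1/k!)(-i ∂_x·∂_ξ)^k for m = 2k (`oscI_Pt_shP`). The remainder
after M terms gains M powers of ⟨z⟩⁻¹ (`SymS.Rt`). This is the asymptotic expansion of the adjoint.

For the expansion at infinity the decisive fact is that ⟨z+w,μ⟩² - ⟨z,μ⟩² does not depend on μ.
Expanding ⟨z+w,μ⟩^s binomially in this difference writes a term c(z+w)⟨z+w,μ⟩^s as a sum of
μ-independent amplitudes times ⟨z,μ⟩^{s-2k}, plus a remainder controlled by `Frame.Sym.binRem`. The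
powers of ⟨z,μ⟩ leave the integral, and the coefficients are oscillatory integrals of μ-independent
amplitudes, hence symbols on phase space (`exists_Tosc_term`, `Bold.Tosc`). Only k = 0 and j = 0
contribute to the leading coefficient, which is therefore the adjoint of the limit symbol. The same
binomial expansion passes between powers of [z,μ] and of ⟨z,μ⟩ (`BoldN.change`), so all work is done
with the latter; uniqueness of coefficients (`IsBasis.coeff_unique`) glues expansions of different
lengths.

For poly-homogeneous a, the operators `Qop m` are applied to the conjugates of χ h_j. Whenever a
derivative falls on χ the result has order minus infinity in z (`HomSym.boldInf_cutoff`,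
`Leads.Qop`), so sorting by m + j gives the homogeneous components; the leading one is the conjugate
of h_0.

The formal adjoint identity follows for integrable symbols from Fubini's theorem and Fourier
inversion (`integral_adjoint_of_integrable`). The general case is the limit of cut-off symbols,
where `osc_main` supplies the uniform bound.

Throughout, symbol classes are described by derivatives in coordinate directions (`Frame`), each of
which multiplies the weight by a prescribed factor (`Gain`). To prove that a function is a symbol
one exhibits a family of weighted functions closed under these derivatives and bounds its members
(`Frame.sym_of_family`); no multi-indices appear. -/

noncomputable section

namespace Shubin

/-! ### Symbol classes defined by coordinate derivatives and weights -/

section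

/-- A convex set with a system of coordinate directions. -/
structure Frame (X ι : Type*) [NormedAddCommGroup X] [NormedSpace ℝ X] [Fintype ι] where
  S : Set X
  b : ι → X
  ℓ : ι → X →L[ℝ] ℝ
  sum_eq : ∀ x, ∑ i, ℓ i x • b i = x
  uniq : UniqueDiffOn ℝ S
  conv : Convex ℝ S
  clint : S ⊆ closure (interior S)

/-- The weights gained by differentiating in the coordinate directions. -/
structure Gain (X ι : Type*) where
  g : ι → X → ℝ
  nonneg : ∀ i p, 0 ≤ g i p

namespace Frame

variable {X ι : Type*} [NormedAddCommGroup X] [NormedSpace ℝ X] [Fintype ι]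
variable {A B : Type*} [NormedAddCommGroup A] [NormedSpace ℝ A] [NormedAddCommGroup B]
  [NormedSpace ℝ B]
variable (𝔽 : Frame X ι)

/-- The derivative in the `i`-th coordinate direction, within the set of the frame. -/
def D (i : ι) (f : X → A) : X → A := fun p => fderivWithin ℝ f 𝔽.S p (𝔽.b i)

/-- Smoothness on the set of the frame. -/
def Smooth (f : X → A) : Prop := ContDiffOn ℝ ∞ f 𝔽.S

variable {𝔽}

theorem D_eq {f : X → A} {p : X} (hp : p ∈ 𝔽.S) {T : X →L[ℝ] A}
    (h : HasFDerivWithinAt f T 𝔽.S p) (i : ι) : 𝔽.D i f p = T (𝔽.b i) := by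
  rw [D, h.fderivWithin (𝔽.uniq p hp)]

theorem D_congr {f f' : X → A} (h : EqOn f f' 𝔽.S) (i : ι) : EqOn (𝔽.D i f) (𝔽.D i f') 𝔽.S := by
  intro p hp
  rw [D, D, fderivWithin_congr h (h hp)]

theorem Smooth.congr {f f' : X → A} (hf : 𝔽.Smooth f) (h : EqOn f' f 𝔽.S) : 𝔽.Smooth f' :=
  ContDiffOn.congr hf h

theorem Smooth.hasFDerivWithinAt {f : X → A} (hf : 𝔽.Smooth f) {p : X} (hp : p ∈ 𝔽.S) :
    HasFDerivWithinAt f (fderivWithin ℝ f 𝔽.S p) 𝔽.S p :=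
  ((ContDiffOn.differentiableOn hf (by simp)) p hp).hasFDerivWithinAt

theorem Smooth.D {f : X → A} (hf : 𝔽.Smooth f) (i : ι) : 𝔽.Smooth (𝔽.D i f) := by
  have h : ContDiffOn ℝ ∞ (fderivWithin ℝ f 𝔽.S) 𝔽.S :=
    ContDiffOn.fderivWithin hf 𝔽.uniq (by simp)
  exact h.clm_apply contDiffOn_const

theorem Smooth.add {f h : X → A} (hf : 𝔽.Smooth f) (hh : 𝔽.Smooth h) :
    𝔽.Smooth (fun p => f p + h p) := ContDiffOn.add hf hh

theorem Smooth.sub {f h : X → A} (hf : 𝔽.Smooth f) (hh : 𝔽.Smooth h) :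
    𝔽.Smooth (fun p => f p - h p) := ContDiffOn.sub hf hh

theorem Smooth.clm {f : X → A} (hf : 𝔽.Smooth f) (T : A →L[ℝ] B) :
    𝔽.Smooth (fun p => T (f p)) := T.contDiff.comp_contDiffOn hf

theorem Smooth.sum {κ : Type*} {s : Finset κ} {f : κ → X → A} (hf : ∀ k ∈ s, 𝔽.Smooth (f k)) :
    𝔽.Smooth (fun p => ∑ k ∈ s, f k p) := ContDiffOn.sum hf

theorem smooth_const (c : A) : 𝔽.Smooth (fun _ => c) := contDiffOn_const

theorem smooth_clm (T : X →L[ℝ] A) : 𝔽.Smooth (fun p => T p) := T.contDiff.contDiffOn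

theorem D_add {f h : X → A} (hf : 𝔽.Smooth f) (hh : 𝔽.Smooth h) (i : ι) {p : X} (hp : p ∈ 𝔽.S) :
    𝔽.D i (fun p => f p + h p) p = 𝔽.D i f p + 𝔽.D i h p := by
  rw [D_eq hp ((hf.hasFDerivWithinAt hp).fun_add (hh.hasFDerivWithinAt hp))]; rfl

theorem D_sub {f h : X → A} (hf : 𝔽.Smooth f) (hh : 𝔽.Smooth h) (i : ι) {p : X} (hp : p ∈ 𝔽.S) :
    𝔽.D i (fun p => f p - h p) p = 𝔽.D i f p - 𝔽.D i h p := by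
  rw [D_eq hp ((hf.hasFDerivWithinAt hp).fun_sub (hh.hasFDerivWithinAt hp))]; rfl

theorem D_sum {κ : Type*} {s : Finset κ} {f : κ → X → A} (hf : ∀ k ∈ s, 𝔽.Smooth (f k)) (i : ι)
    {p : X} (hp : p ∈ 𝔽.S) :
    𝔽.D i (fun p => ∑ k ∈ s, f k p) p = ∑ k ∈ s, 𝔽.D i (f k) p := by
  rw [D_eq hp (HasFDerivWithinAt.fun_sum fun k hk => (hf k hk).hasFDerivWithinAt hp)]
  simp [D]

theorem D_clm {f : X → A} (hf : 𝔽.Smooth f) (T : A →L[ℝ] B) (i : ι) {p : X} (hp : p ∈ 𝔽.S) :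
    𝔽.D i (fun p => T (f p)) p = T (𝔽.D i f p) := by
  exact D_eq hp (T.hasFDerivAt.comp_hasFDerivWithinAt p (hf.hasFDerivWithinAt hp)) i

theorem D_const (c : A) (i : ι) (p : X) : 𝔽.D i (fun _ => c) p = 0 := by
  simp [D]

theorem D_linear (T : X →L[ℝ] A) (i : ι) {p : X} (hp : p ∈ 𝔽.S) :
    𝔽.D i (fun p => T p) p = T (𝔽.b i) := D_eq hp T.hasFDerivWithinAt i

/-- Symmetry of the second derivative persists at boundary points, such as those with μ = 0, because
the set lies in the closure of its interior. -/
theorem D_comm {f : X → A} (hf : 𝔽.Smooth f) (i j : ι) {p : X} (hp : p ∈ 𝔽.S) :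
    𝔽.D i (𝔽.D j f) p = 𝔽.D j (𝔽.D i f) p := by
  have h1 : ContDiffOn ℝ ∞ (fderivWithin ℝ f 𝔽.S) 𝔽.S :=
    ContDiffOn.fderivWithin hf 𝔽.uniq (by simp)
  have key : ∀ i j, 𝔽.D i (𝔽.D j f) p =
      fderivWithin ℝ (fderivWithin ℝ f 𝔽.S) 𝔽.S p (𝔽.b i) (𝔽.b j) := by
    intro i j
    have h2 := ((h1.differentiableOn (by simp)) p hp).hasFDerivWithinAt
    exact D_eq hp (h2.clm_apply (hasFDerivWithinAt_const (𝔽.b j) p 𝔽.S)) i |>.trans (by simp)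
  rw [key, key]
  have hs : IsSymmSndFDerivWithinAt ℝ f 𝔽.S p :=
    ContDiffWithinAt.isSymmSndFDerivWithinAt (n := ∞) (hf p hp)
      (by simpa using WithTop.coe_le_coe.2 (le_top : (2 : ℕ∞) ≤ ⊤)) 𝔽.uniq (𝔽.clint hp) hp
  exact hs _ _

section Algebra

variable {R : Type*} [NormedCommRing R] [NormedAlgebra ℝ R]

theorem Smooth.mul {f h : X → R} (hf : 𝔽.Smooth f) (hh : 𝔽.Smooth h) :
    𝔽.Smooth (fun p => f p * h p) := ContDiffOn.mul hf hh

theorem D_mul {f h : X → R} (hf : 𝔽.Smooth f) (hh : 𝔽.Smooth h) (i : ι) {p : X} (hp : p ∈ 𝔽.S) :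
    𝔽.D i (fun p => f p * h p) p = 𝔽.D i f p * h p + f p * 𝔽.D i h p := by
  rw [D_eq hp ((hf.hasFDerivWithinAt hp).fun_mul (hh.hasFDerivWithinAt hp))]
  simp [D, mul_comm, add_comm]

theorem D_const_mul (c : R) {f : X → R} (hf : 𝔽.Smooth f) (i : ι) {p : X} (hp : p ∈ 𝔽.S) :
    𝔽.D i (fun p => c * f p) p = c * 𝔽.D i f p := by
  rw [D_mul (smooth_const c) hf i hp, D_const]; simp

end Algebra

/-- Induction on the order of differentiability: the full derivative is reassembled from the
coordinate derivatives by means of the functionals `ℓ`, and these belong to the same family. -/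
theorem smooth_of_family {𝒢 : (X → A) → Prop}
    (h : ∀ f, 𝒢 f → ∃ f' : ι → X → A, (∀ i, 𝒢 (f' i)) ∧
      ∀ p ∈ 𝔽.S, ∃ T : X →L[ℝ] A, HasFDerivWithinAt f T 𝔽.S p ∧ ∀ i, T (𝔽.b i) = f' i p) :
    ∀ f, 𝒢 f → 𝔽.Smooth f := by
  suffices H : ∀ n : ℕ, ∀ f, 𝒢 f → ContDiffOn ℝ n f 𝔽.S from
    fun f hf => contDiffOn_infty.2 fun n => H n f hf
  intro n
  induction n with
  | zero =>
    intro f hf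
    obtain ⟨f', -, h2⟩ := h f hf
    refine contDiffOn_zero.2 fun p hp => ?_
    obtain ⟨T, hT, -⟩ := h2 p hp
    exact hT.continuousWithinAt
  | succ n ih =>
    intro f hf
    obtain ⟨f', h1, h2⟩ := h f hf
    rw [show ((n + 1 : ℕ) : ℕ∞ω) = (n : ℕ∞ω) + 1 by simp, contDiffOn_succ_iff_fderivWithin 𝔽.uniq]
    refine ⟨fun p hp => ?_, by simp, ?_⟩
    · obtain ⟨T, hT, -⟩ := h2 p hp
      exact hT.differentiableWithinAt
    · have e : EqOn (fderivWithin ℝ f 𝔽.S)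
          (fun p => ∑ i, ContinuousLinearMap.smulRightL ℝ X A (𝔽.ℓ i) (f' i p)) 𝔽.S := by
        intro p hp
        obtain ⟨T, hT, hT'⟩ := h2 p hp
        rw [hT.fderivWithin (𝔽.uniq p hp)]
        ext x
        conv_lhs => rw [← 𝔽.sum_eq x]
        simp [hT']
      refine ContDiffOn.congr ?_ e
      exact ContDiffOn.sum fun i _ =>
        (ContinuousLinearMap.smulRightL ℝ X A (𝔽.ℓ i)).contDiff.comp_contDiffOn (ih _ (h1 i))

variable (𝔽) (G : Gain X ι)

/-- Symbol estimates with weight `m` for the derivatives up to order `n`. -/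
def SymN : ℕ → (X → ℝ) → (X → A) → Prop
  | 0, m, f => ∃ C, 0 ≤ C ∧ ∀ p ∈ 𝔽.S, ‖f p‖ ≤ C * m p
  | n + 1, m, f => (∃ C, 0 ≤ C ∧ ∀ p ∈ 𝔽.S, ‖f p‖ ≤ C * m p) ∧
      ∀ i, SymN n (fun p => m p * G.g i p) (𝔽.D i f)

/-- The class of symbols with weight `m`. -/
def Sym (m : X → ℝ) (f : X → A) : Prop := 𝔽.Smooth f ∧ ∀ n, 𝔽.SymN G n m f

variable {𝔽 G}

theorem SymN.bound {n : ℕ} {m : X → ℝ} {f : X → A} (h : 𝔽.SymN G n m f) :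
    ∃ C, 0 ≤ C ∧ ∀ p ∈ 𝔽.S, ‖f p‖ ≤ C * m p := by
  cases n with
  | zero => exact h
  | succ n => exact h.1

theorem SymN.pred {n : ℕ} : ∀ {m : X → ℝ} {f : X → A}, 𝔽.SymN G (n + 1) m f → 𝔽.SymN G n m f := by
  induction n with
  | zero => intro m f h; exact h.1
  | succ n ih => intro m f h; exact ⟨h.1, fun i => ih (h.2 i)⟩

theorem SymN.mono {n : ℕ} : ∀ {m m' : X → ℝ} {f : X → A}, 𝔽.SymN G n m f →
    (∃ C, 0 ≤ C ∧ ∀ p ∈ 𝔽.S, m p ≤ C * m' p) → 𝔽.SymN G n m' f := by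
  have base : ∀ {m m' : X → ℝ} {f : X → A}, (∃ C, 0 ≤ C ∧ ∀ p ∈ 𝔽.S, ‖f p‖ ≤ C * m p) →
      (∃ C, 0 ≤ C ∧ ∀ p ∈ 𝔽.S, m p ≤ C * m' p) →
      ∃ C, 0 ≤ C ∧ ∀ p ∈ 𝔽.S, ‖f p‖ ≤ C * m' p := by
    rintro m m' f ⟨C, hC, h⟩ ⟨C', hC', h'⟩
    refine ⟨C * C', mul_nonneg hC hC', fun p hp => (h p hp).trans ?_⟩
    rw [mul_assoc]; exact mul_le_mul_of_nonneg_left (h' p hp) hC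
  induction n with
  | zero => intro m m' f h hm; exact base h hm
  | succ n ih =>
    intro m m' f h hm
    refine ⟨base h.1 hm, fun i => ih (h.2 i) ?_⟩
    obtain ⟨C, hC, h'⟩ := hm
    refine ⟨C, hC, fun p hp => ?_⟩
    rw [← mul_assoc]; exact mul_le_mul_of_nonneg_right (h' p hp) (G.nonneg i p)

theorem SymN.congr {n : ℕ} : ∀ {m : X → ℝ} {f f' : X → A}, 𝔽.SymN G n m f →
    EqOn f' f 𝔽.S → 𝔽.SymN G n m f' := by
  have base : ∀ {m : X → ℝ} {f f' : X → A}, (∃ C, 0 ≤ C ∧ ∀ p ∈ 𝔽.S, ‖f p‖ ≤ C * m p) →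
      EqOn f' f 𝔽.S → ∃ C, 0 ≤ C ∧ ∀ p ∈ 𝔽.S, ‖f' p‖ ≤ C * m p := by
    rintro m f f' ⟨C, hC, h⟩ e
    exact ⟨C, hC, fun p hp => by rw [e hp]; exact h p hp⟩
  induction n with
  | zero => intro m f f' h e; exact base h e
  | succ n ih => intro m f f' h e; exact ⟨base h.1 e, fun i => ih (h.2 i) (D_congr e i)⟩

theorem SymN.add {n : ℕ} : ∀ {m : X → ℝ} {f h : X → A}, 𝔽.Smooth f → 𝔽.Smooth h →
    𝔽.SymN G n m f → 𝔽.SymN G n m h → 𝔽.SymN G n m (fun p => f p + h p) := by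
  have base : ∀ {m : X → ℝ} {f h : X → A}, (∃ C, 0 ≤ C ∧ ∀ p ∈ 𝔽.S, ‖f p‖ ≤ C * m p) →
      (∃ C, 0 ≤ C ∧ ∀ p ∈ 𝔽.S, ‖h p‖ ≤ C * m p) →
      ∃ C, 0 ≤ C ∧ ∀ p ∈ 𝔽.S, ‖f p + h p‖ ≤ C * m p := by
    rintro m f h ⟨C, hC, h1⟩ ⟨C', hC', h2⟩
    refine ⟨C + C', add_nonneg hC hC', fun p hp => (norm_add_le _ _).trans ?_⟩
    rw [add_mul]; exact add_le_add (h1 p hp) (h2 p hp)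
  induction n with
  | zero => intro m f h _ _ h1 h2; exact base h1 h2
  | succ n ih =>
    intro m f h sf sh h1 h2
    exact ⟨base h1.1 h2.1, fun i => (ih (sf.D i) (sh.D i) (h1.2 i) (h2.2 i)).congr
      fun p hp => D_add sf sh i hp⟩

theorem SymN.clm {n : ℕ} (T : A →L[ℝ] B) : ∀ {m : X → ℝ} {f : X → A}, 𝔽.Smooth f →
    𝔽.SymN G n m f → 𝔽.SymN G n m (fun p => T (f p)) := by
  have base : ∀ {m : X → ℝ} {f : X → A}, (∃ C, 0 ≤ C ∧ ∀ p ∈ 𝔽.S, ‖f p‖ ≤ C * m p) →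
      ∃ C, 0 ≤ C ∧ ∀ p ∈ 𝔽.S, ‖T (f p)‖ ≤ C * m p := by
    rintro m f ⟨C, hC, h1⟩
    refine ⟨‖T‖ * C, mul_nonneg (norm_nonneg _) hC, fun p hp => (T.le_opNorm _).trans ?_⟩
    rw [mul_assoc]; exact mul_le_mul_of_nonneg_left (h1 p hp) (norm_nonneg _)
  induction n with
  | zero => intro m f _ h1; exact base h1
  | succ n ih =>
    intro m f sf h1
    exact ⟨base h1.1, fun i => (ih (sf.D i) (h1.2 i)).congr fun p hp => D_clm sf T i hp⟩

theorem SymN.mul {R : Type*} [NormedCommRing R] [NormedAlgebra ℝ R] {n : ℕ} :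
    ∀ {m m' : X → ℝ} {f h : X → R}, 𝔽.Smooth f → 𝔽.Smooth h →
    𝔽.SymN G n m f → 𝔽.SymN G n m' h →
      𝔽.SymN G n (fun p => m p * m' p) (fun p => f p * h p) := by
  have base : ∀ {m m' : X → ℝ} {f h : X → R}, (∃ C, 0 ≤ C ∧ ∀ p ∈ 𝔽.S, ‖f p‖ ≤ C * m p) →
      (∃ C, 0 ≤ C ∧ ∀ p ∈ 𝔽.S, ‖h p‖ ≤ C * m' p) →
      ∃ C, 0 ≤ C ∧ ∀ p ∈ 𝔽.S, ‖f p * h p‖ ≤ C * (m p * m' p) := by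
    rintro m m' f h ⟨C, hC, h1⟩ ⟨C', hC', h2⟩
    refine ⟨C * C', mul_nonneg hC hC', fun p hp => (norm_mul_le _ _).trans ?_⟩
    have := mul_le_mul (h1 p hp) (h2 p hp) (norm_nonneg _) ((norm_nonneg _).trans (h1 p hp))
    linarith
  induction n with
  | zero => intro m m' f h _ _ h1 h2; exact base h1 h2
  | succ n ih =>
    intro m m' f h sf sh h1 h2
    refine ⟨base h1.1 h2.1, fun i => ?_⟩
    have a1 := ih (sf.D i) sh (h1.2 i) h2.pred
    have a2 := ih sf (sh.D i) h1.pred (h2.2 i)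
    have w1 : (fun p => m p * G.g i p * m' p) = fun p => m p * m' p * G.g i p := by
      funext p; ring
    have w2 : (fun p => m p * (m' p * G.g i p)) = fun p => m p * m' p * G.g i p := by
      funext p; ring
    rw [w1] at a1; rw [w2] at a2
    exact (a1.add ((sf.D i).mul sh) (sf.mul (sh.D i)) a2).congr fun p hp => D_mul sf sh i hp

theorem Sym.smooth {m : X → ℝ} {f : X → A} (h : 𝔽.Sym G m f) : 𝔽.Smooth f := h.1

theorem Sym.bound {m : X → ℝ} {f : X → A} (h : 𝔽.Sym G m f) :
    ∃ C, 0 ≤ C ∧ ∀ p ∈ 𝔽.S, ‖f p‖ ≤ C * m p := (h.2 0).bound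

theorem Sym.D {m : X → ℝ} {f : X → A} (h : 𝔽.Sym G m f) (i : ι) :
    𝔽.Sym G (fun p => m p * G.g i p) (𝔽.D i f) := ⟨h.1.D i, fun n => (h.2 (n + 1)).2 i⟩

theorem Sym.mono {m m' : X → ℝ} {f : X → A} (h : 𝔽.Sym G m f) (C : ℝ) (hC : 0 ≤ C)
    (h' : ∀ p ∈ 𝔽.S, m p ≤ C * m' p) : 𝔽.Sym G m' f :=
  ⟨h.1, fun n => (h.2 n).mono ⟨C, hC, h'⟩⟩

theorem Sym.mono_le {m m' : X → ℝ} {f : X → A} (h : 𝔽.Sym G m f)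
    (h' : ∀ p ∈ 𝔽.S, m p ≤ m' p) : 𝔽.Sym G m' f :=
  h.mono 1 zero_le_one fun p hp => by rw [one_mul]; exact h' p hp

theorem Sym.congr {m : X → ℝ} {f f' : X → A} (h : 𝔽.Sym G m f) (e : EqOn f' f 𝔽.S) :
    𝔽.Sym G m f' := ⟨h.1.congr e, fun n => (h.2 n).congr e⟩

theorem Sym.add {m : X → ℝ} {f h : X → A} (hf : 𝔽.Sym G m f) (hh : 𝔽.Sym G m h) :
    𝔽.Sym G m (fun p => f p + h p) := ⟨hf.1.add hh.1, fun n => (hf.2 n).add hf.1 hh.1 (hh.2 n)⟩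

theorem Sym.clm {m : X → ℝ} {f : X → A} (hf : 𝔽.Sym G m f) (T : A →L[ℝ] B) :
    𝔽.Sym G m (fun p => T (f p)) := ⟨hf.1.clm T, fun n => (hf.2 n).clm T hf.1⟩

theorem Sym.neg {m : X → ℝ} {f : X → A} (hf : 𝔽.Sym G m f) : 𝔽.Sym G m (fun p => - f p) :=
  hf.clm (-(ContinuousLinearMap.id ℝ A))

theorem Sym.sub {m : X → ℝ} {f h : X → A} (hf : 𝔽.Sym G m f) (hh : 𝔽.Sym G m h) :
    𝔽.Sym G m (fun p => f p - h p) := by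
  simpa only [sub_eq_add_neg] using hf.add hh.neg

theorem Sym.mul {R : Type*} [NormedCommRing R] [NormedAlgebra ℝ R] {m m' : X → ℝ} {f h : X → R}
    (hf : 𝔽.Sym G m f) (hh : 𝔽.Sym G m' h) :
    𝔽.Sym G (fun p => m p * m' p) (fun p => f p * h p) :=
  ⟨hf.1.mul hh.1, fun n => (hf.2 n).mul hf.1 hh.1 (hh.2 n)⟩

theorem symN_zero {n : ℕ} : ∀ {m : X → ℝ}, (∀ p ∈ 𝔽.S, 0 ≤ m p) →
    𝔽.SymN G n m (fun _ => (0 : A)) := by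
  have base : ∀ {m : X → ℝ}, (∀ p ∈ 𝔽.S, 0 ≤ m p) →
      ∃ C, 0 ≤ C ∧ ∀ p ∈ 𝔽.S, ‖(0 : A)‖ ≤ C * m p := by
    intro m _
    exact ⟨0, le_rfl, fun p _ => by simp⟩
  induction n with
  | zero => intro m hm; exact base hm
  | succ n ih =>
    intro m hm
    refine ⟨base hm, fun i => ?_⟩
    rw [show 𝔽.D i (fun _ => (0 : A)) = fun _ => 0 from funext fun p => D_const 0 i p]
    exact ih fun p hp => mul_nonneg (hm p hp) (G.nonneg i p)

theorem sym_zero {m : X → ℝ} (hm : ∀ p ∈ 𝔽.S, 0 ≤ m p) : 𝔽.Sym G m (fun _ => (0 : A)) :=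
  ⟨smooth_const 0, fun _ => symN_zero hm⟩

theorem sym_const (c : A) : 𝔽.Sym G (fun _ => 1) (fun _ => c) := by
  have base : ∃ C, 0 ≤ C ∧ ∀ p ∈ 𝔽.S, ‖c‖ ≤ C * 1 := ⟨‖c‖, norm_nonneg _, fun p _ => by simp⟩
  refine ⟨smooth_const c, fun n => ?_⟩
  cases n with
  | zero => exact base
  | succ n =>
    refine ⟨base, fun i => ?_⟩
    rw [show 𝔽.D i (fun _ => c) = fun _ => 0 from funext fun p => D_const c i p]
    exact symN_zero fun p _ => mul_nonneg zero_le_one (G.nonneg i p)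

theorem Sym.const_mul {R : Type*} [NormedCommRing R] [NormedAlgebra ℝ R] {m : X → ℝ} {f : X → R}
    (hf : 𝔽.Sym G m f) (c : R) : 𝔽.Sym G m (fun p => c * f p) := by
  simpa only [one_mul] using (sym_const c).mul hf

theorem Sym.sum {κ : Type*} {s : Finset κ} {m : X → ℝ} (hm : ∀ p ∈ 𝔽.S, 0 ≤ m p) {f : κ → X → A}
    (hf : ∀ k ∈ s, 𝔽.Sym G m (f k)) : 𝔽.Sym G m (fun p => ∑ k ∈ s, f k p) := by
  classical
  induction s using Finset.induction_on with
  | empty => simpa using sym_zero hm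
  | insert a s ha ih =>
    simp only [Finset.sum_insert ha]
    exact (hf a (by simp)).add (ih fun k hk => hf k (by simp [hk]))

theorem Sym.pow {R : Type*} [NormedCommRing R] [NormedAlgebra ℝ R] {m : X → ℝ} {f : X → R}
    (hf : 𝔽.Sym G m f) (k : ℕ) : 𝔽.Sym G (fun p => m p ^ k) (fun p => f p ^ k) := by
  induction k with
  | zero => simpa using sym_const (1 : R)
  | succ k ih => simpa only [pow_succ] using ih.mul hf

/-- Symbol classes are characterized by families closed under differentiation. -/
theorem sym_of_family {𝒢 : (X → ℝ) → (X → A) → Prop}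
    (h : ∀ m f, 𝒢 m f → (∃ C, 0 ≤ C ∧ ∀ p ∈ 𝔽.S, ‖f p‖ ≤ C * m p) ∧
      ∃ f' : ι → X → A, (∀ i, 𝒢 (fun p => m p * G.g i p) (f' i)) ∧
      ∀ p ∈ 𝔽.S, ∃ T : X →L[ℝ] A, HasFDerivWithinAt f T 𝔽.S p ∧ ∀ i, T (𝔽.b i) = f' i p)
    {m : X → ℝ} {f : X → A} (hf : 𝒢 m f) : 𝔽.Sym G m f := by
  -- Smoothness does not see the weights, so they are forgotten here.
  refine ⟨smooth_of_family (𝒢 := fun f => ∃ m, 𝒢 m f) ?_ f ⟨m, hf⟩, fun n => ?_⟩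
  · rintro f ⟨m, hf⟩
    obtain ⟨-, f', h1, h2⟩ := h m f hf
    exact ⟨f', fun i => ⟨_, h1 i⟩, h2⟩
  · induction n generalizing m f with
    | zero => exact (h m f hf).1
    | succ n ih =>
      obtain ⟨hb, f', h1, h2⟩ := h m f hf
      refine ⟨hb, fun i => (ih (h1 i)).congr fun p hp => ?_⟩
      obtain ⟨T, hT, hT'⟩ := h2 p hp
      rw [D_eq hp hT, hT']

/-- Pullback of symbols under maps that are affine in the coordinate directions. -/
theorem Sym.comp {Y κ : Type*} [NormedAddCommGroup Y] [NormedSpace ℝ Y] [Fintype κ]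
    {𝔼 : Frame Y κ} {H : Gain Y κ} {m : X → ℝ} {f : X → A} (hf : 𝔽.Sym G m f)
    (Ψ : Y → X) (L : Y →L[ℝ] X) (hΨ : ∀ y ∈ 𝔼.S, HasFDerivWithinAt Ψ L 𝔼.S y)
    (hmap : MapsTo Ψ 𝔼.S 𝔽.S) (σ : κ → ι) (c : κ → ℝ) (hb : ∀ k, L (𝔼.b k) = c k • 𝔽.b (σ k))
    (B : ℝ) (hB : 0 ≤ B)
    (hg : ∀ k, ∀ y ∈ 𝔼.S, |c k| * G.g (σ k) (Ψ y) ≤ B * H.g k y)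
    {m' : Y → ℝ} (C : ℝ) (hC : 0 ≤ C) (hm : ∀ y ∈ 𝔼.S, m (Ψ y) ≤ C * m' y)
    (hm0 : ∀ y ∈ 𝔼.S, 0 ≤ m' y) :
    𝔼.Sym H m' (fun y => f (Ψ y)) := by
  -- By the chain rule a derivative of f ∘ Ψ is a constant multiple of (D f) ∘ Ψ; the family
  -- therefore carries a scalar r that accumulates these constants.
  refine sym_of_family (𝒢 := fun m' h => ∃ m f C, ∃ r : ℝ, 0 ≤ C ∧ 𝔽.Sym G m f ∧
    (∀ y ∈ 𝔼.S, |r| * m (Ψ y) ≤ C * m' y) ∧ (∀ y ∈ 𝔼.S, 0 ≤ m' y) ∧ h = fun y => r • f (Ψ y)) ?_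
    ⟨m, f, C, 1, hC, hf, by simpa using hm, hm0, by simp⟩
  rintro m' h ⟨m, f, C, r, hC, hf, hm, hm0, rfl⟩
  refine ⟨?_, fun k y => (r * c k) • 𝔽.D (σ k) f (Ψ y), fun k => ?_, fun y hy => ?_⟩
  · obtain ⟨C', hC', h'⟩ := hf.bound
    refine ⟨C' * C, by positivity, fun y hy => ?_⟩
    rw [norm_smul, Real.norm_eq_abs]
    calc |r| * ‖f (Ψ y)‖ ≤ |r| * (C' * m (Ψ y)) := by gcongr; exact h' _ (hmap hy)
      _ = C' * (|r| * m (Ψ y)) := by ring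
      _ ≤ C' * (C * m' y) := mul_le_mul_of_nonneg_left (hm y hy) hC'
      _ = _ := by ring
  · refine ⟨_, _, C * B, r * c k, by positivity, hf.D (σ k), fun y hy => ?_,
      fun y hy => mul_nonneg (hm0 y hy) (H.nonneg k y), rfl⟩
    rw [abs_mul]
    calc |r| * |c k| * (m (Ψ y) * G.g (σ k) (Ψ y))
        = (|r| * m (Ψ y)) * (|c k| * G.g (σ k) (Ψ y)) := by ring
      _ ≤ (C * m' y) * (|c k| * G.g (σ k) (Ψ y)) :=
        mul_le_mul_of_nonneg_right (hm y hy) (mul_nonneg (abs_nonneg _) (G.nonneg _ _))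
      _ ≤ (C * m' y) * (B * H.g k y) :=
        mul_le_mul_of_nonneg_left (hg k y hy) (mul_nonneg hC (hm0 y hy))
      _ = _ := by ring
  · refine ⟨_, ((hf.1.hasFDerivWithinAt (hmap hy)).comp y (hΨ y hy) hmap).const_smul r,
      fun k => ?_⟩
    simp [hb, Frame.D, mul_smul]

end Frame

end

/-! ### Binomial expansion of real powers and its remainder -/

section

/-- Binomial coefficients with real upper argument. -/
def rbin : ℝ → ℕ → ℝ
  | _, 0 => 1
  | s, k + 1 => s / (k + 1) * rbin (s - 1) k

/-- This identity and the next one turn the derivatives of a partial binomial sum in y and in x into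
partial sums with exponent s - 1. -/
theorem rbin_succ_mul (s : ℝ) (k : ℕ) : (k + 1) * rbin s (k + 1) = s * rbin (s - 1) k := by
  rw [rbin]; field_simp

theorem sub_mul_rbin (s : ℝ) (k : ℕ) : (s - k) * rbin s k = s * rbin (s - 1) k := by
  induction k generalizing s with
  | zero => simp [rbin]
  | succ k ih =>
    have h := ih (s - 1)
    have hk : ((k : ℝ) + 1) ≠ 0 := by positivity
    simp only [rbin]
    push_cast
    have e : (s - (k + 1)) * (s / (k + 1) * rbin (s - 1) k) =
        s / (k + 1) * ((s - 1 - k) * rbin (s - 1) k) := by ring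
    rw [e, h]; ring

/-- The remainder of the binomial expansion of `(x + y)^s`. -/
def binRem (s : ℝ) (K : ℕ) (x y : ℝ) : ℝ :=
  (x + y) ^ s - ∑ k ∈ Finset.range K, rbin s k * (y ^ k * x ^ (s - k))

theorem binRem_zero_right (s : ℝ) (K : ℕ) (x : ℝ) : binRem s (K + 1) x 0 = 0 := by
  simp [binRem, Finset.sum_range_succ', rbin]

/-- The derivative of a partial sum along a curve with velocities dx, dy. The x-part keeps the
number of terms and the y-part loses one, so derivatives of remainders are again remainders. -/
theorem sum_rbin_deriv (s : ℝ) (K : ℕ) (x y dx dy : ℝ) :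
    ∑ k ∈ Finset.range (K + 1), rbin s k * ((k * y ^ (k - 1) * dy) * x ^ (s - k) +
      y ^ k * ((s - k) * x ^ (s - k - 1) * dx)) =
    s * dx * ∑ k ∈ Finset.range (K + 1), rbin (s - 1) k * (y ^ k * x ^ (s - 1 - k)) +
    s * dy * ∑ k ∈ Finset.range K, rbin (s - 1) k * (y ^ k * x ^ (s - 1 - k)) := by
  have e1 : ∑ k ∈ Finset.range (K + 1), rbin s k * (y ^ k * ((s - k) * x ^ (s - k - 1) * dx)) =
      s * dx * ∑ k ∈ Finset.range (K + 1), rbin (s - 1) k * (y ^ k * x ^ (s - 1 - k)) := by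
    rw [Finset.mul_sum]
    refine Finset.sum_congr rfl fun k _ => ?_
    have h := sub_mul_rbin s k
    rw [show s - (k : ℝ) - 1 = s - 1 - k by ring]
    calc _ = ((s - k) * rbin s k) * (y ^ k * x ^ (s - 1 - k) * dx) := by ring
      _ = _ := by rw [h]; ring
  have e2 : ∑ k ∈ Finset.range (K + 1), rbin s k * ((k * y ^ (k - 1) * dy) * x ^ (s - k)) =
      s * dy * ∑ k ∈ Finset.range K, rbin (s - 1) k * (y ^ k * x ^ (s - 1 - k)) := by
    rw [Finset.sum_range_succ', Finset.mul_sum]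
    simp only [Nat.cast_zero, zero_mul, mul_zero, add_zero]
    refine Finset.sum_congr rfl fun k _ => ?_
    have h := rbin_succ_mul s k
    rw [Nat.add_sub_cancel, show s - ((k + 1 : ℕ) : ℝ) = s - 1 - k by push_cast; ring]
    calc _ = ((k + 1) * rbin s (k + 1)) * (y ^ k * x ^ (s - 1 - k) * dy) := by push_cast; ring
      _ = _ := by rw [h]; ring
  rw [← e1, ← e2, ← Finset.sum_add_distrib]
  exact Finset.sum_congr rfl fun k _ => by ring

theorem binRem_hasDerivAt (s : ℝ) (K : ℕ) {x y : ℝ} (hy : 0 < x + y) :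
    HasDerivAt (fun y => binRem s (K + 1) x y) (s * binRem (s - 1) K x y) y := by
  have h1 : HasDerivAt (fun y : ℝ => (x + y) ^ s) (s * (x + y) ^ (s - 1)) y := by
    simpa using ((hasDerivAt_id' y).const_add x).rpow_const (p := s) (Or.inl hy.ne')
  have h2 : HasDerivAt (fun y : ℝ => ∑ k ∈ Finset.range (K + 1), rbin s k * (y ^ k * x ^ (s - k)))
      (∑ k ∈ Finset.range (K + 1), rbin s k * ((k * y ^ (k - 1) * 1) * x ^ (s - k))) y := by
    refine HasDerivAt.fun_sum fun k _ => HasDerivAt.const_mul _ (HasDerivAt.mul_const ?_ _)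
    simpa using hasDerivAt_pow k y
  have h3 := sum_rbin_deriv s K x y 0 1
  simp only [mul_zero, add_zero, zero_mul, zero_add] at h3
  rw [h3] at h2
  have := h1.sub h2
  refine this.congr_deriv ?_
  rw [binRem]; ring

/-- Induction on K by the mean value inequality: the remainder vanishes at y = 0 and its
y-derivative is s times a remainder of one order less. A power of x + t is monotone in t, whatever
the sign of the exponent, so between the endpoints it is bounded by the sum of its endpoint values.
-/
theorem abs_binRem_le (K : ℕ) (s : ℝ) : ∃ C, 0 ≤ C ∧ ∀ x y : ℝ, 0 < x → 0 < x + y →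
    |binRem s K x y| ≤ C * (|y| ^ K * (x ^ (s - K) + (x + y) ^ (s - K))) := by
  induction K generalizing s with
  | zero =>
    refine ⟨1, zero_le_one, fun x y hx hy => ?_⟩
    simp only [binRem, Finset.range_zero, Finset.sum_empty, sub_zero, Nat.cast_zero, pow_zero,
      one_mul]
    rw [abs_of_pos (Real.rpow_pos_of_pos hy s)]
    linarith [Real.rpow_pos_of_pos hx s]
  | succ K ih =>
    obtain ⟨C, hC, h⟩ := ih (s - 1)
    -- The 2 arises because both x^q and (x + t)^q are bounded by x^q + (x + y)^q.
    refine ⟨|s| * (C * 2), by positivity, fun x y hx hy => ?_⟩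
    set q := s - 1 - (K : ℝ) with hq
    have hq' : s - ((K + 1 : ℕ) : ℝ) = q := by push_cast; ring
    rw [hq']
    have hpos : ∀ t ∈ segment ℝ 0 y, 0 < x + t ∧ |t| ≤ |y| ∧
        (x + t) ^ q ≤ x ^ q + (x + y) ^ q := by
      intro t ht
      rw [segment_eq_uIcc, mem_uIcc] at ht
      have h1 : 0 < x + t := by rcases ht with ht | ht <;> linarith [ht.1, ht.2]
      refine ⟨h1, ?_, ?_⟩
      · rcases ht with ht | ht
        · rw [abs_of_nonneg ht.1, abs_of_nonneg (ht.1.trans ht.2)]; exact ht.2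
        · rw [abs_of_nonpos ht.2, abs_of_nonpos (ht.1.trans ht.2)]; linarith [ht.1]
      · have p1 := Real.rpow_pos_of_pos hx q
        have p2 := Real.rpow_pos_of_pos hy q
        rcases le_total 0 q with h0 | h0
        · rcases ht with ht | ht
          · linarith [Real.rpow_le_rpow h1.le (by linarith [ht.2] : x + t ≤ x + y) h0]
          · linarith [Real.rpow_le_rpow h1.le (by linarith [ht.2] : x + t ≤ x) h0]
        · rcases ht with ht | ht
          · linarith [Real.rpow_le_rpow_of_nonpos hx (by linarith [ht.1] : x ≤ x + t) h0]
          · linarith [Real.rpow_le_rpow_of_nonpos hy (by linarith [ht.1] : x + y ≤ x + t) h0]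
    have key := (convex_segment (0 : ℝ) y).norm_image_sub_le_of_norm_hasDerivWithin_le
      (f := fun y => binRem s (K + 1) x y) (f' := fun t => s * binRem (s - 1) K x t)
      (C := |s| * (C * 2) * (|y| ^ K * (x ^ q + (x + y) ^ q)))
      (fun t ht => (binRem_hasDerivAt s K (hpos t ht).1).hasDerivWithinAt)
      (fun t ht => ?_) (left_mem_segment ℝ 0 y) (right_mem_segment ℝ 0 y)
    · rw [binRem_zero_right, sub_zero, Real.norm_eq_abs, Real.norm_eq_abs, sub_zero] at key
      rw [pow_succ]
      linarith
    · obtain ⟨t1, t2, t3⟩ := hpos t ht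
      rw [Real.norm_eq_abs, abs_mul, mul_assoc]
      refine mul_le_mul_of_nonneg_left ((h x t hx t1).trans ?_) (abs_nonneg _)
      have p1 := Real.rpow_pos_of_pos hx q
      have p2 := Real.rpow_pos_of_pos hy q
      rw [mul_assoc]
      refine mul_le_mul_of_nonneg_left ?_ hC
      calc |t| ^ K * (x ^ q + (x + t) ^ q) ≤ |y| ^ K * (2 * (x ^ q + (x + y) ^ q)) := by
            refine mul_le_mul (pow_le_pow_left₀ (abs_nonneg _) t2 K) (by linarith) ?_ (by positivity)
            linarith [Real.rpow_pos_of_pos t1 q]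
        _ = _ := by ring

namespace Frame

variable {X ι : Type*} [NormedAddCommGroup X] [NormedSpace ℝ X] [Fintype ι]
variable {𝔽 : Frame X ι} {G : Gain X ι}

theorem Smooth.rpow {Λ : X → ℝ} (h : 𝔽.Smooth Λ) (hpos : ∀ p ∈ 𝔽.S, 0 < Λ p) (s : ℝ) :
    𝔽.Smooth (fun p => Λ p ^ s) :=
  ContDiffOn.rpow_const_of_ne h fun p hp => (hpos p hp).ne'

theorem D_rpow {Λ : X → ℝ} (h : 𝔽.Smooth Λ) (hpos : ∀ p ∈ 𝔽.S, 0 < Λ p) (s : ℝ) (i : ι) {p : X}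
    (hp : p ∈ 𝔽.S) : 𝔽.D i (fun p => Λ p ^ s) p = s * (Λ p ^ (s - 1) * 𝔽.D i Λ p) := by
  rw [D_eq hp ((h.hasFDerivWithinAt hp).rpow_const (p := s) (Or.inl (hpos p hp).ne'))]
  simp [Frame.D, mul_assoc]

theorem Sym.rpow {Λ : X → ℝ} (h : 𝔽.Sym G Λ Λ) (hpos : ∀ p ∈ 𝔽.S, 0 < Λ p) (s : ℝ) :
    𝔽.Sym G (fun p => Λ p ^ s) (fun p => Λ p ^ s) := by
  have base : ∀ s : ℝ, ∃ C, 0 ≤ C ∧ ∀ p ∈ 𝔽.S, ‖Λ p ^ s‖ ≤ C * Λ p ^ s := fun s =>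
    ⟨1, zero_le_one, fun p hp => by
      rw [one_mul, Real.norm_of_nonneg (Real.rpow_pos_of_pos (hpos p hp) s).le]⟩
  refine ⟨h.1.rpow hpos s, fun n => ?_⟩
  induction n generalizing s with
  | zero => exact base s
  | succ n ih =>
    refine ⟨base s, fun i => ?_⟩
    have h1 := (ih (s - 1)).mul (h.1.rpow hpos _) (h.1.D i) ((h.D i).2 n)
    have h2 := ((sym_const s).2 n).mul (smooth_const s) ((h.1.rpow hpos _).mul (h.1.D i)) h1
    refine (h2.mono ⟨1, zero_le_one, fun p hp => ?_⟩).congr fun p hp => D_rpow h.1 hpos s i hp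
    have : Λ p ^ s = Λ p ^ (s - 1) * Λ p := by
      rw [Real.rpow_sub_one (hpos p hp).ne', div_mul_cancel₀ _ (hpos p hp).ne']
    exact le_of_eq (by simp only [this]; ring)

theorem Smooth.binRem {Λ δ : X → ℝ} (h : 𝔽.Smooth Λ) (hδ : 𝔽.Smooth δ)
    (hpos : ∀ p ∈ 𝔽.S, 0 < Λ p) (hpos' : ∀ p ∈ 𝔽.S, 0 < Λ p + δ p) (s : ℝ) (K : ℕ) :
    𝔽.Smooth (fun p => binRem s K (Λ p) (δ p)) := by
  refine ((h.add hδ).rpow hpos' s).sub (Smooth.sum fun k _ => ?_)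
  exact (smooth_const _).mul (ContDiffOn.mul (ContDiffOn.pow hδ k) (h.rpow hpos _))

theorem D_binRem {Λ δ : X → ℝ} (h : 𝔽.Smooth Λ) (hδ : 𝔽.Smooth δ)
    (hpos : ∀ p ∈ 𝔽.S, 0 < Λ p) (hpos' : ∀ p ∈ 𝔽.S, 0 < Λ p + δ p) (s : ℝ) (K : ℕ) (i : ι)
    {p : X} (hp : p ∈ 𝔽.S) :
    𝔽.D i (fun p => Shubin.binRem s (K + 1) (Λ p) (δ p)) p =
      s * (𝔽.D i Λ p * Shubin.binRem (s - 1) (K + 1) (Λ p) (δ p) +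
        𝔽.D i δ p * Shubin.binRem (s - 1) K (Λ p) (δ p)) := by
  have h1 := D_rpow (h.add hδ) hpos' s i hp
  rw [D_add h hδ i hp] at h1
  have sm : ∀ k : ℕ, 𝔽.Smooth (fun p => δ p ^ k) := fun k => ContDiffOn.pow hδ k
  have dp : ∀ k : ℕ, 𝔽.D i (fun p => δ p ^ k) p = k * δ p ^ (k - 1) * 𝔽.D i δ p := by
    intro k
    exact (D_eq hp ((hδ.hasFDerivWithinAt hp).pow k) i).trans (by simp [Frame.D])
  have h2 : 𝔽.D i (fun p => ∑ k ∈ Finset.range (K + 1), rbin s k * (δ p ^ k * Λ p ^ (s - k))) p =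
      ∑ k ∈ Finset.range (K + 1), rbin s k * ((k * δ p ^ (k - 1) * 𝔽.D i δ p) * Λ p ^ (s - k) +
      δ p ^ k * ((s - k) * Λ p ^ (s - k - 1) * 𝔽.D i Λ p)) := by
    rw [D_sum (fun k _ => (smooth_const _).mul ((sm k).mul (h.rpow hpos _))) i hp]
    refine Finset.sum_congr rfl fun k _ => ?_
    rw [D_const_mul _ ((sm k).mul (h.rpow hpos _)) i hp, D_mul (sm k) (h.rpow hpos _) i hp, dp,
      D_rpow h hpos _ i hp]
    ring
  have e : 𝔽.D i (fun p => Shubin.binRem s (K + 1) (Λ p) (δ p)) p =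
      𝔽.D i (fun p => (Λ p + δ p) ^ s) p -
      𝔽.D i (fun p => ∑ k ∈ Finset.range (K + 1), rbin s k * (δ p ^ k * Λ p ^ (s - k))) p :=
    D_sub ((h.add hδ).rpow hpos' s)
      (Smooth.sum fun k _ => (smooth_const _).mul ((sm k).mul (h.rpow hpos _))) i hp
  rw [e, h1, h2, sum_rbin_deriv s K, Shubin.binRem, Shubin.binRem]
  ring

/-- Differentiating the remainder gives one term with DΛ and one with Dδ. The latter lowers K and s
together and keeps s - K. The former lowers s alone, which may cost a further factor M in the
comparison of Λ + δ with Λ; the hypothesis that DΛ is smaller by M⁻¹ than the gain requires pays for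
it. Thus the power of M in the estimate does not grow with the number of derivatives. -/
theorem Sym.binRem {Λ δ mδ M : X → ℝ} (h : 𝔽.Smooth Λ) (hδ : 𝔽.Sym G mδ δ)
    (hmδ : ∀ p ∈ 𝔽.S, 0 ≤ mδ p)
    (hpos : ∀ p ∈ 𝔽.S, 0 < Λ p) (hpos' : ∀ p ∈ 𝔽.S, 0 < Λ p + δ p) (hM : ∀ p ∈ 𝔽.S, 1 ≤ M p)
    (hΛ : ∀ i, 𝔽.Sym G (fun p => Λ p * (M p)⁻¹ * G.g i p) (𝔽.D i Λ))
    (hΛ' : 𝔽.Sym G (fun p => Λ p + δ p) (fun p => Λ p + δ p))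
    (B : ℝ) (hB : 1 ≤ B) (h1 : ∀ p ∈ 𝔽.S, Λ p ≤ B * M p * (Λ p + δ p))
    (h2 : ∀ p ∈ 𝔽.S, Λ p + δ p ≤ B * M p * Λ p) (s : ℝ) (K : ℕ) :
    𝔽.Sym G (fun p => mδ p ^ K * (Λ p ^ (s - K) * M p ^ |s - K|))
      (fun p => Shubin.binRem s K (Λ p) (δ p)) := by
  obtain ⟨Cδ, hCδ, hδb⟩ := hδ.bound
  have cmp : ∀ q : ℝ, ∀ p ∈ 𝔽.S, (Λ p + δ p) ^ q ≤ B ^ |q| * (Λ p ^ q * M p ^ |q|) := by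
    intro q p hp
    have a0 := hpos p hp
    have a1 := hpos' p hp
    have m1 := hM p hp
    have hBM : 0 < B * M p := by positivity
    have e : B ^ |q| * (Λ p ^ q * M p ^ |q|) = (B * M p) ^ |q| * Λ p ^ q := by
      rw [Real.mul_rpow (by positivity) (by positivity)]; ring
    rw [e]
    rcases le_total 0 q with hq | hq
    · rw [abs_of_nonneg hq, ← Real.mul_rpow hBM.le a0.le]
      exact Real.rpow_le_rpow a1.le (h2 p hp) hq
    · rw [abs_of_nonpos hq, Real.rpow_neg hBM.le, ← Real.inv_rpow hBM.le,
        ← Real.mul_rpow (inv_nonneg.2 hBM.le) a0.le]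
      refine Real.rpow_le_rpow_of_nonpos (by positivity) ?_ hq
      rw [inv_mul_le_iff₀ hBM]
      exact h1 p hp
  have base : ∀ (s : ℝ) (K : ℕ), ∃ C, 0 ≤ C ∧ ∀ p ∈ 𝔽.S,
      ‖Shubin.binRem s K (Λ p) (δ p)‖ ≤ C * (mδ p ^ K * (Λ p ^ (s - K) * M p ^ |s - K|)) := by
    intro s K
    obtain ⟨C, hC, hb⟩ := abs_binRem_le K s
    refine ⟨C * (Cδ ^ K * (1 + B ^ |s - K|)), by positivity, fun p hp => ?_⟩
    have a0 := hpos p hp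
    have m1 := hM p hp
    have q1 := Real.rpow_pos_of_pos a0 (s - K)
    have q2 : 1 ≤ M p ^ |s - K| := Real.one_le_rpow m1 (abs_nonneg _)
    have q3 := Real.rpow_pos_of_pos (hpos' p hp) (s - K)
    calc ‖Shubin.binRem s K (Λ p) (δ p)‖
        ≤ C * (|δ p| ^ K * (Λ p ^ (s - K) + (Λ p + δ p) ^ (s - K))) := hb _ _ a0 (hpos' p hp)
      _ ≤ C * ((Cδ * mδ p) ^ K * ((1 + B ^ |s - K|) * (Λ p ^ (s - K) * M p ^ |s - K|))) := by
        refine mul_le_mul_of_nonneg_left (mul_le_mul ?_ ?_ (by positivity) ?_) hC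
        · exact pow_le_pow_left₀ (abs_nonneg _) (hδb p hp) K
        · have := cmp (s - K) p hp
          nlinarith
        · exact pow_nonneg ((norm_nonneg _).trans (hδb p hp)) K
      _ = _ := by rw [mul_pow]; ring
  refine ⟨h.binRem hδ.1 hpos hpos' s K, fun n => ?_⟩
  induction n generalizing s K with
  | zero => exact base s K
  | succ n ih =>
    cases K with
    | zero =>
      -- For K = 0 the remainder is the full power (Λ + δ)^s, whose derivatives are controlled by
      -- the symbol property of the sum.
      have := (hΛ'.rpow hpos' s).2 (n + 1)
      refine (this.mono ⟨B ^ |s|, by positivity, fun p hp => ?_⟩).congr fun p hp => ?_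
      · simpa using cmp s p hp
      · simp [Shubin.binRem]
    | succ K =>
      refine ⟨base s (K + 1), fun i => ?_⟩
      have sm := fun s K => h.binRem (δ := δ) hδ.1 hpos hpos' s K
      have t1 := ((hΛ i).2 n).mul (h.D i) (sm (s - 1) (K + 1)) (ih (s - 1) (K + 1))
      have t2 := ((hδ.D i).2 n).mul (hδ.1.D i) (sm (s - 1) K) (ih (s - 1) K)
      have t1' := t1.mono (m' := fun p => mδ p ^ (K + 1) * (Λ p ^ (s - (K + 1 : ℕ)) *
        M p ^ |s - (K + 1 : ℕ)|) * G.g i p) ?_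
      · have t2' := t2.mono (m' := fun p => mδ p ^ (K + 1) * (Λ p ^ (s - (K + 1 : ℕ)) *
          M p ^ |s - (K + 1 : ℕ)|) * G.g i p) ⟨1, zero_le_one, fun p hp => ?_⟩
        · have t3 := ((sym_const s).2 n).mul (smooth_const s) (((h.D i).mul (sm _ _)).add
            ((hδ.1.D i).mul (sm _ _))) (t1'.add ((h.D i).mul (sm _ _))
              ((hδ.1.D i).mul (sm _ _)) t2')
          simp only [one_mul] at t3
          exact t3.congr fun p hp => D_binRem h hδ.1 hpos hpos' s K i hp
        · rw [one_mul, show s - ((K + 1 : ℕ) : ℝ) = s - 1 - K by push_cast; ring]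
          exact le_of_eq (by ring)
      · refine ⟨1, zero_le_one, fun p hp => ?_⟩
        have a0 := hpos p hp
        have m1 := hM p hp
        have m0 : 0 < M p := one_pos.trans_le m1
        rw [show s - 1 - ((K + 1 : ℕ) : ℝ) = s - (K + 1 : ℕ) - 1 by ring, one_mul]
        set q := s - ((K + 1 : ℕ) : ℝ)
        have e1 : Λ p * Λ p ^ (q - 1) = Λ p ^ q := by
          rw [Real.rpow_sub_one a0.ne', mul_div_cancel₀ _ a0.ne']
        -- Here |q - 1| ≤ |q| + 1, and the surplus factor M cancels against M⁻¹.
        have e2 : (M p)⁻¹ * M p ^ |q - 1| ≤ M p ^ |q| := by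
          rw [← Real.rpow_neg_one, ← Real.rpow_add m0]
          refine Real.rpow_le_rpow_of_exponent_le m1 ?_
          have := abs_sub q 1
          rw [abs_one] at this
          linarith
        have c0 : 0 ≤ mδ p ^ (K + 1) * Λ p ^ q * G.g i p :=
          mul_nonneg (mul_nonneg (pow_nonneg (hmδ p hp) _) (Real.rpow_pos_of_pos a0 q).le)
            (G.nonneg i p)
        calc _ = mδ p ^ (K + 1) * (Λ p * Λ p ^ (q - 1)) * G.g i p *
              ((M p)⁻¹ * M p ^ |q - 1|) := by ring
          _ ≤ mδ p ^ (K + 1) * Λ p ^ q * G.g i p * M p ^ |q| := by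
            rw [e1]; exact mul_le_mul_of_nonneg_left e2 c0
          _ = _ := by ring

end Frame

end

/-! ### Coordinate frames for phase space, the parameter and the integration variables -/

section

/-- The product of two frames. -/
def Frame.prod {X Y ι κ : Type*} [NormedAddCommGroup X] [NormedSpace ℝ X] [NormedAddCommGroup Y]
    [NormedSpace ℝ Y] [Fintype ι] [Fintype κ] (𝔽 : Frame X ι) (𝔼 : Frame Y κ) :
    Frame (X × Y) (ι ⊕ κ) where
  S := 𝔽.S ×ˢ 𝔼.S
  b := Sum.elim (fun i => (𝔽.b i, 0)) (fun k => (0, 𝔼.b k))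
  ℓ := Sum.elim (fun i => (𝔽.ℓ i).comp (ContinuousLinearMap.fst ℝ X Y))
    (fun k => (𝔼.ℓ k).comp (ContinuousLinearMap.snd ℝ X Y))
  sum_eq := by
    rintro ⟨x, y⟩
    have h1 := 𝔽.sum_eq x
    have h2 := 𝔼.sum_eq y
    ext
    · simpa [Prod.fst_sum] using h1
    · simpa [Prod.snd_sum] using h2
  uniq := 𝔽.uniq.prod 𝔼.uniq
  conv := 𝔽.conv.prod 𝔼.conv
  clint := by
    rw [interior_prod_eq, closure_prod_eq]
    exact prod_mono 𝔽.clint 𝔼.clint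

variable {n : ℕ}

/-- The index set of the coordinates of phase space. -/
abbrev Idx (n : ℕ) : Type := Fin n ⊕ Fin n

/-- The space of the integration variables `w = (y, η)`. -/
abbrev Dbl (n : ℕ) : Type := Space n × Space n

/-- The frame of all of `ℝⁿ`. -/
def frSpace (n : ℕ) : Frame (Space n) (Fin n) where
  S := univ
  b := fun k => EuclideanSpace.single k 1
  ℓ := fun k => EuclideanSpace.proj k
  sum_eq := by
    intro x
    ext k
    simp [Pi.single_apply]
  uniq := uniqueDiffOn_univ
  conv := convex_univ
  clint := by simp

/-- The frame of the integration variables. -/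
def frW (n : ℕ) : Frame (Dbl n) (Idx n) := (frSpace n).prod (frSpace n)

theorem frW_S : (frW n).S = univ := by simp [frW, Frame.prod, frSpace]

/-- The identification of pairs with points of phase space. -/
def toE (n : ℕ) : Dbl n ≃L[ℝ] Phase n := (WithLp.prodContinuousLinearEquiv 2 ℝ _ _).symm

theorem toE_apply (w : Dbl n) : toE n w = pt w.1 w.2 := rfl

theorem toE_symm_apply (z : Phase n) : (toE n).symm z = (z.fst, z.snd) := rfl

instance instContinuousSMulPhase : ContinuousSMul ℝ (Phase n) := IsBoundedSMul.continuousSMul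

/-- The frame of phase space. -/
def frE (n : ℕ) : Frame (Phase n) (Idx n) where
  S := univ
  b := fun i => toE n ((frW n).b i)
  ℓ := fun i => ((frW n).ℓ i).comp ((toE n).symm : Phase n →L[ℝ] Dbl n)
  sum_eq := by
    intro z
    have h := congrArg (toE n) ((frW n).sum_eq ((toE n).symm z))
    rw [map_sum] at h
    simpa using h
  uniq := uniqueDiffOn_univ
  conv := convex_univ
  clint := by simp

/-- The frame of the parameter half line. -/
def frR : Frame ℝ Unit where
  S := Ici 0
  b := fun _ => 1
  ℓ := fun _ => ContinuousLinearMap.id ℝ ℝ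
  sum_eq := by simp
  uniq := uniqueDiffOn_Ici 0
  conv := convex_Ici 0
  clint := by simp

/-- The frame of the parameter-dependent phase space. -/
def frP (n : ℕ) : Frame (Phase n × ℝ) (Idx n ⊕ Unit) := (frE n).prod frR

/-- The frame of amplitudes. -/
def frX (n : ℕ) : Frame ((Phase n × ℝ) × Dbl n) ((Idx n ⊕ Unit) ⊕ Idx n) := (frP n).prod (frW n)

theorem mem_frP {p : Phase n × ℝ} : p ∈ (frP n).S ↔ 0 ≤ p.2 := by
  simp [frP, Frame.prod, frE, frR]

theorem mem_frX {q : (Phase n × ℝ) × Dbl n} : q ∈ (frX n).S ↔ 0 ≤ q.1.2 := by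
  rw [← mem_frP]
  simp [frX, Frame.prod, frW_S]

theorem frP_S : (frP n).S = univ ×ˢ Ici 0 := by ext p; simp [mem_frP]

theorem frX_S : (frX n).S = (frP n).S ×ˢ univ := by ext p; simp [mem_frX, mem_frP]

/-! ### Brackets -/

section Bracket

variable {E : Type*} [NormedAddCommGroup E]

theorem jap_sq (z : E) : jap z ^ 2 = 1 + ‖z‖ ^ 2 := Real.sq_sqrt (by positivity)

theorem japPar_sq (z : E) (μ : ℝ) : japPar z μ ^ 2 = 1 + ‖z‖ ^ 2 + μ ^ 2 :=
  Real.sq_sqrt (by positivity)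

theorem one_le_jap (z : E) : 1 ≤ jap z := Real.one_le_sqrt.2 (by nlinarith [norm_nonneg z])

theorem jap_pos (z : E) : 0 < jap z := one_pos.trans_le (one_le_jap z)

theorem jap_le_japPar (z : E) (μ : ℝ) : jap z ≤ japPar z μ :=
  Real.sqrt_le_sqrt (by nlinarith [sq_nonneg μ])

theorem one_le_japPar (z : E) (μ : ℝ) : 1 ≤ japPar z μ := (one_le_jap z).trans (jap_le_japPar z μ)

theorem japPar_pos (z : E) (μ : ℝ) : 0 < japPar z μ := one_pos.trans_le (one_le_japPar z μ)

theorem jap_neg (z : E) : jap (-z) = jap z := by simp [jap]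

theorem norm_le_jap (z : E) : ‖z‖ ≤ jap z := by
  refine Real.le_sqrt_of_sq_le ?_; linarith

theorem le_japPar (z : E) (μ : ℝ) : |μ| ≤ japPar z μ := by
  refine Real.le_sqrt_of_sq_le ?_; rw [sq_abs]; nlinarith [sq_nonneg ‖z‖]

/-- Peetre's inequality, uniform in the parameter. Applied to z + w and -w it also gives the reverse
comparison, and with it estimates for powers of either sign. -/
theorem japPar_add_le (z w : E) (μ : ℝ) : japPar (z + w) μ ≤ 2 * jap w * japPar z μ := by
  have h1 := jap_pos w
  have h2 := japPar_pos z μ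
  refine Real.sqrt_le_iff.2 ⟨by positivity, ?_⟩
  rw [mul_pow, mul_pow, jap_sq, japPar_sq]
  have h := norm_add_le z w
  have h3 : ‖z + w‖ ^ 2 ≤ 2 * ‖z‖ ^ 2 + 2 * ‖w‖ ^ 2 := by
    nlinarith [norm_nonneg (z + w), sq_nonneg (‖z‖ - ‖w‖), norm_nonneg z, norm_nonneg w]
  nlinarith [sq_nonneg ‖z‖, sq_nonneg ‖w‖, sq_nonneg μ, mul_nonneg (sq_nonneg ‖w‖) (sq_nonneg ‖z‖),
    mul_nonneg (sq_nonneg ‖w‖) (sq_nonneg μ)]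

theorem japPar_zero (z : E) : japPar z 0 = jap z := by simp [japPar, jap]

theorem jap_add_le (z w : E) : jap (z + w) ≤ 2 * jap w * jap z := by
  simpa [japPar_zero] using japPar_add_le z w 0

theorem japPar_le_add (z w : E) (μ : ℝ) : japPar z μ ≤ 2 * jap w * japPar (z + w) μ := by
  simpa [jap_neg] using japPar_add_le (z + w) (-w) μ

theorem jap_le_add (z w : E) : jap z ≤ 2 * jap w * jap (z + w) := by
  simpa [jap_neg] using jap_add_le (z + w) (-w)

/-- For a negative exponent the roles of the two comparisons are exchanged; this is why both are
assumed and |s| appears. -/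
theorem rpow_le_of_comparable {x y B : ℝ} (hx : 0 < x) (hy : 0 < y) (hB : 0 < B) (h1 : x ≤ B * y)
    (h2 : y ≤ B * x) (s : ℝ) : x ^ s ≤ B ^ |s| * y ^ s := by
  rcases le_total 0 s with hs | hs
  · rw [abs_of_nonneg hs, ← Real.mul_rpow hB.le hy.le]
    exact Real.rpow_le_rpow hx.le h1 hs
  · rw [abs_of_nonpos hs, Real.rpow_neg hB.le, ← Real.inv_rpow hB.le,
      ← Real.mul_rpow (inv_nonneg.2 hB.le) hy.le]
    refine Real.rpow_le_rpow_of_nonpos (by positivity) ?_ hs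
    rwa [inv_mul_le_iff₀ hB]

theorem jap_add_rpow_le (z w : E) (s : ℝ) :
    jap (z + w) ^ s ≤ 2 ^ |s| * (jap z ^ s * jap w ^ |s|) := by
  have := rpow_le_of_comparable (jap_pos _) (jap_pos _) (mul_pos two_pos (jap_pos w))
    (jap_add_le z w) (jap_le_add z w) s
  rw [Real.mul_rpow zero_le_two (jap_pos w).le] at this
  linarith

theorem japPar_add_rpow_le (z w : E) (μ s : ℝ) :
    japPar (z + w) μ ^ s ≤ 2 ^ |s| * (japPar z μ ^ s * jap w ^ |s|) := by
  have := rpow_le_of_comparable (japPar_pos _ _) (japPar_pos _ _) (mul_pos two_pos (jap_pos w))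
    (japPar_add_le z w μ) (japPar_le_add z w μ) s
  rw [Real.mul_rpow zero_le_two (jap_pos w).le] at this
  linarith

theorem continuous_jap : Continuous (jap : E → ℝ) :=
  Real.continuous_sqrt.comp (by fun_prop)

theorem continuous_japPar : Continuous (fun p : E × ℝ => japPar p.1 p.2) :=
  Real.continuous_sqrt.comp (by fun_prop)

end Bracket

/-! ### Symbols as elements of weighted classes -/

/-- The gains of parameter-dependent symbols. -/
def gP (n : ℕ) : Gain (Phase n × ℝ) (Idx n ⊕ Unit) where
  g := Sum.elim (fun _ p => (jap p.1)⁻¹) (fun _ p => (japPar p.1 p.2)⁻¹)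
  nonneg := by
    rintro (i | i) p
    · exact inv_nonneg.2 (jap_pos _).le
    · exact inv_nonneg.2 (japPar_pos _ _).le

/-- The weight of the symbols of order `d` and regularity `ν`. -/
def wP (n : ℕ) (d ν : ℝ) (p : Phase n × ℝ) : ℝ := jap p.1 ^ ν * japPar p.1 p.2 ^ (d - ν)

theorem wP_pos (d ν : ℝ) (p : Phase n × ℝ) : 0 < wP n d ν p :=
  mul_pos (Real.rpow_pos_of_pos (jap_pos _) _) (Real.rpow_pos_of_pos (japPar_pos _ _) _)

/-- Symbols of order `d` and regularity `ν`. -/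
abbrev SymP (d ν : ℝ) (f : Phase n × ℝ → ℂ) : Prop := (frP n).Sym (gP n) (wP n d ν) f

theorem D_inr_eq {f : Phase n × ℝ → ℂ} (hf : (frP n).Smooth f) (z : Phase n) {μ : ℝ} (hμ : 0 ≤ μ) :
    derivWithin (fun μ => f (z, μ)) (Ici 0) μ = (frP n).D (Sum.inr ()) f (z, μ) := by
  have h := hf.hasFDerivWithinAt (mem_frP.2 hμ : (z, μ) ∈ (frP n).S)
  have h2 : HasFDerivWithinAt (fun μ : ℝ => (z, μ)) (ContinuousLinearMap.inr ℝ (Phase n) ℝ)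
      (Ici 0) μ := (hasFDerivAt_prodMk_right z μ).hasFDerivWithinAt
  have h3 := (h.comp μ h2 (fun μ' h' => mem_frP.2 h')).hasDerivWithinAt.derivWithin
    (uniqueDiffOn_Ici 0 μ hμ)
  refine h3.trans ?_
  simp only [Frame.D]; rfl

theorem hasFDerivAt_slice {f : Phase n × ℝ → ℂ} (hf : (frP n).Smooth f) (z : Phase n) {μ : ℝ}
    (hμ : 0 ≤ μ) : HasFDerivAt (fun z => f (z, μ))
      ((fderivWithin ℝ f (frP n).S (z, μ)).comp (ContinuousLinearMap.inl ℝ (Phase n) ℝ)) z := by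
  have h := hf.hasFDerivWithinAt (mem_frP.2 hμ : (z, μ) ∈ (frP n).S)
  have h2 : HasFDerivWithinAt (fun z : Phase n => (z, μ)) (ContinuousLinearMap.inl ℝ (Phase n) ℝ)
      univ z := (hasFDerivAt_prodMk_left z μ).hasFDerivWithinAt
  exact hasFDerivWithinAt_univ.1 (h.comp z h2 (fun z' _ => mem_frP.2 hμ))

theorem fderiv_slice {f : Phase n × ℝ → ℂ} (hf : (frP n).Smooth f) (z : Phase n) {μ : ℝ}
    (hμ : 0 ≤ μ) (i : Idx n) :
    fderiv ℝ (fun z => f (z, μ)) z ((frE n).b i) = (frP n).D (Sum.inl i) f (z, μ) := by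
  rw [(hasFDerivAt_slice hf z hμ).fderiv]; rfl

theorem contDiff_slice {f : Phase n × ℝ → ℂ} (hf : (frP n).Smooth f) {μ : ℝ} (hμ : 0 ≤ μ) :
    ContDiff ℝ ∞ (fun z => f (z, μ)) := by
  rw [← contDiffOn_univ]
  have h : ContDiffOn ℝ ∞ f (frP n).S := hf
  exact h.comp (contDiff_prodMk_left μ).contDiffOn fun z _ => mem_frP.2 hμ

/-- Iterated derivatives in the parameter. -/
def Dμ (n : ℕ) (j : ℕ) (f : Phase n × ℝ → ℂ) : Phase n × ℝ → ℂ := ((frP n).D (Sum.inr ()))^[j] f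

theorem Dμ_succ (j : ℕ) (f : Phase n × ℝ → ℂ) : Dμ n (j + 1) f = Dμ n j ((frP n).D (Sum.inr ()) f) :=
  Function.iterate_succ_apply _ _ _

theorem Dμ_succ' (j : ℕ) (f : Phase n × ℝ → ℂ) : Dμ n (j + 1) f = (frP n).D (Sum.inr ()) (Dμ n j f) :=
  Function.iterate_succ_apply' _ _ _

theorem smooth_Dμ (j : ℕ) {f : Phase n × ℝ → ℂ} (hf : (frP n).Smooth f) :
    (frP n).Smooth (Dμ n j f) := by
  induction j with
  | zero => exact hf
  | succ j ih => rw [Dμ_succ']; exact ih.D _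

theorem iteratedDerivWithin_eq_Dμ (j : ℕ) {f : Phase n × ℝ → ℂ} (hf : (frP n).Smooth f)
    (z : Phase n) {μ : ℝ} (hμ : 0 ≤ μ) :
    iteratedDerivWithin j (fun μ => f (z, μ)) (Ici 0) μ = Dμ n j f (z, μ) := by
  induction j generalizing μ with
  | zero => simp [Dμ]
  | succ j ih =>
    rw [iteratedDerivWithin_succ, Dμ_succ', ← D_inr_eq (smooth_Dμ j hf) z hμ]
    exact derivWithin_congr (fun μ' h' => ih h') (ih hμ)

/-- The definition of the symbol class differentiates first in μ and then in z, whereas the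
recursive classes allow any order; commuting the derivatives reconciles the two. -/
theorem Dμ_D (j : ℕ) {f : Phase n × ℝ → ℂ} (hf : (frP n).Smooth f) (i : Idx n ⊕ Unit) :
    EqOn (Dμ n j ((frP n).D i f)) ((frP n).D i (Dμ n j f)) (frP n).S := by
  induction j with
  | zero => exact fun _ _ => rfl
  | succ j ih =>
    rw [Dμ_succ', Dμ_succ']
    exact fun p hp => (Frame.D_congr ih _ hp).trans (Frame.D_comm (smooth_Dμ j hf) _ _ hp)

theorem sym_Dμ (j : ℕ) {m : Phase n × ℝ → ℝ} {f : Phase n × ℝ → ℂ} (hf : (frP n).Sym (gP n) m f) :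
    (frP n).Sym (gP n) (fun p => m p * (japPar p.1 p.2)⁻¹ ^ j) (Dμ n j f) := by
  induction j with
  | zero => simpa [Dμ] using hf
  | succ j ih =>
    rw [Dμ_succ']
    have h := ih.D (Sum.inr ())
    simp only [pow_succ, ← mul_assoc]
    exact h

/-- The z-derivative of a slice is a sum of the functionals `ℓ` with coefficients the coordinate
derivatives; these are again symbols, with weight divided by ⟨z⟩, so induction on k applies. -/
theorem sym_iteratedFDeriv_le (k : ℕ) {m : Phase n × ℝ → ℝ} {f : Phase n × ℝ → ℂ}
    (hf : (frP n).Sym (gP n) m f) : ∃ C, 0 ≤ C ∧ ∀ z : Phase n, ∀ μ : ℝ, 0 ≤ μ →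
      ‖iteratedFDeriv ℝ k (fun z => f (z, μ)) z‖ ≤ C * (m (z, μ) * (jap z)⁻¹ ^ k) := by
  induction k generalizing m f with
  | zero =>
    obtain ⟨C, hC, h⟩ := hf.bound
    exact ⟨C, hC, fun z μ hμ => by simpa using h (z, μ) (mem_frP.2 hμ)⟩
  | succ k ih =>
    choose C hC h using fun i : Idx n => ih (hf.D (Sum.inl i))
    refine ⟨∑ i, ‖(frE n).ℓ i‖ * C i, Finset.sum_nonneg fun i _ => mul_nonneg (norm_nonneg _) (hC i),
      fun z μ hμ => ?_⟩
    have e : fderiv ℝ (fun z => f (z, μ)) = fun z => ∑ i,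
        ContinuousLinearMap.smulRightL ℝ (Phase n) ℂ ((frE n).ℓ i)
          ((frP n).D (Sum.inl i) f (z, μ)) := by
      funext z
      ext x
      conv_lhs => rw [← (frE n).sum_eq x]
      simp [fderiv_slice hf.1 z hμ, -fderiv_eq_smul_deriv]
    have cd : ∀ i : Idx n, ContDiff ℝ ∞ (fun z => (frP n).D (Sum.inl i) f (z, μ)) := fun i =>
      contDiff_slice (hf.1.D _) hμ
    rw [← norm_iteratedFDeriv_fderiv, e, iteratedFDeriv_sum]
    · rw [Finset.sum_apply, Finset.sum_mul]
      refine (norm_sum_le _ _).trans (Finset.sum_le_sum fun i _ => ?_)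
      have h1 := ContinuousLinearMap.norm_iteratedFDeriv_comp_left
        (ContinuousLinearMap.smulRightL ℝ (Phase n) ℂ ((frE n).ℓ i))
        (f := fun z => (frP n).D (Sum.inl i) f (z, μ)) (x := z) (n := k)
        ((cd i).contDiffAt (x := z)) (by exact_mod_cast le_top)
      refine h1.trans ?_
      rw [mul_assoc]
      refine mul_le_mul ?_ ?_ (norm_nonneg _) (norm_nonneg _)
      · refine ContinuousLinearMap.opNorm_le_bound _ (norm_nonneg _) fun x => ?_
        simp [ContinuousLinearMap.norm_smulRight_apply]
      · refine (h i z μ hμ).trans (le_of_eq ?_)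
        simp only [gP, Sum.elim_inl, pow_succ]; ring
    · intro i _
      exact (((ContinuousLinearMap.smulRightL ℝ (Phase n) ℂ ((frE n).ℓ i)).contDiff.comp (cd i)).of_le
        (by exact_mod_cast le_top))

theorem norm_iteratedFDeriv_fderiv_apply_le {f : Phase n → ℂ} (hf : ContDiff ℝ ∞ f) (v : Phase n)
    (k : ℕ) (z : Phase n) : ‖iteratedFDeriv ℝ k (fun z => fderiv ℝ f z v) z‖ ≤
      ‖v‖ * ‖iteratedFDeriv ℝ (k + 1) f z‖ := by
  have cd : ContDiff ℝ ∞ (fderiv ℝ f) := hf.fderiv_right (by simp)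
  have h1 := ContinuousLinearMap.norm_iteratedFDeriv_comp_left
    (ContinuousLinearMap.apply ℝ ℂ v) (f := fderiv ℝ f) (x := z) (n := k)
    (cd.contDiffAt (x := z)) (by exact_mod_cast le_top)
  refine h1.trans ?_
  rw [norm_iteratedFDeriv_fderiv]
  refine mul_le_mul_of_nonneg_right ?_ (norm_nonneg _)
  refine ContinuousLinearMap.opNorm_le_bound _ (norm_nonneg _) fun T => ?_
  simpa [mul_comm] using T.le_opNorm v

theorem sym_of_iteratedFDeriv_le {m : Phase n × ℝ → ℝ} {f : Phase n × ℝ → ℂ}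
    (hm : ∀ p, 0 ≤ m p) (hs : (frP n).Smooth f)
    (h : ∀ k j : ℕ, ∃ C, 0 ≤ C ∧ ∀ z : Phase n, ∀ μ : ℝ, 0 ≤ μ →
      ‖iteratedFDeriv ℝ k (fun z => Dμ n j f (z, μ)) z‖ ≤
        C * (m (z, μ) * (jap z)⁻¹ ^ k * (japPar z μ)⁻¹ ^ j)) : (frP n).Sym (gP n) m f := by
  refine Frame.sym_of_family (𝒢 := fun m f => (∀ p, 0 ≤ m p) ∧ (frP n).Smooth f ∧
    ∀ k j : ℕ, ∃ C, 0 ≤ C ∧ ∀ z : Phase n, ∀ μ : ℝ, 0 ≤ μ →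
      ‖iteratedFDeriv ℝ k (fun z => Dμ n j f (z, μ)) z‖ ≤
        C * (m (z, μ) * (jap z)⁻¹ ^ k * (japPar z μ)⁻¹ ^ j)) ?_ ⟨hm, hs, h⟩
  rintro m f ⟨hm, hs, h⟩
  refine ⟨?_, fun i => (frP n).D i f, ?_, fun p hp => ⟨_, hs.hasFDerivWithinAt hp, fun i => rfl⟩⟩
  · obtain ⟨C, hC, h'⟩ := h 0 0
    exact ⟨C, hC, fun p hp => by simpa [Dμ] using h' p.1 p.2 (mem_frP.1 hp)⟩
  · rintro (i | i)
    · refine ⟨fun p => mul_nonneg (hm p) ((gP n).nonneg _ _), hs.D _, fun k j => ?_⟩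
      obtain ⟨C, hC, h'⟩ := h (k + 1) j
      refine ⟨‖(frE n).b i‖ * C, by positivity, fun z μ hμ => ?_⟩
      have e : (fun z => Dμ n j ((frP n).D (Sum.inl i) f) (z, μ)) =
          fun z => fderiv ℝ (fun z => Dμ n j f (z, μ)) z ((frE n).b i) := by
        funext z
        rw [fderiv_slice (smooth_Dμ j hs) z hμ]
        exact Dμ_D j hs _ (mem_frP.2 hμ)
      rw [e]
      refine (norm_iteratedFDeriv_fderiv_apply_le (contDiff_slice (smooth_Dμ j hs) hμ) _ _ _).trans ?_
      rw [mul_assoc]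
      refine mul_le_mul_of_nonneg_left ((h' z μ hμ).trans (le_of_eq ?_)) (norm_nonneg _)
      simp only [gP, Sum.elim_inl, pow_succ]; ring
    · refine ⟨fun p => mul_nonneg (hm p) ((gP n).nonneg _ _), hs.D _, fun k j => ?_⟩
      obtain ⟨C, hC, h'⟩ := h k (j + 1)
      refine ⟨C, hC, fun z μ hμ => ?_⟩
      rw [← Dμ_succ]
      refine (h' z μ hμ).trans (le_of_eq ?_)
      simp only [gP, Sum.elim_inr, pow_succ]; ring

theorem jap_rpow_sub_nat (z : Phase n) (ν : ℝ) (k : ℕ) : jap z ^ (ν - k) = jap z ^ ν * (jap z)⁻¹ ^ k := by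
  rw [Real.rpow_sub_natCast (jap_pos z).ne', inv_pow, div_eq_mul_inv]

theorem japPar_rpow_sub_nat (z : Phase n) (μ ν : ℝ) (k : ℕ) :
    japPar z μ ^ (ν - k) = japPar z μ ^ ν * (japPar z μ)⁻¹ ^ k := by
  rw [Real.rpow_sub_natCast (japPar_pos z μ).ne', inv_pow, div_eq_mul_inv]

/-- The bridge from operator norms of iterated derivatives to coordinate derivatives. It rests on
writing the total derivative through the frame in one direction and evaluating it on frame vectors
in the other. -/
theorem memSTilde_iff {d ν : ℝ} {a : Phase n → ℝ → ℂ} :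
    MemSTilde d ν a ↔ SymP d ν (fun p : Phase n × ℝ => a p.1 p.2) := by
  have wt : ∀ (z : Phase n) (μ C : ℝ) (k j : ℕ), C * jap z ^ (ν - k) * japPar z μ ^ (d - ν - j) =
      C * (wP n d ν (z, μ) * (jap z)⁻¹ ^ k * (japPar z μ)⁻¹ ^ j) := by
    intro z μ C k j
    rw [jap_rpow_sub_nat, japPar_rpow_sub_nat, wP]; ring
  constructor
  · rintro ⟨hs, h⟩
    rw [← frP_S] at hs
    refine sym_of_iteratedFDeriv_le (fun p => (wP_pos d ν p).le) hs fun k j => ?_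
    obtain ⟨C, h'⟩ := h k j
    refine ⟨|C|, abs_nonneg C, fun z μ hμ => ?_⟩
    have h2 := h' z μ hμ
    rw [wt] at h2
    have e : (fun z' => iteratedDerivWithin j (a z') (Ici 0) μ) =
        fun z => Dμ n j (fun p : Phase n × ℝ => a p.1 p.2) (z, μ) := by
      funext z'
      exact iteratedDerivWithin_eq_Dμ j hs z' hμ
    rw [e] at h2
    refine h2.trans (mul_le_mul_of_nonneg_right (le_abs_self C) ?_)
    have := wP_pos d ν (z, μ)
    have := jap_pos z
    have := japPar_pos z μ
    positivity
  · intro h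
    refine ⟨by rw [← frP_S]; exact h.1, fun k j => ?_⟩
    obtain ⟨C, hC, h'⟩ := sym_iteratedFDeriv_le k (sym_Dμ j h)
    refine ⟨C, fun z μ hμ => ?_⟩
    rw [wt]
    have e : (fun z' => iteratedDerivWithin j (a z') (Ici 0) μ) =
        fun z => Dμ n j (fun p : Phase n × ℝ => a p.1 p.2) (z, μ) := by
      funext z'
      exact iteratedDerivWithin_eq_Dμ j h.1 z' hμ
    rw [e]
    exact (h' z μ hμ).trans (le_of_eq (by ring))

/-- With d = ν the factor ⟨z,μ⟩^{d-ν} is 1 and all μ-derivatives vanish, so the classes on phase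
space need no separate calculus. -/
theorem memS_iff {ν : ℝ} {c : Phase n → ℂ} :
    MemS ν c ↔ SymP ν ν (fun p : Phase n × ℝ => c p.1) := by
  rw [← memSTilde_iff (a := fun z _ => c z)]
  constructor
  · rintro ⟨hs, h⟩
    refine ⟨(hs.comp contDiff_fst).contDiffOn, fun k j => ?_⟩
    cases j with
    | zero =>
      obtain ⟨C, h'⟩ := h k
      exact ⟨C, fun z μ _ => by simpa using h' z⟩
    | succ j =>
      refine ⟨0, fun z μ _ => ?_⟩
      have : (fun z' => iteratedDerivWithin (j + 1) (fun _ : ℝ => c z') (Ici 0) μ) =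
          fun _ : Phase n => (0 : ℂ) := by
        funext z'
        rw [iteratedDerivWithin_const]; simp
      rw [this]
      simp
  · rintro ⟨hs, h⟩
    have hs' : ContDiffOn ℝ ∞ (fun p : Phase n × ℝ => c p.1) (frP n).S := by rwa [frP_S]
    refine ⟨contDiff_slice (f := fun p : Phase n × ℝ => c p.1) hs' le_rfl, fun k => ?_⟩
    obtain ⟨C, h'⟩ := h k 0
    exact ⟨C, fun z => by simpa using h' z 0 le_rfl⟩

end

/-! ### Integration variables and amplitudes -/

section

open scoped LineDeriv

variable {n : ℕ}

instance instIsAddHaarMeasureDbl : (volume : Measure (Dbl n)).IsAddHaarMeasure :=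
  inferInstanceAs (((volume : Measure (Space n)).prod (volume : Measure (Space n))).IsAddHaarMeasure)

/-- The bracket of the integration variables. -/
def jw (w : Dbl n) : ℝ := jap (toE n w)

theorem one_le_jw (w : Dbl n) : 1 ≤ jw w := one_le_jap _

theorem jw_pos (w : Dbl n) : 0 < jw w := jap_pos _

theorem continuous_jw : Continuous (jw : Dbl n → ℝ) := continuous_jap.comp (toE n).continuous

/-- The coordinates of the integration variables. -/
def cw (i : Idx n) : Dbl n →L[ℝ] ℝ := (frW n).ℓ i

theorem jw_sq (w : Dbl n) : jw w ^ 2 = 1 + ∑ i, cw i w ^ 2 := by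
  rw [jw, jap_sq, WithLp.prod_norm_sq_eq_of_L2, EuclideanSpace.norm_sq_eq, EuclideanSpace.norm_sq_eq,
    Fintype.sum_sum_type]
  simp [cw, frW, Frame.prod, frSpace, toE_apply, pt]

theorem abs_cw_le (i : Idx n) (w : Dbl n) : |cw i w| ≤ jw w := by
  refine abs_le_of_sq_le_sq ?_ (jw_pos w).le
  rw [jw_sq]
  have := Finset.single_le_sum (f := fun i => cw i w ^ 2) (fun i _ => sq_nonneg _)
    (Finset.mem_univ i)
  linarith

theorem one_add_norm_le_jw (w : Dbl n) : 1 + ‖w‖ ≤ 2 * jw w := by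
  have h1 : ‖w.1‖ ^ 2 + ‖w.2‖ ^ 2 = jw w ^ 2 - 1 := by
    rw [jw, jap_sq, WithLp.prod_norm_sq_eq_of_L2]; simp [toE_apply, pt]
  have h2 : ‖w‖ ≤ jw w := by
    rw [Prod.norm_def]
    refine max_le ?_ ?_ <;> refine abs_le_of_sq_le_sq' (by nlinarith [sq_nonneg ‖w.1‖, sq_nonneg ‖w.2‖]) (jw_pos w).le |>.2
  linarith [one_le_jw w]

theorem jw_le_one_add_norm (w : Dbl n) : jw w ≤ 2 * (1 + ‖w‖) := by
  have h1 : ‖w.1‖ ^ 2 + ‖w.2‖ ^ 2 = jw w ^ 2 - 1 := by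
    rw [jw, jap_sq, WithLp.prod_norm_sq_eq_of_L2]; simp [toE_apply, pt]
  have h2 := norm_fst_le w
  have h3 := norm_snd_le w
  refine abs_le_of_sq_le_sq' ?_ (by positivity) |>.2
  nlinarith [norm_nonneg w.1, norm_nonneg w.2, norm_nonneg w]

/-- The exponent exceeds the dimension 2n of the w-space by one; it is the threshold of absolute
convergence used everywhere below. -/
theorem integrable_jw : Integrable (fun w : Dbl n => jw w ^ (-(2 * n + 1 : ℝ))) := by
  have h : Integrable (fun w : Dbl n => (1 + ‖w‖) ^ (-(2 * n + 1 : ℝ))) :=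
    integrable_one_add_norm (by simp; linarith)
  refine (h.const_mul (2 ^ (2 * n + 1 : ℝ))).mono' ?_ (Eventually.of_forall fun w => ?_)
  · exact (continuous_jw.rpow_const fun w => Or.inl (jw_pos w).ne').aestronglyMeasurable
  · rw [Real.norm_of_nonneg (Real.rpow_nonneg (jw_pos w).le _)]
    have h1 := one_add_norm_le_jw w
    have h0 := jw_pos w
    rw [Real.rpow_neg h0.le, Real.rpow_neg (by positivity), ← div_eq_mul_inv,
      ← Real.div_rpow (by positivity) (by positivity), ← Real.inv_rpow h0.le]
    refine Real.rpow_le_rpow (by positivity) ?_ (by positivity)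
    rw [inv_eq_one_div, div_le_div_iff₀ h0 (by positivity)]
    linarith

/-- The trivial gains. -/
def gOne (n : ℕ) : Gain (Dbl n) (Idx n) := ⟨fun _ _ => 1, fun _ _ => zero_le_one⟩

/-- The gains of amplitudes. -/
def gF (n : ℕ) : Gain ((Phase n × ℝ) × Dbl n) ((Idx n ⊕ Unit) ⊕ Idx n) where
  g := Sum.elim (fun i q => (gP n).g i q.1 * jw q.2 ^ 2) (fun _ _ => 1)
  nonneg := by
    rintro (i | i) q
    · exact mul_nonneg ((gP n).nonneg _ _) (sq_nonneg _)
    · exact zero_le_one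

/-- First derivatives are constant and second ones vanish, so only two estimates have to be
supplied. -/
theorem Frame.sym_linear {X ι : Type*} [NormedAddCommGroup X] [NormedSpace ℝ X] [Fintype ι]
    {𝔽 : Frame X ι} {G : Gain X ι} {A : Type*} [NormedAddCommGroup A] [NormedSpace ℝ A]
    (T : X →L[ℝ] A) {m : X → ℝ} (C : ℝ) (hC : 0 ≤ C)
    (h0 : ∀ p ∈ 𝔽.S, ‖T p‖ ≤ C * m p) (h1 : ∀ i, ∀ p ∈ 𝔽.S, ‖T (𝔽.b i)‖ ≤ C * (m p * G.g i p))
    (hm : ∀ p ∈ 𝔽.S, 0 ≤ m p) :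
    𝔽.Sym G m (fun p => T p) := by
  refine ⟨Frame.smooth_clm T, fun k => ?_⟩
  cases k with
  | zero => exact ⟨C, hC, h0⟩
  | succ k =>
    refine ⟨⟨C, hC, h0⟩, fun i => ?_⟩
    refine Frame.SymN.congr (f := fun _ => T (𝔽.b i)) ?_ fun p hp => Frame.D_linear T i hp
    cases k with
    | zero => exact ⟨C, hC, h1 i⟩
    | succ k =>
      refine ⟨⟨C, hC, h1 i⟩, fun j => ?_⟩
      rw [show 𝔽.D j (fun _ => T (𝔽.b i)) = fun _ => 0 from funext fun p => Frame.D_const _ j p]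
      exact Frame.symN_zero fun p hp =>
        mul_nonneg (mul_nonneg (hm p hp) (G.nonneg i p)) (G.nonneg j p)

theorem symW_cw (i : Idx n) : (frW n).Sym (gOne n) jw (fun w => cw i w) := by
  refine Frame.sym_linear (cw i) (1 + ∑ j, ‖cw i ((frW n).b j)‖) (by positivity) (fun w _ => ?_)
    (fun j w _ => ?_) fun w _ => (jw_pos w).le
  · have h := abs_cw_le i w
    have h1 := jw_pos w
    have h2 : 0 ≤ ∑ j, ‖cw i ((frW n).b j)‖ := by positivity
    rw [Real.norm_eq_abs]
    nlinarith
  · have h1 := one_le_jw w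
    have h2 := Finset.single_le_sum (f := fun j => ‖cw i ((frW n).b j)‖)
      (fun i _ => norm_nonneg _) (Finset.mem_univ j)
    simp only [gOne, mul_one] at h2 ⊢
    nlinarith [norm_nonneg (cw i ((frW n).b j))]

/-- Amplitudes: symbols on the product of the parameter space with the integration variables. -/
abbrev SymF (m : (Phase n × ℝ) × Dbl n → ℝ) (f : (Phase n × ℝ) × Dbl n → ℂ) : Prop :=
  (frX n).Sym (gF n) m f

/-- Functions of the integration variables are amplitudes. -/
theorem symF_of_symW {A : Type*} [NormedAddCommGroup A] [NormedSpace ℝ A] {m : Dbl n → ℝ}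
    {f : Dbl n → A} (hf : (frW n).Sym (gOne n) m f) (hm : ∀ w, 0 ≤ m w) :
    (frX n).Sym (gF n) (fun q => m q.2) (fun q => f q.2) := by
  -- Pulling back along the projection assigns an index of `Idx n` to every parameter direction,
  -- with coefficient zero. For n = 0 there is no such index, but then the space of the w is a point
  -- and the function is constant.
  rcases n with _ | n
  · refine ⟨?_, fun k => ?_⟩
    · have h : ContDiffOn ℝ ∞ f (frW 0).S := hf.1
      exact h.comp contDiff_snd.contDiffOn fun q _ => by simp [frW_S]
    · have e : (fun q : (Phase 0 × ℝ) × Dbl 0 => f q.2) = fun _ => f 0 := by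
        funext q; congr 1; exact Subsingleton.elim _ _
      have e2 : (fun q : (Phase 0 × ℝ) × Dbl 0 => m q.2) = fun _ => m 0 := by
        funext q; congr 1; exact Subsingleton.elim _ _
      rw [e, e2]
      obtain ⟨C, hC, h⟩ := hf.bound
      have base : ∃ C, 0 ≤ C ∧ ∀ p ∈ (frX 0).S, ‖f 0‖ ≤ C * m 0 :=
        ⟨C, hC, fun _ _ => h 0 (by simp [frW_S])⟩
      cases k with
      | zero => exact base
      | succ k =>
        refine ⟨base, fun i => ?_⟩
        rw [show (frX 0).D i (fun _ => f 0) = fun _ => 0 from funext fun p => Frame.D_const _ i p]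
        exact Frame.symN_zero fun p _ => mul_nonneg (hm 0) ((gF 0).nonneg i p)
  · refine hf.comp (𝔼 := frX (n + 1)) (H := gF (n + 1)) (fun q => q.2)
      (ContinuousLinearMap.snd ℝ _ _) (fun q _ => hasFDerivWithinAt_snd)
      (fun q _ => by simp [frW_S]) (Sum.elim (fun _ => Sum.inl 0) id)
      (Sum.elim (fun _ => 0) (fun _ => 1)) ?_ 1 zero_le_one ?_ 1 zero_le_one (by simp)
      fun q _ => hm q.2
    · rintro (i | i)
      · simp [frX, Frame.prod]
      · simp [frX, Frame.prod]
    · rintro (i | i) q _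
      · simpa using (gF (n + 1)).nonneg (Sum.inl i) q
      · simp [gOne, gF]

/-- Slices of amplitudes. -/
theorem SymF.slice {m : Phase n × ℝ → ℝ} {K : ℝ} {F : (Phase n × ℝ) × Dbl n → ℂ}
    (hm : ∀ p, 0 ≤ m p) (hF : SymF (fun q => m q.1 * jw q.2 ^ K) F) {p : Phase n × ℝ}
    (hp : p ∈ (frP n).S) : (frW n).Sym (gOne n) (fun w => jw w ^ K) (fun w => F (p, w)) := by
  refine hF.comp (𝔼 := frW n) (H := gOne n) (fun w => (p, w)) (ContinuousLinearMap.inr ℝ _ _)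
    (fun w _ => (hasFDerivAt_prodMk_right p w).hasFDerivWithinAt)
    (fun w _ => by rw [frX_S]; exact ⟨hp, trivial⟩) Sum.inr (fun _ => 1) ?_ 1 zero_le_one ?_ (m p) (hm p)
    (fun w _ => le_rfl) fun w _ => Real.rpow_nonneg (jw_pos w).le _
  · intro i
    simp [frX, Frame.prod]
  · intro i w _
    simp [gF, gOne]

theorem D_slice {F : (Phase n × ℝ) × Dbl n → ℂ} (hF : (frX n).Smooth F) {p : Phase n × ℝ}
    (hp : p ∈ (frP n).S) (i : Idx n) (w : Dbl n) :
    (frW n).D i (fun w => F (p, w)) w = (frX n).D (Sum.inr i) F (p, w) := by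
  have hw : (p, w) ∈ (frX n).S := by rw [frX_S]; exact ⟨hp, trivial⟩
  have h2 : HasFDerivWithinAt (fun w : Dbl n => (p, w)) (ContinuousLinearMap.inr ℝ _ (Dbl n))
    (frW n).S w := (hasFDerivAt_prodMk_right p w).hasFDerivWithinAt
  have h3 := (hF.hasFDerivWithinAt hw).comp w h2 (fun w' _ => by rw [frX_S]; exact ⟨hp, trivial⟩)
  exact Frame.D_eq (by simp [frW_S]) h3 i

theorem frW_D (i : Idx n) (u : Dbl n → ℂ) (w : Dbl n) :
    (frW n).D i u w = fderiv ℝ u w ((frW n).b i) := by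
  rw [Frame.D, frW_S, fderivWithin_univ]

/-! ### Integration by parts against the oscillating factor -/

/-- The oscillating factor `e^{-iyη}`. -/
def osc (w : Dbl n) : ℂ := Complex.exp (-(Complex.I * ((inner ℝ w.1 w.2 : ℝ) : ℂ)))

theorem norm_osc (w : Dbl n) : ‖osc w‖ = 1 := by
  rw [osc, ← mul_neg, ← Complex.ofReal_neg, mul_comm, Complex.norm_exp_ofReal_mul_I]

theorem contDiff_osc : ContDiff ℝ ∞ (osc : Dbl n → ℂ) := by
  refine ContDiff.cexp (ContDiff.neg (contDiff_const.mul ?_))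
  exact Complex.ofRealCLM.contDiff.comp (contDiff_fst.inner ℝ contDiff_snd)

/-- The phase is bilinear in (y, η), so differentiation in one coordinate brings down the dual
coordinate, obtained by swapping the two halves of the index set. -/
theorem fderiv_osc (i : Idx n) (w : Dbl n) :
    fderiv ℝ osc w ((frW n).b i) = -Complex.I * (cw i.swap w : ℂ) * osc w := by
  have h1 : HasFDerivAt (fun w : Dbl n => (inner ℝ w.1 w.2 : ℝ))
      ((fderivInnerCLM ℝ (w.1, w.2)).comp ((ContinuousLinearMap.fst ℝ (Space n) (Space n)).prod
        (ContinuousLinearMap.snd ℝ (Space n) (Space n)))) w :=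
    HasFDerivAt.inner ℝ hasFDerivAt_fst hasFDerivAt_snd
  have h2 := Complex.ofRealCLM.hasFDerivAt.comp w h1
  have h3 := ((h2.const_mul Complex.I).neg).cexp
  have h4 : fderiv ℝ osc w = _ := h3.fderiv
  rw [h4]
  rcases i with i | i
  · simp [osc, frW, Frame.prod, frSpace, cw, EuclideanSpace.inner_single_left]
    ring
  · simp [osc, frW, Frame.prod, frSpace, cw, EuclideanSpace.inner_single_right]
    ring

/-- Smooth functions that decay rapidly with all derivatives. -/
def Rap (u : Dbl n → ℂ) : Prop := ∀ N : ℕ, (frW n).Sym (gOne n) (fun w => jw w ^ (-(N : ℝ))) u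

theorem Rap.mul {u h : Dbl n → ℂ} (hu : Rap u) {K : ℝ}
    (hh : (frW n).Sym (gOne n) (fun w => jw w ^ K) h) : Rap (fun w => u w * h w) := by
  intro N
  obtain ⟨M, hM⟩ := exists_nat_ge (N + K)
  refine ((hu M).mul hh).mono_le fun w _ => ?_
  rw [← Real.rpow_add (jw_pos w)]
  exact Real.rpow_le_rpow_of_exponent_le (one_le_jw w) (by linarith)

theorem Rap.D {u : Dbl n → ℂ} (hu : Rap u) (i : Idx n) : Rap ((frW n).D i u) := by
  intro N
  simpa [gOne] using (hu N).D i

theorem Rap.contDiff {u : Dbl n → ℂ} (hu : Rap u) : ContDiff ℝ ∞ u := by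
  have h : ContDiffOn ℝ ∞ u (frW n).S := (hu 0).1
  rwa [frW_S, contDiffOn_univ] at h

theorem symW_ofReal {m : Dbl n → ℝ} {f : Dbl n → ℝ} (h : (frW n).Sym (gOne n) m f) :
    (frW n).Sym (gOne n) m (fun w => (f w : ℂ)) := h.clm Complex.ofRealCLM

theorem Rap.cw_mul {u : Dbl n → ℂ} (hu : Rap u) (i : Idx n) : Rap (fun w => u w * (cw i w : ℂ)) := by
  refine hu.mul (K := 1) ?_
  simpa only [Real.rpow_one] using symW_ofReal (symW_cw i)

theorem integrable_of_le_jw {u : Dbl n → ℂ} (hu : Continuous u) {C : ℝ}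
    (h : ∀ w, ‖u w‖ ≤ C * jw w ^ (-(2 * n + 1 : ℝ))) : Integrable u :=
  (integrable_jw.const_mul C).mono' hu.aestronglyMeasurable (Eventually.of_forall h)

theorem integrable_osc_mul {u : Dbl n → ℂ} (hu : Continuous u) {C : ℝ}
    (h : ∀ w, ‖u w‖ ≤ C * jw w ^ (-(2 * n + 1 : ℝ))) : Integrable (fun w => osc w * u w) :=
  integrable_of_le_jw (contDiff_osc.continuous.mul hu) fun w => by
    rw [norm_mul, norm_osc, one_mul]; exact h w

theorem Rap.integrable {u : Dbl n → ℂ} (hu : Rap u) : Integrable (fun w => osc w * u w) := by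
  obtain ⟨C, -, h⟩ := (hu (2 * n + 1)).bound
  exact integrable_osc_mul hu.contDiff.continuous (C := C) fun w => by
    simpa using h w (by simp [frW_S])

theorem Rap.integral_osc_mul_cw {u : Dbl n → ℂ} (hu : Rap u) (i : Idx n) :
    ∫ w, osc w * (u w * (cw i.swap w : ℂ)) = -Complex.I * ∫ w, osc w * (frW n).D i u w := by
  have h1 := (hu.cw_mul i.swap).integrable
  have h2 := (hu.D i).integrable
  have key := integral_mul_fderiv_eq_neg_fderiv_mul_of_integrable (μ := volume) (f := osc) (g := u)
    (v := (frW n).b i) (by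
      refine (h1.const_mul (-Complex.I)).congr (Eventually.of_forall fun w => ?_)
      simp only [fderiv_osc]; ring)
    (by simpa only [frW_D] using h2) hu.integrable
    (fun w _ => (contDiff_osc.differentiable (by simp)) w)
    (fun w _ => (hu.contDiff.differentiable (by simp)) w)
  simp only [← frW_D i u] at key
  rw [key]
  have e : (fun w => fderiv ℝ osc w ((frW n).b i) * u w) =
      fun w => -Complex.I * (osc w * (u w * (cw i.swap w : ℂ))) := by
    funext w; rw [fderiv_osc]; ring
  rw [e, integral_const_mul]
  linear_combination (∫ w, osc w * (u w * (cw i.swap w : ℂ))) * Complex.I_mul_I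

/-- A coordinate never coincides with its dual, so integration by parts can be repeated in the same
direction without commutator terms. -/
theorem D_cw_swap (i : Idx n) (w : Dbl n) : (frW n).D i (fun w => (cw i.swap w : ℂ)) w = 0 := by
  have h := Frame.D_linear (𝔽 := frW n) (Complex.ofRealCLM.comp (cw i.swap)) i (p := w)
    (by simp [frW_S])
  refine h.trans ?_
  rcases i with i | i <;> simp [cw, frW, Frame.prod, frSpace]

theorem Rap.integral_osc_mul_cw_sq {u : Dbl n → ℂ} (hu : Rap u) (i : Idx n) :
    ∫ w, osc w * (u w * (cw i.swap w : ℂ) ^ 2) = -∫ w, osc w * (frW n).D i ((frW n).D i u) w := by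
  have h1 := (hu.cw_mul i.swap).integral_osc_mul_cw i
  have h2 := (hu.D i).integral_osc_mul_cw i
  have e : (frW n).D i (fun w => u w * (cw i.swap w : ℂ)) =
      fun w => (frW n).D i u w * (cw i.swap w : ℂ) := by
    funext w
    rw [Frame.D_mul (hu 0).1 (symW_ofReal (symW_cw i.swap)).1 i (by simp [frW_S]), D_cw_swap,
      mul_zero, add_zero]
  rw [e, h2] at h1
  calc _ = ∫ w, osc w * (u w * (cw i.swap w : ℂ) * (cw i.swap w : ℂ)) := by
        congr 1; funext w; ring
    _ = _ := by
      rw [h1]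
      linear_combination (∫ w, osc w * (frW n).D i ((frW n).D i u) w) * Complex.I_mul_I

/-- Integrated form of (1 - Δ_w) e^{-iyη} = ⟨w⟩² e^{-iyη}: summing squares of dual coordinates over
all indices is the same as summing the squares of all coordinates. -/
theorem Rap.integral_osc_jw {u : Dbl n → ℂ} (hu : Rap u) :
    ∫ w, osc w * (u w * ((jw w ^ 2 : ℝ) : ℂ)) =
      ∫ w, osc w * (u w - ∑ i, (frW n).D i ((frW n).D i u) w) := by
  have e1 : ∀ w : Dbl n, osc w * (u w * ((jw w ^ 2 : ℝ) : ℂ)) =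
      osc w * u w + ∑ i : Idx n, osc w * (u w * (cw i.swap w : ℂ) ^ 2) := by
    intro w
    have : ∑ i : Idx n, (cw i.swap w : ℂ) ^ 2 = ∑ i : Idx n, (cw i w : ℂ) ^ 2 :=
      Equiv.sum_comp (Equiv.sumComm (Fin n) (Fin n)) (fun i => (cw i w : ℂ) ^ 2)
    rw [← Finset.mul_sum, ← Finset.mul_sum, this, jw_sq]
    push_cast; ring
  have e2 : ∀ w : Dbl n, osc w * (u w - ∑ i, (frW n).D i ((frW n).D i u) w) =
      osc w * u w - ∑ i : Idx n, osc w * (frW n).D i ((frW n).D i u) w := by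
    intro w; rw [mul_sub, Finset.mul_sum]
  simp_rw [e1, e2]
  have i1 : ∀ i : Idx n, Integrable (fun w => osc w * (u w * (cw i.swap w : ℂ) ^ 2)) := by
    intro i
    simpa only [pow_two, mul_assoc] using ((hu.cw_mul i.swap).cw_mul i.swap).integrable
  have i2 : ∀ i : Idx n, Integrable (fun w => osc w * (frW n).D i ((frW n).D i u) w) :=
    fun i => ((hu.D i).D i).integrable
  rw [integral_add hu.integrable (integrable_finsetSum _ fun i _ => i1 i),
    integral_sub hu.integrable (integrable_finsetSum _ fun i _ => i2 i),
    integral_finsetSum _ fun i _ => i1 i, integral_finsetSum _ fun i _ => i2 i,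
    sub_eq_add_neg, ← Finset.sum_neg_distrib]
  simp_rw [fun i => hu.integral_osc_mul_cw_sq i]

theorem rap_schwartz (φ : 𝓢(Dbl n, ℂ)) : Rap (fun w => φ w) := by
  intro N
  refine Frame.sym_of_family (𝒢 := fun m f => (∃ φ : 𝓢(Dbl n, ℂ), f = fun w => φ w) ∧
    m = fun w => jw w ^ (-(N : ℝ))) ?_ ⟨⟨φ, rfl⟩, rfl⟩
  rintro m f ⟨⟨φ, rfl⟩, rfl⟩
  refine ⟨?_, fun i w => (∂_{(frW n).b i} φ) w, fun i => ⟨⟨_, rfl⟩, by simp [gOne]⟩, fun w _ =>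
    ⟨_, (φ.hasFDerivAt w).hasFDerivWithinAt, fun i =>
      (SchwartzMap.lineDerivOp_apply_eq_fderiv _ _ _).symm⟩⟩
  have h := SchwartzMap.one_add_le_sup_seminorm_apply (𝕜 := ℝ) (m := (N, 0)) (k := N) (n := 0)
    le_rfl le_rfl φ
  set C := 2 ^ N * ((Finset.Iic (N, 0)).sup fun m => SchwartzMap.seminorm ℝ m.1 m.2) φ
  refine ⟨2 ^ N * C, by positivity, fun w _ => ?_⟩
  have h1 := h w
  rw [norm_iteratedFDeriv_zero] at h1
  simp only
  rw [Real.rpow_neg (jw_pos w).le, Real.rpow_natCast, ← div_eq_mul_inv,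
    le_div_iff₀ (pow_pos (jw_pos w) N)]
  calc ‖φ w‖ * jw w ^ N ≤ ‖φ w‖ * (2 * (1 + ‖w‖)) ^ N := by
        gcongr
        · exact (jw_pos w).le
        · exact jw_le_one_add_norm w
    _ = 2 ^ N * ((1 + ‖w‖) ^ N * ‖φ w‖) := by rw [mul_pow]; ring
    _ ≤ _ := by gcongr

/-- The dilated and translated function `φ(ε w + a)`. -/
def dilate (φ : 𝓢(Dbl n, ℂ)) (ε : ℝ) (hε : ε ≠ 0) (a : Dbl n) : 𝓢(Dbl n, ℂ) :=
  SchwartzMap.compCLMOfContinuousLinearEquiv ℝ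
    (ContinuousLinearEquiv.smulLeft (R₁ := ℝ) (M₁ := Dbl n) (Units.mk0 ε hε))
    (SchwartzMap.compSubConstCLM ℝ (-a) φ)

theorem dilate_apply (φ : 𝓢(Dbl n, ℂ)) {ε : ℝ} (hε : ε ≠ 0) (a w : Dbl n) :
    dilate φ ε hε a w = φ (ε • w + a) := by
  simp only [dilate, SchwartzMap.compCLMOfContinuousLinearEquiv_apply, Function.comp_apply,
    SchwartzMap.compSubConstCLM_apply, sub_neg_eq_add]
  rfl

theorem D_dilate (φ : 𝓢(Dbl n, ℂ)) (ε : ℝ) (a : Dbl n) (i : Idx n) (w : Dbl n) :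
    (frW n).D i (fun w => φ (ε • w + a)) w = ε * (∂_{(frW n).b i} φ) (ε • w + a) := by
  have h1 : HasFDerivAt (fun w : Dbl n => ε • w + a) (ε • ContinuousLinearMap.id ℝ (Dbl n)) w :=
    ((hasFDerivAt_id w).const_smul ε).add_const a
  have h2 := (φ.hasFDerivAt (ε • w + a)).comp w h1
  rw [frW_D, SchwartzMap.lineDerivOp_apply_eq_fderiv]
  have h3 : fderiv ℝ (fun w => φ (ε • w + a)) w = _ := h2.fderiv
  rw [h3]
  simp

theorem rap_dilate (φ : 𝓢(Dbl n, ℂ)) {ε : ℝ} (hε : ε ≠ 0) (a : Dbl n) :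
    Rap (fun w => φ (ε • w + a)) := by
  simpa only [dilate_apply] using rap_schwartz (dilate φ ε hε a)

end

section

open scoped LineDeriv

variable {n : ℕ}

/-! ### Convergence of oscillatory integrals -/

theorem symW_jw_sq : (frW n).Sym (gOne n) (fun w => jw w ^ 2) (fun w => jw w ^ 2) := by
  have h1 : (frW n).Sym (gOne n) (fun w => jw w ^ 2) (fun _ => (1 : ℝ)) :=
    (Frame.sym_const (1 : ℝ)).mono_le fun w _ => by nlinarith [one_le_jw w]
  have h2 : (frW n).Sym (gOne n) (fun w => jw w ^ 2) (fun w => ∑ i, cw i w ^ 2) :=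
    Frame.Sym.sum (fun w _ => sq_nonneg _) fun i _ => (symW_cw i).pow 2
  exact (h1.add h2).congr fun w _ => jw_sq w

/-- The factor `⟨w⟩⁻²`. -/
def om (w : Dbl n) : ℂ := ((jw w ^ 2)⁻¹ : ℝ)

theorem symW_om : (frW n).Sym (gOne n) (fun w => jw w ^ (-2 : ℝ)) om := by
  have h := symW_ofReal ((symW_jw_sq (n := n)).rpow (fun w _ => pow_pos (jw_pos w) 2) (-1))
  have e : ∀ w : Dbl n, (jw w ^ 2) ^ (-1 : ℝ) = (jw w ^ 2)⁻¹ := fun w => Real.rpow_neg_one _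
  simp only [e] at h
  refine h.mono_le fun w _ => le_of_eq ?_
  rw [Real.rpow_neg (jw_pos w).le]; simp

theorem jw_sq_mul_om (w : Dbl n) : om w * ((jw w ^ 2 : ℝ) : ℂ) = 1 := by
  rw [om, ← Complex.ofReal_mul, inv_mul_cancel₀ (pow_pos (jw_pos w) 2).ne', Complex.ofReal_one]

/-- `⟨w⟩⁻²` times an amplitude. -/
def omMul (F : (Phase n × ℝ) × Dbl n → ℂ) : (Phase n × ℝ) × Dbl n → ℂ := fun q => om q.2 * F q

/-- The regularizing operator `(1 - Δ_w) ⟨w⟩⁻²`. -/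
def Lop (F : (Phase n × ℝ) × Dbl n → ℂ) : (Phase n × ℝ) × Dbl n → ℂ := fun q =>
  omMul F q - ∑ i, (frX n).D (Sum.inr i) ((frX n).D (Sum.inr i) (omMul F)) q

/-- The weight of amplitudes of growth `K`. -/
def wA (m : Phase n × ℝ → ℝ) (K : ℝ) (q : (Phase n × ℝ) × Dbl n) : ℝ := m q.1 * jw q.2 ^ K

theorem wA_nonneg {m : Phase n × ℝ → ℝ} (hm : ∀ p, 0 ≤ m p) (K : ℝ) (q) : 0 ≤ wA (n := n) m K q :=
  mul_nonneg (hm _) (Real.rpow_nonneg (jw_pos _).le _)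

theorem SymF.mono_growth {m : Phase n × ℝ → ℝ} (hm : ∀ p, 0 ≤ m p) {K K' : ℝ} (h : K ≤ K')
    {F : (Phase n × ℝ) × Dbl n → ℂ} (hF : SymF (wA m K) F) : SymF (wA m K') F :=
  hF.mono_le fun _ _ => mul_le_mul_of_nonneg_left
    (Real.rpow_le_rpow_of_exponent_le (one_le_jw _) h) (hm _)

theorem SymF.mulW {m : Phase n × ℝ → ℝ} {K K' : ℝ} {F : (Phase n × ℝ) × Dbl n → ℂ} {u : Dbl n → ℂ}
    (hu : (frW n).Sym (gOne n) (fun w => jw w ^ K') u) (hF : SymF (wA m K) F) :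
    SymF (wA m (K + K')) (fun q => u q.2 * F q) := by
  refine ((symF_of_symW hu fun w => Real.rpow_nonneg (jw_pos w).le _).mul hF).mono_le
    fun q _ => le_of_eq ?_
  rw [wA, wA, Real.rpow_add (jw_pos _)]; ring

theorem SymF.omMul {m : Phase n × ℝ → ℝ} {K : ℝ} {F : (Phase n × ℝ) × Dbl n → ℂ}
    (hF : SymF (wA m K) F) : SymF (wA m (K - 2)) (omMul F) := by
  rw [sub_eq_add_neg]
  exact hF.mulW symW_om

theorem SymF.Dw {m : (Phase n × ℝ) × Dbl n → ℝ} {F : (Phase n × ℝ) × Dbl n → ℂ}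
    (hF : SymF m F) (i : Idx n) : SymF m ((frX n).D (Sum.inr i) F) := by
  have h := hF.D (Sum.inr i)
  rwa [show (fun q => m q * (gF n).g (Sum.inr i) q) = m from funext fun q => mul_one _] at h

theorem SymF.Lop {m : Phase n × ℝ → ℝ} (hm : ∀ p, 0 ≤ m p) {K : ℝ}
    {F : (Phase n × ℝ) × Dbl n → ℂ} (hF : SymF (wA m K) F) : SymF (wA m (K - 2)) (Lop F) :=
  hF.omMul.sub (Frame.Sym.sum (fun q _ => wA_nonneg hm _ q) fun i _ => (hF.omMul.Dw i).Dw i)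

theorem SymF.Lop_iterate {m : Phase n × ℝ → ℝ} (hm : ∀ p, 0 ≤ m p) {K : ℝ}
    {F : (Phase n × ℝ) × Dbl n → ℂ} (hF : SymF (wA m K) F) (k : ℕ) :
    SymF (wA m (K - 2 * k)) (Shubin.Lop^[k] F) := by
  induction k with
  | zero => simpa using hF
  | succ k ih =>
    rw [Function.iterate_succ_apply']
    have := ih.Lop hm
    rwa [show K - 2 * (k : ℝ) - 2 = K - 2 * ((k + 1 : ℕ) : ℝ) by push_cast; ring] at this

theorem mem_X {p : Phase n × ℝ} (hp : p ∈ (frP n).S) (w : Dbl n) : (p, w) ∈ (frX n).S := by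
  rw [frX_S]; exact ⟨hp, trivial⟩

theorem SymF.continuous_slice {m : (Phase n × ℝ) × Dbl n → ℝ} {F : (Phase n × ℝ) × Dbl n → ℂ}
    (hF : SymF m F) {p : Phase n × ℝ} (hp : p ∈ (frP n).S) : Continuous fun w => F (p, w) := by
  have h : ContDiffOn ℝ ∞ F (frX n).S := hF.1
  exact h.continuousOn.comp_continuous (by fun_prop) fun w => mem_X hp w

/-- One step of the regularization of the integrals with a cut-off. -/
theorem integral_osc_mul_schwartz {m : Phase n × ℝ → ℝ} (hm : ∀ p, 0 ≤ m p) {K : ℝ}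
    {F : (Phase n × ℝ) × Dbl n → ℂ} (hF : SymF (wA m K) F) (φ : 𝓢(Dbl n, ℂ)) {ε : ℝ} (hε : ε ≠ 0)
    (a : Dbl n) {p : Phase n × ℝ} (hp : p ∈ (frP n).S) :
    ∫ w, osc w * φ (ε • w + a) * F (p, w) = (∫ w, osc w * φ (ε • w + a) * Lop F (p, w)) -
      2 * ε * (∑ i, ∫ w, osc w * (∂_{(frW n).b i} φ) (ε • w + a) *
        (frX n).D (Sum.inr i) (omMul F) (p, w)) -
      ε ^ 2 * ∑ i, ∫ w, osc w * (∂_{(frW n).b i} (∂_{(frW n).b i} φ)) (ε • w + a) *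
        omMul F (p, w) := by
  have hG := hF.omMul
  have hGs := SymF.slice hm hG hp
  have hD : ∀ i, (frW n).Sym (gOne n) (fun w => jw w ^ (K - 2))
      (fun w => (frX n).D (Sum.inr i) (omMul F) (p, w)) := fun i => SymF.slice hm (hG.Dw i) hp
  have hDD : ∀ i, (frW n).Sym (gOne n) (fun w => jw w ^ (K - 2))
      (fun w => (frX n).D (Sum.inr i) ((frX n).D (Sum.inr i) (omMul F)) (p, w)) :=
    fun i => SymF.slice hm ((hG.Dw i).Dw i) hp
  have hL := SymF.slice hm (hF.Lop hm) hp
  have rφ := fun φ : 𝓢(Dbl n, ℂ) => rap_dilate φ hε a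
  have hu : Rap (fun w => φ (ε • w + a) * omMul F (p, w)) := (rφ φ).mul hGs
  have h1 := hu.integral_osc_jw
  -- The factor ⟨w⟩² undoes the ⟨w⟩⁻² contained in `omMul F`.
  have e0 : ∀ w, osc w * (φ (ε • w + a) * omMul F (p, w) * ((jw w ^ 2 : ℝ) : ℂ)) =
      osc w * φ (ε • w + a) * F (p, w) := by
    intro w
    have := jw_sq_mul_om w
    simp only [omMul]
    linear_combination (osc w * φ (ε • w + a) * F (p, w)) * this
  have mW : ∀ w : Dbl n, w ∈ (frW n).S := fun w => by simp [frW_S]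
  have e1 : ∀ i w, (frW n).D i (fun w => φ (ε • w + a) * omMul F (p, w)) w =
      ε * (∂_{(frW n).b i} φ) (ε • w + a) * omMul F (p, w) +
        φ (ε • w + a) * (frX n).D (Sum.inr i) (omMul F) (p, w) := by
    intro i w
    rw [Frame.D_mul (rφ φ 0).1 hGs.1 i (mW w), D_dilate, D_slice hG.1 hp]
  have e2 : ∀ i w, (frW n).D i ((frW n).D i (fun w => φ (ε • w + a) * omMul F (p, w))) w =
      ε ^ 2 * ((∂_{(frW n).b i} (∂_{(frW n).b i} φ)) (ε • w + a) * omMul F (p, w)) +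
      2 * ε * ((∂_{(frW n).b i} φ) (ε • w + a) * (frX n).D (Sum.inr i) (omMul F) (p, w)) +
        φ (ε • w + a) * (frX n).D (Sum.inr i) ((frX n).D (Sum.inr i) (omMul F)) (p, w) := by
    intro i w
    rw [funext (e1 i)]
    have s1 : (frW n).Smooth fun w => (ε : ℂ) * (∂_{(frW n).b i} φ) (ε • w + a) :=
      (Frame.smooth_const (ε : ℂ)).mul (rφ (∂_{(frW n).b i} φ) 0).1
    rw [Frame.D_add (s1.mul hGs.1) ((rφ φ 0).1.mul (hD i).1) i (mW w),
      Frame.D_mul s1 hGs.1 i (mW w), Frame.D_mul (rφ φ 0).1 (hD i).1 i (mW w),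
      Frame.D_const_mul (ε : ℂ) (rφ (∂_{(frW n).b i} φ) 0).1 i (mW w), D_dilate, D_dilate,
      D_slice hG.1 hp, D_slice (hG.Dw i).1 hp]
    ring
  have e3 : ∀ w, osc w * (φ (ε • w + a) * omMul F (p, w) -
      ∑ i, (frW n).D i ((frW n).D i (fun w => φ (ε • w + a) * omMul F (p, w))) w) =
      osc w * (φ (ε • w + a) * Lop F (p, w)) -
      2 * ε * ∑ i, osc w * ((∂_{(frW n).b i} φ) (ε • w + a) *
        (frX n).D (Sum.inr i) (omMul F) (p, w)) -
      ε ^ 2 * ∑ i, osc w * ((∂_{(frW n).b i} (∂_{(frW n).b i} φ)) (ε • w + a) *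
        omMul F (p, w)) := by
    intro w
    simp_rw [e2, Finset.sum_add_distrib, ← Finset.mul_sum, Lop]
    ring
  simp_rw [e0, e3] at h1
  rw [h1]
  have i0 := ((rφ φ).mul hL).integrable
  have i1 := fun i => ((rφ (∂_{(frW n).b i} φ)).mul (hD i)).integrable
  have i2 := fun i => ((rφ (∂_{(frW n).b i} (∂_{(frW n).b i} φ))).mul hGs).integrable
  rw [integral_sub, integral_sub i0, integral_const_mul, integral_const_mul, integral_finsetSum,
    integral_finsetSum]
  · simp only [mul_assoc]
  · exact fun i _ => i2 i
  · exact fun i _ => i1 i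
  · exact (integrable_finsetSum _ fun i _ => i1 i).const_mul _
  · exact i0.sub ((integrable_finsetSum _ fun i _ => i1 i).const_mul _)
  · exact (integrable_finsetSum _ fun i _ => i2 i).const_mul _

theorem schwartz_bound (φ : 𝓢(Dbl n, ℂ)) : ∃ C, 0 ≤ C ∧ ∀ w, ‖φ w‖ ≤ C := by
  obtain ⟨C, hC, h⟩ := (rap_schwartz φ 0).bound
  exact ⟨C, hC, fun w => by simpa using h w (by simp [frW_S])⟩

/-- Here k counts integrations by parts. For k = 0 the amplitude is absolutely integrable and
dominated convergence applies. In the step the cut-off is differentiated as well, but each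
derivative of it brings a factor ε in front of an integral to which the induction hypothesis
applies; these terms are bounded for ε ≤ 1 and vanish in the limit. The translation a of the
cut-off, and the bound uniform in it, are needed for the formal adjoint, where the cut-off is
centred at a moving point. -/
theorem osc_main (k : ℕ) : ∀ {m : Phase n × ℝ → ℝ}, (∀ p, 0 ≤ m p) →
    ∀ {F : (Phase n × ℝ) × Dbl n → ℂ}, SymF (wA m (2 * k + -(2 * n + 1))) F → ∀ φ : 𝓢(Dbl n, ℂ),
    (∃ C, 0 ≤ C ∧ ∀ ε : ℝ, 0 < ε → ε ≤ 1 → ∀ a, ∀ p ∈ (frP n).S,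
      ‖∫ w, osc w * φ (ε • w + a) * F (p, w)‖ ≤ C * m p) ∧
    ∀ p ∈ (frP n).S, ∀ a : ℝ → Dbl n, Tendsto a (𝓝[>] 0) (𝓝 0) →
      Tendsto (fun ε => ∫ w, osc w * φ (ε • w + a ε) * F (p, w)) (𝓝[>] 0)
        (𝓝 (φ 0 * ∫ w, osc w * (Lop^[k] F) (p, w))) := by
  induction k with
  | zero =>
    intro m hm F hF φ
    simp only [Nat.cast_zero, mul_zero, zero_add] at hF
    obtain ⟨C, hC, hb⟩ := hF.bound
    obtain ⟨B, hB, hφ⟩ := schwartz_bound φ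
    have bnd : ∀ (ε : ℝ) a, ∀ p ∈ (frP n).S, ∀ w, ‖osc w * φ (ε • w + a) * F (p, w)‖ ≤
        B * C * m p * jw w ^ (-(2 * n + 1 : ℝ)) := by
      intro ε a p hp w
      rw [norm_mul, norm_mul, norm_osc, one_mul]
      calc _ ≤ B * (C * wA m (-(2 * n + 1 : ℝ)) (p, w)) :=
            mul_le_mul (hφ _) (hb _ (mem_X hp w)) (norm_nonneg _) hB
        _ = _ := by rw [wA]; ring
    constructor
    · refine ⟨B * C * ∫ w : Dbl n, jw w ^ (-(2 * n + 1 : ℝ)), ?_, fun ε _ _ a p hp => ?_⟩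
      · exact mul_nonneg (by positivity) (integral_nonneg fun w => Real.rpow_nonneg (jw_pos w).le _)
      · refine (norm_integral_le_of_norm_le (integrable_jw.const_mul (B * C * m p))
          (Eventually.of_forall fun w => bnd ε a p hp w)).trans (le_of_eq ?_)
        rw [integral_const_mul]; ring
    · intro p hp a ha
      have e : φ 0 * ∫ w, osc w * (Lop^[0] F) (p, w) = ∫ w, osc w * φ 0 * F (p, w) := by
        rw [← integral_const_mul]; congr 1; funext w; simp; ring
      rw [e]
      have hc := hF.continuous_slice hp
      have ho : Continuous (osc : Dbl n → ℂ) := contDiff_osc.continuous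
      refine tendsto_integral_filter_of_dominated_convergence
        (fun w => B * C * m p * jw w ^ (-(2 * n + 1 : ℝ))) (Eventually.of_forall fun ε => ?_)
        (Eventually.of_forall fun ε => Eventually.of_forall fun w => bnd ε _ p hp w)
        (integrable_jw.const_mul _) (Eventually.of_forall fun w => ?_)
      · have : Continuous fun w : Dbl n => φ (ε • w + a ε) := φ.continuous.comp (by fun_prop)
        exact ((ho.mul this).mul hc).aestronglyMeasurable
      · refine Tendsto.mul_const _ (Tendsto.const_mul _ ?_)
        refine (φ.continuous.tendsto 0).comp ?_
        have h1 : Tendsto (fun ε : ℝ => ε • w) (𝓝[>] 0) (𝓝 ((0 : ℝ) • w)) :=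
          (tendsto_nhdsWithin_of_tendsto_nhds tendsto_id).smul_const w
        simpa using h1.add ha
  | succ k ih =>
    intro m hm F hF φ
    -- `Lop F`, `omMul F` and the first w-derivatives of the latter all have growth lowered by two,
    -- so the induction hypothesis covers the main term and both error terms.
    have hK : (2 * ((k + 1 : ℕ) : ℝ) + -(2 * n + 1)) - 2 = 2 * k + -(2 * n + 1) := by
      push_cast; ring
    have hG := hF.omMul
    have hL := hF.Lop hm
    rw [hK] at hG hL
    have A0 := ih hm hL φ
    have A1 := fun i => ih hm (hG.Dw i) (∂_{(frW n).b i} φ)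
    have A2 := fun i : Idx n => ih hm hG (∂_{(frW n).b i} (∂_{(frW n).b i} φ))
    constructor
    · obtain ⟨C0, hC0, h0⟩ := A0.1
      choose C1 hC1 h1 using fun i => (A1 i).1
      choose C2 hC2 h2 using fun i => (A2 i).1
      have s1 := Finset.sum_nonneg fun i (_ : i ∈ Finset.univ) => hC1 i
      have s2 := Finset.sum_nonneg fun i (_ : i ∈ Finset.univ) => hC2 i
      refine ⟨C0 + 2 * ∑ i, C1 i + ∑ i, C2 i, by positivity, fun ε ε0 ε1 a p hp => ?_⟩
      rw [integral_osc_mul_schwartz hm hF φ ε0.ne' a hp]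
      have hmp := hm p
      refine (norm_sub_le _ _).trans ((add_le_add_left (norm_sub_le _ _) _).trans ?_)
      rw [add_mul, add_mul]
      refine add_le_add (add_le_add (h0 ε ε0 ε1 a p hp) ?_) ?_
      · rw [norm_mul, norm_mul, Complex.norm_real, Real.norm_of_nonneg ε0.le, mul_assoc]
        simp only [Complex.norm_ofNat]
        rw [mul_assoc]
        refine mul_le_mul_of_nonneg_left ?_ two_pos.le
        calc _ ≤ 1 * ∑ i, C1 i * m p := by
              refine mul_le_mul ε1 ((norm_sum_le _ _).trans (Finset.sum_le_sum fun i _ =>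
                h1 i ε ε0 ε1 a p hp)) (norm_nonneg _) zero_le_one
          _ = _ := by rw [one_mul, Finset.sum_mul]
      · rw [norm_mul, norm_pow, Complex.norm_real, Real.norm_of_nonneg ε0.le]
        calc _ ≤ 1 * ∑ i, C2 i * m p := by
              refine mul_le_mul (pow_le_one₀ ε0.le ε1) ((norm_sum_le _ _).trans
                (Finset.sum_le_sum fun i _ => h2 i ε ε0 ε1 a p hp)) (norm_nonneg _) zero_le_one
          _ = _ := by rw [one_mul, Finset.sum_mul]
    · intro p hp a ha
      have t0 := A0.2 p hp a ha
      have t1 := tendsto_finsetSum Finset.univ fun i _ => (A1 i).2 p hp a ha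
      have t2 := tendsto_finsetSum Finset.univ fun i _ => (A2 i).2 p hp a ha
      have tε : Tendsto (fun ε : ℝ => (ε : ℂ)) (𝓝[>] 0) (𝓝 0) :=
        tendsto_nhdsWithin_of_tendsto_nhds (Complex.continuous_ofReal.tendsto' 0 0 (by simp))
      have t := (t0.sub ((tε.const_mul 2).mul t1)).sub ((tε.pow 2).mul t2)
      simp only [mul_zero, zero_mul, sub_zero, ne_eq, OfNat.ofNat_ne_zero, not_false_eq_true,
        zero_pow] at t
      rw [Function.iterate_succ_apply]
      refine t.congr' ?_
      filter_upwards [self_mem_nhdsWithin] with ε hε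
      exact (integral_osc_mul_schwartz hm hF φ (ne_of_gt hε) (a ε) hp).symm

end

/-! ### The value of an oscillatory integral -/

section

open scoped LineDeriv

variable {n : ℕ}

/-- The normalizing factor `(2π)⁻ⁿ`. -/
def cn (n : ℕ) : ℂ := ((2 * Real.pi : ℝ) : ℂ)⁻¹ ^ n

open Classical in
/-- The value of the oscillatory integral of `f`, zero if it does not exist. -/
def oscI (f : Dbl n → ℂ) : ℂ :=
  if h : ∃ I : ℂ, HasOscIntegral (fun y η => f (y, η)) I then h.choose else 0

theorem adj_eq_oscI (p : Phase n → ℂ) (z : Phase n) :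
    adj p z = oscI (fun w => conj (p (z + toE n w))) := rfl

theorem exists_schwartz_one (n : ℕ) : ∃ φ : 𝓢(Dbl n, ℂ), φ 0 = 1 := by
  let f : ContDiffBump (0 : Dbl n) := ⟨1, 2, one_pos, one_lt_two⟩
  have h1 : HasCompactSupport (fun w => (f w : ℂ)) := f.hasCompactSupport.comp_left Complex.ofReal_zero
  have h2 : ContDiff ℝ ∞ (fun w => (f w : ℂ)) := Complex.ofRealCLM.contDiff.comp f.contDiff
  refine ⟨h1.toSchwartzMap h2, ?_⟩
  change (f 0 : ℂ) = 1
  rw [f.one_of_mem_closedBall (by simp [f.rIn_pos.le]), Complex.ofReal_one]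

theorem HasOscIntegral.unique {f : Space n → Space n → ℂ} {I J : ℂ} (h : HasOscIntegral f I)
    (h' : HasOscIntegral f J) : I = J := by
  obtain ⟨φ, hφ⟩ := exists_schwartz_one n
  exact tendsto_nhds_unique (h φ hφ) (h' φ hφ)

theorem HasOscIntegral.oscI_eq {f : Dbl n → ℂ} {I : ℂ}
    (h : HasOscIntegral (fun y η => f (y, η)) I) : oscI f = I := by
  have h' : ∃ I : ℂ, HasOscIntegral (fun y η => f (y, η)) I := ⟨I, h⟩
  rw [oscI, dif_pos h']
  exact h'.choose_spec.unique h

/-- Smooth functions of polynomial growth, together with all derivatives. -/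
def PolyW (f : Dbl n → ℂ) : Prop := ∃ K : ℝ, (frW n).Sym (gOne n) (fun w => jw w ^ K) f

theorem PolyW.mono {f : Dbl n → ℂ} {K K' : ℝ} (h : K ≤ K')
    (hf : (frW n).Sym (gOne n) (fun w => jw w ^ K) f) :
    (frW n).Sym (gOne n) (fun w => jw w ^ K') f :=
  hf.mono_le fun w _ => Real.rpow_le_rpow_of_exponent_le (one_le_jw w) h

theorem PolyW.add {f h : Dbl n → ℂ} (hf : PolyW f) (hh : PolyW h) : PolyW (fun w => f w + h w) := by
  obtain ⟨K, hf⟩ := hf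
  obtain ⟨K', hh⟩ := hh
  exact ⟨max K K', (PolyW.mono (le_max_left _ _) hf).add (PolyW.mono (le_max_right _ _) hh)⟩

theorem PolyW.const_mul {f : Dbl n → ℂ} (hf : PolyW f) (c : ℂ) : PolyW (fun w => c * f w) := by
  obtain ⟨K, hf⟩ := hf
  exact ⟨K, hf.const_mul c⟩

theorem PolyW.sub {f h : Dbl n → ℂ} (hf : PolyW f) (hh : PolyW h) : PolyW (fun w => f w - h w) := by
  simpa [sub_eq_add_neg] using hf.add (hh.const_mul (-1))

theorem PolyW.sum {κ : Type*} {s : Finset κ} {f : κ → Dbl n → ℂ} (hf : ∀ k ∈ s, PolyW (f k)) :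
    PolyW (fun w => ∑ k ∈ s, f k w) := by
  classical
  induction s using Finset.induction_on with
  | empty => exact ⟨0, by simpa using Frame.sym_zero fun _ _ => zero_le_one⟩
  | insert a s ha ih =>
    simp only [Finset.sum_insert ha]
    exact (hf a (by simp)).add (ih fun k hk => hf k (by simp [hk]))

theorem PolyW.D {f : Dbl n → ℂ} (hf : PolyW f) (i : Idx n) : PolyW ((frW n).D i f) := by
  obtain ⟨K, hf⟩ := hf
  exact ⟨K, by simpa [gOne] using hf.D i⟩

theorem PolyW.cw_mul {f : Dbl n → ℂ} (hf : PolyW f) (i : Idx n) :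
    PolyW (fun w => f w * (cw i w : ℂ)) := by
  obtain ⟨K, hf⟩ := hf
  refine ⟨K + 1, (hf.mul (symW_ofReal (symW_cw i))).mono_le fun w _ => le_of_eq ?_⟩
  rw [Real.rpow_add (jw_pos w), Real.rpow_one]

theorem PolyW.smooth {f : Dbl n → ℂ} (hf : PolyW f) : (frW n).Smooth f := hf.choose_spec.1

theorem PolyW.rap {f : Dbl n → ℂ} (hf : PolyW f) (φ : 𝓢(Dbl n, ℂ)) {ε : ℝ} (hε : ε ≠ 0)
    (a : Dbl n) : Rap (fun w => φ (ε • w + a) * f w) := by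
  obtain ⟨K, hf⟩ := hf
  exact (rap_dilate φ hε a).mul hf

theorem SymF.hasOsc {m : Phase n × ℝ → ℝ} (hm : ∀ p, 0 ≤ m p) {K : ℝ}
    {F : (Phase n × ℝ) × Dbl n → ℂ} (hF : SymF (wA m K) F) {k : ℕ} (hk : K ≤ 2 * k + -(2 * n + 1))
    {p : Phase n × ℝ} (hp : p ∈ (frP n).S) :
    HasOscIntegral (fun y η => F (p, (y, η))) (cn n * ∫ w, osc w * (Shubin.Lop^[k] F) (p, w)) := by
  intro φ hφ
  have h := (osc_main k hm (hF.mono_growth hm hk) φ).2 p hp (fun _ => 0) tendsto_const_nhds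
  simp only [add_zero, hφ, one_mul] at h
  exact h.const_mul _

theorem SymF.oscI_eq {m : Phase n × ℝ → ℝ} (hm : ∀ p, 0 ≤ m p) {K : ℝ}
    {F : (Phase n × ℝ) × Dbl n → ℂ} (hF : SymF (wA m K) F) {k : ℕ} (hk : K ≤ 2 * k + -(2 * n + 1))
    {p : Phase n × ℝ} (hp : p ∈ (frP n).S) :
    oscI (fun w => F (p, w)) = cn n * ∫ w, osc w * (Shubin.Lop^[k] F) (p, w) :=
  HasOscIntegral.oscI_eq (f := fun w => F (p, w)) (hF.hasOsc hm hk hp)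

theorem zero_mem_P : ((0, 0) : Phase n × ℝ) ∈ (frP n).S := mem_frP.2 le_rfl

theorem PolyW.symF {f : Dbl n → ℂ} {K : ℝ} (hf : (frW n).Sym (gOne n) (fun w => jw w ^ K) f) :
    SymF (wA (fun _ => 1) K) (fun q => f q.2) := by
  refine (symF_of_symW hf fun w => Real.rpow_nonneg (jw_pos w).le _).mono_le fun q _ => ?_
  simp [wA]

theorem PolyW.hasOsc {f : Dbl n → ℂ} (hf : PolyW f) :
    HasOscIntegral (fun y η => f (y, η)) (oscI f) := by
  obtain ⟨K, hf⟩ := hf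
  obtain ⟨k, hk⟩ := exists_nat_ge (K + (2 * n + 1))
  have h := (PolyW.symF hf).hasOsc (fun _ => zero_le_one) (k := k) (K := K)
    (by have := k.cast_nonneg (α := ℝ); linarith) zero_mem_P
  rw [h.oscI_eq]
  exact h

/-- The cut-off need not be normalized here, so that derivatives of a normalized one may be
inserted. -/
theorem PolyW.tendsto {f : Dbl n → ℂ} (hf : PolyW f) (φ : 𝓢(Dbl n, ℂ)) :
    Tendsto (fun ε : ℝ => cn n * ∫ w, osc w * φ (ε • w) * f w) (𝓝[>] 0) (𝓝 (φ 0 * oscI f)) := by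
  obtain ⟨K, hf'⟩ := hf
  obtain ⟨k, hk⟩ := exists_nat_ge (K + (2 * n + 1))
  have hk' : K ≤ 2 * k + -(2 * n + 1) := by have := k.cast_nonneg (α := ℝ); linarith
  have h := (osc_main k (fun _ => zero_le_one) ((PolyW.symF hf').mono_growth
    (fun _ => zero_le_one) hk') φ).2 _ zero_mem_P (fun _ => 0) tendsto_const_nhds
  simp only [add_zero] at h
  have e := HasOscIntegral.oscI_eq (f := f)
    ((PolyW.symF hf').hasOsc (fun _ => zero_le_one) hk' zero_mem_P)
  rw [e]
  simpa only [mul_left_comm (φ 0)] using h.const_mul (cn n)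

theorem oscI_add {f h : Dbl n → ℂ} (hf : PolyW f) (hh : PolyW h) :
    oscI (fun w => f w + h w) = oscI f + oscI h := by
  refine HasOscIntegral.oscI_eq fun φ hφ => ?_
  have t := (hf.hasOsc φ hφ).add (hh.hasOsc φ hφ)
  refine t.congr' ?_
  filter_upwards [self_mem_nhdsWithin] with ε hε
  have i1 := (hf.rap φ (ne_of_gt hε) 0).integrable
  have i2 := (hh.rap φ (ne_of_gt hε) 0).integrable
  simp only [add_zero, ← mul_assoc] at i1 i2
  rw [← mul_add]
  congr 1
  refine (integral_add i1 i2).symm.trans ?_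
  congr 1; funext w; simp only [osc]; ring

theorem oscI_const_mul {f : Dbl n → ℂ} (hf : PolyW f) (c : ℂ) :
    oscI (fun w => c * f w) = c * oscI f := by
  refine HasOscIntegral.oscI_eq fun φ hφ => ?_
  refine ((hf.hasOsc φ hφ).const_mul c).congr fun ε => ?_
  rw [mul_left_comm, ← integral_const_mul]
  congr 2; funext w; ring

theorem oscI_sub {f h : Dbl n → ℂ} (hf : PolyW f) (hh : PolyW h) :
    oscI (fun w => f w - h w) = oscI f - oscI h := by
  have := oscI_add hf (hh.const_mul (-1))
  rw [oscI_const_mul hh] at this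
  simpa [sub_eq_add_neg] using this

theorem oscI_zero : oscI (fun _ : Dbl n => (0 : ℂ)) = 0 := by
  refine HasOscIntegral.oscI_eq fun φ hφ => ?_
  simp

theorem oscI_sum {κ : Type*} {s : Finset κ} {f : κ → Dbl n → ℂ} (hf : ∀ k ∈ s, PolyW (f k)) :
    oscI (fun w => ∑ k ∈ s, f k w) = ∑ k ∈ s, oscI (f k) := by
  classical
  induction s using Finset.induction_on with
  | empty => simpa using oscI_zero
  | insert a s ha ih =>
    simp only [Finset.sum_insert ha]
    rw [oscI_add (hf a (by simp)) (PolyW.sum fun k hk => hf k (by simp [hk])),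
      ih fun k hk => hf k (by simp [hk])]

/-- Multiplication by a coordinate corresponds to differentiation in the dual one. -/
theorem oscI_mul_cw {f : Dbl n → ℂ} (hf : PolyW f) (i : Idx n) :
    oscI (fun w => f w * (cw i.swap w : ℂ)) = -Complex.I * oscI ((frW n).D i f) := by
  refine HasOscIntegral.oscI_eq fun φ hφ => ?_
  -- The derivative of the cut-off is not normalized, but its integrals converge, and the factor ε
  -- in front of them removes this term in the limit.
  have t1 := hf.tendsto (∂_{(frW n).b i} φ)
  have t2 := (hf.D i).tendsto φ
  rw [hφ, one_mul] at t2
  have tε : Tendsto (fun ε : ℝ => (ε : ℂ)) (𝓝[>] 0) (𝓝 0) :=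
    tendsto_nhdsWithin_of_tendsto_nhds (Complex.continuous_ofReal.tendsto' 0 0 (by simp))
  have t := ((tε.mul t1).add t2).const_mul (-Complex.I)
  simp only [zero_mul, zero_add] at t
  refine t.congr' ?_
  filter_upwards [self_mem_nhdsWithin] with ε hε
  have hε' : ε ≠ 0 := ne_of_gt hε
  have key := (hf.rap φ hε' 0).integral_osc_mul_cw i
  have e : (frW n).D i (fun w => φ (ε • w + 0) * f w) = fun w =>
      ε * ((∂_{(frW n).b i} φ) (ε • w + 0) * f w) + φ (ε • w + 0) * (frW n).D i f w := by
    funext w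
    rw [Frame.D_mul (rap_dilate φ hε' 0 0).1 hf.smooth i (by simp [frW_S]), D_dilate]
    ring
  rw [e] at key
  have i1 := (hf.rap (∂_{(frW n).b i} φ) hε' 0).integrable
  have i2 := ((hf.D i).rap φ hε' 0).integrable
  have e2 : ∫ w, osc w * (ε * ((∂_{(frW n).b i} φ) (ε • w + 0) * f w) +
      φ (ε • w + 0) * (frW n).D i f w) =
      ε * (∫ w, osc w * ((∂_{(frW n).b i} φ) (ε • w + 0) * f w)) +
        ∫ w, osc w * (φ (ε • w + 0) * (frW n).D i f w) := by
    rw [← integral_const_mul, ← integral_add (i1.const_mul _) i2]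
    congr 1; funext w; ring
  rw [e2] at key
  simp only [add_zero, ← mul_assoc] at key ⊢
  have e3 : (fun w : Dbl n => Complex.exp (-(Complex.I * ((inner ℝ w.1 w.2 : ℝ) : ℂ))) * φ (ε • w) *
      f (w.1, w.2) * (cw i.swap (w.1, w.2) : ℂ)) =
      fun w => osc w * φ (ε • w) * f w * (cw i.swap w : ℂ) := rfl
  rw [e3, key, cn]
  ring

/-! ### Smooth dependence on parameters -/

theorem SymF.hasFDerivWithinAt_param {m : (Phase n × ℝ) × Dbl n → ℝ}
    {F : (Phase n × ℝ) × Dbl n → ℂ} (hF : SymF m F) {p : Phase n × ℝ} (hp : p ∈ (frP n).S)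
    (w : Dbl n) : HasFDerivWithinAt (fun p => F (p, w))
      (∑ i, ((frP n).ℓ i).smulRight ((frX n).D (Sum.inl i) F (p, w))) (frP n).S p := by
  have h := hF.1.hasFDerivWithinAt (mem_X hp w)
  have h2 : HasFDerivWithinAt (fun p : Phase n × ℝ => (p, w))
    (ContinuousLinearMap.inl ℝ (Phase n × ℝ) (Dbl n)) (frP n).S p :=
    (hasFDerivAt_prodMk_left p w).hasFDerivWithinAt
  have h3 := h.comp p h2 (fun p' hp' => mem_X hp' w)
  refine h3.congr_fderiv ?_
  refine ContinuousLinearMap.ext fun x => ?_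
  conv_lhs => rw [← (frP n).sum_eq x]
  rw [map_sum]
  simp [Frame.D, frX, Frame.prod]

theorem frP_ℓ_b (i j : Idx n ⊕ Unit) : (frP n).ℓ i ((frP n).b j) = if j = i then 1 else 0 := by
  rcases i with (i | i) | i <;> rcases j with (j | j) | j <;>
    simp [frP, Frame.prod, frE, frW, frSpace, frR, eq_comm]

theorem continuous_gP (i : Idx n ⊕ Unit) : Continuous ((gP n).g i) := by
  rcases i with i | i
  · exact (continuous_jap.comp continuous_fst).inv₀ fun p => (jap_pos _).ne'
  · exact continuous_japPar.inv₀ fun p => (japPar_pos _ _).ne'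

/-- Differentiation under the integral sign up to the boundary μ = 0, where no neighbourhood in the
parameter space is available. The two additional powers of decay in w pay for the factor ⟨w⟩² that a
parameter derivative of an amplitude may cost. -/
theorem SymF.hasFDerivWithinAt_integral {m : Phase n × ℝ → ℝ} (hm : ∀ p, 0 ≤ m p)
    (hmc : Continuous m) {F : (Phase n × ℝ) × Dbl n → ℂ}
    (hF : SymF (wA m (-(2 * n + 1) - 2)) F) {p : Phase n × ℝ} (hp : p ∈ (frP n).S) :
    HasFDerivWithinAt (fun p => ∫ w, osc w * F (p, w))
      (∑ i, ((frP n).ℓ i).smulRight (∫ w, osc w * (frX n).D (Sum.inl i) F (p, w))) (frP n).S p := by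
  obtain ⟨C0, hC0, hb0⟩ := hF.bound
  choose C hC hb using fun i => (hF.D (Sum.inl i)).bound
  have hexp : ∀ w : Dbl n, jw w ^ (-(2 * n + 1 : ℝ) - 2) ≤ jw w ^ (-(2 * n + 1 : ℝ)) := fun w =>
    Real.rpow_le_rpow_of_exponent_le (one_le_jw w) (by linarith)
  have hb' : ∀ i, ∀ p ∈ (frP n).S, ∀ w, ‖(frX n).D (Sum.inl i) F (p, w)‖ ≤
      C i * (m p * (gP n).g i p) * jw w ^ (-(2 * n + 1 : ℝ)) := by
    intro i p hp w
    refine (hb i _ (mem_X hp w)).trans (le_of_eq ?_)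
    have : jw w ^ (-(2 * n + 1 : ℝ)) = jw w ^ (-(2 * n + 1 : ℝ) - 2) * jw w ^ 2 := by
      rw [← Real.rpow_natCast (jw w) 2, ← Real.rpow_add (jw_pos w)]; norm_num
    rw [this]
    simp only [wA, gF, Sum.elim_inl]; ring
  have int0 : ∀ p ∈ (frP n).S, Integrable fun w => osc w * F (p, w) := fun p hp =>
    integrable_osc_mul (hF.continuous_slice hp) (C := C0 * m p) fun w => by
      refine (hb0 _ (mem_X hp w)).trans ?_
      rw [wA, ← mul_assoc]
      exact mul_le_mul_of_nonneg_left (hexp w) (mul_nonneg hC0 (hm p))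
  have int1 : ∀ i, Integrable fun w => osc w * (frX n).D (Sum.inl i) F (p, w) := fun i =>
    integrable_osc_mul (SymF.continuous_slice (hF.D (Sum.inl i)) hp) (hb' i p hp)
  -- a bound of the derivative near `p`
  set B : Phase n × ℝ → ℝ := fun p => ∑ i, ‖(frP n).ℓ i‖ * (C i * (m p * (gP n).g i p)) with hB
  have hBc : Continuous B := continuous_finsetSum _ fun i _ =>
    continuous_const.mul (continuous_const.mul (hmc.mul (continuous_gP i)))
  have opb : ∀ p ∈ (frP n).S, ∀ w,
      ‖∑ i, ((frP n).ℓ i).smulRight ((frX n).D (Sum.inl i) F (p, w))‖ ≤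
        B p * jw w ^ (-(2 * n + 1 : ℝ)) := by
    intro p hp w
    rw [hB, Finset.sum_mul]
    refine (norm_sum_le _ _).trans (Finset.sum_le_sum fun i _ => ?_)
    rw [ContinuousLinearMap.norm_smulRight_apply, mul_assoc]
    exact mul_le_mul_of_nonneg_left (hb' i p hp w) (norm_nonneg _)
  obtain ⟨r, hr, hball⟩ := Metric.mem_nhds_iff.1 (hBc.continuousAt.eventually
    (gt_mem_nhds (show B p < B p + 1 by linarith)))
  -- The half space intersected with a ball is convex, so the mean value inequality yields a
  -- Lipschitz bound that is integrable in w.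
  have lip : ∀ p' ∈ (frP n).S ∩ Metric.ball p r, ∀ w, ‖F (p', w) - F (p, w)‖ ≤
      (B p + 1) * jw w ^ (-(2 * n + 1 : ℝ)) * ‖p' - p‖ := by
    intro p' hp' w
    refine ((frP n).conv.inter (convex_ball p r)).norm_image_sub_le_of_norm_hasFDerivWithin_le
      (f := fun p => F (p, w))
      (fun x hx => (hF.hasFDerivWithinAt_param hx.1 w).mono inter_subset_left)
      (fun x hx => (opb x hx.1 w).trans (mul_le_mul_of_nonneg_right (hball hx.2).le
        (Real.rpow_nonneg (jw_pos w).le _))) ⟨hp, Metric.mem_ball_self hr⟩ hp'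
  rw [hasFDerivWithinAt_iff_tendsto]
  set T : Dbl n → Phase n × ℝ → ℂ := fun w x =>
    ∑ i, (frP n).ℓ i x • (frX n).D (Sum.inl i) F (p, w) with hT
  have Tle : ∀ w x, ‖T w x‖ ≤ (B p + 1) * jw w ^ (-(2 * n + 1 : ℝ)) * ‖x‖ := by
    intro w x
    have h1 := (∑ i, ((frP n).ℓ i).smulRight ((frX n).D (Sum.inl i) F (p, w))).le_opNorm x
    have h2 : (∑ i, ((frP n).ℓ i).smulRight ((frX n).D (Sum.inl i) F (p, w))) x = T w x := by
      simp [hT]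
    rw [h2] at h1
    refine h1.trans (mul_le_mul_of_nonneg_right ((opb p hp w).trans ?_) (norm_nonneg _))
    exact mul_le_mul_of_nonneg_right (by linarith) (Real.rpow_nonneg (jw_pos w).le _)
  have Tc : ∀ x, Continuous fun w => T w x := fun x => continuous_finsetSum _ fun i _ =>
    show Continuous ((frP n).ℓ i x • fun w => (frX n).D (Sum.inl i) F (p, w)) from
      (SymF.continuous_slice (hF.D (Sum.inl i)) hp).const_smul _
  -- Differentiability of the integral reduces to the convergence of the integrated error quotients,
  -- which are dominated by the Lipschitz bound plus the bound of the candidate derivative.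
  have dom : Tendsto (fun p' => ∫ w, ‖p' - p‖⁻¹ * ‖F (p', w) - F (p, w) - T w (p' - p)‖)
      (𝓝[(frP n).S] p) (𝓝 (∫ _ : Dbl n, (0 : ℝ))) := by
    refine tendsto_integral_filter_of_dominated_convergence
      (fun w => 2 * (B p + 1) * jw w ^ (-(2 * n + 1 : ℝ))) ?_ ?_ (integrable_jw.const_mul _) ?_
    · filter_upwards [self_mem_nhdsWithin] with p' hp'
      exact (continuous_const.mul (((hF.continuous_slice hp').sub
        (hF.continuous_slice hp)).sub (Tc _)).norm).aestronglyMeasurable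
    · filter_upwards [self_mem_nhdsWithin, mem_nhdsWithin_of_mem_nhds (Metric.ball_mem_nhds p hr)]
        with p' hp' hpb
      refine Eventually.of_forall fun w => ?_
      have hj : 0 ≤ jw w ^ (-(2 * n + 1 : ℝ)) := Real.rpow_nonneg (jw_pos w).le _
      rw [Real.norm_of_nonneg (by positivity)]
      have h1 := (norm_sub_le _ _).trans (add_le_add (lip p' ⟨hp', hpb⟩ w) (Tle w (p' - p)))
      rcases (norm_nonneg (p' - p)).eq_or_lt with h0 | h0
      · rw [← h0, inv_zero, zero_mul]
        have : 0 ≤ B p := by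
          have := (norm_nonneg _).trans (opb p hp 0)
          exact nonneg_of_mul_nonneg_left this (Real.rpow_pos_of_pos (jw_pos 0) _)
        positivity
      · rw [inv_mul_le_iff₀ h0]
        refine h1.trans (le_of_eq ?_)
        ring
    · refine Eventually.of_forall fun w => ?_
      have := hasFDerivWithinAt_iff_tendsto.1 (hF.hasFDerivWithinAt_param hp w)
      refine this.congr fun p' => ?_
      simp [hT]
  rw [integral_zero] at dom
  refine squeeze_zero' (Eventually.of_forall fun p' => by positivity) ?_ dom
  filter_upwards [self_mem_nhdsWithin] with p' hp'
  rw [integral_const_mul]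
  refine mul_le_mul_of_nonneg_left ?_ (by positivity)
  have e : (∫ w, osc w * F (p', w)) - (∫ w, osc w * F (p, w)) -
      (∑ i, ((frP n).ℓ i).smulRight (∫ w, osc w * (frX n).D (Sum.inl i) F (p, w))) (p' - p) =
      ∫ w, osc w * (F (p', w) - F (p, w) - T w (p' - p)) := by
    have e1 : ∀ w, osc w * (F (p', w) - F (p, w) - T w (p' - p)) =
        osc w * F (p', w) - osc w * F (p, w) -
          ∑ i, ((frP n).ℓ i (p' - p) : ℂ) * (osc w * (frX n).D (Sum.inl i) F (p, w)) := by
      intro w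
      simp only [hT, mul_sub, Finset.mul_sum, Complex.real_smul]
      congr 1
      exact Finset.sum_congr rfl fun i _ => by ring
    simp_rw [e1]
    have int2 : Integrable fun w => osc w * F (p', w) - osc w * F (p, w) :=
      (int0 p' hp').sub (int0 p hp)
    rw [integral_sub int2 (integrable_finsetSum _ fun i _ => (int1 i).const_mul _),
      integral_sub (int0 p' hp') (int0 p hp),
      integral_finsetSum _ fun i _ => (int1 i).const_mul _]
    simp [integral_const_mul]
  rw [e]
  refine (norm_integral_le_integral_norm _).trans (le_of_eq ?_)
  congr 1; funext w
  rw [norm_mul, norm_osc, one_mul]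

/-- Oscillatory integrals of amplitudes are symbols. -/
theorem SymF.oscI_sym {m : Phase n × ℝ → ℝ} (hm : ∀ p, 0 ≤ m p) (hmc : Continuous m) {K : ℝ}
    {F : (Phase n × ℝ) × Dbl n → ℂ} (hF : SymF (wA m K) F) :
    (frP n).Sym (gP n) m (fun p => oscI (fun w => F (p, w))) := by
  refine Frame.sym_of_family (𝒢 := fun m f => (∀ p, 0 ≤ m p) ∧ Continuous m ∧
    ∃ K F, SymF (wA m K) F ∧ f = fun p => oscI (fun w => F (p, w))) ?_ ⟨hm, hmc, K, F, hF, rfl⟩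
  rintro m f ⟨hm, hmc, K, F, hF, rfl⟩
  -- Two more powers than absolute convergence requires, so that the regularized amplitude can still
  -- be differentiated once.
  obtain ⟨k, hk⟩ := exists_nat_ge (K + (2 * n + 3))
  have hk0 := k.cast_nonneg (α := ℝ)
  have hk1 : K ≤ 2 * k + -(2 * n + 1) := by linarith
  set H := Shubin.Lop^[k] F
  have hH : SymF (wA m (-(2 * n + 1) - 2)) H :=
    (hF.Lop_iterate hm k).mono_growth hm (by linarith)
  have hHD : ∀ i, SymF (wA (fun p => m p * (gP n).g i p) (-(2 * n + 1)))
      ((frX n).D (Sum.inl i) H) := by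
    intro i
    refine (hH.D (Sum.inl i)).mono_le fun q _ => le_of_eq ?_
    have : jw q.2 ^ (-(2 * n + 1 : ℝ)) = jw q.2 ^ (-(2 * n + 1 : ℝ) - 2) * jw q.2 ^ 2 := by
      rw [← Real.rpow_natCast (jw q.2) 2, ← Real.rpow_add (jw_pos q.2)]; norm_num
    simp only [wA, gF, Sum.elim_inl, this]; ring
  have hm' : ∀ i p, 0 ≤ m p * (gP n).g i p := fun i p => mul_nonneg (hm p) ((gP n).nonneg i p)
  have eF : ∀ p ∈ (frP n).S, oscI (fun w => F (p, w)) = cn n * ∫ w, osc w * H (p, w) :=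
    fun p hp => hF.oscI_eq hm hk1 hp
  -- The differentiated amplitude is already integrable, so its oscillatory integral is an ordinary
  -- one and no further regularization is needed to stay within the family.
  have eD : ∀ i, ∀ p ∈ (frP n).S, oscI (fun w => (frX n).D (Sum.inl i) H (p, w)) =
      cn n * ∫ w, osc w * (frX n).D (Sum.inl i) H (p, w) := fun i p hp => by
    simpa using (hHD i).oscI_eq (hm' i) (k := 0) (by simp) hp
  refine ⟨?_, fun i p => oscI (fun w => (frX n).D (Sum.inl i) H (p, w)), fun i =>
    ⟨hm' i, hmc.mul (continuous_gP i), _, _, hHD i, rfl⟩, fun p hp => ?_⟩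
  · obtain ⟨C, hC, hb⟩ := hH.bound
    refine ⟨‖cn n‖ * (C * ∫ w : Dbl n, jw w ^ (-(2 * n + 1 : ℝ))), mul_nonneg (norm_nonneg _)
      (mul_nonneg hC (integral_nonneg fun w => Real.rpow_nonneg (jw_pos w).le _)), fun p hp => ?_⟩
    simp only
    rw [eF p hp, norm_mul, mul_assoc]
    refine mul_le_mul_of_nonneg_left ?_ (norm_nonneg _)
    refine (norm_integral_le_of_norm_le (integrable_jw.const_mul (C * m p))
      (Eventually.of_forall fun w => ?_)).trans (le_of_eq ?_)
    · rw [norm_mul, norm_osc, one_mul]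
      refine (hb _ (mem_X hp w)).trans ?_
      rw [wA, ← mul_assoc]
      exact mul_le_mul_of_nonneg_left (Real.rpow_le_rpow_of_exponent_le (one_le_jw w)
        (by linarith)) (mul_nonneg hC (hm p))
    · rw [integral_const_mul]; ring
  · have h := (hH.hasFDerivWithinAt_integral hm hmc hp).const_mul (cn n)
    have h2 : HasFDerivWithinAt (fun p => oscI (fun w => F (p, w))) _ (frP n).S p :=
      h.congr (fun p' hp' => eF p' hp') (eF p hp)
    refine ⟨_, h2, fun i => ?_⟩
    beta_reduce
    rw [eD i p hp]
    rw [smul_apply, smul_eq_mul, sum_apply]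
    simp only [ContinuousLinearMap.smulRight_apply, frP_ℓ_b, ite_smul, one_smul, zero_smul,
      Finset.sum_ite_eq, Finset.mem_univ, if_true]

end

/-! ### Fourier inversion and the oscillatory integral of a constant -/

section

open scoped FourierTransform

variable {n : ℕ}

theorem fourierHat_eq (u : 𝓢(Space n, ℂ)) (ξ : Space n) :
    fourierHat u ξ = (𝓕 u) ((2 * Real.pi)⁻¹ • ξ) := by
  rw [fourierHat, SchwartzMap.fourier_coe, Real.fourier_eq']
  congr 1; funext y
  rw [smul_eq_mul, inner_smul_right]
  congr 2
  have : (Real.pi : ℂ) ≠ 0 := by exact_mod_cast Real.pi_ne_zero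
  push_cast
  field_simp

theorem continuous_fourierHat (u : 𝓢(Space n, ℂ)) : Continuous (fourierHat u) := by
  rw [show fourierHat u = fun ξ => (𝓕 u) ((2 * Real.pi)⁻¹ • ξ) from funext (fourierHat_eq u)]
  exact (𝓕 u).continuous.comp (continuous_const_smul _)

theorem integrable_fourierHat (u : 𝓢(Space n, ℂ)) : Integrable (fourierHat u) := by
  rw [show fourierHat u = fun ξ => (𝓕 u) ((2 * Real.pi)⁻¹ • ξ) from funext (fourierHat_eq u)]
  exact (𝓕 u).integrable.comp_smul (by positivity)

/-- The Fourier inversion formula. -/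
theorem fourierHat_inversion (u : 𝓢(Space n, ℂ)) (x : Space n) :
    cn n * ∫ ξ : Space n, Complex.exp (Complex.I * ((inner ℝ x ξ : ℝ) : ℂ)) * fourierHat u ξ = u x := by
  have h1 : 𝓕⁻ (𝓕 u) x = u x := by simp
  rw [SchwartzMap.fourierInv_coe, Real.fourierInv_eq'] at h1
  have h2 := Measure.integral_comp_smul (volume : Measure (Space n))
    (fun ξ => Complex.exp ((2 * Real.pi * inner ℝ ξ x : ℝ) * Complex.I) • (𝓕 u) ξ) (2 * Real.pi)⁻¹
  rw [h1] at h2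
  have hp : (0 : ℝ) < 2 * Real.pi := by positivity
  have e : ∀ ξ : Space n, Complex.exp (Complex.I * ((inner ℝ x ξ : ℝ) : ℂ)) * fourierHat u ξ =
      Complex.exp ((2 * Real.pi * inner ℝ ((2 * Real.pi)⁻¹ • ξ) x : ℝ) * Complex.I) •
        (𝓕 u) ((2 * Real.pi)⁻¹ • ξ) := by
    intro ξ
    rw [fourierHat_eq, smul_eq_mul, inner_smul_left, real_inner_comm]
    congr 2
    rw [mul_comm]
    congr 2
    simp only [conj_trivial]
    rw [mul_inv_cancel_left₀ hp.ne']
  simp_rw [e]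
  rw [h2, finrank_euclideanSpace, Fintype.card_fin, inv_pow, inv_inv, abs_of_pos (pow_pos hp n), cn,
    Complex.real_smul, ← mul_assoc]
  push_cast
  rw [← mul_pow, inv_mul_cancel₀ (by simp [Real.pi_ne_zero]), one_pow, one_mul]

theorem fourierHat_comp_smul (u : 𝓢(Space n, ℂ)) {ε : ℝ} (hε : 0 < ε) (η : Space n) :
    ∫ y : Space n, Complex.exp (-(Complex.I * ((inner ℝ y η : ℝ) : ℂ))) * u (ε • y) =
      ((ε ^ n)⁻¹ : ℝ) * fourierHat u (ε⁻¹ • η) := by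
  have h := Measure.integral_comp_smul (volume : Measure (Space n))
    (fun y => Complex.exp (-(Complex.I * ((inner ℝ y (ε⁻¹ • η) : ℝ) : ℂ))) * u y) ε
  rw [finrank_euclideanSpace, Fintype.card_fin, abs_of_pos (by positivity), Complex.real_smul] at h
  rw [fourierHat, ← h]
  congr 1; funext y
  rw [inner_smul_left, inner_smul_right]
  simp only [conj_trivial]
  rw [mul_inv_cancel_left₀ hε.ne']

theorem exists_schwartz_space_one (n : ℕ) :
    ∃ u : 𝓢(Space n, ℂ), u 0 = 1 ∧ HasCompactSupport (u : Space n → ℂ) := by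
  let f : ContDiffBump (0 : Space n) := ⟨1, 2, one_pos, one_lt_two⟩
  have h1 : HasCompactSupport (fun w => (f w : ℂ)) := f.hasCompactSupport.comp_left Complex.ofReal_zero
  have h2 : ContDiff ℝ ∞ (fun w => (f w : ℂ)) := Complex.ofRealCLM.contDiff.comp f.contDiff
  refine ⟨h1.toSchwartzMap h2, ?_, h1⟩
  change (f 0 : ℂ) = 1
  rw [f.one_of_mem_closedBall (by simp [f.rIn_pos.le]), Complex.ofReal_one]

theorem polyW_const (c : ℂ) : PolyW (fun _ : Dbl n => c) :=
  ⟨0, by simpa using Frame.sym_const c⟩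

/-- Since the value does not depend on the cut-off, a product u(y)u(η) may be used. The y-integral
gives ε^{-n} û(η/ε), and the substitution η = εζ leaves the integral of u(ε²ζ) û(ζ), whose limit is
given by Fourier inversion at the origin. -/
theorem oscI_one : oscI (fun _ : Dbl n => (1 : ℂ)) = 1 := by
  obtain ⟨u, hu, hc⟩ := exists_schwartz_space_one n
  have hs : HasCompactSupport (fun w : Dbl n => u w.1 * u w.2) := by
    refine HasCompactSupport.of_support_subset_isCompact (hc.prod hc) fun w hw => ?_
    have := mul_ne_zero_iff.1 hw
    exact ⟨subset_tsupport _ this.1, subset_tsupport _ this.2⟩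
  have hd : ContDiff ℝ ∞ (fun w : Dbl n => u w.1 * u w.2) :=
    ((u.smooth ⊤).comp contDiff_fst).mul ((u.smooth ⊤).comp contDiff_snd)
  set φ : 𝓢(Dbl n, ℂ) := hs.toSchwartzMap hd
  have hφ : ∀ w, φ w = u w.1 * u w.2 := fun w => rfl
  have hφ0 : φ 0 = 1 := by rw [hφ]; simp [hu]
  have t1 := (polyW_const (n := n) 1).tendsto φ
  rw [hφ0, one_mul] at t1
  refine tendsto_nhds_unique t1 ?_
  obtain ⟨C, hC⟩ : ∃ C, ∀ x, ‖u x‖ ≤ C := by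
    obtain ⟨C, hC⟩ := u.decay 0 0
    exact ⟨C, fun x => by simpa using hC.2 x⟩
  -- The limit after both substitutions; û is integrable and u is bounded, so dominated convergence
  -- applies.
  have t2 : Tendsto (fun ε : ℝ => cn n * ∫ ζ : Space n, u ((ε * ε) • ζ) * fourierHat u ζ)
      (𝓝[>] 0) (𝓝 (cn n * ∫ ζ : Space n, u 0 * fourierHat u ζ)) := by
    refine Tendsto.const_mul _ (tendsto_integral_filter_of_dominated_convergence
      (fun ζ => C * ‖fourierHat u ζ‖) ?_ ?_ ((integrable_fourierHat u).norm.const_mul C) ?_)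
    · exact Eventually.of_forall fun ε => ((u.continuous.comp (continuous_const_smul _)).mul
        (continuous_fourierHat u)).aestronglyMeasurable
    · exact Eventually.of_forall fun ε => Eventually.of_forall fun ζ => by
        rw [norm_mul]; exact mul_le_mul_of_nonneg_right (hC _) (norm_nonneg _)
    · refine Eventually.of_forall fun ζ => Tendsto.mul_const _ ?_
      refine tendsto_nhdsWithin_of_tendsto_nhds ?_
      have : Continuous fun ε : ℝ => u ((ε * ε) • ζ) := u.continuous.comp (by fun_prop)
      simpa using this.tendsto 0
  have e0 : cn n * ∫ ζ : Space n, u 0 * fourierHat u ζ = 1 := by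
    have := fourierHat_inversion u 0
    simp only [inner_zero_left, Complex.ofReal_zero, mul_zero, Complex.exp_zero, one_mul] at this
    rw [hu]; simpa [hu] using this
  rw [e0] at t2
  refine t2.congr' ?_
  filter_upwards [self_mem_nhdsWithin] with ε hε
  have hε0 : (0 : ℝ) < ε := hε
  congr 1
  have hInt := (rap_dilate φ hε0.ne' 0).integrable
  simp only [add_zero] at hInt
  have s1 : ∫ w : Dbl n, osc w * φ (ε • w) * 1 = ∫ η : Space n, ∫ y : Space n,
      osc (y, η) * φ (ε • (y, η)) := by
    simp only [mul_one]
    exact integral_prod_symm _ hInt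
  have s2 : ∀ η : Space n, ∫ y : Space n, osc (y, η) * φ (ε • (y, η)) =
      ((ε ^ n)⁻¹ : ℝ) * (u ((ε * ε) • (ε⁻¹ • η)) * fourierHat u (ε⁻¹ • η)) := by
    intro η
    have : ∀ y : Space n, osc (y, η) * φ (ε • (y, η)) = u (ε • η) *
        (Complex.exp (-(Complex.I * ((inner ℝ y η : ℝ) : ℂ))) * u (ε • y)) := by
      intro y; rw [hφ]; simp only [osc, Prod.smul_mk]; ring
    simp_rw [this]
    rw [integral_const_mul, fourierHat_comp_smul u hε0, smul_smul, mul_assoc ε,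
      mul_inv_cancel₀ hε0.ne', mul_one]
    ring
  rw [s1]
  simp_rw [s2]
  have h := Measure.integral_comp_smul (volume : Measure (Space n))
    (fun ζ => u ((ε * ε) • ζ) * fourierHat u ζ) ε⁻¹
  rw [integral_const_mul, h, finrank_euclideanSpace, Fintype.card_fin, abs_of_pos (by positivity),
    Complex.real_smul, ← mul_assoc, ← Complex.ofReal_mul, inv_pow, inv_inv,
    inv_mul_cancel₀ (pow_pos hε0 n).ne', Complex.ofReal_one, one_mul]

theorem oscI_const (c : ℂ) : oscI (fun _ : Dbl n => c) = c := by
  have := oscI_const_mul (polyW_const (n := n) 1) c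
  simpa [oscI_one] using this

end

/-! ### Taylor expansion in the integration variables -/

section

variable {n : ℕ}

/-- The gains of shifted symbols. -/
def gS (n : ℕ) : Gain ((Phase n × ℝ) × Dbl n) ((Idx n ⊕ Unit) ⊕ Idx n) where
  g := Sum.elim (fun i q => (gP n).g i q.1 * jw q.2 ^ 2) (fun _ q => (jap (q.1.1 + toE n q.2))⁻¹)
  nonneg := by
    rintro (i | i) q
    · exact mul_nonneg ((gP n).nonneg _ _) (sq_nonneg _)
    · exact inv_nonneg.2 (jap_pos _).le

/-- The class of shifted symbols with weight `m`. -/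
abbrev SymS (m : (Phase n × ℝ) × Dbl n → ℝ) (f : (Phase n × ℝ) × Dbl n → ℂ) : Prop :=
  (frX n).Sym (gS n) m f

/-- The homogeneous part of degree `m` of the Taylor expansion of `F` at `w = 0`. -/
def Pt : ℕ → ((Phase n × ℝ) × Dbl n → ℂ) → (Phase n × ℝ) × Dbl n → ℂ
  | 0, F => fun q => F (q.1, 0)
  | m + 1, F => fun q => ((m : ℂ) + 1)⁻¹ * ∑ i, (cw i q.2 : ℂ) * Pt m ((frX n).D (Sum.inr i) F) q

/-- The remainder of the Taylor expansion. -/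
def Rt (M : ℕ) (F : (Phase n × ℝ) × Dbl n → ℂ) : (Phase n × ℝ) × Dbl n → ℂ := fun q =>
  F q - ∑ m ∈ Finset.range M, Pt m F q

theorem mem_X_zero {q : (Phase n × ℝ) × Dbl n} (hq : q ∈ (frX n).S) (w : Dbl n) :
    (q.1, w) ∈ (frX n).S := mem_frX.2 (mem_frX.1 hq)

theorem Pt_congr (m : ℕ) : ∀ {F F' : (Phase n × ℝ) × Dbl n → ℂ}, EqOn F F' (frX n).S →
    EqOn (Pt m F) (Pt m F') (frX n).S := by
  induction m with
  | zero => exact fun h q hq => h (mem_X_zero hq 0)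
  | succ m ih =>
    intro F F' h q hq
    simp only [Pt]
    congr 1
    exact Finset.sum_congr rfl fun i _ => by rw [ih (Frame.D_congr h _) hq]

theorem Rt_congr (M : ℕ) {F F' : (Phase n × ℝ) × Dbl n → ℂ} (h : EqOn F F' (frX n).S) :
    EqOn (Rt M F) (Rt M F') (frX n).S := fun q hq => by
  simp only [Rt]
  rw [h hq, Finset.sum_congr rfl fun m _ => Pt_congr m h hq]

/-- The coordinate functions as functions on the space of amplitudes. -/
def cX (i : Idx n) : (Phase n × ℝ) × Dbl n →L[ℝ] ℂ :=
  (Complex.ofRealCLM.comp (cw i)).comp (ContinuousLinearMap.snd ℝ _ _)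

theorem cX_apply (i : Idx n) (q : (Phase n × ℝ) × Dbl n) : cX i q = (cw i q.2 : ℂ) := rfl

theorem D_inl_cX (i : Idx n ⊕ Unit) (j : Idx n) {q : (Phase n × ℝ) × Dbl n} (hq : q ∈ (frX n).S) :
    (frX n).D (Sum.inl i) (fun q => cX j q) q = 0 := by
  rw [Frame.D_linear _ _ hq]
  simp [cX, frX, Frame.prod]

theorem cw_b (i j : Idx n) : cw j ((frW n).b i) = if i = j then 1 else 0 := by
  rcases i with i | i <;> rcases j with j | j <;> simp [cw, frW, Frame.prod, frSpace, eq_comm]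

theorem D_inr_cX (i : Idx n) (j : Idx n) {q : (Phase n × ℝ) × Dbl n} (hq : q ∈ (frX n).S) :
    (frX n).D (Sum.inr i) (fun q => cX j q) q = if i = j then 1 else 0 := by
  rw [Frame.D_linear _ _ hq]
  have : cX j ((frX n).b (Sum.inr i)) = ((cw j ((frW n).b i) : ℝ) : ℂ) := rfl
  rw [this, cw_b]
  split_ifs <;> simp

/-- Restriction to `w = 0`. -/
def restr (n : ℕ) : (Phase n × ℝ) × Dbl n →L[ℝ] (Phase n × ℝ) × Dbl n :=
  (ContinuousLinearMap.inl ℝ _ _).comp (ContinuousLinearMap.fst ℝ _ _)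

theorem smooth_Pt (m : ℕ) : ∀ {F : (Phase n × ℝ) × Dbl n → ℂ}, (frX n).Smooth F →
    (frX n).Smooth (Pt m F) := by
  induction m with
  | zero =>
    intro F hF
    exact ContDiffOn.comp (g := F) (f := restr n) hF (restr n).contDiff.contDiffOn
      fun q hq => mem_X_zero hq 0
  | succ m ih =>
    intro F hF
    exact (Frame.smooth_const _).mul (Frame.Smooth.sum fun i _ =>
      (Frame.smooth_clm (cX i)).mul (ih (hF.D _)))

theorem smooth_Rt (M : ℕ) {F : (Phase n × ℝ) × Dbl n → ℂ} (hF : (frX n).Smooth F) :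
    (frX n).Smooth (Rt M F) := hF.sub (Frame.Smooth.sum fun m _ => smooth_Pt m hF)

theorem hasFDerivWithinAt_Pt_zero {F : (Phase n × ℝ) × Dbl n → ℂ} (hF : (frX n).Smooth F)
    {q : (Phase n × ℝ) × Dbl n} (hq : q ∈ (frX n).S) : HasFDerivWithinAt (Pt 0 F)
      ((fderivWithin ℝ F (frX n).S (q.1, 0)).comp (restr n)) (frX n).S q :=
  (hF.hasFDerivWithinAt (mem_X_zero hq 0)).comp q (restr n).hasFDerivWithinAt
    fun _ hq => mem_X_zero hq 0

theorem D_inl_Pt (m : ℕ) (i : Idx n ⊕ Unit) : ∀ {F : (Phase n × ℝ) × Dbl n → ℂ},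
    (frX n).Smooth F →
    EqOn ((frX n).D (Sum.inl i) (Pt m F)) (Pt m ((frX n).D (Sum.inl i) F)) (frX n).S := by
  induction m with
  | zero =>
    intro F hF q hq
    rw [Frame.D_eq hq (hasFDerivWithinAt_Pt_zero hF hq)]
    rfl
  | succ m ih =>
    intro F hF q hq
    have hs : ∀ j : Idx n, (frX n).Smooth (fun q => cX j q * Pt m ((frX n).D (Sum.inr j) F) q) :=
      fun j => (Frame.smooth_clm (cX j)).mul (smooth_Pt m (hF.D _))
    have e : Pt (m + 1) F = fun q => ((m : ℂ) + 1)⁻¹ * ∑ j, cX j q *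
      Pt m ((frX n).D (Sum.inr j) F) q := rfl
    rw [e, Frame.D_const_mul _ (Frame.Smooth.sum fun j _ => hs j) _ hq,
      Frame.D_sum (fun j _ => hs j) _ hq]
    simp only [Pt]
    congr 1
    refine Finset.sum_congr rfl fun j _ => ?_
    rw [Frame.D_mul (Frame.smooth_clm (cX j)) (smooth_Pt m (hF.D _)) _ hq, D_inl_cX i j hq,
      zero_mul, zero_add, ih (hF.D _) hq, cX_apply,
      Pt_congr m (fun q hq => Frame.D_comm hF (Sum.inl i) (Sum.inr j) hq) hq]

theorem D_inr_Pt_zero (i : Idx n) {F : (Phase n × ℝ) × Dbl n → ℂ} (hF : (frX n).Smooth F)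
    {q : (Phase n × ℝ) × Dbl n} (hq : q ∈ (frX n).S) : (frX n).D (Sum.inr i) (Pt 0 F) q = 0 := by
  rw [Frame.D_eq hq (hasFDerivWithinAt_Pt_zero hF hq)]
  have : restr n ((frX n).b (Sum.inr i)) = 0 := by simp [restr, frX, Frame.prod]
  rw [ContinuousLinearMap.comp_apply, this, map_zero]

/-- The product rule yields P_m(∂_i F) plus the sum of w_j ∂_i P_m(∂_j F), all divided by m + 1. By
induction and symmetry of second derivatives that sum is m P_m(∂_i F), and the factors cancel. -/
theorem D_inr_Pt_succ (m : ℕ) (i : Idx n) : ∀ {F : (Phase n × ℝ) × Dbl n → ℂ},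
    (frX n).Smooth F →
    EqOn ((frX n).D (Sum.inr i) (Pt (m + 1) F)) (Pt m ((frX n).D (Sum.inr i) F)) (frX n).S := by
  have aux : ∀ m : ℕ, ∀ {F : (Phase n × ℝ) × Dbl n → ℂ}, (frX n).Smooth F → ∀ q ∈ (frX n).S,
      (frX n).D (Sum.inr i) (Pt (m + 1) F) q = ((m : ℂ) + 1)⁻¹ *
        (Pt m ((frX n).D (Sum.inr i) F) q + ∑ j, (cw j q.2 : ℂ) *
          (frX n).D (Sum.inr i) (Pt m ((frX n).D (Sum.inr j) F)) q) := by
    intro m F hF q hq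
    have hs : ∀ j : Idx n, (frX n).Smooth (fun q => cX j q * Pt m ((frX n).D (Sum.inr j) F) q) :=
      fun j => (Frame.smooth_clm (cX j)).mul (smooth_Pt m (hF.D _))
    have e : Pt (m + 1) F = fun q => ((m : ℂ) + 1)⁻¹ * ∑ j, cX j q *
      Pt m ((frX n).D (Sum.inr j) F) q := rfl
    rw [e, Frame.D_const_mul _ (Frame.Smooth.sum fun j _ => hs j) _ hq,
      Frame.D_sum (fun j _ => hs j) _ hq]
    congr 1
    have e2 : ∀ j : Idx n, (frX n).D (Sum.inr i) (fun q => cX j q *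
        Pt m ((frX n).D (Sum.inr j) F) q) q = (if i = j then Pt m ((frX n).D (Sum.inr j) F) q else 0) +
        (cw j q.2 : ℂ) * (frX n).D (Sum.inr i) (Pt m ((frX n).D (Sum.inr j) F)) q := by
      intro j
      rw [Frame.D_mul (Frame.smooth_clm (cX j)) (smooth_Pt m (hF.D _)) _ hq, D_inr_cX i j hq,
        cX_apply]
      congr 1
      split_ifs <;> simp
    rw [Finset.sum_congr rfl fun j _ => e2 j, Finset.sum_add_distrib]
    simp only [Finset.sum_ite_eq, Finset.mem_univ, if_true]
  induction m with
  | zero =>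
    intro F hF q hq
    rw [aux 0 hF q hq, Finset.sum_eq_zero fun j _ => by rw [D_inr_Pt_zero i (hF.D _) hq, mul_zero]]
    simp
  | succ m ih =>
    intro F hF q hq
    rw [aux (m + 1) hF q hq]
    have e : ∑ j, (cw j q.2 : ℂ) * (frX n).D (Sum.inr i) (Pt (m + 1) ((frX n).D (Sum.inr j) F)) q =
        ((m : ℂ) + 1) * Pt (m + 1) ((frX n).D (Sum.inr i) F) q := by
      have hm : ((m : ℂ) + 1) ≠ 0 := by exact_mod_cast m.succ_ne_zero
      conv_rhs => rw [Pt, mul_inv_cancel_left₀ hm]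
      refine Finset.sum_congr rfl fun j _ => ?_
      rw [ih (hF.D _) hq, Pt_congr m (fun q hq => Frame.D_comm hF (Sum.inr i) (Sum.inr j) hq) hq]
    rw [e]
    have hm : ((m : ℂ) + 1 + 1) ≠ 0 := by exact_mod_cast (m + 1).succ_ne_zero
    push_cast
    field_simp
    ring

theorem D_inl_Rt (M : ℕ) (i : Idx n ⊕ Unit) {F : (Phase n × ℝ) × Dbl n → ℂ}
    (hF : (frX n).Smooth F) :
    EqOn ((frX n).D (Sum.inl i) (Rt M F)) (Rt M ((frX n).D (Sum.inl i) F)) (frX n).S := by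
  intro q hq
  have e : Rt M F = fun q => F q - ∑ m ∈ Finset.range M, Pt m F q := rfl
  rw [e, Frame.D_sub hF (Frame.Smooth.sum fun m _ => smooth_Pt m hF) _ hq,
    Frame.D_sum (fun m _ => smooth_Pt m hF) _ hq, Rt,
    Finset.sum_congr rfl fun m _ => D_inl_Pt m i hF hq]

/-- A w-derivative lowers the order of the remainder by one. As the remainder vanishes at w = 0, it
can be estimated by the mean value inequality and induction, without an integral formula. -/
theorem D_inr_Rt (M : ℕ) (i : Idx n) {F : (Phase n × ℝ) × Dbl n → ℂ} (hF : (frX n).Smooth F) :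
    EqOn ((frX n).D (Sum.inr i) (Rt (M + 1) F)) (Rt M ((frX n).D (Sum.inr i) F)) (frX n).S := by
  intro q hq
  have e : Rt (M + 1) F = fun q => F q - ∑ m ∈ Finset.range (M + 1), Pt m F q := rfl
  rw [e, Frame.D_sub hF (Frame.Smooth.sum fun m _ => smooth_Pt m hF) _ hq,
    Frame.D_sum (fun m _ => smooth_Pt m hF) _ hq, Rt, Finset.sum_range_succ',
    D_inr_Pt_zero i hF hq, add_zero, Finset.sum_congr rfl fun m _ => D_inr_Pt_succ m i hF hq]

theorem Rt_zero_right (M : ℕ) (F : (Phase n × ℝ) × Dbl n → ℂ) (p : Phase n × ℝ) :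
    Rt (M + 1) F (p, 0) = 0 := by
  rw [Rt, Finset.sum_range_succ', Finset.sum_eq_zero fun m _ => by simp [Pt]]
  simp [Pt]

theorem jw_smul_le (w : Dbl n) {t : ℝ} (h0 : 0 ≤ t) (h1 : t ≤ 1) : jw (t • w) ≤ jw w := by
  refine abs_le_of_sq_le_sq' ?_ (jw_pos w).le |>.2
  rw [jw_sq, jw_sq]
  have : ∀ i ∈ Finset.univ, cw i (t • w) ^ 2 ≤ cw (n := n) i w ^ 2 := fun i _ => by
    rw [map_smul, smul_eq_mul, mul_pow]
    exact mul_le_of_le_one_left (sq_nonneg _) (pow_le_one₀ h0 h1)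
  linarith [Finset.sum_le_sum this]

/-- The mean value inequality along the segment from `0` to `w`. -/
theorem norm_le_of_D_inr_le {F : (Phase n × ℝ) × Dbl n → ℂ} (hF : (frX n).Smooth F)
    {p : Phase n × ℝ} (hp : p ∈ (frP n).S) (h0 : F (p, 0) = 0) (w : Dbl n) {C : ℝ}
    (h : ∀ i, ∀ t : ℝ, 0 ≤ t → t ≤ 1 → ‖(frX n).D (Sum.inr i) F (p, t • w)‖ ≤ C) :
    ‖F (p, w)‖ ≤ jw w * ∑ _i : Idx n, C := by
  have hd : ∀ t ∈ Icc (0 : ℝ) 1, HasDerivWithinAt (fun t : ℝ => F (p, t • w))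
      (∑ i, (cw i w : ℂ) * (frX n).D (Sum.inr i) F (p, t • w)) (Icc 0 1) t := by
    intro t _
    have h1 := hF.hasFDerivWithinAt (mem_X hp (t • w))
    have h2 : HasDerivWithinAt (fun t : ℝ => (p, t • w)) ((0 : Phase n × ℝ), w) (Icc 0 1) t := by
      have := ((hasDerivAt_id t).smul_const w)
      simp only [one_smul] at this
      exact ((hasDerivAt_const t p).prodMk this).hasDerivWithinAt
    have h3 := h1.comp_hasDerivWithinAt t h2 (fun t _ => mem_X hp (t • w))
    refine h3.congr_deriv ?_
    have e : ((0 : Phase n × ℝ), w) = ∑ i, cw i w • (frX n).b (Sum.inr i) := by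
      have := (frW n).sum_eq w
      refine Prod.ext ?_ ?_
      · simp [Prod.fst_sum, frX, Frame.prod]
      · rw [Prod.snd_sum]; exact this.symm
    rw [e, map_sum]
    exact Finset.sum_congr rfl fun i _ => by rw [map_smul, Complex.real_smul]; rfl
  have key := (convex_Icc (0 : ℝ) 1).norm_image_sub_le_of_norm_hasDerivWithin_le hd
    (C := jw w * ∑ _i : Idx n, C) (fun t ht => ?_) (left_mem_Icc.2 zero_le_one)
    (right_mem_Icc.2 zero_le_one)
  · simpa [h0] using key
  · rw [Finset.mul_sum]
    refine (norm_sum_le _ _).trans (Finset.sum_le_sum fun i _ => ?_)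
    rw [norm_mul, Complex.norm_real, Real.norm_eq_abs]
    exact mul_le_mul (abs_cw_le i w) (h i t ht.1 ht.2) (norm_nonneg _) (jw_pos w).le

/-- The weight of shifted symbols that gain `r` powers of `⟨z + w⟩`. -/
def wS (m : Phase n × ℝ → ℝ) (r : ℕ) (K : ℝ) (q : (Phase n × ℝ) × Dbl n) : ℝ :=
  m q.1 * (jap (q.1.1 + toE n q.2))⁻¹ ^ r * jw q.2 ^ K

theorem inv_jap_add_pow_le (z : Phase n) (w : Dbl n) (r : ℕ) :
    (jap (z + toE n w))⁻¹ ^ r ≤ 2 ^ r * ((jap z)⁻¹ ^ r * jw w ^ r) := by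
  rw [← mul_pow, ← mul_pow]
  refine pow_le_pow_left₀ (inv_nonneg.2 (jap_pos _).le) ?_ r
  have h1 := jap_le_add z (toE n w)
  have h2 := jap_pos z
  have h3 := jap_pos (z + toE n w)
  rw [inv_le_iff_one_le_mul₀ h3]
  have e : 2 * ((jap z)⁻¹ * jw w) * jap (z + toE n w) =
    (jap z)⁻¹ * (2 * jap (toE n w) * jap (z + toE n w)) := by rw [jw]; ring
  rw [e, ← inv_mul_cancel₀ h2.ne']
  exact mul_le_mul_of_nonneg_left h1 (inv_nonneg.2 h2.le)

/-- By Peetre's inequality the r powers of ⟨z+w⟩⁻¹ become r powers of ⟨z⟩⁻¹ at the price of ⟨w⟩^r,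
which is harmless in an oscillatory integral. -/
theorem SymS.symF {m : Phase n × ℝ → ℝ} (hm : ∀ p, 0 ≤ m p) {r : ℕ} {K : ℝ}
    {F : (Phase n × ℝ) × Dbl n → ℂ} (hF : SymS (wS m r K) F) :
    SymF (wA (fun p => m p * (jap p.1)⁻¹ ^ r) (K + r)) F := by
  refine hF.comp (𝔼 := frX n) (H := gF n) (fun q => q) (ContinuousLinearMap.id ℝ _)
    (fun q _ => hasFDerivWithinAt_id q _) (fun q hq => hq) (fun i => i) (fun _ => 1) (by simp) 1
    zero_le_one ?_ (2 ^ r) (by positivity) (fun q _ => ?_) fun q _ => wA_nonneg (fun p =>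
      mul_nonneg (hm p) (pow_nonneg (inv_nonneg.2 (jap_pos _).le) _)) _ _
  · rintro (i | i) q -
    · simp [gS, gF]
    · simpa [gS, gF] using inv_le_one_of_one_le₀ (one_le_jap _)
  · have h := inv_jap_add_pow_le q.1.1 q.2 r
    have hj := Real.rpow_nonneg (jw_pos q.2).le K
    rw [wS, wA, Real.rpow_add (jw_pos q.2), Real.rpow_natCast]
    calc m q.1 * (jap (q.1.1 + toE n q.2))⁻¹ ^ r * jw q.2 ^ K
        ≤ m q.1 * (2 ^ r * ((jap q.1.1)⁻¹ ^ r * jw q.2 ^ r)) * jw q.2 ^ K := by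
          gcongr; exact hm _
      _ = _ := by ring

theorem SymS.D_inr {m : Phase n × ℝ → ℝ} {r : ℕ} {K : ℝ} {F : (Phase n × ℝ) × Dbl n → ℂ}
    (hF : SymS (wS m r K) F) (i : Idx n) : SymS (wS m (r + 1) K) ((frX n).D (Sum.inr i) F) :=
  (hF.D (Sum.inr i)).mono_le fun q _ => le_of_eq (by
    simp only [wS, gS, Sum.elim_inr, pow_succ]; ring)

theorem SymS.D_inl {m : Phase n × ℝ → ℝ} {r : ℕ} {K : ℝ} {F : (Phase n × ℝ) × Dbl n → ℂ}
    (hF : SymS (wS m r K) F) (i : Idx n ⊕ Unit) :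
    SymS (wS (fun p => m p * (gP n).g i p) r (K + 2)) ((frX n).D (Sum.inl i) F) :=
  (hF.D (Sum.inl i)).mono_le fun q _ => le_of_eq (by
    rw [wS, wS, Real.rpow_add (jw_pos q.2)]
    simp only [gS, Sum.elim_inl, Real.rpow_ofNat]; ring)

/-- The Taylor remainder of a shifted symbol gains powers of `⟨z⟩`. -/
theorem SymS.Rt (M : ℕ) : ∀ {m : Phase n × ℝ → ℝ}, (∀ p, 0 ≤ m p) → ∀ {r : ℕ} {K : ℝ}, 0 ≤ K →
    ∀ {F : (Phase n × ℝ) × Dbl n → ℂ}, SymS (wS m r K) F →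
    SymF (wA (fun p => m p * (jap p.1)⁻¹ ^ (r + M)) (K + r + 2 * M)) (Rt M F) := by
  induction M with
  | zero =>
    intro m hm r K hK F hF
    have e : Shubin.Rt 0 F = F := by funext q; simp [Shubin.Rt]
    rw [e]
    simpa using hF.symF hm
  | succ M ih =>
    intro m hm r K hK F hF
    -- Parameter derivatives of a remainder are remainders of the same order, so they stay in the
    -- second alternative; w-derivatives are remainders of order M and fall under the induction
    -- hypothesis, which is the first alternative.
    refine Frame.sym_of_family (𝒢 := fun m' f => SymF m' f ∨ ∃ (m : Phase n × ℝ → ℝ) (K : ℝ)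
      (F : (Phase n × ℝ) × Dbl n → ℂ), (∀ p, 0 ≤ m p) ∧ 0 ≤ K ∧ SymS (wS m r K) F ∧
      m' = wA (fun p => m p * (jap p.1)⁻¹ ^ (r + (M + 1))) (K + r + 2 * (M + 1 : ℕ)) ∧
      f = Shubin.Rt (M + 1) F) ?_ (Or.inr ⟨m, K, F, hm, hK, hF, rfl, rfl⟩)
    rintro m' f (hf | ⟨m, K, F, hm, hK, hF, rfl, rfl⟩)
    · exact ⟨hf.bound, fun i => (frX n).D i f, fun i => Or.inl (hf.D i), fun p hp =>
        ⟨_, hf.1.hasFDerivWithinAt hp, fun i => rfl⟩⟩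
    · have hs := smooth_Rt (M + 1) hF.1
      have hD : ∀ i, SymF (wA (fun p => m p * (jap p.1)⁻¹ ^ (r + (M + 1))) (K + (r + 1 : ℕ) + 2 * M))
          ((frX n).D (Sum.inr i) (Shubin.Rt (M + 1) F)) := fun i => by
        have := ih hm hK (hF.D_inr i)
        rw [show r + 1 + M = r + (M + 1) by ring] at this
        exact this.congr (D_inr_Rt M i hF.1)
      have hm' : ∀ p, 0 ≤ m p * (jap p.1)⁻¹ ^ (r + (M + 1)) := fun p =>
        mul_nonneg (hm p) (pow_nonneg (inv_nonneg.2 (jap_pos _).le) _)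
      refine ⟨?_, Sum.elim (fun i => Shubin.Rt (M + 1) ((frX n).D (Sum.inl i) F))
        (fun i => (frX n).D (Sum.inr i) (Shubin.Rt (M + 1) F)), ?_, fun p hp =>
        ⟨_, hs.hasFDerivWithinAt hp, ?_⟩⟩
      · choose C hC hb using fun i => (hD i).bound
        refine ⟨∑ _i : Idx n, ∑ j, C j, Finset.sum_nonneg fun _ _ => Finset.sum_nonneg fun j _ => hC j,
          fun q hq => ?_⟩
        have hp : q.1 ∈ (frP n).S := mem_frP.2 (mem_frX.1 hq)
        -- The size of the remainder is recovered from its w-derivatives along the segment from 0 to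
        -- w. Each order costs two powers of ⟨w⟩: one from this step and one from the additional
        -- factor ⟨z+w⟩⁻¹.
        have h := norm_le_of_D_inr_le hs hp (Rt_zero_right M F q.1) q.2
          (C := (∑ j, C j) * (m q.1 * (jap q.1.1)⁻¹ ^ (r + (M + 1)) *
            jw q.2 ^ (K + (r + 1 : ℕ) + 2 * M))) fun i t h0 h1 => by
              refine (hb i _ (mem_X hp _)).trans ?_
              -- A nonnegative exponent makes the bound increase along the segment; this is where 0
              -- ≤ K enters.
              have e0 : (0 : ℝ) ≤ K + (r + 1 : ℕ) + 2 * M := by positivity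
              refine mul_le_mul (Finset.single_le_sum (f := C) (fun j _ => hC j) (Finset.mem_univ i))
                (mul_le_mul_of_nonneg_left (Real.rpow_le_rpow (jw_pos _).le (jw_smul_le _ h0 h1) e0)
                  (hm' _)) (wA_nonneg hm' _ _) (Finset.sum_nonneg fun j _ => hC j)
        refine h.trans (le_of_eq ?_)
        have e : jw q.2 ^ (K + r + 2 * (M + 1 : ℕ)) =
            jw q.2 * jw q.2 ^ (K + (r + 1 : ℕ) + 2 * M) := by
          rw [mul_comm (jw q.2), ← Real.rpow_add_one (jw_pos q.2).ne']
          congr 1; push_cast; ring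
        rw [wA, e, ← Finset.sum_mul]
        ring
      · rintro (i | i)
        · refine Or.inr ⟨fun p => m p * (gP n).g i p, K + 2, (frX n).D (Sum.inl i) F,
            fun p => mul_nonneg (hm p) ((gP n).nonneg i p), by linarith, hF.D_inl i, ?_, rfl⟩
          funext q
          simp only [wA, gF, Sum.elim_inl]
          rw [show K + 2 + r + 2 * ((M + 1 : ℕ) : ℝ) = K + r + 2 * (M + 1 : ℕ) + (2 : ℕ) by
            push_cast; ring, Real.rpow_add_natCast (jw_pos q.2).ne']
          ring
        · refine Or.inl ((hD i).mono_le fun q _ => ?_)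
          rw [wA, wA]
          simp only [gF, Sum.elim_inr, mul_one]
          refine mul_le_mul_of_nonneg_left (Real.rpow_le_rpow_of_exponent_le (one_le_jw _) ?_) (hm' _)
          push_cast; linarith
      · rintro (i | i)
        · exact D_inl_Rt (M + 1) i hF.1 hp
        · rfl

end

/-! ### Shifted symbols -/

section

variable {n : ℕ}

/-- The shift `(z, μ, w) ↦ (z + w, μ)`. -/
def shiftL (n : ℕ) : (Phase n × ℝ) × Dbl n →L[ℝ] Phase n × ℝ :=
  ContinuousLinearMap.fst ℝ _ _ +
    (ContinuousLinearMap.inl ℝ (Phase n) ℝ).comp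
      (((toE n : Dbl n →L[ℝ] Phase n)).comp (ContinuousLinearMap.snd ℝ (Phase n × ℝ) (Dbl n)))

theorem shiftL_apply (q : (Phase n × ℝ) × Dbl n) : shiftL n q = (q.1.1 + toE n q.2, q.1.2) := by
  refine Prod.ext ?_ ?_ <;> simp [shiftL]

theorem shiftL_fst (q : (Phase n × ℝ) × Dbl n) : (shiftL n q).1 = q.1.1 + toE n q.2 := by
  rw [shiftL_apply]

theorem shiftL_snd (q : (Phase n × ℝ) × Dbl n) : (shiftL n q).2 = q.1.2 := by
  rw [shiftL_apply]

theorem shiftL_mem {q : (Phase n × ℝ) × Dbl n} (hq : q ∈ (frX n).S) : shiftL n q ∈ (frP n).S := by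
  rw [mem_frP, shiftL_snd]; exact mem_frX.1 hq

theorem shiftL_b_inl (i : Idx n ⊕ Unit) : shiftL n ((frX n).b (Sum.inl i)) = (frP n).b i := by
  rw [shiftL_apply]; refine Prod.ext ?_ ?_ <;> simp [frX, Frame.prod]

theorem shiftL_b_inr (i : Idx n) : shiftL n ((frX n).b (Sum.inr i)) = (frP n).b (Sum.inl i) := by
  rw [shiftL_apply]; refine Prod.ext ?_ ?_ <;> simp [frX, Frame.prod, frP, frE]

theorem inv_jap_add_le (z : Phase n) (w : Dbl n) :
    (jap (z + toE n w))⁻¹ ≤ 2 * ((jap z)⁻¹ * jw w ^ 2) := by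
  have h := inv_jap_add_pow_le z w 1
  simp only [pow_one] at h
  have h1 := one_le_jw w
  have h2 : 0 ≤ (jap z)⁻¹ := inv_nonneg.2 (jap_pos z).le
  nlinarith [mul_le_mul_of_nonneg_left (show jw w ≤ jw w ^ 2 by nlinarith) h2]

theorem inv_japPar_add_le (z : Phase n) (μ : ℝ) (w : Dbl n) :
    (japPar (z + toE n w) μ)⁻¹ ≤ 2 * ((japPar z μ)⁻¹ * jw w ^ 2) := by
  have h1 := japPar_le_add z (toE n w) μ
  have h2 := japPar_pos z μ
  have h3 := japPar_pos (z + toE n w) μ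
  have h4 := one_le_jw w
  rw [inv_le_iff_one_le_mul₀ h3]
  have e : 2 * ((japPar z μ)⁻¹ * jw w ^ 2) * japPar (z + toE n w) μ =
    (japPar z μ)⁻¹ * (2 * jw w ^ 2 * japPar (z + toE n w) μ) := by ring
  rw [e, ← inv_mul_cancel₀ h2.ne']
  refine mul_le_mul_of_nonneg_left (h1.trans ?_) (inv_nonneg.2 h2.le)
  change 2 * jw w * _ ≤ _
  gcongr
  nlinarith

section General

variable {A : Type*} [NormedAddCommGroup A] [NormedSpace ℝ A]

/-- Shifting symbols. -/
theorem sym_shift {m : Phase n × ℝ → ℝ} (hm : ∀ p, 0 ≤ m p) {f : Phase n × ℝ → A}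
    (hf : (frP n).Sym (gP n) m f) :
    (frX n).Sym (gS n) (fun q => m (shiftL n q)) (fun q => f (shiftL n q)) := by
  refine hf.comp (𝔼 := frX n) (H := gS n) (shiftL n) (shiftL n)
    (fun q _ => (shiftL n).hasFDerivWithinAt) (fun q hq => shiftL_mem hq)
    (Sum.elim id Sum.inl) (fun _ => 1) ?_ 2 zero_le_two ?_ 1 zero_le_one (by simp)
    fun q _ => hm _
  · rintro (i | i)
    · simp [shiftL_b_inl]
    · simp [shiftL_b_inr]
  · rintro ((i | i) | i) q -
    · simpa [gS, gP, shiftL_fst] using inv_jap_add_le q.1.1 q.2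
    · simpa [gS, gP, shiftL_fst, shiftL_snd] using inv_japPar_add_le q.1.1 q.1.2 q.2
    · have := inv_nonneg.2 (jap_pos (q.1.1 + toE n q.2)).le
      simp only [gS, gP, shiftL_fst, Sum.elim_inr, Sum.elim_inl, abs_one, one_mul]
      linarith

/-- Symbols as amplitudes that do not depend on `w`. -/
theorem sym_fst {m : Phase n × ℝ → ℝ} (hm : ∀ p, 0 ≤ m p) {f : Phase n × ℝ → A}
    (hf : (frP n).Sym (gP n) m f) :
    (frX n).Sym (gS n) (fun q => m q.1) (fun q => f q.1) := by
  refine hf.comp (𝔼 := frX n) (H := gS n) Prod.fst (ContinuousLinearMap.fst ℝ _ _)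
    (fun q _ => hasFDerivWithinAt_fst) (fun q hq => mem_frP.2 (mem_frX.1 hq))
    (Sum.elim id fun _ => Sum.inr ()) (Sum.elim (fun _ => 1) fun _ => 0) ?_ 1 zero_le_one ?_ 1
    zero_le_one (by simp) fun q _ => hm _
  · rintro (i | i) <;> simp [frX, Frame.prod]
  · rintro (i | i) q -
    · simp only [Sum.elim_inl, abs_one, one_mul, id, gS]
      exact le_mul_of_one_le_right ((gP n).nonneg _ _) (one_le_pow₀ (one_le_jw _))
    · simpa using (gS n).nonneg (Sum.inr i) q

end General

/-! ### The brackets are symbols -/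

/-- The bracket `⟨z, μ⟩` as a function of pairs. -/
def lam (p : Phase n × ℝ) : ℝ := japPar p.1 p.2

theorem lam_pos (p : Phase n × ℝ) : 0 < lam p := japPar_pos _ _

theorem sym_coord (i : Idx n) : (frP n).Sym (gP n) (fun p => jap p.1)
    (fun p => (cw i ((toE n).symm p.1))) := by
  let T : Phase n × ℝ →L[ℝ] ℝ := ((cw i).comp ((toE n).symm : Phase n →L[ℝ] Dbl n)).comp
    (ContinuousLinearMap.fst ℝ _ _)
  have hb : ∀ j, ‖T ((frP n).b j)‖ ≤ if j.isLeft then 1 else 0 := by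
    rintro (j | j)
    · have : T ((frP n).b (Sum.inl j)) = cw i ((frW n).b j) := by simp [T, frP, Frame.prod, frE]
      rw [this, cw_b, Sum.isLeft_inl, if_pos rfl]; split_ifs <;> simp
    · simp [T, frP, Frame.prod]
  refine Frame.sym_linear T 1 zero_le_one (fun p _ => ?_) (fun j p _ => (hb j).trans ?_)
    fun p _ => (jap_pos _).le
  · have := abs_cw_le i ((toE n).symm p.1)
    rw [one_mul, Real.norm_eq_abs]
    change |cw i ((toE n).symm p.1)| ≤ _
    simpa [jw] using this
  · rcases j with j | j
    · simp [gP, (jap_pos p.1).ne']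
    · simp only [Sum.isLeft_inr, one_mul]
      exact mul_nonneg (jap_pos _).le ((gP n).nonneg _ _)

theorem sym_jap_sq : (frP n).Sym (gP n) (fun p => jap p.1 ^ 2) (fun p => jap p.1 ^ 2) := by
  have h1 : (frP n).Sym (gP n) (fun p => jap p.1 ^ 2) (fun _ => (1 : ℝ)) :=
    (Frame.sym_const (1 : ℝ)).mono_le fun p _ => one_le_pow₀ (one_le_jap _)
  have h2 : (frP n).Sym (gP n) (fun p => jap p.1 ^ 2)
      (fun p => ∑ i, cw i ((toE n).symm p.1) ^ 2) :=
    Frame.Sym.sum (fun p _ => sq_nonneg _) fun i _ => (sym_coord i).pow 2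
  refine (h1.add h2).congr fun p _ => ?_
  have := jw_sq ((toE n).symm p.1)
  simpa [jw] using this

theorem sym_mu : (frP n).Sym (gP n) lam (fun p => p.2) := by
  have hb : ∀ j, ‖(ContinuousLinearMap.snd ℝ (Phase n) ℝ) ((frP n).b j)‖ ≤
      if j.isLeft then 0 else 1 := by
    rintro (j | j) <;> simp [frP, Frame.prod, frR]
  refine Frame.sym_linear (ContinuousLinearMap.snd ℝ (Phase n) ℝ) 1 zero_le_one (fun p _ => ?_)
    (fun j p _ => (hb j).trans ?_) fun p _ => (lam_pos _).le
  · simpa [lam] using le_japPar p.1 p.2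
  · rcases j with j | j
    · simp only [Sum.isLeft_inl, one_mul]
      exact mul_nonneg (lam_pos _).le ((gP n).nonneg _ _)
    · simp [gP, lam, (japPar_pos p.1 p.2).ne']

theorem sym_lam_sq : (frP n).Sym (gP n) (fun p => lam p ^ 2) (fun p => lam p ^ 2) := by
  refine ((sym_jap_sq.mono_le fun p _ => pow_le_pow_left₀ (jap_pos _).le (jap_le_japPar _ _) 2).add
    (sym_mu.pow 2)).congr fun p _ => ?_
  simp only [lam]
  rw [jap_sq, japPar_sq]

/-- Powers of the brackets are treated as half powers of their squares, which are polynomials. -/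
theorem sq_rpow_half {x : ℝ} (hx : 0 < x) (s : ℝ) : (x ^ 2) ^ (s / 2) = x ^ s := by
  rw [← Real.rpow_natCast, ← Real.rpow_mul hx.le]; congr 1; push_cast; ring

theorem sym_lam_rpow (s : ℝ) : (frP n).Sym (gP n) (fun p => lam p ^ s) (fun p => lam p ^ s) := by
  simpa only [sq_rpow_half (lam_pos _)] using
    sym_lam_sq.rpow (fun p _ => pow_pos (lam_pos p) 2) (s / 2)

theorem continuous_lam : Continuous (lam : Phase n × ℝ → ℝ) := continuous_japPar

theorem continuous_wP (d ν : ℝ) : Continuous (wP n d ν) :=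
  ((continuous_jap.comp continuous_fst).rpow_const fun _ => Or.inl (jap_pos _).ne').mul
    (continuous_lam.rpow_const fun _ => Or.inl (lam_pos _).ne')

theorem wP_shift_le (d ν : ℝ) (q : (Phase n × ℝ) × Dbl n) :
    wP n d ν (shiftL n q) ≤ 2 ^ |ν| * 2 ^ |d - ν| * (wP n d ν q.1 * jw q.2 ^ (|ν| + |d - ν|)) := by
  rw [wP, shiftL_fst, shiftL_snd, Real.rpow_add (jw_pos _)]
  calc _ ≤ (2 ^ |ν| * (jap q.1.1 ^ ν * jap (toE n q.2) ^ |ν|)) *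
        (2 ^ |d - ν| * (japPar q.1.1 q.1.2 ^ (d - ν) * jap (toE n q.2) ^ |d - ν|)) :=
        mul_le_mul (jap_add_rpow_le _ _ _) (japPar_add_rpow_le _ _ _ _)
          (Real.rpow_nonneg (japPar_pos _ _).le _)
          (mul_nonneg (by positivity) (mul_nonneg (Real.rpow_nonneg (jap_pos _).le _)
            (Real.rpow_nonneg (jap_pos _).le _)))
    _ = _ := by simp only [wP, jw]; ring

/-- The shifted symbol `a(z + w, μ)`. -/
def shP (f : Phase n × ℝ → ℂ) (q : (Phase n × ℝ) × Dbl n) : ℂ := f (shiftL n q)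

theorem SymP.shP {d ν : ℝ} {f : Phase n × ℝ → ℂ} (hf : SymP d ν f) :
    SymS (wS (wP n d ν) 0 (|ν| + |d - ν|)) (shP f) :=
  (sym_shift (fun p => (wP_pos d ν p).le) hf).mono (2 ^ |ν| * 2 ^ |d - ν|) (by positivity)
    fun q _ => by simpa [wS] using wP_shift_le d ν q

theorem smooth_shP {f : Phase n × ℝ → ℂ} (hf : (frP n).Smooth f) : (frX n).Smooth (shP f) :=
  ContDiffOn.comp (g := f) (f := shiftL n) hf (shiftL n).contDiff.contDiffOn fun _ hq => shiftL_mem hq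

theorem D_inr_shP {f : Phase n × ℝ → ℂ} (hf : (frP n).Smooth f) (i : Idx n) :
    EqOn ((frX n).D (Sum.inr i) (shP f)) (shP ((frP n).D (Sum.inl i) f)) (frX n).S := by
  intro q hq
  have h := (hf.hasFDerivWithinAt (shiftL_mem hq)).comp q (shiftL n).hasFDerivWithinAt
    (fun _ hq => shiftL_mem hq)
  refine (Frame.D_eq hq h _).trans ?_
  rw [ContinuousLinearMap.comp_apply, shiftL_b_inr]
  rfl

/-! ### Oscillatory integrals of Taylor polynomials -/

theorem polyW_Pt (m : ℕ) : ∀ (F : (Phase n × ℝ) × Dbl n → ℂ) (p : Phase n × ℝ),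
    PolyW (fun w => Pt m F (p, w)) := by
  induction m with
  | zero => exact fun F p => polyW_const (F (p, 0))
  | succ m ih =>
    intro F p
    refine PolyW.const_mul (PolyW.sum fun i _ => ?_) _
    simpa only [mul_comm] using (ih ((frX n).D (Sum.inr i) F) p).cw_mul i

theorem oscI_Pt_zero (F : (Phase n × ℝ) × Dbl n → ℂ) (p : Phase n × ℝ) :
    oscI (fun w => Pt 0 F (p, w)) = F (p, 0) := oscI_const (F (p, 0))

/-- Each coordinate factor in the Taylor polynomial is exchanged for a derivative in the dual
direction. -/
theorem oscI_Pt_succ (m : ℕ) {F : (Phase n × ℝ) × Dbl n → ℂ} (hF : (frX n).Smooth F)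
    {p : Phase n × ℝ} (hp : p ∈ (frP n).S) :
    oscI (fun w => Pt (m + 1) F (p, w)) = ((m : ℂ) + 1)⁻¹ * ∑ i : Idx n, -Complex.I *
      oscI (fun w => (frX n).D (Sum.inr i.swap) (Pt m ((frX n).D (Sum.inr i) F)) (p, w)) := by
  have h1 : ∀ i : Idx n, PolyW (fun w => (cw i w : ℂ) * Pt m ((frX n).D (Sum.inr i) F) (p, w)) :=
    fun i => by simpa only [mul_comm] using (polyW_Pt m ((frX n).D (Sum.inr i) F) p).cw_mul i
  have e : (fun w => Pt (m + 1) F (p, w)) = fun w => ((m : ℂ) + 1)⁻¹ *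
    ∑ i, (cw i w : ℂ) * Pt m ((frX n).D (Sum.inr i) F) (p, w) := rfl
  rw [e, oscI_const_mul (PolyW.sum fun i _ => h1 i), oscI_sum fun i _ => h1 i]
  congr 1
  refine Finset.sum_congr rfl fun i _ => ?_
  have := oscI_mul_cw (polyW_Pt m ((frX n).D (Sum.inr i) F) p) i.swap
  rw [Sum.swap_swap] at this
  simp only [mul_comm (cw i _ : ℂ)]
  rw [this]
  congr 2
  funext w
  exact D_slice (smooth_Pt m (hF.D _)) hp _ w

theorem oscI_Pt_one {F : (Phase n × ℝ) × Dbl n → ℂ} (hF : (frX n).Smooth F)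
    {p : Phase n × ℝ} (hp : p ∈ (frP n).S) : oscI (fun w => Pt 1 F (p, w)) = 0 := by
  rw [oscI_Pt_succ 0 hF hp, Finset.sum_eq_zero, mul_zero]
  intro i _
  rw [show (fun w => (frX n).D (Sum.inr i.swap) (Pt 0 ((frX n).D (Sum.inr i) F)) (p, w)) =
    fun _ => 0 from funext fun w => D_inr_Pt_zero _ (hF.D _) (mem_X hp w), oscI_zero, mul_zero]

/-- The dual derivative lowers the degree of the Taylor polynomial once more. Degrees thus fall in
steps of two, and since degree one contributes zero, so does every odd degree. -/
theorem oscI_Pt_add_two (m : ℕ) {F : (Phase n × ℝ) × Dbl n → ℂ} (hF : (frX n).Smooth F)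
    {p : Phase n × ℝ} (hp : p ∈ (frP n).S) :
    oscI (fun w => Pt (m + 2) F (p, w)) = ((m : ℂ) + 2)⁻¹ * ∑ i : Idx n, -Complex.I *
      oscI (fun w => Pt m ((frX n).D (Sum.inr i.swap) ((frX n).D (Sum.inr i) F)) (p, w)) := by
  rw [oscI_Pt_succ (m + 1) hF hp]
  congr 1
  · push_cast; ring
  · refine Finset.sum_congr rfl fun i _ => ?_
    congr 2
    funext w
    exact D_inr_Pt_succ m _ (hF.D _) (mem_X hp w)

/-- The differential operators of the asymptotic expansion of the adjoint symbol. -/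
def Qop : ℕ → (Phase n × ℝ → ℂ) → Phase n × ℝ → ℂ
  | 0, f => f
  | 1, _ => fun _ => 0
  | m + 2, f => fun p => ((m : ℂ) + 2)⁻¹ * ∑ i : Idx n, -Complex.I *
      Qop m ((frP n).D (Sum.inl i.swap) ((frP n).D (Sum.inl i) f)) p

theorem oscI_Pt_shP (m : ℕ) : ∀ {f : Phase n × ℝ → ℂ}, (frP n).Smooth f → ∀ {p : Phase n × ℝ},
    p ∈ (frP n).S → oscI (fun w => Pt m (shP f) (p, w)) = Qop m f p := by
  induction m using Nat.twoStepInduction with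
  | zero =>
    intro f hf p hp
    rw [oscI_Pt_zero, Qop, shP, shiftL_apply]
    simp
  | one => exact fun hf p hp => oscI_Pt_one (smooth_shP hf) hp
  | more m ih _ =>
    intro f hf p hp
    rw [oscI_Pt_add_two m (smooth_shP hf) hp, Qop]
    congr 1
    refine Finset.sum_congr rfl fun i _ => ?_
    rw [← ih ((hf.D _).D _) hp]
    congr 2
    funext w
    refine Pt_congr m (fun q hq => ?_) (mem_X hp w)
    rw [Frame.D_congr (D_inr_shP hf i) _ hq, D_inr_shP (hf.D _) _ hq]

/-! ### Oscillatory integrals of Taylor remainders -/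

/-- The oscillatory integral of the Taylor remainder. -/
def Tosc (M : ℕ) (F : (Phase n × ℝ) × Dbl n → ℂ) (p : Phase n × ℝ) : ℂ :=
  oscI (fun w => Rt M F (p, w))

/-- The powers of ⟨z⟩⁻¹ gained by the Taylor remainder survive integration, while its polynomial
growth in w disappears. -/
theorem SymS.sym_Tosc (M : ℕ) {m : Phase n × ℝ → ℝ} (hm : ∀ p, 0 ≤ m p) (hmc : Continuous m)
    {K : ℝ} (hK : 0 ≤ K) {F : (Phase n × ℝ) × Dbl n → ℂ} (hF : SymS (wS m 0 K) F) :
    (frP n).Sym (gP n) (fun p => m p * (jap p.1)⁻¹ ^ M) (Tosc M F) := by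
  have h := hF.Rt M hm hK
  rw [zero_add] at h
  refine h.oscI_sym (fun p => mul_nonneg (hm p) (pow_nonneg (inv_nonneg.2 (jap_pos _).le) _)) ?_
  exact hmc.mul (((continuous_jap.comp continuous_fst).inv₀ fun p => (jap_pos _).ne').pow M)

theorem SymS.polyW {m : Phase n × ℝ → ℝ} (hm : ∀ p, 0 ≤ m p) {K : ℝ}
    {F : (Phase n × ℝ) × Dbl n → ℂ} (hF : SymS (wS m 0 K) F) {p : Phase n × ℝ}
    (hp : p ∈ (frP n).S) : PolyW (fun w => F (p, w)) :=
  ⟨_, (hF.symF hm).slice (fun p => mul_nonneg (hm p) (pow_nonneg (inv_nonneg.2 (jap_pos _).le) _)) hp⟩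

/-- Smooth functions whose restrictions to fixed `p` have polynomial growth. -/
structure Amp (F : (Phase n × ℝ) × Dbl n → ℂ) : Prop where
  smooth : (frX n).Smooth F
  poly : ∀ p ∈ (frP n).S, PolyW (fun w => F (p, w))

theorem SymS.amp {m : Phase n × ℝ → ℝ} (hm : ∀ p, 0 ≤ m p) {K : ℝ}
    {F : (Phase n × ℝ) × Dbl n → ℂ} (hF : SymS (wS m 0 K) F) : Amp F :=
  ⟨hF.1, fun _ hp => hF.polyW hm hp⟩

theorem Amp.polyW_Rt (M : ℕ) {F : (Phase n × ℝ) × Dbl n → ℂ} (hF : Amp F) {p : Phase n × ℝ}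
    (hp : p ∈ (frP n).S) : PolyW (fun w => Shubin.Rt M F (p, w)) :=
  (hF.poly p hp).sub (PolyW.sum fun m _ => polyW_Pt m F p)

/-- The asymptotic expansion of the oscillatory integral of a shifted symbol. -/
theorem SymP.oscI_shP (M : ℕ) {d ν : ℝ} {f : Phase n × ℝ → ℂ} (hf : SymP d ν f)
    {p : Phase n × ℝ} (hp : p ∈ (frP n).S) :
    oscI (fun w => Shubin.shP f (p, w)) =
      ∑ m ∈ Finset.range M, Qop m f p + Tosc M (Shubin.shP f) p := by
  have h := SymP.shP hf
  have hw : ∀ p, 0 ≤ wP n d ν p := fun p => (wP_pos d ν p).le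
  rw [Tosc, show (fun w => Rt M (Shubin.shP f) (p, w)) = fun w => Shubin.shP f (p, w) -
    ∑ m ∈ Finset.range M, Pt m (Shubin.shP f) (p, w) from rfl, oscI_sub (SymS.polyW hw h hp)
    (PolyW.sum fun m _ => polyW_Pt m _ p), oscI_sum fun m _ => polyW_Pt m _ p,
    Finset.sum_congr rfl fun m _ => oscI_Pt_shP m hf.1 hp]
  ring

theorem Pt_add (m : ℕ) : ∀ {F F' : (Phase n × ℝ) × Dbl n → ℂ}, (frX n).Smooth F →
    (frX n).Smooth F' → EqOn (Pt m (fun q => F q + F' q)) (fun q => Pt m F q + Pt m F' q)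
      (frX n).S := by
  induction m with
  | zero => exact fun _ _ q _ => rfl
  | succ m ih =>
    intro F F' hF hF' q hq
    simp only [Pt]
    rw [← mul_add, ← Finset.sum_add_distrib]
    congr 1
    refine Finset.sum_congr rfl fun i _ => ?_
    rw [Pt_congr m (fun q hq => Frame.D_add hF hF' (Sum.inr i) hq) hq, ih (hF.D _) (hF'.D _) hq,
      mul_add]

theorem hasFDerivWithinAt_fst_X {A : Type*} [NormedAddCommGroup A] [NormedSpace ℝ A]
    {g : Phase n × ℝ → A} (hg : (frP n).Smooth g) {q : (Phase n × ℝ) × Dbl n}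
    (hq : q ∈ (frX n).S) : HasFDerivWithinAt (fun q : (Phase n × ℝ) × Dbl n => g q.1)
      ((fderivWithin ℝ g (frP n).S q.1).comp (ContinuousLinearMap.fst ℝ (Phase n × ℝ) (Dbl n)))
      (frX n).S q :=
  (hg.hasFDerivWithinAt (mem_frP.2 (mem_frX.1 hq))).comp q
    (ContinuousLinearMap.fst ℝ (Phase n × ℝ) (Dbl n)).hasFDerivWithinAt
    fun _ hq => mem_frP.2 (mem_frX.1 hq)

theorem D_inr_fst {A : Type*} [NormedAddCommGroup A] [NormedSpace ℝ A] {g : Phase n × ℝ → A}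
    (hg : (frP n).Smooth g) (i : Idx n) {q : (Phase n × ℝ) × Dbl n} (hq : q ∈ (frX n).S) :
    (frX n).D (Sum.inr i) (fun q => g q.1) q = 0 := by
  refine (Frame.D_eq hq (hasFDerivWithinAt_fst_X hg hq) _).trans ?_
  have : (ContinuousLinearMap.fst ℝ (Phase n × ℝ) (Dbl n)) ((frX n).b (Sum.inr i)) = 0 := by
    simp [frX, Frame.prod]
  rw [ContinuousLinearMap.comp_apply, this, map_zero]

theorem D_inl_fst_X {A : Type*} [NormedAddCommGroup A] [NormedSpace ℝ A] {g : Phase n × ℝ → A}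
    (hg : (frP n).Smooth g) (i : Idx n ⊕ Unit) {q : (Phase n × ℝ) × Dbl n} (hq : q ∈ (frX n).S) :
    (frX n).D (Sum.inl i) (fun q => g q.1) q = (frP n).D i g q.1 :=
  Frame.D_eq hq (hasFDerivWithinAt_fst_X hg hq) _

theorem smooth_fst {g : Phase n × ℝ → ℂ} (hg : (frP n).Smooth g) :
    (frX n).Smooth (fun q => g q.1) :=
  ContDiffOn.comp (g := g) (f := Prod.fst) hg contDiff_fst.contDiffOn fun _ hq =>
    mem_frP.2 (mem_frX.1 hq)

theorem Pt_fst_mul (m : ℕ) {g : Phase n × ℝ → ℂ} (hg : (frP n).Smooth g) :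
    ∀ {F : (Phase n × ℝ) × Dbl n → ℂ}, (frX n).Smooth F →
    EqOn (Pt m (fun q => g q.1 * F q)) (fun q => g q.1 * Pt m F q) (frX n).S := by
  induction m with
  | zero => exact fun _ q _ => rfl
  | succ m ih =>
    intro F hF q hq
    simp only [Pt]
    rw [mul_left_comm]
    congr 1
    rw [Finset.mul_sum]
    refine Finset.sum_congr rfl fun i _ => ?_
    rw [Pt_congr m (F' := fun q => g q.1 * (frX n).D (Sum.inr i) F q) (fun q hq => by
      rw [Frame.D_mul (smooth_fst hg) hF _ hq, D_inr_fst hg i hq, zero_mul, zero_add]) hq,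
      ih (hF.D _) hq, mul_left_comm]

theorem Amp.fst_mul {F : (Phase n × ℝ) × Dbl n → ℂ} (hF : Amp F) {g : Phase n × ℝ → ℂ}
    (hg : (frP n).Smooth g) : Amp (fun q => g q.1 * F q) :=
  ⟨(smooth_fst hg).mul hF.smooth, fun p hp => (hF.poly p hp).const_mul (g p)⟩

theorem Amp.Tosc_add (M : ℕ) {F F' : (Phase n × ℝ) × Dbl n → ℂ} (hF : Amp F) (hF' : Amp F')
    {p : Phase n × ℝ} (hp : p ∈ (frP n).S) :
    Tosc M (fun q => F q + F' q) p = Tosc M F p + Tosc M F' p := by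
  rw [Tosc, Tosc, Tosc, ← oscI_add (hF.polyW_Rt M hp) (hF'.polyW_Rt M hp)]
  congr 1
  funext w
  have e : ∑ k ∈ Finset.range M, Pt k (fun q => F q + F' q) (p, w) =
      ∑ k ∈ Finset.range M, (Pt k F (p, w) + Pt k F' (p, w)) :=
    Finset.sum_congr rfl fun k _ => Pt_add k hF.smooth hF'.smooth (mem_X hp w)
  simp only [Shubin.Rt]
  rw [e, Finset.sum_add_distrib]
  ring

/-- Factors that depend on (z, μ) only commute with Taylor expansion in w and with the integral.
This is how powers of ⟨z,μ⟩ leave the oscillatory integral. -/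
theorem Amp.Tosc_fst_mul (M : ℕ) {F : (Phase n × ℝ) × Dbl n → ℂ} (hF : Amp F) {g : Phase n × ℝ → ℂ}
    (hg : (frP n).Smooth g) {p : Phase n × ℝ} (hp : p ∈ (frP n).S) :
    Tosc M (fun q => g q.1 * F q) p = g p * Tosc M F p := by
  rw [Tosc, Tosc, ← oscI_const_mul (hF.polyW_Rt M hp)]
  congr 1
  funext w
  have e : ∑ k ∈ Finset.range M, Pt k (fun q => g q.1 * F q) (p, w) =
      ∑ k ∈ Finset.range M, g p * Pt k F (p, w) :=
    Finset.sum_congr rfl fun k _ => Pt_fst_mul k hg hF.smooth (mem_X hp w)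
  simp only [Shubin.Rt]
  rw [e, ← Finset.mul_sum, mul_sub]

theorem Tosc_congr (M : ℕ) {F F' : (Phase n × ℝ) × Dbl n → ℂ} (h : EqOn F F' (frX n).S) :
    EqOn (Tosc M F) (Tosc M F') (frP n).S := fun p hp => by
  rw [Tosc, Tosc]
  congr 1
  funext w
  exact Rt_congr M h (mem_X hp w)

/-- Sums of amplitudes with coefficients that do not depend on `w`. -/
theorem Amp.sum_fst_mul (N : ℕ) {F : ℕ → (Phase n × ℝ) × Dbl n → ℂ}
    (hF : ∀ k, Amp (F k)) {g : ℕ → Phase n × ℝ → ℂ} (hg : ∀ k, (frP n).Smooth (g k)) :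
    Amp (fun q => ∑ k ∈ Finset.range N, g k q.1 * F k q) :=
  ⟨Frame.Smooth.sum fun k _ => ((hF k).fst_mul (hg k)).smooth, fun p hp =>
    PolyW.sum fun k _ => ((hF k).fst_mul (hg k)).poly p hp⟩

theorem Amp.Tosc_sum_fst_mul (M N : ℕ) {F : ℕ → (Phase n × ℝ) × Dbl n → ℂ}
    (hF : ∀ k, Amp (F k)) {g : ℕ → Phase n × ℝ → ℂ} (hg : ∀ k, (frP n).Smooth (g k))
    {p : Phase n × ℝ} (hp : p ∈ (frP n).S) :
    Tosc M (fun q => ∑ k ∈ Finset.range N, g k q.1 * F k q) p =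
      ∑ k ∈ Finset.range N, g k p * Tosc M (F k) p := by
  induction N with
  | zero =>
    have h := (hF 0).Tosc_fst_mul M (Frame.smooth_const (0 : ℂ)) hp
    simpa using h
  | succ N ih =>
    simp only [Finset.sum_range_succ]
    rw [(Amp.sum_fst_mul N hF hg).Tosc_add M ((hF N).fst_mul (hg N)) hp, ih,
      (hF N).Tosc_fst_mul M (hg N) hp]

theorem Pt_slice_congr (m : ℕ) : ∀ {F : (Phase n × ℝ) × Dbl n → ℂ}, (frX n).Smooth F →
    ∀ {p p' : Phase n × ℝ}, p ∈ (frP n).S → p' ∈ (frP n).S → (∀ w, F (p, w) = F (p', w)) → ∀ w,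
    Pt m F (p, w) = Pt m F (p', w) := by
  induction m with
  | zero => exact fun _ _ _ _ _ h _ => h 0
  | succ m ih =>
    intro F hF p p' hp hp' h w
    simp only [Pt]
    congr 1
    refine Finset.sum_congr rfl fun i _ => congrArg _ (ih (hF.D _) hp hp' (fun w => ?_) w)
    rw [← D_slice hF hp, ← D_slice hF hp', funext h]

/-- Used to see that the integral does not depend on μ when the amplitude does not. -/
theorem Tosc_slice_congr (M : ℕ) {F : (Phase n × ℝ) × Dbl n → ℂ} (hF : (frX n).Smooth F)
    {p p' : Phase n × ℝ} (hp : p ∈ (frP n).S) (hp' : p' ∈ (frP n).S)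
    (h : ∀ w, F (p, w) = F (p', w)) : Tosc M F p = Tosc M F p' := by
  rw [Tosc, Tosc]
  congr 1
  funext w
  have e : ∑ k ∈ Finset.range M, Pt k F (p, w) = ∑ k ∈ Finset.range M, Pt k F (p', w) :=
    Finset.sum_congr rfl fun k _ => Pt_slice_congr k hF hp hp' h w
  simp only [Rt]
  rw [h, e]

end

/-! ### Weights, and symbols independent of the parameter -/

section

variable {n : ℕ}

/-- The weight is (⟨z⟩/⟨z,μ⟩)^ν ⟨z,μ⟩^d with a quotient at most one, so a larger regularity number
means a smaller class. -/
theorem wP_anti {d ν ν' : ℝ} (h : ν ≤ ν') (p : Phase n × ℝ) : wP n d ν' p ≤ wP n d ν p := by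
  have h1 := jap_pos p.1
  have h2 := japPar_pos p.1 p.2
  have e : ∀ ν, wP n d ν p = (jap p.1 / japPar p.1 p.2) ^ ν * japPar p.1 p.2 ^ d := by
    intro ν
    rw [wP, Real.div_rpow h1.le h2.le, Real.rpow_sub h2]
    ring
  rw [e, e]
  refine mul_le_mul_of_nonneg_right ?_ (Real.rpow_nonneg h2.le _)
  exact Real.rpow_le_rpow_of_exponent_ge (div_pos h1 h2)
    ((div_le_one h2).2 (jap_le_japPar _ _)) h

theorem wP_mul (d ν d' ν' : ℝ) (p : Phase n × ℝ) :
    wP n d ν p * wP n d' ν' p = wP n (d + d') (ν + ν') p := by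
  simp only [wP]
  rw [Real.rpow_add (jap_pos _), show d + d' - (ν + ν') = (d - ν) + (d' - ν') by ring,
    Real.rpow_add (japPar_pos _ _)]
  ring

theorem wP_mul_inv_jap (d ν : ℝ) (M : ℕ) (p : Phase n × ℝ) :
    wP n d ν p * (jap p.1)⁻¹ ^ M = wP n (d - M) (ν - M) p := by
  simp only [wP]
  rw [jap_rpow_sub_nat, show d - M - (ν - M) = d - ν by ring]
  ring

theorem SymP.mono_reg {d ν ν' : ℝ} (h : ν ≤ ν') {f : Phase n × ℝ → ℂ} (hf : SymP d ν' f) :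
    SymP d ν f := hf.mono_le fun p _ => wP_anti h p

theorem SymP.mul {d ν d' ν' : ℝ} {f f' : Phase n × ℝ → ℂ} (hf : SymP d ν f) (hf' : SymP d' ν' f') :
    SymP (d + d') (ν + ν') (fun p => f p * f' p) :=
  (Frame.Sym.mul hf hf').mono_le fun p _ => (wP_mul d ν d' ν' p).le

theorem SymP.D_inl {d ν : ℝ} {f : Phase n × ℝ → ℂ} (hf : SymP d ν f) (i : Idx n) :
    SymP (d - 1) (ν - 1) ((frP n).D (Sum.inl i) f) :=
  (hf.D (Sum.inl i)).mono_le fun p _ => by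
    have := wP_mul_inv_jap d ν 1 p
    simp only [pow_one, Nat.cast_one] at this
    rw [← this]; rfl

theorem SymP.zero (d ν : ℝ) : SymP d ν (fun _ : Phase n × ℝ => (0 : ℂ)) :=
  Frame.sym_zero fun p _ => (wP_pos d ν p).le

theorem SymP.sum {κ : Type*} {s : Finset κ} {d ν : ℝ} {f : κ → Phase n × ℝ → ℂ}
    (hf : ∀ k ∈ s, SymP d ν (f k)) : SymP d ν (fun p => ∑ k ∈ s, f k p) :=
  Frame.Sym.sum (fun p _ => (wP_pos d ν p).le) hf

theorem SymP.conj {d ν : ℝ} {f : Phase n × ℝ → ℂ} (hf : SymP d ν f) :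
    SymP d ν (fun p => conj (f p)) := hf.clm Complex.conjCLE.toContinuousLinearMap

theorem MemS.mono {ν ν' : ℝ} (h : ν ≤ ν') {c : Phase n → ℂ} (hc : MemS ν c) : MemS ν' c := by
  rw [memS_iff] at hc ⊢
  refine hc.mono_le fun p _ => ?_
  simp only [wP, sub_self, Real.rpow_zero, mul_one]
  exact Real.rpow_le_rpow_of_exponent_le (one_le_jap _) h

theorem MemS.mul {ν ν' : ℝ} {c c' : Phase n → ℂ} (hc : MemS ν c) (hc' : MemS ν' c') :
    MemS (ν + ν') (fun z => c z * c' z) := by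
  rw [memS_iff] at hc hc' ⊢
  exact SymP.mul hc hc'

theorem MemS.add {ν : ℝ} {c c' : Phase n → ℂ} (hc : MemS ν c) (hc' : MemS ν c') :
    MemS ν (fun z => c z + c' z) := by
  rw [memS_iff] at hc hc' ⊢
  exact Frame.Sym.add hc hc'

theorem MemS.const_mul {ν : ℝ} {c : Phase n → ℂ} (hc : MemS ν c) (k : ℂ) :
    MemS ν (fun z => k * c z) := by
  rw [memS_iff] at hc ⊢
  exact Frame.Sym.const_mul hc k

theorem MemS.conj {ν : ℝ} {c : Phase n → ℂ} (hc : MemS ν c) : MemS ν (fun z => conj (c z)) := by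
  rw [memS_iff] at hc ⊢
  exact SymP.conj hc

theorem MemS.zero (ν : ℝ) : MemS ν (fun _ : Phase n => (0 : ℂ)) := by
  rw [memS_iff]; exact SymP.zero ν ν

/-- A symbol that does not depend on the parameter. -/
theorem memS_of_symP {ν : ℝ} {f : Phase n × ℝ → ℂ} (hf : SymP ν ν f)
    (h : ∀ z μ, 0 ≤ μ → f (z, μ) = f (z, 0)) : MemS ν (fun z => f (z, 0)) := by
  rw [memS_iff]
  exact hf.congr fun p hp => (h p.1 p.2 (mem_frP.1 hp)).symm

theorem MemS.D {ν : ℝ} {c : Phase n → ℂ} (hc : MemS ν c) (i : Idx n) :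
    MemS (ν - 1) (fun z => fderiv ℝ c z ((frE n).b i)) := by
  have h := hc
  rw [memS_iff] at h ⊢
  exact (SymP.D_inl h i).congr fun p hp => fderiv_slice h.1 p.1 (mem_frP.1 hp) i

theorem memS_coord (i : Idx n) : MemS 1 (fun z : Phase n => (cw i ((toE n).symm z) : ℂ)) := by
  rw [memS_iff]
  refine ((sym_coord i).clm Complex.ofRealCLM).mono_le fun p _ => ?_
  simp [wP]

/-! ### Compactly supported symbols -/

/-- Compactly supported smooth functions belong to all symbol classes. -/
theorem sym_of_compact {A : Type*} [NormedAddCommGroup A] [NormedSpace ℝ A] {f : Phase n × ℝ → A}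
    (hf : (frP n).Smooth f) (R : ℝ) (hR : ∀ p ∈ (frP n).S, R < ‖p‖ → f p = 0)
    {m : Phase n × ℝ → ℝ} (hm : Continuous m) (hm0 : ∀ p, 0 < m p) : (frP n).Sym (gP n) m f := by
  refine Frame.sym_of_family (𝒢 := fun m f => Continuous m ∧ (∀ p, 0 < m p) ∧ (frP n).Smooth f ∧
    ∀ p ∈ (frP n).S, R < ‖p‖ → f p = 0) ?_ ⟨hm, hm0, hf, hR⟩
  rintro m f ⟨hm, hm0, hf, hR⟩
  refine ⟨?_, fun i => (frP n).D i f, fun i => ⟨hm.mul (continuous_gP i), fun p => ?_, hf.D i, ?_⟩,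
    fun p hp => ⟨_, hf.hasFDerivWithinAt hp, fun i => rfl⟩⟩
  · have hc : IsCompact ((frP n).S ∩ Metric.closedBall 0 R) := by
      refine (isCompact_closedBall (0 : Phase n × ℝ) R).inter_left ?_
      rw [frP_S]; exact isClosed_univ.prod isClosed_Ici
    have hcont : ContinuousOn (fun p => ‖f p‖ / m p) ((frP n).S ∩ Metric.closedBall 0 R) :=
      ((ContDiffOn.continuousOn hf).mono inter_subset_left).norm.div hm.continuousOn
        fun p _ => (hm0 p).ne'
    obtain ⟨C, hC⟩ := hc.bddAbove_image hcont
    refine ⟨max C 0, le_max_right _ _, fun p hp => ?_⟩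
    rcases le_or_gt ‖p‖ R with h | h
    · have := hC (mem_image_of_mem _ ⟨hp, mem_closedBall_zero_iff.2 h⟩)
      rw [div_le_iff₀ (hm0 p)] at this
      exact this.trans (mul_le_mul_of_nonneg_right (le_max_left _ _) (hm0 p).le)
    · rw [hR p hp h, norm_zero]
      exact mul_nonneg (le_max_right _ _) (hm0 p).le
  · rcases i with i | i
    · exact mul_pos (hm0 p) (inv_pos.2 (jap_pos _))
    · exact mul_pos (hm0 p) (inv_pos.2 (japPar_pos _ _))
  · intro p hp h
    have e : f =ᶠ[𝓝[(frP n).S] p] fun _ => 0 := by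
      filter_upwards [self_mem_nhdsWithin,
        mem_nhdsWithin_of_mem_nhds (continuous_norm.continuousAt.eventually (lt_mem_nhds h))]
        with p' hp' h'
      exact hR p' hp' h'
    change fderivWithin ℝ f (frP n).S p ((frP n).b i) = 0
    rw [e.fderivWithin_eq (hR p hp h)]
    simp

theorem symP_of_compact {f : Phase n × ℝ → ℂ} (hf : (frP n).Smooth f) (R : ℝ)
    (hR : ∀ p ∈ (frP n).S, R < ‖p‖ → f p = 0) (d ν : ℝ) : SymP d ν f :=
  sym_of_compact hf R hR (continuous_wP d ν) (wP_pos d ν)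

theorem memS_of_compact {c : Phase n → ℂ} (hc : ContDiff ℝ ∞ c) (R : ℝ)
    (hR : ∀ z, R < ‖z‖ → c z = 0) (ν : ℝ) : MemS ν c := by
  have hs : HasCompactSupport c := by
    refine HasCompactSupport.intro (isCompact_closedBall (0 : Phase n) R) fun z hz => hR z ?_
    simpa using hz
  refine ⟨hc, fun k => ?_⟩
  have hcont : Continuous fun z => (jap z ^ (ν - k))⁻¹ * ‖iteratedFDeriv ℝ k c z‖ :=
    ((continuous_jap.rpow_const fun z => Or.inl (jap_pos z).ne').inv₀ fun z =>
      (Real.rpow_pos_of_pos (jap_pos z) _).ne').mul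
      (hc.continuous_iteratedFDeriv (by exact_mod_cast le_top)).norm
  have hs' : HasCompactSupport fun z => (jap z ^ (ν - k))⁻¹ * ‖iteratedFDeriv ℝ k c z‖ :=
    (hs.iteratedFDeriv (𝕜 := ℝ) k).norm.mul_left
  obtain ⟨C, hC⟩ := hs'.exists_bound_of_continuous hcont
  refine ⟨C, fun z => ?_⟩
  have h0 := Real.rpow_pos_of_pos (jap_pos z) (ν - k)
  have := (le_abs_self _).trans (hC z)
  rw [inv_mul_le_iff₀ h0] at this
  linarith

/-! ### Bases of the expansions at infinity -/

theorem norm_le_lam (p : Phase n × ℝ) : ‖p‖ ≤ lam p := by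
  rw [Prod.norm_def]
  refine max_le ((norm_le_jap _).trans (jap_le_japPar _ _)) ?_
  simpa [lam] using le_japPar p.1 p.2

/-- Functions whose squares differ from `⟨z, μ⟩²` by a constant outside a compact set. -/
structure IsBasis (β : Phase n × ℝ → ℝ) : Prop where
  smooth : (frP n).Smooth β
  pos : ∀ p ∈ (frP n).S, 0 < β p
  far : ∃ c R : ℝ, ∀ p ∈ (frP n).S, R < ‖p‖ → β p ^ 2 - lam p ^ 2 = c

theorem smooth_lam : (frP n).Smooth (lam : Phase n × ℝ → ℝ) := by
  simpa using (sym_lam_rpow (n := n) 1).1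

theorem isBasis_lam : IsBasis (lam : Phase n × ℝ → ℝ) :=
  ⟨smooth_lam, fun p _ => lam_pos p, 0, 0, fun _ _ _ => sub_self _⟩

theorem isBasis_of_isSmoothedLength {br : Phase n → ℝ → ℝ} (h : IsSmoothedLength br) :
    IsBasis (fun p : Phase n × ℝ => br p.1 p.2) := by
  refine ⟨?_, fun p hp => h.pos _ _ (mem_frP.1 hp), -1, 1, fun p hp h1 => ?_⟩
  · have := h.smooth
    rwa [← frP_S] at this
  · have e : 1 ≤ len p.1 p.2 := by
      rw [len, Real.one_le_sqrt]
      rw [Prod.norm_def, lt_max_iff, Real.norm_eq_abs] at h1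
      rcases h1 with h1 | h1
      · nlinarith [sq_nonneg p.2]
      · nlinarith [sq_abs p.2, sq_nonneg ‖p.1‖]
    rw [h.eq_len _ _ (mem_frP.1 hp) e, lam, japPar_sq, len, Real.sq_sqrt (by positivity)]
    ring

theorem IsBasis.sub_sq {β γ : Phase n × ℝ → ℝ} (hβ : IsBasis β) (hγ : IsBasis γ) :
    ∃ c R : ℝ, ∀ p ∈ (frP n).S, R < ‖p‖ → γ p ^ 2 - β p ^ 2 = c := by
  obtain ⟨c, R, h⟩ := hβ.far
  obtain ⟨c', R', h'⟩ := hγ.far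
  exact ⟨c' - c, max R R', fun p hp hR => by
    linarith [h p hp (lt_of_le_of_lt (le_max_left _ _) hR),
      h' p hp (lt_of_le_of_lt (le_max_right _ _) hR)]⟩

theorem IsBasis.smooth_sq {β : Phase n × ℝ → ℝ} (hβ : IsBasis β) :
    (frP n).Smooth (fun p => β p ^ 2) := ContDiffOn.pow hβ.smooth 2

/-- The difference is a constant plus a compactly supported function. -/
theorem IsBasis.sym_sub_sq {β γ : Phase n × ℝ → ℝ} (hβ : IsBasis β) (hγ : IsBasis γ) :
    (frP n).Sym (gP n) (fun _ => 1) (fun p => γ p ^ 2 - β p ^ 2) := by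
  obtain ⟨c, R, h⟩ := hβ.sub_sq hγ
  have h1 : (frP n).Sym (gP n) (fun _ => 1) (fun p => γ p ^ 2 - β p ^ 2 - c) :=
    sym_of_compact ((hγ.smooth_sq.sub hβ.smooth_sq).sub (Frame.smooth_const c)) R
      (fun p hp hR => by rw [h p hp hR, sub_self]) continuous_const fun _ => one_pos
  exact (h1.add (Frame.sym_const c)).congr fun p _ => by simp

/-- Far out the constant difference of the squares is at most half of ⟨z,μ⟩²; on the remaining
compact set continuity and positivity suffice. -/
theorem IsBasis.le_lam {β : Phase n × ℝ → ℝ} (hβ : IsBasis β) :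
    ∃ B : ℝ, 1 ≤ B ∧ ∀ p ∈ (frP n).S, β p ^ 2 ≤ B * lam p ^ 2 ∧ lam p ^ 2 ≤ B * β p ^ 2 := by
  obtain ⟨c, R, h⟩ := hβ.far
  set R' := max R (2 * |c| + 1) with hR'
  have hc : IsCompact ((frP n).S ∩ Metric.closedBall 0 R') := by
    refine (isCompact_closedBall (0 : Phase n × ℝ) R').inter_left ?_
    rw [frP_S]; exact isClosed_univ.prod isClosed_Ici
  have hβc : ContinuousOn β ((frP n).S ∩ Metric.closedBall 0 R') :=
    (ContDiffOn.continuousOn hβ.smooth).mono inter_subset_left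
  have h1 : ContinuousOn (fun p => β p ^ 2 / lam p ^ 2) ((frP n).S ∩ Metric.closedBall 0 R') :=
    (hβc.pow 2).div (continuous_lam.pow 2).continuousOn fun p _ => (pow_pos (lam_pos p) 2).ne'
  have h2 : ContinuousOn (fun p => lam p ^ 2 / β p ^ 2) ((frP n).S ∩ Metric.closedBall 0 R') :=
    (continuous_lam.pow 2).continuousOn.div (hβc.pow 2) fun p hp => (pow_pos (hβ.pos p hp.1) 2).ne'
  obtain ⟨C1, hC1⟩ := hc.bddAbove_image h1
  obtain ⟨C2, hC2⟩ := hc.bddAbove_image h2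
  refine ⟨max 2 (max C1 C2), le_max_of_le_left one_le_two, fun p hp => ?_⟩
  have l2 := pow_pos (lam_pos p) 2
  have b2 := pow_pos (hβ.pos p hp) 2
  rcases le_or_gt ‖p‖ R' with hp' | hp'
  · have a1 := hC1 (mem_image_of_mem _ ⟨hp, mem_closedBall_zero_iff.2 hp'⟩)
    have a2 := hC2 (mem_image_of_mem _ ⟨hp, mem_closedBall_zero_iff.2 hp'⟩)
    rw [div_le_iff₀ l2] at a1
    rw [div_le_iff₀ b2] at a2
    exact ⟨a1.trans (mul_le_mul_of_nonneg_right
      ((le_max_left _ _).trans (le_max_right _ _)) l2.le), a2.trans (mul_le_mul_of_nonneg_right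
      ((le_max_right _ _).trans (le_max_right _ _)) b2.le)⟩
  · have e := h p hp (lt_of_le_of_lt (le_max_left _ _) hp')
    have a1 : 2 * |c| + 1 < lam p :=
      (lt_of_le_of_lt (le_max_right _ _) hp').trans_le (norm_le_lam p)
    have a2 : 2 * |c| ≤ lam p ^ 2 := by nlinarith [abs_nonneg c]
    have a3 := abs_le.1 (le_refl |c|)
    have hB : 2 ≤ max 2 (max C1 C2) := le_max_left _ _
    exact ⟨le_trans (by linarith) (mul_le_mul_of_nonneg_right hB l2.le),
      le_trans (by linarith) (mul_le_mul_of_nonneg_right hB b2.le)⟩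

theorem IsBasis.sym_sq {β : Phase n × ℝ → ℝ} (hβ : IsBasis β) :
    (frP n).Sym (gP n) (fun p => β p ^ 2) (fun p => β p ^ 2) := by
  obtain ⟨B, hB, h⟩ := hβ.le_lam
  have h1 : (frP n).Sym (gP n) (fun p => lam p ^ 2) (fun p => β p ^ 2 - lam p ^ 2) :=
    (isBasis_lam.sym_sub_sq hβ).mono_le fun p _ => one_le_pow₀ (one_le_japPar _ _)
  have h2 := (sym_lam_sq.add h1).mono (m' := fun p => β p ^ 2) B (by linarith) fun p hp => (h p hp).2
  exact h2.congr fun p _ => by simp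

theorem IsBasis.rpow_le {β γ : Phase n × ℝ → ℝ} (hβ : IsBasis β) (hγ : IsBasis γ) (s : ℝ) :
    ∃ B : ℝ, 0 ≤ B ∧ ∀ p ∈ (frP n).S, β p ^ s ≤ B * γ p ^ s := by
  obtain ⟨B, hB, h⟩ := hβ.le_lam
  obtain ⟨B', hB', h'⟩ := hγ.le_lam
  refine ⟨(B * B') ^ |s / 2|, by positivity, fun p hp => ?_⟩
  have b2 := pow_pos (hβ.pos p hp) 2
  have c2 := pow_pos (hγ.pos p hp) 2
  have := rpow_le_of_comparable b2 c2 (B := B * B') (by positivity)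
    (by nlinarith [(h p hp).1, (h' p hp).2]) (by nlinarith [(h p hp).2, (h' p hp).1]) (s / 2)
  rwa [sq_rpow_half (hβ.pos p hp), sq_rpow_half (hγ.pos p hp)] at this

theorem IsBasis.sym_rpow {β : Phase n × ℝ → ℝ} (hβ : IsBasis β) (s : ℝ) :
    (frP n).Sym (gP n) (fun p => lam p ^ s) (fun p => β p ^ s) := by
  obtain ⟨B, hB, h⟩ := hβ.rpow_le isBasis_lam s
  have h1 := hβ.sym_sq.rpow (fun p hp => pow_pos (hβ.pos p hp) 2) (s / 2)
  refine (h1.congr fun p hp => (sq_rpow_half (hβ.pos p hp) s).symm).mono B hB fun p hp => ?_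
  rw [sq_rpow_half (hβ.pos p hp)]
  exact h p hp

theorem symP_rpow_of_sym {s : ℝ} {f : Phase n × ℝ → ℝ}
    (hf : (frP n).Sym (gP n) (fun p => lam p ^ s) f) : SymP s 0 (fun p => (f p : ℂ)) :=
  (hf.clm Complex.ofRealCLM).mono_le fun p _ => by simp [wP, lam]

theorem IsBasis.symP_rpow {β : Phase n × ℝ → ℝ} (hβ : IsBasis β) (s : ℝ) :
    SymP s 0 (fun p => ((β p ^ s : ℝ) : ℂ)) := symP_rpow_of_sym (hβ.sym_rpow s)

/-- The binomial expansion of one basis in terms of another. -/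
theorem IsBasis.sym_binRem {β γ : Phase n × ℝ → ℝ} (hβ : IsBasis β) (hγ : IsBasis γ) (s : ℝ) (K : ℕ) :
    (frP n).Sym (gP n) (fun p => lam p ^ (s - 2 * K))
      (fun p => binRem (s / 2) K (β p ^ 2) (γ p ^ 2 - β p ^ 2)) := by
  obtain ⟨B, hB, h⟩ := hβ.le_lam
  obtain ⟨B', hB', h'⟩ := hγ.le_lam
  have e : ∀ p, β p ^ 2 + (γ p ^ 2 - β p ^ 2) = γ p ^ 2 := fun p => by ring
  have h1 := Frame.Sym.binRem (M := fun _ => 1) hβ.smooth_sq (hβ.sym_sub_sq hγ)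
    (fun _ _ => zero_le_one) (fun p hp => pow_pos (hβ.pos p hp) 2)
    (fun p hp => by rw [e]; exact pow_pos (hγ.pos p hp) 2) (fun _ _ => le_rfl)
    (fun i => by simpa using hβ.sym_sq.D i) (by simp only [e]; exact hγ.sym_sq) (B * B')
    (by nlinarith) (fun p hp => by rw [e]; nlinarith [(h p hp).1, (h' p hp).2])
    (fun p hp => by rw [e]; nlinarith [(h p hp).2, (h' p hp).1]) (s / 2) K
  obtain ⟨B2, hB2, h2⟩ := hβ.rpow_le isBasis_lam (s - 2 * K)
  refine h1.mono B2 hB2 fun p hp => ?_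
  rw [one_pow, one_mul, Real.one_rpow, mul_one, show s / 2 - (K : ℝ) = (s - 2 * K) / 2 by ring,
    sq_rpow_half (hβ.pos p hp)]
  exact h2 p hp

/-! ### Finite expansions at infinity -/

/-- `f` has an expansion at infinity of length `N` in powers of `β`. -/
def BoldN (β : Phase n × ℝ → ℝ) (N : ℕ) (d ν : ℝ) (f : Phase n × ℝ → ℂ) : Prop :=
  ∃ c : ℕ → Phase n → ℂ, (∀ j : ℕ, MemS (ν + j) (c j)) ∧
    SymP d (ν + N) (fun p => f p - ∑ j ∈ Finset.range N, c j p.1 * ((β p ^ (d - ν - j) : ℝ) : ℂ))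

theorem BoldN.of_symP {β : Phase n × ℝ → ℝ} {N : ℕ} {d ν : ℝ} {f : Phase n × ℝ → ℂ}
    (hf : SymP d (ν + N) f) : BoldN β N d ν f :=
  ⟨fun _ _ => 0, fun _ => MemS.zero _, by simpa using hf⟩

theorem BoldN.congr {β : Phase n × ℝ → ℝ} {N : ℕ} {d ν : ℝ} {f f' : Phase n × ℝ → ℂ}
    (hf : BoldN β N d ν f) (h : EqOn f' f (frP n).S) : BoldN β N d ν f' := by
  obtain ⟨c, hc, h'⟩ := hf
  exact ⟨c, hc, h'.congr fun p hp => by simp only [h hp]⟩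

theorem BoldN.add {β : Phase n × ℝ → ℝ} {N : ℕ} {d ν : ℝ} {f f' : Phase n × ℝ → ℂ}
    (hf : BoldN β N d ν f) (hf' : BoldN β N d ν f') : BoldN β N d ν (fun p => f p + f' p) := by
  obtain ⟨c, hc, h⟩ := hf
  obtain ⟨c', hc', h'⟩ := hf'
  refine ⟨fun j z => c j z + c' j z, fun j => (hc j).add (hc' j), (h.add h').congr fun p _ => ?_⟩
  simp only [add_mul, Finset.sum_add_distrib]
  ring

theorem BoldN.const_mul {β : Phase n × ℝ → ℝ} {N : ℕ} {d ν : ℝ} {f : Phase n × ℝ → ℂ}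
    (hf : BoldN β N d ν f) (k : ℂ) : BoldN β N d ν (fun p => k * f p) := by
  obtain ⟨c, hc, h⟩ := hf
  refine ⟨fun j z => k * c j z, fun j => (hc j).const_mul k, (h.const_mul k).congr fun p _ => ?_⟩
  simp only [mul_assoc, ← Finset.mul_sum]
  ring

theorem BoldN.sub {β : Phase n × ℝ → ℝ} {N : ℕ} {d ν : ℝ} {f f' : Phase n × ℝ → ℂ}
    (hf : BoldN β N d ν f) (hf' : BoldN β N d ν f') : BoldN β N d ν (fun p => f p - f' p) := by
  simpa [sub_eq_add_neg] using hf.add (hf'.const_mul (-1))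

theorem BoldN.zero (β : Phase n × ℝ → ℝ) (N : ℕ) (d ν : ℝ) : BoldN β N d ν (fun _ => 0) :=
  BoldN.of_symP (SymP.zero _ _)

theorem BoldN.sum {κ : Type*} {s : Finset κ} {β : Phase n × ℝ → ℝ} {N : ℕ} {d ν : ℝ}
    {f : κ → Phase n × ℝ → ℂ} (hf : ∀ k ∈ s, BoldN β N d ν (f k)) :
    BoldN β N d ν (fun p => ∑ k ∈ s, f k p) := by
  classical
  induction s using Finset.induction_on with
  | empty => simpa using BoldN.zero β N d ν
  | insert a s ha ih =>
    simp only [Finset.sum_insert ha]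
    exact (hf a (by simp)).add (ih fun k hk => hf k (by simp [hk]))

theorem BoldN.conj {β : Phase n × ℝ → ℝ} {N : ℕ} {d ν : ℝ} {f : Phase n × ℝ → ℂ}
    (hf : BoldN β N d ν f) : BoldN β N d ν (fun p => conj (f p)) := by
  obtain ⟨c, hc, h⟩ := hf
  refine ⟨fun j z => (starRingEnd ℂ) (c j z), fun j => (hc j).conj, h.conj.congr fun p _ => ?_⟩
  simp

theorem IsBasis.symP_term {β : Phase n × ℝ → ℝ} (hβ : IsBasis β) {κ s : ℝ} {c : Phase n → ℂ}
    (hc : MemS κ c) : SymP (κ + s) κ (fun p => c p.1 * ((β p ^ s : ℝ) : ℂ)) := by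
  simpa using SymP.mul (memS_iff.1 hc) (hβ.symP_rpow s)

/-- A single term is its own expansion if j < N; otherwise its regularity is high enough for it to
be part of the remainder. Any term of the correct shape may therefore be added without regard to its
index. -/
theorem IsBasis.boldN_term {β : Phase n × ℝ → ℝ} (hβ : IsBasis β) {d ν : ℝ} (N j : ℕ) {c : Phase n → ℂ}
    (hc : MemS (ν + j) c) : BoldN β N d ν (fun p => c p.1 * ((β p ^ (d - ν - j) : ℝ) : ℂ)) := by
  classical
  rcases lt_or_ge j N with h | h
  · refine ⟨fun i => if i = j then c else fun _ => 0, fun i => ?_, ?_⟩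
    · by_cases hi : i = j
      · subst hi; simpa using hc
      · simpa [hi] using MemS.zero _
    · refine (SymP.zero d (ν + N)).congr fun p _ => ?_
      rw [Finset.sum_eq_single j]
      · simp
      · intro i _ hi; simp [hi]
      · intro hj; exact absurd (Finset.mem_range.2 h) hj
  · refine BoldN.of_symP (SymP.mono_reg (ν' := ν + j) (by simpa using h) ?_)
    have := hβ.symP_term (s := d - ν - j) hc
    rwa [show ν + j + (d - ν - j) = d by ring] at this

theorem MemS.boldN_mul {β : Phase n × ℝ → ℝ} {N : ℕ} {d ν κ : ℝ} {b : Phase n → ℂ}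
    (hb : MemS κ b) {f : Phase n × ℝ → ℂ} (hf : BoldN β N d ν f) :
    BoldN β N (d + κ) (ν + κ) (fun p => b p.1 * f p) := by
  obtain ⟨c, hc, h⟩ := hf
  refine ⟨fun j z => b z * c j z, fun j => ?_, ?_⟩
  · have := hb.mul (hc j)
    rwa [show κ + (ν + j) = ν + κ + j by ring] at this
  · have := SymP.mul (memS_iff.1 hb) h
    rw [show κ + (ν + N) = ν + κ + N by ring, show κ + d = d + κ by ring] at this
    refine this.congr fun p _ => ?_
    simp only [mul_sub, Finset.mul_sum, mul_assoc]
    rw [show d + κ - (ν + κ) = d - ν by ring]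

/-- Change of the basis of the expansion. -/
theorem BoldN.change {β γ : Phase n × ℝ → ℝ} (hβ : IsBasis β) (hγ : IsBasis γ) {N : ℕ} {d ν : ℝ}
    {f : Phase n × ℝ → ℂ} (hf : BoldN γ N d ν f) : BoldN β N d ν f := by
  obtain ⟨c, hc, h⟩ := hf
  suffices H : ∀ j : ℕ, BoldN β N d ν (fun p => c j p.1 * ((γ p ^ (d - ν - j) : ℝ) : ℂ)) by
    exact ((BoldN.of_symP h).add (BoldN.sum (s := Finset.range N) fun j _ => H j)).congr
      fun p _ => by simp
  intro j
  set s := d - ν - j with hs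
  obtain ⟨c0, R, hR⟩ := hβ.sub_sq hγ
  -- the terms with constant coefficients
  have t1 : ∀ k : ℕ, BoldN β N d ν (fun p => ((rbin (s / 2) k * c0 ^ k : ℝ) : ℂ) *
      (c j p.1 * ((β p ^ (s - 2 * k) : ℝ) : ℂ))) := fun k => by
    refine BoldN.const_mul ?_ _
    -- The power of β has dropped by 2k, so this is a term of index j + 2k; its coefficient lies in
    -- the larger class belonging to that index.
    have hc' : MemS (ν + (j + 2 * k : ℕ)) (c j) := (hc j).mono (by
      have : (0 : ℝ) ≤ k := k.cast_nonneg
      push_cast; linarith)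
    have := hβ.boldN_term (d := d) N (j + 2 * k) hc'
    rwa [show d - ν - ((j + 2 * k : ℕ) : ℝ) = s - 2 * k by rw [hs]; push_cast; ring] at this
  -- the compactly supported terms
  have t2 : ∀ k : ℕ, BoldN β N d ν (fun p => ((rbin (s / 2) k : ℝ) : ℂ) *
      (c j p.1 * ((((γ p ^ 2 - β p ^ 2) ^ k - c0 ^ k) * β p ^ (s - 2 * k) : ℝ) : ℂ))) := fun k => by
    refine BoldN.const_mul (BoldN.of_symP (symP_of_compact ?_ R (fun p hp hp' => ?_) _ _)) _
    · refine (memS_iff.1 (hc j)).1.mul (Frame.Smooth.clm ?_ Complex.ofRealCLM)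
      exact ((ContDiffOn.pow (hγ.smooth_sq.sub hβ.smooth_sq) k).sub (Frame.smooth_const _)).mul
        (hβ.smooth.rpow hβ.pos _)
    · rw [hR p hp hp']; simp
  -- After N binomial terms the power of the bracket has dropped by 2N. Giving those powers to ⟨z⟩
  -- yields regularity ν + j + 2N, more than the ν + N required.
  have t3 : BoldN β N d ν (fun p => c j p.1 *
      ((binRem (s / 2) N (β p ^ 2) (γ p ^ 2 - β p ^ 2) : ℝ) : ℂ)) := by
    refine BoldN.of_symP ?_
    have h1 := symP_rpow_of_sym (hβ.sym_binRem hγ s N)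
    have h2 : SymP (s - 2 * N) 0 (fun p : Phase n × ℝ =>
      ((binRem (s / 2) N (β p ^ 2) (γ p ^ 2 - β p ^ 2) : ℝ) : ℂ)) := h1
    refine (Frame.Sym.mul (memS_iff.1 (hc j)) h2).mono_le fun p _ => ?_
    rw [wP_mul]
    simp only [wP]
    rw [show ν + j + (s - 2 * N) - (ν + j + 0) = s - 2 * N by ring, add_zero]
    have a1 := one_le_jap p.1
    have a2 := jap_le_japPar p.1 p.2
    have a0 := jap_pos p.1
    have a3 := japPar_pos p.1 p.2
    calc jap p.1 ^ (ν + j) * japPar p.1 p.2 ^ (s - 2 * N)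
        ≤ jap p.1 ^ (ν + j + 2 * N) * japPar p.1 p.2 ^ (s - 2 * N) := by
          refine mul_le_mul_of_nonneg_right (Real.rpow_le_rpow_of_exponent_le a1 ?_)
            (Real.rpow_nonneg a3.le _)
          have : (0 : ℝ) ≤ N := N.cast_nonneg
          linarith
      _ = wP n d (ν + j + 2 * N) p := by rw [wP]; congr 2; rw [hs]; ring
      _ ≤ _ := wP_anti (by
        have : (0 : ℝ) ≤ N := N.cast_nonneg
        have : (0 : ℝ) ≤ j := j.cast_nonneg
        linarith) p
  refine ((BoldN.sum (s := Finset.range N) fun k _ => (t1 k).add (t2 k)).add t3).congr fun p hp => ?_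
  have e : γ p ^ s = ∑ k ∈ Finset.range N, rbin (s / 2) k * ((γ p ^ 2 - β p ^ 2) ^ k *
      β p ^ (s - 2 * k)) + binRem (s / 2) N (β p ^ 2) (γ p ^ 2 - β p ^ 2) := by
    have e1 : ∀ k : ℕ, (β p ^ 2) ^ (s / 2 - k) = β p ^ (s - 2 * k) := fun k => by
      rw [show s / 2 - (k : ℝ) = (s - 2 * k) / 2 by ring, sq_rpow_half (hβ.pos p hp)]
    simp only [binRem, e1, add_sub_cancel]
    rw [sq_rpow_half (hγ.pos p hp)]
  simp only
  rw [e]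
  push_cast
  rw [mul_add, Finset.mul_sum]
  congr 1
  refine Finset.sum_congr rfl fun k _ => ?_
  ring

end

section

variable {n : ℕ}

/-! ### Uniqueness of expansions -/

/-- The constant term is the limit as y tends to 0, hence zero; division by y lowers N. -/
theorem coeff_eq_zero_of_le {ι : Type*} {l : Filter ι} [l.NeBot] {y : ι → ℝ} (hy : Tendsto y l (𝓝 0))
    (hpos : ∀ᶠ t in l, 0 < y t) (N : ℕ) : ∀ (e : ℕ → ℂ) (C : ℝ),
    (∀ᶠ t in l, ‖∑ j ∈ Finset.range N, e j * (y t : ℂ) ^ j‖ ≤ C * y t ^ N) → ∀ j < N, e j = 0 := by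
  induction N with
  | zero => intro e C _ j hj; exact absurd hj (by simp)
  | succ N ih =>
    intro e C h
    have h0 : e 0 = 0 := by
      have t1 : Tendsto (fun t => ∑ j ∈ Finset.range (N + 1), e j * (y t : ℂ) ^ j) l (𝓝 (e 0)) := by
        have c : Continuous fun x : ℝ => ∑ j ∈ Finset.range (N + 1), e j * (x : ℂ) ^ j := by fun_prop
        have := (c.tendsto 0).comp hy
        simpa [Finset.sum_range_succ', Function.comp_def] using this
      have t2 : Tendsto (fun t => C * y t ^ (N + 1)) l (𝓝 0) := by
        have := (hy.pow (N + 1)).const_mul C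
        simpa using this
      exact tendsto_nhds_unique t1 (squeeze_zero_norm' h t2)
    have h1 := ih (fun j => e (j + 1)) C (by
      filter_upwards [h, hpos] with t ht hp
      rw [Finset.sum_range_succ', h0, zero_mul, add_zero] at ht
      have e1 : ∑ j ∈ Finset.range N, e (j + 1) * (y t : ℂ) ^ (j + 1) =
          (∑ j ∈ Finset.range N, e (j + 1) * (y t : ℂ) ^ j) * (y t : ℂ) := by
        rw [Finset.sum_mul]; exact Finset.sum_congr rfl fun j _ => by ring
      rw [e1, norm_mul, Complex.norm_real, Real.norm_of_nonneg hp.le, pow_succ, ← mul_assoc] at ht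
      exact le_of_mul_le_mul_right ht hp)
    intro j hj
    cases j with
    | zero => exact h0
    | succ j => exact h1 j (by omega)

/-- For fixed z let μ tend to infinity: divided by β^{d-ν}, the difference of two expansions is a
polynomial in y = 1/β(z, μ) of degree below N that is O(y^N). -/
theorem IsBasis.coeff_unique {β : Phase n × ℝ → ℝ} (hβ : IsBasis β) {N : ℕ} {d ν : ℝ}
    {f : Phase n × ℝ → ℂ} {c c' : ℕ → Phase n → ℂ}
    (h : SymP d (ν + N) (fun p => f p - ∑ j ∈ Finset.range N, c j p.1 * ((β p ^ (d - ν - j) : ℝ) : ℂ)))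
    (h' : SymP d (ν + N) (fun p => f p - ∑ j ∈ Finset.range N, c' j p.1 * ((β p ^ (d - ν - j) : ℝ) : ℂ)))
    {j : ℕ} (hj : j < N) : c j = c' j := by
  funext z
  obtain ⟨C, hC, hb⟩ := (h'.sub h).bound
  obtain ⟨B, hB, hl⟩ := isBasis_lam.rpow_le hβ (d - (ν + N))
  obtain ⟨B1, hB1, hl1⟩ := isBasis_lam.rpow_le hβ 1
  have hβ0 : ∀ μ : ℝ, 0 ≤ μ → 0 < β (z, μ) := fun μ hμ => hβ.pos _ (mem_frP.2 hμ)
  have hβt : Tendsto (fun μ : ℝ => β (z, μ)) atTop atTop := by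
    refine tendsto_atTop_mono' _ (f₁ := fun μ => (B1 + 1)⁻¹ * μ) ?_
      (tendsto_id.const_mul_atTop (by positivity))
    filter_upwards [eventually_ge_atTop (0 : ℝ)] with μ hμ
    have h1 := hl1 (z, μ) (mem_frP.2 hμ)
    simp only [Real.rpow_one] at h1
    have h2 : μ ≤ lam (z, μ) := (le_abs_self μ).trans (le_japPar z μ)
    rw [inv_mul_le_iff₀ (by positivity)]
    have := hβ0 μ hμ
    nlinarith
  have key := coeff_eq_zero_of_le (l := atTop) (y := fun μ => (β (z, μ))⁻¹)
    (tendsto_inv_atTop_zero.comp hβt) (by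
      filter_upwards [eventually_ge_atTop (0 : ℝ)] with μ hμ
      exact inv_pos.2 (hβ0 μ hμ)) N (fun j => c j z - c' j z) (C * (jap z ^ (ν + N) * B)) (by
      filter_upwards [eventually_ge_atTop (0 : ℝ)] with μ hμ
      have h0 := hβ0 μ hμ
      have hb' := hb (z, μ) (mem_frP.2 hμ)
      have hl' := hl (z, μ) (mem_frP.2 hμ)
      have e1 : ∀ k : ℕ, β (z, μ) ^ (d - ν - k) = β (z, μ) ^ (d - ν) * (β (z, μ))⁻¹ ^ k := fun k => by
        rw [Real.rpow_sub_natCast h0.ne', inv_pow, div_eq_mul_inv]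
      have e2 : (f (z, μ) - ∑ j ∈ Finset.range N, c' j z * ((β (z, μ) ^ (d - ν - j) : ℝ) : ℂ)) -
          (f (z, μ) - ∑ j ∈ Finset.range N, c j z * ((β (z, μ) ^ (d - ν - j) : ℝ) : ℂ)) =
          ((β (z, μ) ^ (d - ν) : ℝ) : ℂ) * ∑ j ∈ Finset.range N, (c j z - c' j z) *
            (((β (z, μ))⁻¹ : ℝ) : ℂ) ^ j := by
        rw [sub_sub_sub_cancel_left, ← Finset.sum_sub_distrib, Finset.mul_sum]
        refine Finset.sum_congr rfl fun k _ => ?_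
        rw [e1, Complex.ofReal_mul, Complex.ofReal_pow]
        ring
      have e3 := e1 N
      have hs := Real.rpow_pos_of_pos h0 (d - ν)
      simp only at hb'
      rw [e2, norm_mul, Complex.norm_real, Real.norm_of_nonneg hs.le] at hb'
      rw [show d - (ν + N) = d - ν - N by ring, e3] at hl'
      have hj0 := Real.rpow_pos_of_pos (jap_pos z) (ν + N)
      refine le_of_mul_le_mul_left (hb'.trans ?_) hs
      rw [wP, show d - (ν + N) = d - ν - N by ring]
      calc C * (jap z ^ (ν + N) * japPar z μ ^ (d - ν - N))
          ≤ C * (jap z ^ (ν + N) * (B * (β (z, μ) ^ (d - ν) * (β (z, μ))⁻¹ ^ N))) := by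
            gcongr; exact hl'
        _ = _ := by ring)
  exact sub_eq_zero.1 (key j hj)

theorem IsBasis.trunc {β : Phase n × ℝ → ℝ} (hβ : IsBasis β) {N N' : ℕ} (hN : N' ≤ N) {d ν : ℝ}
    {f : Phase n × ℝ → ℂ} {c : ℕ → Phase n → ℂ} (hc : ∀ j : ℕ, MemS (ν + j) (c j))
    (h : SymP d (ν + N) (fun p => f p - ∑ j ∈ Finset.range N, c j p.1 * ((β p ^ (d - ν - j) : ℝ) : ℂ))) :
    SymP d (ν + N') (fun p => f p -
      ∑ j ∈ Finset.range N', c j p.1 * ((β p ^ (d - ν - j) : ℝ) : ℂ)) := by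
  have h1 : SymP d (ν + N') (fun p => ∑ j ∈ Finset.Ico N' N,
      c j p.1 * ((β p ^ (d - ν - j) : ℝ) : ℂ)) := by
    refine SymP.sum fun j hj => SymP.mono_reg (ν' := ν + j) ?_ ?_
    · have := (Finset.mem_Ico.1 hj).1
      have : (N' : ℝ) ≤ j := by exact_mod_cast this
      linarith
    · have := hβ.symP_term (s := d - ν - j) (hc j)
      rwa [show ν + j + (d - ν - j) = d by ring] at this
  have h2 := SymP.mono_reg (ν := ν + N') (by have : (N' : ℝ) ≤ N := by exact_mod_cast hN
                                             linarith) h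
  refine (h2.add h1).congr fun p _ => ?_
  simp only
  rw [← Finset.sum_range_add_sum_Ico (fun j => c j p.1 * ((β p ^ (d - ν - j) : ℝ) : ℂ)) hN]
  ring

/-! ### Full expansions at infinity and their differentiation -/

/-- Symbols with expansions at infinity of arbitrary length. -/
def Bold (d ν : ℝ) (f : Phase n × ℝ → ℂ) : Prop := ∀ N, BoldN lam N d ν f

/-- Two discrepancies are removed: the basis [z,μ] is exchanged for ⟨z,μ⟩, and the single
coefficient sequence of the definition for one that may vary with N. Uniqueness of coefficients
makes the finite expansions compatible. -/
theorem memBold_iff {br : Phase n → ℝ → ℝ} (hbr : IsSmoothedLength br) {d ν : ℝ}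
    {a : Phase n → ℝ → ℂ} : MemBold br d ν a ↔ Bold d ν (fun p : Phase n × ℝ => a p.1 p.2) := by
  have hβ := isBasis_of_isSmoothedLength hbr
  constructor
  · rintro ⟨-, c, hc, h⟩ N
    exact BoldN.change isBasis_lam hβ ⟨c, hc, memSTilde_iff.1 (h N)⟩
  · intro h
    have h' := fun N => BoldN.change hβ isBasis_lam (h N)
    choose c hc hs using h'
    -- The j-th coefficient is read off from the expansion of length j + 1, the shortest one that
    -- determines it.
    refine ⟨memSTilde_iff.2 (by simpa using hs 0), fun j => c (j + 1) j, fun j => hc _ _, fun N => ?_⟩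
    refine memSTilde_iff.2 ((hs N).congr fun p _ => ?_)
    simp only
    congr 1
    refine Finset.sum_congr rfl fun j hj => ?_
    have hj' := Finset.mem_range.1 hj
    rw [hβ.coeff_unique (hs (j + 1)) (hβ.trunc (Nat.succ_le_of_lt hj') (hc N) (hs N)) (Nat.lt_succ_self j)]

theorem Bold.symP {d ν : ℝ} {f : Phase n × ℝ → ℂ} (hf : Bold d ν f) : SymP d ν f := by
  obtain ⟨c, -, h⟩ := hf 0
  simpa using h

theorem Bold.congr {d ν : ℝ} {f f' : Phase n × ℝ → ℂ} (hf : Bold d ν f)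
    (h : EqOn f' f (frP n).S) : Bold d ν f' := fun N => (hf N).congr h

theorem Bold.add {d ν : ℝ} {f f' : Phase n × ℝ → ℂ} (hf : Bold d ν f) (hf' : Bold d ν f') :
    Bold d ν (fun p => f p + f' p) := fun N => (hf N).add (hf' N)

theorem Bold.sub {d ν : ℝ} {f f' : Phase n × ℝ → ℂ} (hf : Bold d ν f) (hf' : Bold d ν f') :
    Bold d ν (fun p => f p - f' p) := fun N => (hf N).sub (hf' N)

theorem Bold.const_mul {d ν : ℝ} {f : Phase n × ℝ → ℂ} (hf : Bold d ν f) (k : ℂ) :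
    Bold d ν (fun p => k * f p) := fun N => (hf N).const_mul k

theorem Bold.zero (d ν : ℝ) : Bold d ν (fun _ : Phase n × ℝ => (0 : ℂ)) := fun N => BoldN.zero _ N d ν

theorem Bold.sum {κ : Type*} {s : Finset κ} {d ν : ℝ} {f : κ → Phase n × ℝ → ℂ}
    (hf : ∀ k ∈ s, Bold d ν (f k)) : Bold d ν (fun p => ∑ k ∈ s, f k p) := fun N =>
  BoldN.sum fun k hk => hf k hk N

theorem Bold.conj {d ν : ℝ} {f : Phase n × ℝ → ℂ} (hf : Bold d ν f) :
    Bold d ν (fun p => conj (f p)) := fun N => (hf N).conj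

theorem MemS.bold_mul {d ν κ : ℝ} {b : Phase n → ℂ} (hb : MemS κ b) {f : Phase n × ℝ → ℂ}
    (hf : Bold d ν f) : Bold (d + κ) (ν + κ) (fun p => b p.1 * f p) := fun N => hb.boldN_mul (hf N)

theorem D_inl_lam_sq (i : Idx n) {p : Phase n × ℝ} (hp : p ∈ (frP n).S) :
    (frP n).D (Sum.inl i) (fun p => lam p ^ 2) p = 2 * cw i ((toE n).symm p.1) := by
  have h : HasFDerivAt (fun p : Phase n × ℝ => 1 + ‖p.1‖ ^ 2 + p.2 ^ 2)
      ((0 + 2 • (innerSL ℝ p.1).comp (ContinuousLinearMap.fst ℝ (Phase n) ℝ)) +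
        (2 * p.2) • ContinuousLinearMap.snd ℝ (Phase n) ℝ) p := by
    refine ((hasFDerivAt_const _ _).add ?_).add ?_
    · exact (hasStrictFDerivAt_norm_sq p.1).hasFDerivAt.comp p hasFDerivAt_fst
    · have := (hasFDerivAt_snd (p := p) (𝕜 := ℝ) (E := Phase n) (F := ℝ)).pow 2
      simpa using this
  have e : (fun p : Phase n × ℝ => lam p ^ 2) = fun p => 1 + ‖p.1‖ ^ 2 + p.2 ^ 2 :=
    funext fun p => japPar_sq _ _
  rw [e, Frame.D_eq hp h.hasFDerivWithinAt]
  have hb1 : ((frP n).b (Sum.inl i)).1 = toE n ((frW n).b i) := rfl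
  have hb2 : ((frP n).b (Sum.inl i)).2 = 0 := rfl
  have hin : inner ℝ p.1 (toE n ((frW n).b i)) = cw i ((toE n).symm p.1) := by
    rw [toE_symm_apply, toE_apply]
    rcases i with i | i <;> simp [pt, WithLp.prod_inner_apply, frW, Frame.prod, frSpace, cw,
      EuclideanSpace.inner_single_right]
  simp [hb1, hb2, hin]

theorem D_inl_lam_rpow (i : Idx n) (s : ℝ) {p : Phase n × ℝ} (hp : p ∈ (frP n).S) :
    (frP n).D (Sum.inl i) (fun p => ((lam p ^ s : ℝ) : ℂ)) p =
      (s : ℂ) * ((cw i ((toE n).symm p.1) : ℂ) * ((lam p ^ (s - 2) : ℝ) : ℂ)) := by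
  have h1 := Frame.D_rpow (sym_lam_sq (n := n)).1 (fun p _ => pow_pos (lam_pos p) 2) (s / 2)
    (Sum.inl i) hp
  rw [D_inl_lam_sq i hp, show s / 2 - 1 = (s - 2) / 2 by ring] at h1
  simp only [sq_rpow_half (lam_pos _)] at h1
  have h2 := Frame.D_clm (sym_lam_rpow (n := n) s).1 Complex.ofRealCLM (Sum.inl i) hp
  refine h2.trans ?_
  rw [h1]
  simp only [Complex.ofRealCLM_apply]
  push_cast
  ring

theorem D_inl_fst {c : Phase n → ℂ} (hc : (frP n).Smooth (fun p : Phase n × ℝ => c p.1)) (i : Idx n)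
    {p : Phase n × ℝ} (hp : p ∈ (frP n).S) :
    (frP n).D (Sum.inl i) (fun p => c p.1) p = fderiv ℝ c p.1 ((frE n).b i) :=
  (fderiv_slice hc p.1 (mem_frP.1 hp) i).symm

/-- Differentiating c_j ⟨z,μ⟩^s gives (∂c_j)⟨z,μ⟩^s, again of index j, and s z_i c_j ⟨z,μ⟩^{s-2},
which is a term of index j + 2 relative to the regularity ν - 1. -/
theorem Bold.D_inl {d ν : ℝ} {f : Phase n × ℝ → ℂ} (hf : Bold d ν f) (i : Idx n) :
    Bold (d - 1) (ν - 1) ((frP n).D (Sum.inl i) f) := by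
  intro N
  obtain ⟨c, hc, h⟩ := hf N
  have t0 : BoldN lam N (d - 1) (ν - 1) ((frP n).D (Sum.inl i) (fun p => f p -
      ∑ j ∈ Finset.range N, c j p.1 * ((lam p ^ (d - ν - j) : ℝ) : ℂ))) := by
    refine BoldN.of_symP ?_
    have := SymP.D_inl h i
    rwa [show ν + N - 1 = ν - 1 + N by ring] at this
  have t1 : ∀ j : ℕ, BoldN lam N (d - 1) (ν - 1) (fun p => fderiv ℝ (c j) p.1 ((frE n).b i) *
      ((lam p ^ (d - ν - j) : ℝ) : ℂ)) := fun j => by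
    have h1 := (hc j).D i
    rw [show ν + j - 1 = ν - 1 + j by ring] at h1
    have := isBasis_lam.boldN_term (d := d - 1) N j h1
    rwa [show d - 1 - (ν - 1) - j = d - ν - j by ring] at this
  have t2 : ∀ j : ℕ, BoldN lam N (d - 1) (ν - 1) (fun p => ((d - ν - j : ℝ) : ℂ) *
      ((cw i ((toE n).symm p.1) : ℂ) * c j p.1 * ((lam p ^ (d - ν - j - 2) : ℝ) : ℂ))) := fun j => by
    refine BoldN.const_mul ?_ _
    have h1 := (memS_coord i).mul (hc j)
    rw [show 1 + (ν + j) = ν - 1 + (j + 2 : ℕ) by push_cast; ring] at h1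
    have := isBasis_lam.boldN_term (d := d - 1) N (j + 2) h1
    rwa [show d - 1 - (ν - 1) - ((j + 2 : ℕ) : ℝ) = d - ν - j - 2 by push_cast; ring] at this
  refine (t0.add (BoldN.sum (s := Finset.range N) fun j _ => (t1 j).add (t2 j))).congr fun p hp => ?_
  have hs : ∀ j : ℕ, (frP n).Smooth (fun p => c j p.1 * ((lam p ^ (d - ν - j) : ℝ) : ℂ)) :=
    fun j => (isBasis_lam.symP_term (hc j)).1
  have hf' : (frP n).Smooth f := hf.symP.1
  beta_reduce
  rw [Frame.D_sub hf' (Frame.Smooth.sum fun j _ => hs j) _ hp, Frame.D_sum (fun j _ => hs j) _ hp,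
    sub_add, ← Finset.sum_sub_distrib, Finset.sum_eq_zero, sub_zero]
  intro j _
  rw [Frame.D_mul (memS_iff.1 (hc j)).1 (isBasis_lam.symP_rpow _).1 _ hp,
    D_inl_fst (memS_iff.1 (hc j)).1 i hp, D_inl_lam_rpow i _ hp]
  ring

theorem Bold.Qop (m : ℕ) : ∀ {d ν : ℝ} {f : Phase n × ℝ → ℂ}, Bold d ν f →
    Bold (d - m) (ν - m) (Qop m f) := by
  induction m using Nat.twoStepInduction with
  | zero => intro d ν f hf; simpa [Shubin.Qop] using hf
  | one => exact fun _ => Bold.zero _ _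
  | more m ih _ =>
    intro d ν f hf
    refine Bold.const_mul (Bold.sum fun i _ => Bold.const_mul ?_ _) _
    have := ih ((hf.D_inl i).D_inl i.swap)
    rwa [show d - 1 - 1 - (m : ℝ) = d - (m + 2 : ℕ) by push_cast; ring,
      show ν - 1 - 1 - (m : ℝ) = ν - (m + 2 : ℕ) by push_cast; ring] at this

end

/-! ### Expansion at infinity of integrated Taylor remainders -/

section

variable {n : ℕ}

/-- The difference `⟨z + w, μ⟩² - ⟨z, μ⟩²`, which does not depend on `μ`. -/
def dX (q : (Phase n × ℝ) × Dbl n) : ℝ := lam (shiftL n q) ^ 2 - lam q.1 ^ 2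

theorem dX_eq (q : (Phase n × ℝ) × Dbl n) : dX q = jap (q.1.1 + toE n q.2) ^ 2 - jap q.1.1 ^ 2 := by
  rw [dX, lam, lam, japPar_sq, japPar_sq, jap_sq, jap_sq, shiftL_fst, shiftL_snd]; ring

theorem sym_dX : (frX n).Sym (gS n) (fun q => jap q.1.1 ^ 2 * jw q.2 ^ 2) (fun q => dX q) := by
  have h1 := sym_shift (fun p => sq_nonneg _) (sym_jap_sq (n := n))
  have h2 := sym_fst (fun p => sq_nonneg _) (sym_jap_sq (n := n))
  refine Frame.Sym.congr ((h1.mono (m' := fun q => jap q.1.1 ^ 2 * jw q.2 ^ 2) 4 (by norm_num)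
    fun q _ => ?_).sub (h2.mono_le fun q _ => ?_)) (f' := fun q => dX q)
    fun q _ => by simp only [dX_eq, shiftL_fst]
  · rw [shiftL_fst]
    have := pow_le_pow_left₀ (jap_pos _).le (jap_add_le q.1.1 (toE n q.2)) 2
    refine this.trans (le_of_eq ?_)
    rw [jw]; ring
  · exact le_mul_of_one_le_right (sq_nonneg _) (one_le_pow₀ (one_le_jw _))

theorem lam_shift_sq_le (q : (Phase n × ℝ) × Dbl n) :
    lam (shiftL n q) ^ 2 ≤ 4 * jw q.2 ^ 2 * lam q.1 ^ 2 := by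
  have := pow_le_pow_left₀ (japPar_pos _ _).le (japPar_add_le q.1.1 (toE n q.2) q.1.2) 2
  rw [lam, lam, shiftL_fst, shiftL_snd]
  refine this.trans (le_of_eq ?_)
  rw [jw]; ring

theorem lam_sq_le_shift (q : (Phase n × ℝ) × Dbl n) :
    lam q.1 ^ 2 ≤ 4 * jw q.2 ^ 2 * lam (shiftL n q) ^ 2 := by
  have := pow_le_pow_left₀ (japPar_pos _ _).le (japPar_le_add q.1.1 (toE n q.2) q.1.2) 2
  rw [lam, lam, shiftL_fst, shiftL_snd]
  refine this.trans (le_of_eq ?_)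
  rw [jw]; ring

/-- The function ⟨z,μ⟩² does not depend on w, so its derivatives do not use the factor ⟨w⟩² that the
gains allow. This spare factor is the M⁻¹ required in `Frame.Sym.binRem` with M = ⟨w⟩². -/
theorem sym_D_lam_sq_fst (i : (Idx n ⊕ Unit) ⊕ Idx n) : (frX n).Sym (gS n)
    (fun q => lam q.1 ^ 2 * (jw q.2 ^ 2)⁻¹ * (gS n).g i q)
    ((frX n).D i fun q => lam q.1 ^ 2) := by
  rcases i with i | i
  · have h1 := sym_fst (fun p => mul_nonneg (sq_nonneg _) ((gP n).nonneg i p))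
      ((sym_lam_sq (n := n)).D i)
    refine (h1.mono_le fun q _ => le_of_eq ?_).congr fun q hq => D_inl_fst_X sym_lam_sq.1 i hq
    have := (jw_pos q.2).ne'
    simp only [gS, Sum.elim_inl]
    field_simp
  · refine (Frame.sym_zero fun q _ => ?_).congr fun q hq => D_inr_fst sym_lam_sq.1 i hq
    exact mul_nonneg (mul_nonneg (sq_nonneg _) (inv_nonneg.2 (sq_nonneg _))) ((gS n).nonneg _ q)

theorem lam_sq_add_dX (q : (Phase n × ℝ) × Dbl n) : lam q.1 ^ 2 + dX q = lam (shiftL n q) ^ 2 := by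
  rw [dX]; ring

/-- The squares of ⟨z,μ⟩ and ⟨z+w,μ⟩ are comparable up to 4⟨w⟩², so the binomial remainder loses
only a power of ⟨w⟩ that is independent of the number of derivatives. -/
theorem sym_binRem_dX (s : ℝ) (K : ℕ) : (frX n).Sym (gS n)
    (fun q => (jap q.1.1 ^ 2 * jw q.2 ^ 2) ^ K *
      ((lam q.1 ^ 2) ^ (s - K) * (jw q.2 ^ 2) ^ |s - K|))
    (fun q => binRem s K (lam q.1 ^ 2) (dX q)) := by
  refine Frame.Sym.binRem (M := fun q => jw q.2 ^ 2) (Λ := fun q => lam q.1 ^ 2) (δ := fun q => dX q)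
    (sym_fst (fun p => sq_nonneg _) (sym_lam_sq (n := n))).1 sym_dX (fun q _ => by positivity)
    (fun q _ => pow_pos (lam_pos _) 2)
    (fun q _ => by rw [lam_sq_add_dX]; exact pow_pos (lam_pos _) 2)
    (fun q _ => one_le_pow₀ (one_le_jw _)) sym_D_lam_sq_fst ?_ 4 (by norm_num) (fun q _ => ?_)
    (fun q _ => ?_) s K
  · simp only [lam_sq_add_dX]
    exact sym_shift (fun p => sq_nonneg _) sym_lam_sq
  · rw [lam_sq_add_dX]; exact lam_sq_le_shift q
  · rw [lam_sq_add_dX]; exact lam_shift_sq_le q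

theorem symS_shP_mul_dX {κ : ℝ} {c : Phase n → ℂ} (hc : MemS κ c) (k : ℕ) :
    SymS (wS (wP n (κ + 2 * k) (κ + 2 * k)) 0 (|κ| + 2 * k))
      (fun q => shP (fun p => c p.1) q * ((dX q ^ k : ℝ) : ℂ)) := by
  refine (Frame.Sym.mul (SymP.shP (memS_iff.1 hc))
    ((sym_dX.pow k).clm Complex.ofRealCLM)).mono_le fun q _ => le_of_eq ?_
  simp only [wS, wP, sub_self, Real.rpow_zero, pow_zero, mul_one, mul_pow, abs_zero, add_zero]
  rw [Real.rpow_add (jap_pos _), Real.rpow_add (jw_pos _),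
    show (2 : ℝ) * k = ((2 * k : ℕ) : ℝ) by push_cast; ring, Real.rpow_natCast, Real.rpow_natCast,
    pow_mul, pow_mul]
  ring

theorem symS_shP_mul_binRem {κ : ℝ} {c : Phase n → ℂ} (hc : MemS κ c) (s : ℝ) (K : ℕ) :
    SymS (wS (wP n (κ + s) (κ + 2 * K)) 0 (|κ| + (2 * K + 2 * |s / 2 - K|)))
      (fun q => shP (fun p => c p.1) q * ((binRem (s / 2) K (lam q.1 ^ 2) (dX q) : ℝ) : ℂ)) := by
  refine (Frame.Sym.mul (SymP.shP (memS_iff.1 hc))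
    ((sym_binRem_dX (s / 2) K).clm Complex.ofRealCLM)).mono_le fun q _ => le_of_eq ?_
  have e1 : (lam q.1 ^ 2) ^ (s / 2 - (K : ℝ)) = lam q.1 ^ (s - 2 * K) := by
    rw [show s / 2 - (K : ℝ) = (s - 2 * K) / 2 by ring, sq_rpow_half (lam_pos _)]
  have e2 : (jw q.2 ^ 2) ^ |s / 2 - (K : ℝ)| = jw q.2 ^ (2 * |s / 2 - (K : ℝ)|) := by
    rw [← Real.rpow_natCast (jw q.2) 2, ← Real.rpow_mul (jw_pos q.2).le, Nat.cast_ofNat]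
  have e3 : ∀ x : ℝ, x ^ ((2 : ℝ) * K) = (x ^ 2) ^ K := fun x => by
    rw [show (2 : ℝ) * K = ((2 * K : ℕ) : ℝ) by push_cast; ring, Real.rpow_natCast, pow_mul]
  simp only [wS, wP, sub_self, Real.rpow_zero, pow_zero, mul_one, mul_pow, abs_zero, add_zero]
  rw [e1, e2, Real.rpow_add (jap_pos _), Real.rpow_add (jw_pos _), Real.rpow_add (jw_pos _), e3, e3,
    show κ + s - (κ + 2 * K) = s - 2 * K by ring, lam]
  ring

/-- The terms of the expansion of a shifted symbol at infinity. -/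
theorem exists_Tosc_term (M K : ℕ) {κ s : ℝ} {c : Phase n → ℂ} (hc : MemS κ c) :
    ∃ e : ℕ → Phase n → ℂ, (∀ k : ℕ, MemS (κ + 2 * k - M) (e k)) ∧
      (e 0 = fun z => Tosc M (shP fun p => c p.1) (z, 0)) ∧
      SymP (κ + s - M) (κ + 2 * K - M) (fun p =>
        Tosc M (shP fun p => c p.1 * ((lam p ^ s : ℝ) : ℂ)) p -
          ∑ k ∈ Finset.range K, ((rbin (s / 2) k : ℝ) : ℂ) *
            (e k p.1 * ((lam p ^ (s - 2 * k) : ℝ) : ℂ))) := by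
  set C : ℕ → (Phase n × ℝ) × Dbl n → ℂ := fun k q => shP (fun p => c p.1) q * ((dX q ^ k : ℝ) : ℂ)
    with hC
  have hCS : ∀ k : ℕ, SymS (wS (wP n (κ + 2 * k) (κ + 2 * k)) 0 (|κ| + 2 * k)) (C k) :=
    symS_shP_mul_dX hc
  have hw : ∀ (d ν : ℝ) (p : Phase n × ℝ), 0 ≤ wP n d ν p := fun d ν p => (wP_pos d ν p).le
  have hK0' : ∀ k : ℕ, 0 ≤ |κ| + 2 * (k : ℝ) := fun k => by positivity
  have hT : ∀ k : ℕ, SymP (κ + 2 * k - M) (κ + 2 * k - M) (Tosc M (C k)) := fun k =>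
    ((hCS k).sym_Tosc M (hw _ _) (continuous_wP _ _) (hK0' k)).mono_le fun p _ =>
      (wP_mul_inv_jap _ _ M p).le
  have hind : ∀ (k : ℕ) (z : Phase n) (μ : ℝ), 0 ≤ μ → Tosc M (C k) (z, μ) = Tosc M (C k) (z, 0) := by
    intro k z μ hμ
    -- Neither c(z+w) nor the difference of the squared brackets involves μ.
    refine Tosc_slice_congr M (hCS k).1 (mem_frP.2 hμ) (mem_frP.2 le_rfl) fun w => ?_
    simp only [hC, shP, dX_eq, shiftL_fst]
  refine ⟨fun k z => Tosc M (C k) (z, 0), fun k => memS_of_symP (hT k) (hind k), ?_, ?_⟩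
  · simp [hC]
  -- the remainder
  set Rm : (Phase n × ℝ) × Dbl n → ℂ := fun q => shP (fun p => c p.1) q *
    ((binRem (s / 2) K (lam q.1 ^ 2) (dX q) : ℝ) : ℂ) with hRm
  have hRS : SymS (wS (wP n (κ + s) (κ + 2 * K)) 0 (|κ| + (2 * K + 2 * |s / 2 - K|))) Rm :=
    symS_shP_mul_binRem hc s K
  have hRT : SymP (κ + s - M) (κ + 2 * K - M) (Tosc M Rm) :=
    (hRS.sym_Tosc M (hw _ _) (continuous_wP _ _) (by positivity)).mono_le fun p _ =>
      (wP_mul_inv_jap _ _ M p).le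
  have hCA : ∀ k, Amp (C k) := fun k => (hCS k).amp (hw _ _)
  have hg : ∀ k : ℕ, (frP n).Smooth (fun p : Phase n × ℝ =>
      ((rbin (s / 2) k : ℝ) : ℂ) * ((lam p ^ (s - 2 * k) : ℝ) : ℂ)) := fun k =>
    (Frame.smooth_const _).mul (isBasis_lam.symP_rpow _).1
  refine hRT.congr fun p hp => ?_
  -- Binomial expansion of ⟨z+w,μ⟩^s about ⟨z,μ⟩; the powers of ⟨z,μ⟩ are then taken out of the
  -- integral.
  have e : EqOn (shP fun p => c p.1 * ((lam p ^ s : ℝ) : ℂ)) (fun q =>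
      (∑ k ∈ Finset.range K, (((rbin (s / 2) k : ℝ) : ℂ) * ((lam q.1 ^ (s - 2 * k) : ℝ) : ℂ)) * C k q)
        + Rm q) (frX n).S := by
    intro q _
    have e1 : ∀ k : ℕ, (lam q.1 ^ 2) ^ (s / 2 - k) = lam q.1 ^ (s - 2 * k) := fun k => by
      rw [show s / 2 - (k : ℝ) = (s - 2 * k) / 2 by ring, sq_rpow_half (lam_pos _)]
    have e2 : lam (shiftL n q) ^ s = ∑ k ∈ Finset.range K, rbin (s / 2) k * (dX q ^ k *
        lam q.1 ^ (s - 2 * k)) + binRem (s / 2) K (lam q.1 ^ 2) (dX q) := by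
      simp only [binRem, e1]
      rw [show lam q.1 ^ 2 + dX q = lam (shiftL n q) ^ 2 from lam_sq_add_dX q, sq_rpow_half (lam_pos _)]
      ring
    simp only [shP, hC, hRm]
    rw [e2, Complex.ofReal_add, mul_add, Complex.ofReal_sum, Finset.mul_sum]
    congr 1
    refine Finset.sum_congr rfl fun k _ => ?_
    push_cast
    ring
  rw [Tosc_congr M e hp, (Amp.sum_fst_mul K hCA hg).Tosc_add M (hRS.amp (hw _ _)) hp,
    Amp.Tosc_sum_fst_mul M K hCA hg hp, add_sub_right_comm, ← Finset.sum_sub_distrib,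
    Finset.sum_eq_zero, zero_add]
  intro k _
  rw [hind k p.1 p.2 (mem_frP.1 hp)]
  ring

/-- The oscillatory integrals of Taylor remainders of shifted symbols have expansions at infinity. -/
theorem Bold.Tosc (M : ℕ) {d ν : ℝ} {f : Phase n × ℝ → ℂ} (hf : Bold d ν f) :
    Bold (d - M) (ν - M) (Tosc M (shP f)) := by
  intro N
  obtain ⟨c, hc, h⟩ := hf N
  have hw : ∀ (d ν : ℝ) (p : Phase n × ℝ), 0 ≤ wP n d ν p := fun d ν p => (wP_pos d ν p).le
  set r : Phase n × ℝ → ℂ := fun p => f p -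
    ∑ j ∈ Finset.range N, c j p.1 * ((lam p ^ (d - ν - j) : ℝ) : ℂ) with hr
  have tr : BoldN lam N (d - M) (ν - M) (Shubin.Tosc M (shP r)) := by
    refine BoldN.of_symP (((SymP.shP h).sym_Tosc M (hw _ _) (continuous_wP _ _)
      (by positivity)).mono_le fun p _ => ?_)
    rw [wP_mul_inv_jap, show ν + N - M = ν - M + N by ring]
  have tj : ∀ j : ℕ, BoldN lam N (d - M) (ν - M) (Shubin.Tosc M
      (shP fun p => c j p.1 * ((lam p ^ (d - ν - j) : ℝ) : ℂ))) := by
    intro j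
    obtain ⟨e, he, -, hT⟩ := exists_Tosc_term M N (s := d - ν - j) (hc j)
    have h1 : ∀ k : ℕ, BoldN lam N (d - M) (ν - M) (fun p =>
        ((rbin ((d - ν - j) / 2) k : ℝ) : ℂ) * (e k p.1 * ((lam p ^ (d - ν - j - 2 * k) : ℝ) : ℂ))) := by
      intro k
      refine BoldN.const_mul ?_ _
      have h2 := he k
      -- The k-th binomial term of the j-th coefficient is a term of index j + 2k.
      rw [show ν + j + 2 * k - M = ν - M + (j + 2 * k : ℕ) by push_cast; ring] at h2
      have := isBasis_lam.boldN_term (d := d - M) N (j + 2 * k) h2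
      rwa [show d - M - (ν - M) - ((j + 2 * k : ℕ) : ℝ) = d - ν - j - 2 * k by push_cast; ring] at this
    rw [show ν + j + (d - ν - j) - (M : ℝ) = d - M by ring] at hT
    have h2 := SymP.mono_reg (ν := ν - M + N) (by
      have : (0 : ℝ) ≤ N := N.cast_nonneg
      have : (0 : ℝ) ≤ j := j.cast_nonneg
      linarith) hT
    exact ((BoldN.of_symP h2).add (BoldN.sum (s := Finset.range N) fun k _ => h1 k)).congr
      fun p _ => by simp
  have hA : ∀ j : ℕ, Amp (shP fun p => c j p.1 * ((lam p ^ (d - ν - j) : ℝ) : ℂ)) := fun j =>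
    (SymP.shP (isBasis_lam.symP_term (hc j))).amp (hw _ _)
  have hone : ∀ _ : ℕ, (frP n).Smooth (fun _ : Phase n × ℝ => (1 : ℂ)) := fun _ =>
    Frame.smooth_const 1
  refine (tr.add (BoldN.sum (s := Finset.range N) fun j _ => tj j)).congr fun p hp => ?_
  have e : EqOn (shP f) (fun q => (∑ j ∈ Finset.range N,
      (1 : ℂ) * shP (fun p => c j p.1 * ((lam p ^ (d - ν - j) : ℝ) : ℂ)) q) + shP r q) (frX n).S := by
    intro q _
    simp only [shP, hr, one_mul]
    ring
  rw [Tosc_congr M e hp, (Amp.sum_fst_mul N hA hone).Tosc_add M ((SymP.shP h).amp (hw _ _)) hp,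
    Amp.Tosc_sum_fst_mul M N hA hone hp, add_comm]
  simp

end

/-! ### The adjoint symbol and its principal limit symbol -/

section

variable {n : ℕ}

theorem adjPar_eq_oscI (a : Phase n → ℝ → ℂ) (p : Phase n × ℝ) :
    adjPar a p.1 p.2 = oscI (fun w => shP (fun p => conj (a p.1 p.2)) (p, w)) := by
  rw [adjPar, adj_eq_oscI]
  simp only [shP, shiftL_apply]

theorem Tosc_zero (F : (Phase n × ℝ) × Dbl n → ℂ) (p : Phase n × ℝ) :
    Tosc 0 F p = oscI (fun w => F (p, w)) := by
  simp [Tosc, Rt]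

/-- The asymptotic expansion of the adjoint symbol. -/
theorem Bold.adjPar_sub {d ν : ℝ} {a : Phase n → ℝ → ℂ}
    (ha : Bold d ν fun p : Phase n × ℝ => a p.1 p.2) (M : ℕ) :
    Bold (d - M) (ν - M) (fun p : Phase n × ℝ => adjPar a p.1 p.2 -
      ∑ m ∈ Finset.range M, Shubin.Qop m (fun p : Phase n × ℝ => starRingEnd ℂ (a p.1 p.2)) p) := by
  refine (ha.conj.Tosc M).congr fun p hp => ?_
  rw [adjPar_eq_oscI, SymP.oscI_shP M ha.conj.symP hp]
  ring

theorem Bold.adjPar {d ν : ℝ} {a : Phase n → ℝ → ℂ}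
    (ha : Bold d ν fun p : Phase n × ℝ => a p.1 p.2) :
    Bold d ν (fun p : Phase n × ℝ => Shubin.adjPar a p.1 p.2) := by
  simpa using Bold.adjPar_sub ha 0

theorem SymP.polyW_shift {d ν : ℝ} {f : Phase n × ℝ → ℂ} (hf : SymP d ν f) (z : Phase n) {μ : ℝ}
    (hμ : 0 ≤ μ) : PolyW (fun w => f (z + toE n w, μ)) := by
  have := SymS.polyW (fun p => (wP_pos d ν p).le) (SymP.shP hf) (mem_frP.2 hμ : (z, μ) ∈ (frP n).S)
  simpa only [Shubin.shP, shiftL_apply] using this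

theorem MemS.isAdjointValue {κ : ℝ} {c : Phase n → ℂ} (hc : MemS κ c) (z : Phase n) :
    IsAdjointValue c z (adj c z) := by
  rw [adj_eq_oscI]
  exact (SymP.polyW_shift (memS_iff.1 hc.conj) z (le_refl (0 : ℝ))).hasOsc

/-- Without Taylor terms to subtract, the zeroth coefficient produced by `exists_Tosc_term` is the
adjoint symbol itself; the exponent s plays no role. -/
theorem MemS.adj {ν : ℝ} {c : Phase n → ℂ} (hc : MemS ν c) : MemS ν (Shubin.adj c) := by
  obtain ⟨e, he, he0, -⟩ := exists_Tosc_term 0 1 (s := 0) hc.conj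
  have := he 0
  rw [he0] at this
  simp only [Tosc_zero, shP, shiftL_apply] at this
  simpa [← adj_eq_oscI] using this

/-- For fixed parameter, symbols of order `d` and regularity `ν` are symbols of order `d`. -/
theorem SymP.memS_slice {d ν : ℝ} {a : Phase n → ℝ → ℂ}
    (ha : SymP d ν fun p : Phase n × ℝ => a p.1 p.2) {μ : ℝ} (hμ : 0 ≤ μ) :
    MemS d (fun z => a z μ) := by
  have hj : ∀ z : Phase n, japPar z μ ≤ (1 + |μ|) * jap z ∧ jap z ≤ (1 + |μ|) * japPar z μ := by
    intro z
    have h1 := jap_le_japPar z μ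
    have h2 := jap_pos z
    have h3 := abs_nonneg μ
    refine ⟨Real.sqrt_le_iff.2 ⟨by positivity, ?_⟩, by nlinarith [japPar_pos z μ]⟩
    rw [mul_pow, jap_sq]
    nlinarith [sq_abs μ, sq_nonneg ‖z‖, mul_nonneg (sq_nonneg ‖z‖) h3,
      mul_nonneg (sq_nonneg ‖z‖) (sq_nonneg |μ|)]
  refine ⟨contDiff_slice ha.smooth hμ, fun k => ?_⟩
  obtain ⟨C, hC, h⟩ := sym_iteratedFDeriv_le k ha
  refine ⟨C * (1 + |μ|) ^ |d - ν|, fun z => (h z μ hμ).trans ?_⟩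
  have hz := jap_pos z
  have h1 := rpow_le_of_comparable (japPar_pos z μ) hz (by positivity) (hj z).1 (hj z).2 (d - ν)
  rw [jap_rpow_sub_nat, wP]
  have h2 : jap z ^ d = jap z ^ ν * jap z ^ (d - ν) := by
    rw [← Real.rpow_add hz]; ring_nf
  rw [h2]
  calc C * (jap z ^ ν * japPar z μ ^ (d - ν) * (jap z)⁻¹ ^ k)
      ≤ C * (jap z ^ ν * ((1 + |μ|) ^ |d - ν| * jap z ^ (d - ν)) * (jap z)⁻¹ ^ k) := by gcongr
    _ = _ := by ring

/-- The principal limit symbol of the adjoint. -/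
theorem symP_adjPar_sub {d ν : ℝ} {a : Phase n → ℝ → ℂ} {c : Phase n → ℂ} (hc : MemS ν c)
    (h : SymP d (ν + 1) (fun p => a p.1 p.2 - c p.1 * ((lam p ^ (d - ν) : ℝ) : ℂ))) :
    SymP d (ν + 1) (fun p => adjPar a p.1 p.2 - adj c p.1 * ((lam p ^ (d - ν) : ℝ) : ℂ)) := by
  have hw : ∀ (d ν : ℝ) (p : Phase n × ℝ), 0 ≤ wP n d ν p := fun d ν p => (wP_pos d ν p).le
  -- No Taylor term is subtracted and only the leading binomial term is separated; what remains has
  -- regularity ν + 2.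
  obtain ⟨e, he, he0, hT⟩ := exists_Tosc_term 0 1 (s := d - ν) hc.conj
  have h' := SymP.shP h.conj
  have hR := h'.sym_Tosc 0 (hw _ _) (continuous_wP _ _) (by positivity)
  simp only [pow_zero, mul_one] at hR
  simp only [Nat.cast_zero, sub_zero, Nat.cast_one, mul_one, Finset.sum_range_one, rbin,
    Complex.ofReal_one, one_mul, mul_zero, add_sub_cancel] at hT
  have hT' := SymP.mono_reg (ν := ν + 1) (by linarith) hT
  refine (hR.add hT').congr fun p hp => ?_
  have e1 : adj c p.1 = e 0 p.1 := by
    rw [he0, adj_eq_oscI]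
    simp only [Tosc_zero, shP, shiftL_apply]
  have hA1 : Amp (shP fun p => conj (a p.1 p.2 - c p.1 * ((lam p ^ (d - ν) : ℝ) : ℂ))) :=
    h'.amp (hw _ _)
  have hA2 : Amp (shP fun p => conj (c p.1) * ((lam p ^ (d - ν) : ℝ) : ℂ)) :=
    (SymP.shP (isBasis_lam.symP_term hc.conj)).amp (hw _ _)
  have e2 := hA1.Tosc_add 0 hA2 hp
  simp only
  rw [e1, ← add_sub_assoc, ← e2, Tosc_zero, adjPar_eq_oscI]
  congr 2
  funext w
  simp [shP]

/-- The leading coefficient is insensitive to the choice between [z,μ] and ⟨z,μ⟩. The computation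
with ⟨z,μ⟩ therefore gives an expansion of length one in [z,μ], and uniqueness of the coefficient
concludes. -/
theorem eq_adj_of_isLimitSymbol {br : Phase n → ℝ → ℝ} (hbr : IsSmoothedLength br) {d ν : ℝ}
    {a : Phase n → ℝ → ℂ} {p q : Phase n → ℂ} (hp : IsLimitSymbol br d ν a p)
    (hq : IsLimitSymbol br d ν (adjPar a) q) : MemS ν p ∧ q = adj p := by
  have hβ := isBasis_of_isSmoothedLength hbr
  obtain ⟨c, ⟨hc, h⟩, rfl⟩ := hp
  obtain ⟨e, ⟨he, h'⟩, rfl⟩ := hq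
  have hc0 : MemS ν (c 0) := by simpa using hc 0
  refine ⟨hc0, ?_⟩
  -- The (d-ν)-th powers of the two brackets differ by a symbol of order d - ν - 2, one order better
  -- than needed.
  have hdiff : ∀ {b : Phase n → ℂ}, MemS ν b → SymP d (ν + 1) (fun p =>
      b p.1 * ((br p.1 p.2 ^ (d - ν) : ℝ) : ℂ) - b p.1 * ((lam p ^ (d - ν) : ℝ) : ℂ)) := by
    intro b hb
    have h1 := symP_rpow_of_sym (isBasis_lam.sym_binRem hβ (d - ν) 1)
    have h2 := SymP.mul (memS_iff.1 hb) h1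
    refine (h2.mono_le fun p _ => ?_).congr fun p hp => ?_
    · simp only [Nat.cast_one, mul_one, add_zero, wP]
      rw [show ν + (d - ν - 2) - ν = d - (ν + 1) - 1 by ring, Real.rpow_sub_one (japPar_pos _ _).ne',
        Real.rpow_add_one (jap_pos _).ne']
      have a1 := one_le_jap p.1
      have a2 := one_le_japPar p.1 p.2
      have a3 := Real.rpow_pos_of_pos (jap_pos p.1) ν
      have a4 := Real.rpow_pos_of_pos (japPar_pos p.1 p.2) (d - (ν + 1))
      refine mul_le_mul (le_mul_of_one_le_right a3.le a1) (div_le_self a4.le a2)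
        (by positivity) (by positivity)
    · have e1 : binRem ((d - ν) / 2) 1 (lam p ^ 2) (br p.1 p.2 ^ 2 - lam p ^ 2) =
          br p.1 p.2 ^ (d - ν) - lam p ^ (d - ν) := by
        simp [binRem, rbin, sq_rpow_half (lam_pos p), sq_rpow_half (hβ.pos p hp)]
      simp only
      rw [e1]
      push_cast
      ring
  have h1 := memSTilde_iff.1 (h 1)
  simp only [Finset.sum_range_one, Nat.cast_zero, sub_zero, Nat.cast_one] at h1
  have h2 := symP_adjPar_sub hc0 ((h1.add (hdiff hc0)).congr (f' := fun p : Phase n × ℝ =>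
    a p.1 p.2 - c 0 p.1 * ((lam p ^ (d - ν) : ℝ) : ℂ)) fun p _ => by simp)
  have h3 : SymP d (ν + (1 : ℕ)) (fun p : Phase n × ℝ => adjPar a p.1 p.2 -
      ∑ j ∈ Finset.range 1, adj (c 0) p.1 * ((br p.1 p.2 ^ (d - ν - j) : ℝ) : ℂ)) := by
    refine (by simpa using h2.sub (hdiff hc0.adj) : SymP d (ν + (1 : ℕ)) _).congr fun p _ => ?_
    simp
  exact hβ.coeff_unique (c := e) (c' := fun _ => adj (c 0)) (memSTilde_iff.1 (h' 1)) h3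
    Nat.zero_lt_one

end

section

open scoped FourierTransform

variable {n : ℕ}

/-! ### The formal adjoint -/

theorem exists_schwartz_fourierHat (v : 𝓢(Space n, ℂ)) :
    ∃ V : 𝓢(Space n, ℂ), ∀ ξ, fourierHat v ξ = V ξ := by
  have h : (2 * Real.pi)⁻¹ ≠ 0 := by positivity
  refine ⟨SchwartzMap.compCLMOfContinuousLinearEquiv ℝ
    (ContinuousLinearEquiv.smulLeft (R₁ := ℝ) (M₁ := Space n) (Units.mk0 _ h)) (𝓕 v), fun ξ => ?_⟩
  rw [fourierHat_eq]
  rfl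

theorem integrable_one_add_norm_pow_mul (u : 𝓢(Space n, ℂ)) (N : ℕ) :
    Integrable (fun x => (1 + ‖x‖) ^ N * ‖u x‖) := by
  have h : ∀ x, (1 + ‖x‖) ^ N * ‖u x‖ = ∑ k ∈ Finset.range (N + 1), (N.choose k : ℝ) * (‖x‖ ^ k * ‖u x‖) := by
    intro x
    rw [add_comm, add_pow, Finset.sum_mul]
    exact Finset.sum_congr rfl fun k _ => by rw [one_pow]; ring
  simp only [h]
  exact integrable_finsetSum _ fun k _ => (u.integrable_pow_mul volume k).const_mul _

theorem jw_rpow_le (κ : ℝ) : ∃ C, ∃ N : ℕ, 0 ≤ C ∧ ∀ z : Dbl n,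
    jw z ^ κ ≤ C * ((1 + ‖z.1‖) ^ N * (1 + ‖z.2‖) ^ N) := by
  obtain ⟨N, hN⟩ := exists_nat_ge κ
  refine ⟨2 ^ N, N, by positivity, fun z => ?_⟩
  calc jw z ^ κ ≤ jw z ^ (N : ℝ) := Real.rpow_le_rpow_of_exponent_le (one_le_jw z) hN
    _ = jw z ^ N := Real.rpow_natCast _ _
    _ ≤ (2 * ((1 + ‖z.1‖) * (1 + ‖z.2‖))) ^ N := by
      refine pow_le_pow_left₀ (jw_pos z).le ((jw_le_one_add_norm z).trans ?_) N
      have h1 := norm_nonneg z.1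
      have h2 := norm_nonneg z.2
      have : ‖z‖ ≤ ‖z.1‖ + ‖z.2‖ := by rw [Prod.norm_def]; exact max_le (by linarith) (by linarith)
      nlinarith [mul_nonneg h1 h2]
    _ = _ := by rw [mul_pow, mul_pow]

theorem integrable_jw_mul_schwartz (u v : 𝓢(Space n, ℂ)) (κ : ℝ) :
    Integrable (fun z : Dbl n => jw z ^ κ * (‖u z.1‖ * ‖v z.2‖)) := by
  obtain ⟨C, N, hC, h⟩ := jw_rpow_le (n := n) κ
  have hi := ((integrable_one_add_norm_pow_mul u N).mul_prod
    (integrable_one_add_norm_pow_mul v N)).const_mul C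
  refine hi.mono' ?_ (Eventually.of_forall fun z => ?_)
  · refine Continuous.aestronglyMeasurable ?_
    exact (continuous_jw.rpow_const fun w => Or.inl (jw_pos w).ne').mul
      ((u.continuous.comp continuous_fst).norm.mul (v.continuous.comp continuous_snd).norm)
  · rw [Real.norm_of_nonneg (mul_nonneg (Real.rpow_nonneg (jw_pos z).le _) (by positivity))]
    calc _ ≤ C * ((1 + ‖z.1‖) ^ N * (1 + ‖z.2‖) ^ N) * (‖u z.1‖ * ‖v z.2‖) := by
          gcongr; exact h z
      _ = _ := by ring

theorem conj_osc (w : Dbl n) :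
    conj (osc w) = Complex.exp (Complex.I * ((inner ℝ w.1 w.2 : ℝ) : ℂ)) := by
  rw [osc, ← Complex.exp_conj]; simp

theorem conj_cn : conj (cn n) = cn n := by
  rw [cn, map_pow, map_inv₀, Complex.conj_ofReal]

/-- Expanding the phase of w - z separates the dependence on the two components of z, so that after
an interchange of integrals the z-integral factorizes. -/
theorem osc_mul_conj_osc (w z : Dbl n) :
    osc z * conj (osc (w - z)) = osc (z.1, w.2) * osc (w.1, z.2) * conj (osc w) := by
  rw [conj_osc, conj_osc, osc, osc, osc, ← Complex.exp_add, ← Complex.exp_add, ← Complex.exp_add]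
  congr 1
  simp only [Prod.fst_sub, Prod.snd_sub, inner_sub_left, inner_sub_right]
  push_cast
  ring

/-- The adjoint formula for integrable symbols. -/
theorem integral_adjoint_of_integrable (u v : 𝓢(Space n, ℂ)) {r : Dbl n → ℂ} (hr : Integrable r) :
    ∫ z : Dbl n, u z.1 * conj (fourierHat v z.2) * (osc z * (cn n * ∫ w, conj (osc w) * r (w + z))) =
      ∫ z : Dbl n, conj (osc z) * r z * fourierHat u z.2 * conj (v z.1) := by
  have hA : Integrable (fun z : Dbl n => u z.1 * conj (fourierHat v z.2)) :=
    u.integrable.mul_prod (Complex.conjCLE.toContinuousLinearMap.integrable_comp (integrable_fourierHat v))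
  have h1 : ∀ z : Dbl n, ∫ w, conj (osc w) * r (w + z) = ∫ w, conj (osc (w - z)) * r w := fun z => by
    rw [← integral_sub_right_eq_self (fun w => conj (osc w) * r (w + z)) z]
    simp
  have h2 : ∀ z : Dbl n, u z.1 * conj (fourierHat v z.2) *
      (osc z * (cn n * ∫ w, conj (osc w) * r (w + z))) =
      ∫ w, (u z.1 * conj (fourierHat v z.2)) * r w *
        (cn n * (osc (z.1, w.2) * osc (w.1, z.2) * conj (osc w))) := fun z => by
    rw [h1, ← integral_const_mul, ← integral_const_mul, ← integral_const_mul]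
    congr 1; funext w
    rw [← osc_mul_conj_osc]; ring
  simp only [h2]
  have hc : Continuous (fun q : Dbl n × Dbl n =>
      cn n * (osc (q.1.1, q.2.2) * osc (q.2.1, q.1.2) * conj (osc q.2))) := by
    have ho := (contDiff_osc (n := n)).continuous
    have := Complex.continuous_conj
    fun_prop
  have hInt : Integrable (fun q : Dbl n × Dbl n => (u q.1.1 * conj (fourierHat v q.1.2)) * r q.2 *
      (cn n * (osc (q.1.1, q.2.2) * osc (q.2.1, q.1.2) * conj (osc q.2)))) (volume.prod volume) := by
    refine (hA.mul_prod hr).mul_bdd (c := ‖cn n‖) hc.aestronglyMeasurable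
      (Eventually.of_forall fun q => ?_)
    simp [norm_osc]
  rw [integral_integral_swap hInt]
  congr 1; funext w
  have h3 : ∀ z : Dbl n, (u z.1 * conj (fourierHat v z.2)) * r w *
      (cn n * (osc (z.1, w.2) * osc (w.1, z.2) * conj (osc w))) =
      (conj (osc w) * r w) * ((osc (z.1, w.2) * u z.1) *
        (cn n * (osc (w.1, z.2) * conj (fourierHat v z.2)))) := fun z => by ring
  simp only [h3]
  rw [integral_const_mul]
  -- The first factor is the Fourier transform of u; the second is the conjugate of v by Fourier
  -- inversion.
  rw [show (∫ z : Dbl n, (osc (z.1, w.2) * u z.1) *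
        (cn n * (osc (w.1, z.2) * conj (fourierHat v z.2)))) =
      (∫ x, osc (x, w.2) * u x) * ∫ ξ, cn n * (osc (w.1, ξ) * conj (fourierHat v ξ)) from
    integral_prod_mul (fun x => osc (x, w.2) * u x)
      (fun ξ => cn n * (osc (w.1, ξ) * conj (fourierHat v ξ)))]
  have h4 : ∫ x, osc (x, w.2) * u x = fourierHat u w.2 := rfl
  have h5 : ∫ ξ, cn n * (osc (w.1, ξ) * conj (fourierHat v ξ)) = conj (v w.1) := by
    rw [← fourierHat_inversion v w.1, map_mul, conj_cn, integral_const_mul, ← integral_conj]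
    congr 2; funext ξ
    rw [map_mul, ← conj_osc (w.1, ξ), Complex.conj_conj]
  rw [h4, h5]
  ring

theorem MemS.exists_bound {κ : ℝ} {p : Phase n → ℂ} (hp : MemS κ p) :
    ∃ C, 0 ≤ C ∧ ∀ z : Dbl n, ‖p (toE n z)‖ ≤ C * jw z ^ κ := by
  obtain ⟨C, hC, h⟩ := (memS_iff.1 hp).bound
  refine ⟨C, hC, fun z => ?_⟩
  simpa [wP, jw] using h (toE n z, 0) (mem_frP.2 le_rfl)

theorem MemS.continuous {κ : ℝ} {p : Phase n → ℂ} (hp : MemS κ p) :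
    Continuous (fun z : Dbl n => p (toE n z)) :=
  hp.1.continuous.comp (toE n).continuous

/-- Integrals over phase space that represent `(p(x,D)u, v)`. -/
theorem integral_op_mul_conj {κ : ℝ} {p : Phase n → ℂ} (hp : MemS κ p) (u v : 𝓢(Space n, ℂ)) :
    ∫ x, op p u x * conj (v x) =
      cn n * ∫ z : Dbl n, conj (osc z) * p (toE n z) * fourierHat u z.2 * conj (v z.1) := by
  obtain ⟨U, hU⟩ := exists_schwartz_fourierHat u
  obtain ⟨C, hC, hb⟩ := hp.exists_bound
  have ho := (contDiff_osc (n := n)).continuous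
  have hi : Integrable (fun z : Dbl n => conj (osc z) * p (toE n z) * fourierHat u z.2 *
      conj (v z.1)) (volume.prod volume) := by
    refine ((integrable_jw_mul_schwartz v U κ).const_mul C).mono' ?_ (Eventually.of_forall fun z => ?_)
    · refine Continuous.aestronglyMeasurable ?_
      exact (((Complex.continuous_conj.comp ho).mul hp.continuous).mul
        ((continuous_fourierHat u).comp continuous_snd)).mul
        (Complex.continuous_conj.comp (v.continuous.comp continuous_fst))
    · simp only [norm_mul, RCLike.norm_conj, norm_osc, one_mul, hU]
      calc _ ≤ C * jw z ^ κ * ‖U z.2‖ * ‖v z.1‖ := by gcongr; exact hb z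
        _ = _ := by ring
  rw [show (∫ z : Dbl n, conj (osc z) * p (toE n z) * fourierHat u z.2 * conj (v z.1)) = _ from
    integral_prod _ hi, ← integral_const_mul]
  congr 1; funext x
  simp only
  rw [integral_mul_const, ← mul_assoc]
  congr 1
  simp only [conj_osc]
  rfl

/-- Both sides are written as integrals over phase space. With the symbol multiplied by a dilated
cut-off they agree by Fubini's theorem, and both converge as the cut-off is removed. -/
theorem MemS.isFormalAdjointSymbol {κ : ℝ} {p : Phase n → ℂ} (hp : MemS κ p) :
    IsFormalAdjointSymbol p (Shubin.adj p) := by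
  refine ⟨hp.isAdjointValue, fun u v => ?_⟩
  have hR : ∫ x, u x * conj (op (Shubin.adj p) v x) =
      conj (∫ x, op (Shubin.adj p) v x * conj (u x)) := by
    rw [← integral_conj]
    congr 1; funext x
    rw [map_mul, Complex.conj_conj, mul_comm]
  rw [hR, integral_op_mul_conj hp, integral_op_mul_conj hp.adj, map_mul, conj_cn, ← integral_conj]
  congr 1
  obtain ⟨φ, hφ⟩ := exists_schwartz_one n
  obtain ⟨B, hB, hφB⟩ := schwartz_bound φ
  obtain ⟨U, hU⟩ := exists_schwartz_fourierHat u
  obtain ⟨V, hV⟩ := exists_schwartz_fourierHat v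
  obtain ⟨C, hC, hb⟩ := hp.exists_bound
  have ho := (contDiff_osc (n := n)).continuous
  have hcU := continuous_fourierHat u
  have hcV := continuous_fourierHat v
  have hφ0 : ∀ z : Dbl n, Tendsto (fun ε : ℝ => ε • z) (𝓝[>] 0) (𝓝 0) := fun z => by
    have : Continuous fun ε : ℝ => ε • z := by fun_prop
    simpa using (this.tendsto 0).mono_left nhdsWithin_le_nhds
  set r : ℝ → Dbl n → ℂ := fun ε w => conj (φ (ε • w)) * p (toE n w) with hr
  have hrc : ∀ ε, Continuous (r ε) := fun ε =>
    (Complex.continuous_conj.comp (φ.continuous.comp (continuous_const_smul ε))).mul hp.continuous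
  -- the left-hand side
  have hL : Tendsto (fun ε => ∫ z : Dbl n, conj (osc z) * r ε z * fourierHat u z.2 * conj (v z.1))
      (𝓝[>] 0) (𝓝 (∫ z : Dbl n, conj (osc z) * p (toE n z) * fourierHat u z.2 * conj (v z.1))) := by
    refine tendsto_integral_filter_of_dominated_convergence
      (fun z => B * C * (jw z ^ κ * (‖v z.1‖ * ‖U z.2‖))) (Eventually.of_forall fun ε => ?_)
      (Eventually.of_forall fun ε => Eventually.of_forall fun z => ?_)
      ((integrable_jw_mul_schwartz v U κ).const_mul _) (Eventually.of_forall fun z => ?_)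
    · refine Continuous.aestronglyMeasurable ?_
      exact (((Complex.continuous_conj.comp ho).mul (hrc ε)).mul (hcU.comp continuous_snd)).mul
        (Complex.continuous_conj.comp (v.continuous.comp continuous_fst))
    · simp only [hr, norm_mul, RCLike.norm_conj, norm_osc, one_mul, hU]
      calc _ ≤ B * (C * jw z ^ κ) * ‖U z.2‖ * ‖v z.1‖ := by gcongr; exacts [hφB _, hb z]
        _ = _ := by ring
    · have h1 := (Complex.continuous_conj.tendsto _).comp ((φ.continuous.tendsto 0).comp (hφ0 z))
      rw [hφ, map_one] at h1
      have h2 := (((h1.mul_const (p (toE n z))).const_mul (conj (osc z))).mul_const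
        (fourierHat u z.2)).mul_const (conj (v z.1))
      simpa [hr, Function.comp_def] using h2
  -- the right-hand side
  set q : ℝ → Dbl n → ℂ := fun ε z => cn n * ∫ w, conj (osc w) * r ε (w + z) with hq
  -- The adjoint of the cut-off symbol at z is, up to conjugation, a regularized oscillatory
  -- integral for p whose cut-off is translated by εz. The estimate of `osc_main`, uniform in
  -- translations, then provides the dominating function.
  have hqeq : ∀ ε z, q ε z = conj (cn n * ∫ w, osc w * φ (ε • w + ε • z) *
      shP (fun p' : Phase n × ℝ => conj (p p'.1)) ((toE n z, 0), w)) := fun ε z => by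
    simp only [hq]
    rw [map_mul, conj_cn, ← integral_conj]
    congr 2; funext w
    simp only [hr, map_mul, shP, shiftL_apply, Complex.conj_conj, smul_add, map_add,
      add_comm (toE n z)]
    ring
  have hF := (SymP.shP (memS_iff.1 hp.conj)).symF fun p => (wP_pos κ κ p).le
  have hm : ∀ p' : Phase n × ℝ, 0 ≤ wP n κ κ p' * (jap p'.1)⁻¹ ^ 0 := fun p' => by
    simpa using (wP_pos κ κ p').le
  obtain ⟨k, hk⟩ := exists_nat_ge (|κ| + |κ - κ| + (0 : ℕ) + (2 * n + 1))
  have hk' : |κ| + |κ - κ| + ((0 : ℕ) : ℝ) ≤ 2 * k + -(2 * n + 1) := by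
    have := k.cast_nonneg (α := ℝ); linarith
  obtain ⟨⟨C', hC', hb'⟩, hlim⟩ := osc_main k hm (hF.mono_growth hm hk') φ
  have hRR : Tendsto (fun ε => ∫ z : Dbl n, u z.1 * conj (fourierHat v z.2) * (osc z * q ε z))
      (𝓝[>] 0) (𝓝 (∫ z : Dbl n, conj (conj (osc z) * Shubin.adj p (toE n z) * fourierHat v z.2 *
        conj (u z.1)))) := by
    refine tendsto_integral_filter_of_dominated_convergence
      (fun z => ‖cn n‖ * C' * (jw z ^ κ * (‖u z.1‖ * ‖V z.2‖))) (Eventually.of_forall fun ε => ?_)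
      ?_ ((integrable_jw_mul_schwartz u V κ).const_mul _) (Eventually.of_forall fun z => ?_)
    · have h1 : AEStronglyMeasurable (q ε) := by
        refine AEStronglyMeasurable.const_mul ?_ _
        have : Continuous (fun x : Dbl n × Dbl n => conj (osc x.2) * r ε (x.2 + x.1)) :=
          (Complex.continuous_conj.comp (ho.comp continuous_snd)).mul
            ((hrc ε).comp (continuous_snd.add continuous_fst))
        exact (this.aestronglyMeasurable (μ := volume.prod volume)).integral_prod_right'
      refine AEStronglyMeasurable.mul (Continuous.aestronglyMeasurable ?_)
        (ho.aestronglyMeasurable.mul h1)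
      exact (u.continuous.comp continuous_fst).mul
        (Complex.continuous_conj.comp (hcV.comp continuous_snd))
    · have : Ioc (0 : ℝ) 1 ∈ 𝓝[>] (0 : ℝ) := Ioc_mem_nhdsGT one_pos
      filter_upwards [this] with ε hε
      refine Eventually.of_forall fun z => ?_
      have h1 := hb' ε hε.1 hε.2 (ε • z) (toE n z, 0) (mem_frP.2 le_rfl)
      simp only [wP, sub_self, Real.rpow_zero, mul_one, pow_zero] at h1
      rw [norm_mul, norm_mul, norm_mul, norm_osc, one_mul, hqeq, RCLike.norm_conj, RCLike.norm_conj,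
        norm_mul, hV]
      calc _ ≤ ‖u z.1‖ * ‖V z.2‖ * (‖cn n‖ * (C' * jw z ^ κ)) := by gcongr; exact h1
        _ = _ := by ring
    · have h1 := (hlim (toE n z, 0) (mem_frP.2 le_rfl) (fun ε => ε • z) (hφ0 z)).const_mul (cn n)
      rw [hφ, one_mul, ← hF.oscI_eq hm hk' (mem_frP.2 le_rfl)] at h1
      have e : oscI (fun w => shP (fun p' : Phase n × ℝ => conj (p p'.1)) ((toE n z, 0), w)) =
          Shubin.adj p (toE n z) := by
        rw [adj_eq_oscI]; simp only [shP, shiftL_apply]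
      rw [e] at h1
      have h2 := (((Complex.continuous_conj.tendsto _).comp h1).const_mul (osc z)).const_mul
        (u z.1 * conj (fourierHat v z.2))
      refine (h2.congr fun ε => ?_).trans_eq ?_
      · rw [hqeq]; rfl
      · congr 1
        simp only [map_mul, Complex.conj_conj]; ring
  refine tendsto_nhds_unique hL (hRR.congr' ?_)
  filter_upwards [self_mem_nhdsWithin] with ε hε
  refine integral_adjoint_of_integrable u v ?_
  obtain ⟨C₀, -, h⟩ := ((SymP.polyW_shift (memS_iff.1 hp.conj) 0 (le_refl (0 : ℝ))).rap φ
    (ne_of_gt hε) 0 (2 * n + 1)).bound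
  refine integrable_of_le_jw (hrc ε) (C := C₀) fun w => ?_
  simpa [hr] using h w (by simp [frW_S])

end

section

variable {n : ℕ}

/-! ### Homogeneous symbols -/

/-- The domain of the homogeneous symbols. -/
def punct (n : ℕ) : Set (Phase n × ℝ) := {0}ᶜ ×ˢ Ici 0

theorem mem_punct {p : Phase n × ℝ} : p ∈ punct n ↔ p.1 ≠ 0 ∧ 0 ≤ p.2 := by simp [punct]

theorem mem_frP_of_mem_punct {p : Phase n × ℝ} (hp : p ∈ punct n) : p ∈ (frP n).S :=
  mem_frP.2 (mem_punct.1 hp).2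

theorem smul_mem_punct {p : Phase n × ℝ} (hp : p ∈ punct n) {t : ℝ} (ht : 0 < t) :
    t • p ∈ punct n := by
  rw [mem_punct] at hp ⊢
  exact ⟨smul_ne_zero ht.ne' hp.1, mul_nonneg ht.le hp.2⟩

theorem punct_eq : punct n = (frP n).S ∩ Prod.fst ⁻¹' {0}ᶜ := by
  ext p; simp [mem_punct, mem_frP, and_comm]

theorem uniqueDiffOn_punct : UniqueDiffOn ℝ (punct n) :=
  isOpen_compl_singleton.uniqueDiffOn.prod (uniqueDiffOn_Ici 0)

theorem fst_preimage_mem_nhds {p : Phase n × ℝ} (hp : p ∈ punct n) :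
    Prod.fst ⁻¹' ({0}ᶜ : Set (Phase n)) ∈ 𝓝 p :=
  continuous_fst.continuousAt.preimage_mem_nhds (isOpen_compl_singleton.mem_nhds (mem_punct.1 hp).1)

/-- Removing z = 0 is an open condition, so near a point of the domain the derivative within the
whole half space is the derivative within the domain. One derivative operator then serves for
symbols and for homogeneous functions. -/
theorem hasFDerivWithinAt_of_punct {H : Phase n × ℝ → ℂ} (hH : ContDiffOn ℝ ∞ H (punct n))
    {p : Phase n × ℝ} (hp : p ∈ punct n) :
    HasFDerivWithinAt H (fderivWithin ℝ H (frP n).S p) (frP n).S p := by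
  have h := hH.differentiableOn (by simp) p hp
  rw [punct_eq, differentiableWithinAt_inter (fst_preimage_mem_nhds hp)] at h
  exact h.hasFDerivWithinAt

theorem contDiffOn_D_punct {H : Phase n × ℝ → ℂ} (hH : ContDiffOn ℝ ∞ H (punct n))
    (i : Idx n ⊕ Unit) : ContDiffOn ℝ ∞ ((frP n).D i H) (punct n) := by
  have h : ContDiffOn ℝ ∞ (fderivWithin ℝ H (punct n)) (punct n) :=
    ContDiffOn.fderivWithin hH uniqueDiffOn_punct (by simp)
  refine (h.clm_apply (g := fun _ => (frP n).b i) contDiffOn_const).congr fun p hp => ?_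
  rw [punct_eq, fderivWithin_inter (fst_preimage_mem_nhds hp), Frame.D]

/-- Homogeneous symbols, in projective coordinates. -/
structure HomSym (d ν : ℝ) (H : Phase n × ℝ → ℂ) : Prop where
  smooth : ContDiffOn ℝ ∞ H (punct n)
  hom : ∀ t : ℝ, 0 < t → ∀ p ∈ punct n, H (t • p) = ((t ^ d : ℝ) : ℂ) * H p
  taylor : ∃ Q : ℝ × Phase n → ℂ, ContDiffOn ℝ ∞ Q (Ici 0 ×ˢ {0}ᶜ) ∧
    ∀ r : ℝ, 0 < r → ∀ w : Phase n, w ≠ 0 → H (r • w, 1) = ((r ^ ν : ℝ) : ℂ) * Q (r, w)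

/-- Restriction to the hyperplane μ = 1 replaces restriction to the sphere. This form has no square
roots and is easy to differentiate in z. -/
theorem HomSym.of_memBoldHom {d ν : ℝ} {h : Phase n → ℝ → ℂ} (hh : MemBoldHom d ν h) :
    HomSym d ν (fun p => h p.1 p.2) := by
  refine ⟨hh.smooth, fun t ht p hp => hh.homogeneous t ht _ (mem_punct.1 hp).1 _ (mem_punct.1 hp).2, ?_⟩
  obtain ⟨g, hg, hgh⟩ := hh.taylor
  -- The length of (r w, 1). Dividing by it moves the point to the unit sphere, at polar radius
  -- r|w|/s; homogeneity accounts for the powers of s.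
  set s : ℝ × Phase n → ℝ := fun q => Real.sqrt (1 + (q.1 * ‖q.2‖) ^ 2) with hs
  have hs0 : ∀ q, 0 < s q := fun q => Real.sqrt_pos.2 (by positivity)
  have hs2 : ∀ q, s q ^ 2 = 1 + (q.1 * ‖q.2‖) ^ 2 := fun q => Real.sq_sqrt (by positivity)
  have cn : ContDiffOn ℝ ∞ (fun q : ℝ × Phase n => ‖q.2‖) (Ici 0 ×ˢ {0}ᶜ) :=
    contDiffOn_snd.norm ℝ fun q hq => hq.2
  have cρ : ContDiffOn ℝ ∞ (fun q : ℝ × Phase n => q.1 * ‖q.2‖) (Ici 0 ×ˢ {0}ᶜ) :=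
    contDiffOn_fst.mul cn
  have cs : ContDiffOn ℝ ∞ s (Ici 0 ×ˢ {0}ᶜ) :=
    (contDiffOn_const.add (cρ.pow 2)).sqrt fun q _ => by positivity
  refine ⟨fun q => ((s q ^ (d - ν) * ‖q.2‖ ^ ν : ℝ) : ℂ) *
    g (q.1 * ‖q.2‖ / s q, ‖q.2‖⁻¹ • q.2), ?_, fun r hr w hw => ?_⟩
  · refine ContDiffOn.mul ?_ ?_
    · refine Complex.ofRealCLM.contDiff.comp_contDiffOn ?_
      exact (cs.rpow_const_of_ne fun q _ => (hs0 q).ne').mul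
        (cn.rpow_const_of_ne fun q hq => norm_ne_zero_iff.2 hq.2)
    · refine hg.comp ((cρ.div cs fun q _ => (hs0 q).ne').prodMk
        ((cn.inv fun q hq => norm_ne_zero_iff.2 hq.2).smul contDiffOn_snd)) fun q hq => ?_
      have h1 : 0 ≤ q.1 * ‖q.2‖ := mul_nonneg hq.1 (norm_nonneg _)
      refine ⟨⟨div_nonneg h1 (hs0 q).le, ?_⟩, ?_⟩
      · rw [div_lt_one (hs0 q)]
        nlinarith [hs2 q, hs0 q]
      · exact smul_ne_zero (inv_ne_zero (norm_ne_zero_iff.2 hq.2)) hq.2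
  · have hw0 : 0 < ‖w‖ := norm_pos_iff.2 hw
    set σ := s (r, w) with hσ
    have hσ0 : 0 < σ := hs0 _
    have hσ2 : σ ^ 2 = 1 + (r * ‖w‖) ^ 2 := hs2 _
    have hρ : 0 < r * ‖w‖ := by positivity
    have h1 : r * ‖w‖ / σ < 1 := by
      rw [div_lt_one hσ0]; nlinarith
    have h2 := hgh (r * ‖w‖ / σ) (by positivity) h1 (‖w‖⁻¹ • w) (by
      rw [norm_smul, norm_inv, norm_norm, inv_mul_cancel₀ hw0.ne'])
    have h3 : Real.sqrt (1 - (r * ‖w‖ / σ) ^ 2) = σ⁻¹ := by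
      rw [Real.sqrt_eq_iff_mul_self_eq_of_pos (by positivity)]
      field_simp
      linarith
    have h4 : (r * ‖w‖ / σ) • (‖w‖⁻¹ • w) = σ⁻¹ • (r • w) := by
      rw [smul_smul, smul_smul]; congr 1; field_simp
    have h5 := hh.homogeneous σ⁻¹ (by positivity) (r • w) (smul_ne_zero hr.ne' hw) 1 zero_le_one
    rw [mul_one] at h5
    rw [h3, h4, h5] at h2
    simp only
    rw [h2, ← mul_assoc, ← mul_assoc, ← mul_assoc, ← Complex.ofReal_mul, ← Complex.ofReal_mul,
      ← Complex.ofReal_mul]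
    have h6 : r ^ ν * (σ ^ (d - ν) * ‖w‖ ^ ν) * (r * ‖w‖ / σ) ^ (-ν) * σ⁻¹ ^ d = 1 := by
      rw [Real.rpow_neg (by positivity), Real.div_rpow (by positivity) hσ0.le,
        Real.mul_rpow hr.le hw0.le, Real.inv_rpow hσ0.le, Real.rpow_sub hσ0]
      have a1 := (Real.rpow_pos_of_pos hr ν).ne'
      have a2 := (Real.rpow_pos_of_pos hw0 ν).ne'
      have a3 := (Real.rpow_pos_of_pos hσ0 ν).ne'
      have a4 := (Real.rpow_pos_of_pos hσ0 d).ne'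
      field_simp
    rw [h6, Complex.ofReal_one, one_mul]

/-- The point (rφ, σ) with σ = √(1-r²) is σ times ((r/σ)φ, 1), and r/σ is smooth up to r = 0 for r <
1. -/
theorem HomSym.memBoldHom {d ν : ℝ} {H : Phase n × ℝ → ℂ} (hH : HomSym d ν H) :
    MemBoldHom d ν (fun z μ => H (z, μ)) := by
  refine ⟨hH.smooth, fun t ht z hz μ hμ => hH.hom t ht (z, μ) (mem_punct.2 ⟨hz, hμ⟩), ?_⟩
  obtain ⟨Q, hQ, h⟩ := hH.taylor
  have hpos : ∀ q ∈ (Ico 0 1 : Set ℝ) ×ˢ ({0}ᶜ : Set (Phase n)), 0 < 1 - q.1 ^ 2 := fun q hq => by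
    nlinarith [hq.1.1, hq.1.2]
  have cs : ContDiffOn ℝ ∞ (fun q : ℝ × Phase n => Real.sqrt (1 - q.1 ^ 2)) (Ico 0 1 ×ˢ {0}ᶜ) :=
    (contDiffOn_const.sub (contDiffOn_fst.pow 2)).sqrt fun q hq => (hpos q hq).ne'
  have hs0 : ∀ q ∈ (Ico 0 1 : Set ℝ) ×ˢ ({0}ᶜ : Set (Phase n)), 0 < Real.sqrt (1 - q.1 ^ 2) :=
    fun q hq => Real.sqrt_pos.2 (hpos q hq)
  refine ⟨fun q => ((Real.sqrt (1 - q.1 ^ 2) ^ (d - ν) : ℝ) : ℂ) *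
    Q (q.1 / Real.sqrt (1 - q.1 ^ 2), q.2), ?_, fun r hr hr1 φ hφ => ?_⟩
  · refine ContDiffOn.mul ?_ ?_
    · exact Complex.ofRealCLM.contDiff.comp_contDiffOn (cs.rpow_const_of_ne fun q hq => (hs0 q hq).ne')
    · exact hQ.comp ((contDiffOn_fst.div cs fun q hq => (hs0 q hq).ne').prodMk contDiffOn_snd)
        fun q hq => ⟨div_nonneg hq.1.1 (hs0 q hq).le, hq.2⟩
  · have hφ0 : φ ≠ 0 := by rintro rfl; simp at hφ
    set σ := Real.sqrt (1 - r ^ 2) with hσ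
    have hσ0 : 0 < σ := hs0 (r, φ) ⟨⟨hr.le, hr1⟩, hφ0⟩
    have h1 := hH.hom σ hσ0 ((r / σ) • φ, 1) (mem_punct.2 ⟨smul_ne_zero (by positivity) hφ0, zero_le_one⟩)
    rw [h _ (by positivity) φ hφ0, Prod.smul_mk, smul_smul, mul_div_cancel₀ _ hσ0.ne', smul_eq_mul,
      mul_one] at h1
    simp only
    rw [h1, ← mul_assoc, ← mul_assoc, ← Complex.ofReal_mul, ← Complex.ofReal_mul]
    congr 2
    rw [Real.div_rpow hr.le hσ0.le, Real.rpow_neg hr.le, Real.rpow_sub hσ0]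
    have a1 := (Real.rpow_pos_of_pos hr ν).ne'
    have a3 := (Real.rpow_pos_of_pos hσ0 ν).ne'
    field_simp

theorem HomSym.zero (d ν : ℝ) : HomSym d ν (fun _ : Phase n × ℝ => (0 : ℂ)) :=
  ⟨contDiffOn_const, by simp, fun _ => 0, contDiffOn_const, by simp⟩

theorem HomSym.add {d ν : ℝ} {H H' : Phase n × ℝ → ℂ} (hH : HomSym d ν H) (hH' : HomSym d ν H') :
    HomSym d ν (fun p => H p + H' p) := by
  obtain ⟨Q, hQ, h⟩ := hH.taylor
  obtain ⟨Q', hQ', h'⟩ := hH'.taylor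
  refine ⟨hH.smooth.add hH'.smooth, fun t ht p hp => ?_, fun q => Q q + Q' q, hQ.add hQ',
    fun r hr w hw => ?_⟩
  · rw [hH.hom t ht p hp, hH'.hom t ht p hp, mul_add]
  · rw [h r hr w hw, h' r hr w hw, mul_add]

theorem HomSym.const_mul {d ν : ℝ} {H : Phase n × ℝ → ℂ} (hH : HomSym d ν H) (k : ℂ) :
    HomSym d ν (fun p => k * H p) := by
  obtain ⟨Q, hQ, h⟩ := hH.taylor
  refine ⟨contDiffOn_const.mul hH.smooth, fun t ht p hp => ?_, fun q => k * Q q,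
    contDiffOn_const.mul hQ, fun r hr w hw => ?_⟩
  · rw [hH.hom t ht p hp, mul_left_comm]
  · rw [h r hr w hw, mul_left_comm]

theorem HomSym.sum {κ : Type*} {s : Finset κ} {d ν : ℝ} {H : κ → Phase n × ℝ → ℂ}
    (hH : ∀ k ∈ s, HomSym d ν (H k)) : HomSym d ν (fun p => ∑ k ∈ s, H k p) := by
  classical
  induction s using Finset.induction_on with
  | empty => simpa using HomSym.zero d ν
  | insert a s ha ih =>
    simp only [Finset.sum_insert ha]
    exact (hH a (by simp)).add (ih fun k hk => hH k (by simp [hk]))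

theorem HomSym.conj {d ν : ℝ} {H : Phase n × ℝ → ℂ} (hH : HomSym d ν H) :
    HomSym d ν (fun p => conj (H p)) := by
  obtain ⟨Q, hQ, h⟩ := hH.taylor
  have hc : ContDiff ℝ ∞ (fun z : ℂ => (starRingEnd ℂ) z) := Complex.conjCLE.contDiff
  refine ⟨hc.comp_contDiffOn hH.smooth, fun t ht p hp => ?_, fun q => (starRingEnd ℂ) (Q q),
    hc.comp_contDiffOn hQ, fun r hr w hw => ?_⟩
  · rw [hH.hom t ht p hp, map_mul, Complex.conj_ofReal]
  · rw [h r hr w hw, map_mul, Complex.conj_ofReal]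

/-- Differentiating the homogeneity relation in z releases a factor t, and differentiating H(rw, 1)
= r^ν Q(r, w) in w releases a factor r; dividing by them lowers both orders by one. The new Taylor
function is the w-derivative of Q. -/
theorem HomSym.D_inl {d ν : ℝ} {H : Phase n × ℝ → ℂ} (hH : HomSym d ν H) (i : Idx n) :
    HomSym (d - 1) (ν - 1) ((frP n).D (Sum.inl i) H) := by
  obtain ⟨Q, hQ, h⟩ := hH.taylor
  have hslice : ∀ p ∈ punct n, HasFDerivAt (fun z => H (z, p.2))
      ((fderivWithin ℝ H (frP n).S p).comp (ContinuousLinearMap.inl ℝ (Phase n) ℝ)) p.1 := by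
    intro p hp
    have h1 := hasFDerivWithinAt_of_punct hH.smooth hp
    have h2 : HasFDerivWithinAt (fun z : Phase n => (z, p.2)) (ContinuousLinearMap.inl ℝ (Phase n) ℝ)
      univ p.1 := (hasFDerivAt_prodMk_left p.1 p.2).hasFDerivWithinAt
    exact hasFDerivWithinAt_univ.1 (HasFDerivWithinAt.comp p.1 (t := (frP n).S) h1 h2
      fun z _ => mem_frP.2 (mem_punct.1 hp).2)
  -- the derivative of a rescaled slice
  have hscale : ∀ t : ℝ, ∀ p : Phase n × ℝ, (t • p.1, p.2) ∈ punct n →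
      fderiv ℝ (fun z => H (t • z, p.2)) p.1 ((frE n).b i) =
        t * (frP n).D (Sum.inl i) H (t • p.1, p.2) := by
    intro t p hp
    have h1 := (hslice _ hp).comp p.1 ((hasFDerivAt_id p.1).const_smul t)
    have h2 : fderiv ℝ (fun z => H (t • z, p.2)) p.1 = _ := h1.fderiv
    rw [h2]
    have e : (frP n).b (Sum.inl i) = ((frE n).b i, 0) := rfl
    simp [Frame.D, e]
  refine ⟨contDiffOn_D_punct hH.smooth _, fun t ht p hp => ?_,
    fun q => fderivWithin ℝ Q (Ici 0 ×ˢ {0}ᶜ) q (0, (frE n).b i), ?_, fun r hr w hw => ?_⟩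
  · have hp' := mem_punct.1 hp
    have h1 := hscale t (p.1, t * p.2) (smul_mem_punct hp ht)
    have h2 : (fun z => H (t • z, t * p.2)) =ᶠ[𝓝 p.1]
        fun z => ((t ^ d : ℝ) : ℂ) * H (z, p.2) := by
      filter_upwards [isOpen_compl_singleton.mem_nhds hp'.1] with z hz
      exact hH.hom t ht (z, p.2) (mem_punct.2 ⟨hz, hp'.2⟩)
    simp only at h1
    rw [h2.fderiv_eq, ((hslice p hp).const_mul _).fderiv] at h1
    have e : (frP n).D (Sum.inl i) H p = fderivWithin ℝ H (frP n).S p ((frE n).b i, 0) := rfl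
    have h3 : ((t ^ d : ℝ) : ℂ) * (frP n).D (Sum.inl i) H p = t * (frP n).D (Sum.inl i) H (t • p) := by
      rw [e, show t • p = (t • p.1, t * p.2) from rfl]; simpa using h1
    rw [Real.rpow_sub_one ht.ne']
    have ht' : (t : ℂ) ≠ 0 := by exact_mod_cast ht.ne'
    push_cast
    field_simp
    rw [h3, mul_comm]
  · refine ContDiffOn.clm_apply (ContDiffOn.fderivWithin hQ ?_ (by simp)) contDiffOn_const
    exact (uniqueDiffOn_Ici 0).prod isOpen_compl_singleton.uniqueDiffOn
  · have h1 := hscale r (w, 1) (mem_punct.2 ⟨smul_ne_zero hr.ne' hw, zero_le_one⟩)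
    have h2 : (fun z => H (r • z, 1)) =ᶠ[𝓝 w] fun z => ((r ^ ν : ℝ) : ℂ) * Q (r, z) := by
      filter_upwards [isOpen_compl_singleton.mem_nhds hw] with z hz
      exact h r hr z hz
    have h3 : HasFDerivAt (fun z => Q (r, z)) ((fderivWithin ℝ Q (Ici 0 ×ˢ {0}ᶜ) (r, w)).comp
        (ContinuousLinearMap.inr ℝ ℝ (Phase n))) w := by
      have h4 := (hQ.differentiableOn (by simp) (r, w) ⟨hr.le, hw⟩).hasFDerivWithinAt
      have h5 : HasFDerivWithinAt (fun z : Phase n => (r, z)) (ContinuousLinearMap.inr ℝ ℝ (Phase n))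
        {0}ᶜ w := (hasFDerivAt_prodMk_right r w).hasFDerivWithinAt
      exact (HasFDerivWithinAt.comp w h4 h5 fun z hz => ⟨hr.le, hz⟩).hasFDerivAt
        (isOpen_compl_singleton.mem_nhds hw)
    simp only at h1
    rw [h2.fderiv_eq, (h3.const_mul _).fderiv] at h1
    rw [Real.rpow_sub_one hr.ne']
    have hr' : (r : ℂ) ≠ 0 := by exact_mod_cast hr.ne'
    push_cast
    field_simp
    rw [mul_comm, ← h1]
    simp

end

section

variable {n : ℕ}

/-! ### Dilations -/

theorem smul_mem_frP {p : Phase n × ℝ} (hp : p ∈ (frP n).S) {t : ℝ} (ht : 0 ≤ t) :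
    t • p ∈ (frP n).S := mem_frP.2 (mul_nonneg ht (mem_frP.1 hp))

theorem jap_smul_comparable (z : Phase n) {t : ℝ} (ht : 1 ≤ t) :
    jap (t • z) ≤ t * jap z ∧ jap z ≤ jap (t • z) := by
  have h1 := one_le_pow₀ (n := 2) ht
  constructor
  · refine Real.sqrt_le_iff.2 ⟨mul_nonneg (by linarith) (jap_pos z).le, ?_⟩
    rw [mul_pow, jap_sq, norm_smul, mul_pow, Real.norm_eq_abs, sq_abs]
    nlinarith
  · refine Real.sqrt_le_sqrt ?_
    rw [norm_smul, mul_pow, Real.norm_eq_abs, sq_abs]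
    nlinarith [sq_nonneg ‖z‖]

theorem japPar_smul_comparable (z : Phase n) (μ : ℝ) {t : ℝ} (ht : 1 ≤ t) :
    japPar (t • z) (t * μ) ≤ t * japPar z μ ∧ japPar z μ ≤ japPar (t • z) (t * μ) := by
  have h1 := one_le_pow₀ (n := 2) ht
  constructor
  · refine Real.sqrt_le_iff.2 ⟨mul_nonneg (by linarith) (japPar_pos z μ).le, ?_⟩
    rw [mul_pow t (japPar z μ), japPar_sq, norm_smul, mul_pow, mul_pow, Real.norm_eq_abs, sq_abs]
    nlinarith
  · refine Real.sqrt_le_sqrt ?_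
    rw [norm_smul, mul_pow, Real.norm_eq_abs, sq_abs]
    nlinarith [sq_nonneg ‖z‖, sq_nonneg μ]

theorem SymP.dilate {d ν : ℝ} {f : Phase n × ℝ → ℂ} (hf : SymP d ν f) {t : ℝ} (ht : 1 ≤ t) :
    SymP d ν (fun p => f (t • p)) := by
  have ht0 : 0 < t := by linarith
  refine Frame.Sym.comp hf (fun p => t • p) (t • ContinuousLinearMap.id ℝ _)
    (fun p _ => ((hasFDerivAt_id p).const_smul t).hasFDerivWithinAt)
    (fun p hp => smul_mem_frP hp ht0.le) id (fun _ => t) (fun k => by simp) t ht0.le ?_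
    (t ^ |ν| * t ^ |d - ν|) (by positivity) (fun p _ => ?_) fun p _ => (wP_pos d ν p).le
  · rintro (i | i) p -
    · rw [abs_of_pos ht0]
      exact mul_le_mul_of_nonneg_left (inv_anti₀ (jap_pos _) (jap_smul_comparable p.1 ht).2) ht0.le
    · rw [abs_of_pos ht0]
      exact mul_le_mul_of_nonneg_left
        (inv_anti₀ (japPar_pos _ _) (japPar_smul_comparable p.1 p.2 ht).2) ht0.le
  · have h1 := jap_smul_comparable p.1 ht
    have h2 := japPar_smul_comparable p.1 p.2 ht
    have a1 := rpow_le_of_comparable (jap_pos _) (jap_pos _) ht0 h1.1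
      (h1.2.trans (le_mul_of_one_le_left (jap_pos _).le ht)) ν
    have a2 := rpow_le_of_comparable (japPar_pos _ _) (japPar_pos _ _) ht0 h2.1
      (h2.2.trans (le_mul_of_one_le_left (japPar_pos _ _).le ht)) (d - ν)
    calc wP n d ν (t • p) ≤ (t ^ |ν| * jap p.1 ^ ν) * (t ^ |d - ν| * japPar p.1 p.2 ^ (d - ν)) :=
          mul_le_mul a1 a2 (Real.rpow_nonneg (japPar_pos _ _).le _)
            (mul_nonneg (by positivity) (Real.rpow_nonneg (jap_pos _).le _))
      _ = _ := by rw [wP]; ring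

theorem MemS.dilate {ν : ℝ} {c : Phase n → ℂ} (hc : MemS ν c) {t : ℝ} (ht : 1 ≤ t) :
    MemS ν (fun z => c (t • z)) := by
  rw [memS_iff] at hc ⊢
  exact hc.dilate ht

/-- The squares differ by the constant t⁻² - 1, so a dilated expansion can be rewritten in powers of
⟨z,μ⟩ by a change of basis. -/
theorem isBasis_dilate {t : ℝ} (ht : 1 ≤ t) : IsBasis (fun p : Phase n × ℝ => t⁻¹ * lam (t • p)) := by
  have ht0 : 0 < t := by linarith
  refine ⟨?_, fun p _ => mul_pos (inv_pos.2 ht0) (lam_pos _), (t⁻¹) ^ 2 - 1, 0, fun p _ _ => ?_⟩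
  · have h : ContDiffOn ℝ ∞ (lam : Phase n × ℝ → ℝ) (frP n).S := smooth_lam
    exact contDiffOn_const.mul (h.comp (contDiff_const_smul t).contDiffOn
      fun p hp => smul_mem_frP hp ht0.le)
  · simp only [lam]
    rw [mul_pow, japPar_sq, japPar_sq, Prod.smul_fst, Prod.smul_snd, norm_smul, smul_eq_mul, mul_pow,
      mul_pow, Real.norm_eq_abs, sq_abs]
    field_simp
    ring

theorem Bold.dilate {d ν : ℝ} {f : Phase n × ℝ → ℂ} (hf : Bold d ν f) {t : ℝ} (ht : 1 ≤ t) :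
    Bold d ν (fun p => f (t • p)) := by
  have ht0 : 0 < t := by linarith
  intro N
  obtain ⟨c, hc, h⟩ := hf N
  refine BoldN.change isBasis_lam (isBasis_dilate ht) ⟨fun j z => ((t ^ (d - ν - j) : ℝ) : ℂ) *
    c j (t • z), fun j => ((hc j).dilate ht).const_mul _, (h.dilate ht).congr fun p _ => ?_⟩
  simp only
  congr 1
  refine Finset.sum_congr rfl fun j _ => ?_
  rw [Real.mul_rpow (inv_pos.2 ht0).le (lam_pos _).le, Real.inv_rpow ht0.le]
  have : ((t ^ (d - ν - j) : ℝ) : ℂ) ≠ 0 := by exact_mod_cast (Real.rpow_pos_of_pos ht0 _).ne'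
  push_cast
  rw [Prod.smul_fst]
  field_simp

/-! ### Symbols of order minus infinity -/

/-- Symbols of order minus infinity in `z`. -/
def BoldInf (s : ℝ) (f : Phase n × ℝ → ℂ) : Prop := ∀ ν, Bold (ν + s) ν f

theorem BoldInf.congr {s : ℝ} {f f' : Phase n × ℝ → ℂ} (hf : BoldInf s f) (h : EqOn f' f (frP n).S) :
    BoldInf s f' := fun ν => (hf ν).congr h

theorem BoldInf.add {s : ℝ} {f f' : Phase n × ℝ → ℂ} (hf : BoldInf s f) (hf' : BoldInf s f') :
    BoldInf s (fun p => f p + f' p) := fun ν => (hf ν).add (hf' ν)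

theorem BoldInf.D_inl {s : ℝ} {f : Phase n × ℝ → ℂ} (hf : BoldInf s f) (i : Idx n) :
    BoldInf s ((frP n).D (Sum.inl i) f) := fun ν => by
  have := (hf (ν + 1)).D_inl i
  rwa [add_sub_cancel_right, add_right_comm, add_sub_cancel_right] at this

theorem memS_one : MemS 0 (fun _ : Phase n => (1 : ℂ)) := by
  rw [memS_iff]
  simpa [wP, SymP] using (Frame.sym_const (𝔽 := frP n) (G := gP n) (1 : ℂ)).congr
    (f' := fun _ => (1 : ℂ)) (fun _ _ => rfl) |>.mono_le (m' := wP n 0 0) (fun p _ => by simp [wP])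

/-- Multiplication by the constant 1, regarded as a symbol of order ν' - ν, raises the order and the
regularity together. -/
theorem Bold.mono {s ν ν' : ℝ} (h : ν ≤ ν') {f : Phase n × ℝ → ℂ} (hf : Bold (ν + s) ν f) :
    Bold (ν' + s) ν' f := by
  have := (memS_one.mono (sub_nonneg.2 h)).bold_mul hf
  simp only [one_mul, add_sub_cancel] at this
  rwa [show ν + s + (ν' - ν) = ν' + s by ring] at this

theorem IsZeroExcision.exists_eq_one {χ : Phase n → ℝ} (hχ : IsZeroExcision χ) :
    ∃ R : ℝ, ∀ z : Phase n, R ≤ ‖z‖ → χ z = 1 := by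
  have := hχ.one_far
  rw [← Metric.cobounded_eq_cocompact, ← comap_norm_atTop, eventually_comap] at this
  obtain ⟨R, h⟩ := eventually_atTop.1 this
  exact ⟨R, fun z hz => h _ hz z rfl⟩

/-- Cutting off a homogeneous symbol to a compact set away from the origin. -/
theorem HomSym.boldInf_cutoff {χ : Phase n → ℝ} (hχ : IsZeroExcision χ) {s ν : ℝ}
    {H : Phase n × ℝ → ℂ} (hH : HomSym (ν + s) ν H) (hb : Bold (ν + s) ν (fun p => χ p.1 * H p))
    {b : Phase n → ℂ} (hbs : ContDiff ℝ ∞ b) (h0 : ∀ᶠ z in 𝓝 0, b z = 0) {R : ℝ}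
    (hR : ∀ z, R < ‖z‖ → b z = 0) : BoldInf s (fun p => b p.1 * H p) := by
  obtain ⟨δ, hδ, hδb⟩ := Metric.eventually_nhds_iff.1 h0
  obtain ⟨R', hR'⟩ := hχ.exists_eq_one
  -- Dilation by t moves every z with |z| ≥ δ into the region where χ = 1. On the support of b, H is
  -- therefore a constant times the dilate of χH, whose expansion at infinity is known, and b
  -- belongs to symbol classes of every order.
  set t := max 1 (R' / δ) with ht
  have ht1 : 1 ≤ t := le_max_left _ _
  have ht0 : 0 < t := by linarith
  intro κ
  have h1 := ((memS_of_compact hbs R hR (κ - ν)).bold_mul (hb.dilate ht1)).const_mul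
    ((t ^ (ν + s) : ℝ) : ℂ)⁻¹
  rw [show ν + s + (κ - ν) = κ + s by ring, add_sub_cancel] at h1
  refine h1.congr fun p hp => ?_
  have ht' : ((t ^ (ν + s) : ℝ) : ℂ) ≠ 0 := by exact_mod_cast (Real.rpow_pos_of_pos ht0 _).ne'
  simp only
  by_cases hz : dist p.1 0 < δ
  · rw [hδb hz]; simp
  · rw [dist_zero_right, not_lt] at hz
    have hz0 : p.1 ≠ 0 := by rintro h; rw [h, norm_zero] at hz; linarith
    have hχ1 : χ (t • p).1 = 1 := by
      refine hR' _ ?_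
      rw [Prod.smul_fst, norm_smul, Real.norm_of_nonneg ht0.le]
      calc R' = R' / δ * δ := by field_simp
        _ ≤ t * ‖p.1‖ := mul_le_mul (le_max_right _ _) hz hδ.le ht0.le
    rw [hχ1, hH.hom t ht0 p (mem_punct.2 ⟨hz0, mem_frP.1 hp⟩)]
    push_cast
    field_simp

/-! ### Homogeneous leading parts -/

/-- The symbol `f` agrees with the homogeneous symbol `H` up to order minus infinity in `z`. -/
structure Leads (χ : Phase n → ℝ) (s ν : ℝ) (f H : Phase n × ℝ → ℂ) : Prop where
  hom : HomSym (ν + s) ν H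
  bold : Bold (ν + s) ν f
  inf : BoldInf s (fun p => f p - χ p.1 * H p)

variable {χ : Phase n → ℝ} {s ν : ℝ}

theorem Leads.excise {f H : Phase n × ℝ → ℂ} (h : Leads χ s ν f H) :
    Bold (ν + s) ν (fun p => χ p.1 * H p) :=
  (h.bold.sub (h.inf ν)).congr fun p _ => by simp

theorem Leads.zero (χ : Phase n → ℝ) (s ν : ℝ) : Leads χ s ν (fun _ => 0) (fun _ => 0) :=
  ⟨HomSym.zero _ _, Bold.zero _ _, fun ν => by simpa using Bold.zero (n := n) (ν + s) ν⟩

theorem Leads.const_mul {f H : Phase n × ℝ → ℂ} (h : Leads χ s ν f H) (k : ℂ) :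
    Leads χ s ν (fun p => k * f p) (fun p => k * H p) :=
  ⟨h.hom.const_mul k, h.bold.const_mul k, fun ν => ((h.inf ν).const_mul k).congr
    fun p _ => by simp only; ring⟩

theorem Leads.sum {ι : Type*} {t : Finset ι} {f H : ι → Phase n × ℝ → ℂ}
    (h : ∀ k ∈ t, Leads χ s ν (f k) (H k)) :
    Leads χ s ν (fun p => ∑ k ∈ t, f k p) (fun p => ∑ k ∈ t, H k p) :=
  ⟨HomSym.sum fun k hk => (h k hk).hom, Bold.sum fun k hk => (h k hk).bold, fun ν =>
    (Bold.sum fun k hk => (h k hk).inf ν).congr fun p _ => by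
      simp only [Finset.mul_sum, Finset.sum_sub_distrib]⟩

theorem Leads.conj {f H : Phase n × ℝ → ℂ} (h : Leads χ s ν f H) :
    Leads χ s ν (fun p => conj (f p)) (fun p => conj (H p)) :=
  ⟨h.hom.conj, h.bold.conj, fun ν => (h.inf ν).conj.congr fun p _ => by simp⟩

/-- The derivative of f - χH differs from ∂f - χ ∂H by (∂χ)H. As ∂χ is supported in a compact set
away from the origin, that term has order minus infinity in z. -/
theorem Leads.D_inl (hχ : IsZeroExcision χ) {f H : Phase n × ℝ → ℂ} (h : Leads χ s ν f H)
    (i : Idx n) : Leads χ s (ν - 1) ((frP n).D (Sum.inl i) f) ((frP n).D (Sum.inl i) H) := by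
  have e1 : ν - 1 + s = ν + s - 1 := by ring
  refine ⟨by rw [e1]; exact h.hom.D_inl i, by rw [e1]; exact h.bold.D_inl i, ?_⟩
  have hχs : ContDiff ℝ ∞ (fun z => (χ z : ℂ)) := Complex.ofRealCLM.contDiff.comp hχ.smooth
  have hχ' : (frP n).Smooth (fun p : Phase n × ℝ => (χ p.1 : ℂ)) :=
    (hχs.comp contDiff_fst).contDiffOn
  set b : Phase n → ℂ := fun z => fderiv ℝ (fun z => (χ z : ℂ)) z ((frE n).b i) with hb
  have hbs : ContDiff ℝ ∞ b := (hχs.fderiv_right (by simp)).clm_apply contDiff_const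
  have h0 : ∀ᶠ z in 𝓝 0, b z = 0 := by
    filter_upwards [eventually_eventually_nhds.2 hχ.zero_near] with z hz
    have : (fun z => (χ z : ℂ)) =ᶠ[𝓝 z] fun _ => 0 := by
      filter_upwards [hz] with w hw
      simp [hw]
    simp [hb, this.fderiv_eq]
  obtain ⟨R, hR⟩ := hχ.exists_eq_one
  have hbR : ∀ z, R < ‖z‖ → b z = 0 := fun z hz => by
    have : (fun z => (χ z : ℂ)) =ᶠ[𝓝 z] fun _ => 1 := by
      filter_upwards [(isOpen_lt continuous_const continuous_norm).mem_nhds hz] with w hw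
      simp [hR w (le_of_lt hw)]
    simp [hb, this.fderiv_eq]
  have h1 := h.hom.boldInf_cutoff hχ h.excise hbs h0 hbR
  refine ((h.inf.D_inl i).add h1).congr fun p hp => ?_
  have hs := h.excise.symP.smooth
  simp only
  rw [Frame.D_sub h.bold.symP.smooth hs _ hp]
  suffices e : (frP n).D (Sum.inl i) (fun p => (χ p.1 : ℂ) * H p) p =
      b p.1 * H p + χ p.1 * (frP n).D (Sum.inl i) H p by rw [e]; ring
  -- At z = 0 nothing is known about H, but χ vanishes nearby, so both sides are zero; elsewhere the
  -- product rule applies.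
  by_cases hz : p.1 = 0
  · have e2 : (fun p : Phase n × ℝ => (χ p.1 : ℂ) * H p) =ᶠ[𝓝[(frP n).S] p] fun _ => 0 := by
      refine Filter.Eventually.filter_mono nhdsWithin_le_nhds ?_
      have : ∀ᶠ q : Phase n × ℝ in 𝓝 p, χ q.1 = 0 :=
        (continuous_fst.tendsto p).eventually (by rw [hz]; exact hχ.zero_near)
      filter_upwards [this] with q hq
      simp [hq]
    have e3 : χ p.1 = 0 := by rw [hz]; exact hχ.zero_near.self_of_nhds
    have e4 : b p.1 = 0 := by rw [hz]; exact h0.self_of_nhds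
    rw [Frame.D, e2.fderivWithin_eq_of_mem hp, e3, e4]
    simp
  · have hp' : p ∈ punct n := mem_punct.2 ⟨hz, mem_frP.1 hp⟩
    have e2 := (hχ'.hasFDerivWithinAt hp).mul (hasFDerivWithinAt_of_punct h.hom.smooth hp')
    rw [show (fun p : Phase n × ℝ => (χ p.1 : ℂ) * H p) = (fun p => (χ p.1 : ℂ)) * H from rfl,
      Frame.D_eq hp e2]
    have e3 : fderivWithin ℝ (fun p : Phase n × ℝ => (χ p.1 : ℂ)) (frP n).S p ((frP n).b (Sum.inl i)) =
      b p.1 := D_inl_fst (c := fun z => (χ z : ℂ)) hχ' i hp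
    simp [e3, Frame.D]
    ring

theorem Leads.Qop (hχ : IsZeroExcision χ) (m : ℕ) : ∀ {ν : ℝ} {f H : Phase n × ℝ → ℂ},
    Leads χ s ν f H → Leads χ s (ν - m) (Shubin.Qop m f) (Shubin.Qop m H) := by
  induction m using Nat.twoStepInduction with
  | zero => intro ν f H h; simpa [Shubin.Qop] using h
  | one => exact fun _ => Leads.zero _ _ _
  | more m ih _ =>
    intro ν f H h
    refine Leads.const_mul (Leads.sum fun i _ => Leads.const_mul ?_ _) _
    have := ih ((h.D_inl hχ i).D_inl hχ i.swap)
    rwa [show ν - 1 - 1 - (m : ℝ) = ν - (m + 2 : ℕ) by push_cast; ring] at this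

end

section

variable {n : ℕ}

/-! ### Poly-homogeneous symbols -/

theorem Qop_congr (m : ℕ) : ∀ {f f' : Phase n × ℝ → ℂ}, EqOn f f' (frP n).S →
    EqOn (Qop m f) (Qop m f') (frP n).S := by
  induction m using Nat.twoStepInduction with
  | zero => exact fun h => h
  | one => exact fun _ p _ => rfl
  | more m ih _ =>
    intro f f' h p hp
    simp only [Qop]
    congr 1
    exact Finset.sum_congr rfl fun i _ => by rw [ih (Frame.D_congr (Frame.D_congr h _) _) hp]

theorem Qop_add (m : ℕ) : ∀ {f f' : Phase n × ℝ → ℂ}, (frP n).Smooth f → (frP n).Smooth f' →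
    ∀ {p : Phase n × ℝ}, p ∈ (frP n).S → Qop m (fun p => f p + f' p) p = Qop m f p + Qop m f' p := by
  induction m using Nat.twoStepInduction with
  | zero => exact fun _ _ _ _ => rfl
  | one => exact fun _ _ _ _ => by simp [Qop]
  | more m ih _ =>
    intro f f' hf hf' p hp
    simp only [Qop]
    rw [← mul_add, ← Finset.sum_add_distrib]
    congr 1
    refine Finset.sum_congr rfl fun i _ => ?_
    have h1 : EqOn ((frP n).D (Sum.inl i.swap) ((frP n).D (Sum.inl i) fun p => f p + f' p))
        (fun p => (frP n).D (Sum.inl i.swap) ((frP n).D (Sum.inl i) f) p +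
          (frP n).D (Sum.inl i.swap) ((frP n).D (Sum.inl i) f') p) (frP n).S := fun p hp => by
      rw [Frame.D_congr (fun p hp => Frame.D_add hf hf' (Sum.inl i) hp) _ hp,
        Frame.D_add (hf.D _) (hf'.D _) _ hp]
    rw [Qop_congr m h1 hp, ih ((hf.D _).D _) ((hf'.D _).D _) hp, mul_add]

theorem Qop_zero_fun (m : ℕ) {p : Phase n × ℝ} (hp : p ∈ (frP n).S) :
    Qop m (fun _ => 0) p = 0 := by
  have h := Qop_add m (Frame.smooth_const (𝔽 := frP n) (0 : ℂ)) (Frame.smooth_const (0 : ℂ)) hp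
  simp only [add_zero] at h
  simpa using h

theorem Qop_sum (m : ℕ) {κ : Type*} (s : Finset κ) {f : κ → Phase n × ℝ → ℂ}
    (hf : ∀ k, (frP n).Smooth (f k)) {p : Phase n × ℝ} (hp : p ∈ (frP n).S) :
    Qop m (fun p => ∑ k ∈ s, f k p) p = ∑ k ∈ s, Qop m (f k) p := by
  classical
  induction s using Finset.induction_on with
  | empty => simpa using Qop_zero_fun m hp
  | insert a s ha ih =>
    simp only [Finset.sum_insert ha]
    rw [Qop_add m (hf a) (Frame.Smooth.sum fun k _ => hf k) hp, ih]

variable {br : Phase n → ℝ → ℝ} {χ : Phase n → ℝ} {d ν : ℝ} {a : Phase n → ℝ → ℂ}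
  {h h' : ℕ → Phase n → ℝ → ℂ}

theorem IsHomExpansion.bold (hbr : IsSmoothedLength br) (hh : IsHomExpansion χ br d ν a h) (N : ℕ) :
    Bold (ν - N + (d - ν)) (ν - N) (fun p : Phase n × ℝ =>
      a p.1 p.2 - (χ p.1 : ℂ) * ∑ j ∈ Finset.range N, h j p.1 p.2) := by
  rw [show ν - (N : ℝ) + (d - ν) = d - N by ring]
  exact (memBold_iff hbr).1 (hh.2 N)

/-- The excised component is the difference of two consecutive remainders and inherits their
expansion at infinity. -/
theorem IsHomExpansion.leads (hbr : IsSmoothedLength br) (hh : IsHomExpansion χ br d ν a h) (j : ℕ) :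
    Leads χ (d - ν) (ν - j) (fun p : Phase n × ℝ => (χ p.1 : ℂ) * h j p.1 p.2)
      (fun p => h j p.1 p.2) := by
  refine ⟨?_, ?_, fun ν => by simpa using Bold.zero (n := n) _ ν⟩
  · rw [show ν - (j : ℝ) + (d - ν) = d - j by ring]
    exact HomSym.of_memBoldHom (hh.1 j)
  · have h1 := Bold.mono (ν' := ν - j) (by push_cast; linarith) (hh.bold hbr (j + 1))
    refine ((hh.bold hbr j).sub h1).congr fun p _ => ?_
    simp only [Finset.sum_range_succ]
    ring

/-- The homogeneous components of the adjoint symbol. -/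
def adjHom (h : ℕ → Phase n → ℝ → ℂ) (J : ℕ) (z : Phase n) (μ : ℝ) : ℂ :=
  ∑ m ∈ Finset.range (J + 1), Qop m (fun p => conj (h (J - m) p.1 p.2)) (z, μ)

theorem adjHom_zero (h : ℕ → Phase n → ℝ → ℂ) (z : Phase n) (μ : ℝ) :
    adjHom h 0 z μ = conj (h 0 z μ) := by
  simp [adjHom, Qop]

/-- In the asymptotic expansion of the adjoint, a is replaced by its first N - m excised components
in the term of order m; the error then has the same order for every m. Collecting the terms with m +
j = J gives the component of degree d - J, up to terms of order minus infinity in which χ was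
differentiated. -/
theorem IsHomExpansion.adjPar (hbr : IsSmoothedLength br) (hχ : IsZeroExcision χ)
    (ha : Bold d ν fun p : Phase n × ℝ => a p.1 p.2) (hh : IsHomExpansion χ br d ν a h) :
    IsHomExpansion χ br d ν (adjPar a) (adjHom h) := by
  have hL : ∀ J : ℕ, Leads χ (d - ν) (ν - J)
      (fun p => ∑ m ∈ Finset.range (J + 1), Qop m (fun p : Phase n × ℝ =>
        conj ((χ p.1 : ℂ) * h (J - m) p.1 p.2)) p)
      (fun p => adjHom h J p.1 p.2) := fun J => by
    refine Leads.sum fun m hm => ?_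
    have hm' : m ≤ J := Nat.lt_succ_iff.1 (Finset.mem_range.1 hm)
    have := (hh.leads hbr (J - m)).conj.Qop hχ m
    rwa [show ν - ((J - m : ℕ) : ℝ) - m = ν - J by push_cast [Nat.cast_sub hm']; ring] at this
  refine ⟨fun J => ?_, fun N => (memBold_iff hbr).2 ?_⟩
  · have := (hL J).hom.memBoldHom
    rwa [show ν - (J : ℝ) + (d - ν) = d - J by ring] at this
  · set g : ℕ → Phase n × ℝ → ℂ := fun j p => conj ((χ p.1 : ℂ) * h j p.1 p.2) with hg
    set R : ℕ → Phase n × ℝ → ℂ := fun N p =>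
      conj (a p.1 p.2 - (χ p.1 : ℂ) * ∑ j ∈ Finset.range N, h j p.1 p.2) with hR
    have hgs : ∀ j, (frP n).Smooth (g j) := fun j => (hh.leads hbr j).conj.bold.symP.smooth
    have hRs : ∀ N, (frP n).Smooth (R N) := fun N => (hh.bold hbr N).conj.symP.smooth
    have t1 := Bold.adjPar_sub ha N
    have t2 : ∀ m ∈ Finset.range N, Bold (d - N) (ν - N) (Qop m (R (N - m))) := fun m hm => by
      have hm' : m ≤ N := (Finset.mem_range.1 hm).le
      have := (hh.bold hbr (N - m)).conj.Qop m
      rwa [show ν - ((N - m : ℕ) : ℝ) - m = ν - N by push_cast [Nat.cast_sub hm']; ring,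
        show ν - ((N - m : ℕ) : ℝ) + (d - ν) - m = d - N by push_cast [Nat.cast_sub hm']; ring] at this
    have t3 : ∀ J : ℕ, Bold (d - N) (ν - N) (fun p => ∑ m ∈ Finset.range (J + 1), Qop m (g (J - m)) p -
        χ p.1 * adjHom h J p.1 p.2) := fun J => by
      have := (hL J).inf (ν - N)
      rwa [show ν - (N : ℝ) + (d - ν) = d - N by ring] at this
    refine ((t1.add (Bold.sum t2)).add (Bold.sum (s := Finset.range N) fun J _ => t3 J)).congr
      fun p hp => ?_
    have e1 : ∀ m, Qop m (fun p : Phase n × ℝ => conj (a p.1 p.2)) p =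
        ∑ j ∈ Finset.range (N - m), Qop m (g j) p + Qop m (R (N - m)) p := fun m => by
      rw [← Qop_sum m _ hgs hp, ← Qop_add m (Frame.Smooth.sum fun k _ => hgs k) (hRs _) hp]
      refine Qop_congr m (fun q _ => ?_) hp
      simp only [hg, hR, ← map_sum, ← map_add, ← Finset.mul_sum, add_sub_cancel]
    -- Resummation along the diagonals m + j = J.
    have e2 := Finset.sum_range_diag_flip N fun m j => Qop m (g j) p
    simp only [Finset.sum_sub_distrib]
    rw [Finset.sum_congr rfl fun m _ => e1 m, e2, Finset.sum_add_distrib, Finset.mul_sum]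
    ring

/-- Uniqueness of the homogeneous principal symbol. -/
theorem IsHomExpansion.principal_unique (hbr : IsSmoothedLength br) (hχ : IsZeroExcision χ)
    (hh : IsHomExpansion χ br d ν a h) (hh' : IsHomExpansion χ br d ν a h') {z : Phase n} (hz : z ≠ 0)
    {μ : ℝ} (hμ : 0 ≤ μ) : h 0 z μ = h' 0 z μ := by
  set δ : Phase n × ℝ → ℂ := fun p => h 0 p.1 p.2 - h' 0 p.1 p.2 with hδ
  have hp : (z, μ) ∈ punct n := mem_punct.2 ⟨hz, hμ⟩
  have h1 : ∀ t : ℝ, 0 < t → δ (t • (z, μ)) = ((t ^ d : ℝ) : ℂ) * δ (z, μ) := fun t ht => by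
    have e1 := (hh.1 0).homogeneous t ht z hz μ hμ
    have e2 := (hh'.1 0).homogeneous t ht z hz μ hμ
    rw [Nat.cast_zero, sub_zero] at e1 e2
    simp only [hδ, Prod.smul_mk, smul_eq_mul, e1, e2, mul_sub]
  have h2 : SymP (ν - 1 + (d - ν)) (ν - 1) (fun p => (χ p.1 : ℂ) * δ p) := by
    have b1 := hh.bold hbr 1
    have b2 := hh'.bold hbr 1
    rw [Nat.cast_one] at b1 b2
    refine (b2.sub b1).symP.congr fun p _ => ?_
    simp only [Finset.sum_range_one, hδ]
    ring
  obtain ⟨C, hC, hb⟩ := h2.bound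
  obtain ⟨R, hR⟩ := hχ.exists_eq_one
  have hz0 : 0 < ‖z‖ := norm_pos_iff.2 hz
  -- A constant for which ⟨tz⟩ and ⟨tz,tμ⟩ are comparable to t for all sufficiently large t, with z
  -- and μ fixed.
  set B := japPar z μ + ‖z‖⁻¹ with hB
  have hB0 : 0 < B := add_pos (japPar_pos z μ) (inv_pos.2 hz0)
  set K := C * (B ^ |ν - 1| * B ^ |d - ν|) with hK
  -- Along the ray the difference of the principal symbols grows exactly like t^d, whereas its
  -- excision is a symbol of order d - 1; so it is O(1/t) for every large t and must vanish.
  have key : ∀ᶠ t : ℝ in atTop, ‖δ (z, μ)‖ ≤ K / t := by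
    filter_upwards [eventually_ge_atTop 1, eventually_ge_atTop (R / ‖z‖)] with t ht1 htR
    have ht : 0 < t := by linarith
    have hχ1 : χ (t • z) = 1 := hR _ (by
      rw [norm_smul, Real.norm_of_nonneg ht.le]; exact (div_le_iff₀ hz0).1 htR)
    have b1 := hb (t • (z, μ)) (mem_frP_of_mem_punct (smul_mem_punct hp ht))
    rw [Prod.smul_fst, hχ1, h1 t ht] at b1
    simp only [Complex.ofReal_one, one_mul, norm_mul, Complex.norm_real,
      Real.norm_of_nonneg (Real.rpow_nonneg ht.le d)] at b1
    have c0 : t ≤ ‖z‖⁻¹ * jap (t • z) := by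
      rw [le_inv_mul_iff₀ hz0]
      have := norm_le_jap (t • z)
      rw [norm_smul, Real.norm_of_nonneg ht.le] at this
      linarith
    have c1 := jap_smul_comparable z ht1
    have c2 := japPar_smul_comparable z μ ht1
    have j1 := jap_pos (t • z)
    have j2 := jap_le_japPar (t • z) (t * μ)
    have j3 := inv_pos.2 hz0
    have j4 := japPar_pos z μ
    have j5 := jap_le_japPar z μ
    have w1 := rpow_le_of_comparable j1 ht hB0 (by rw [hB]; nlinarith) (by rw [hB]; nlinarith) (ν - 1)
    have w2 := rpow_le_of_comparable (japPar_pos (t • z) (t * μ)) ht hB0 (by rw [hB]; nlinarith)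
      (by rw [hB]; nlinarith) (d - ν)
    have w3 : wP n (ν - 1 + (d - ν)) (ν - 1) (t • (z, μ)) ≤
        (B ^ |ν - 1| * t ^ (ν - 1)) * (B ^ |d - ν| * t ^ (d - ν)) := by
      rw [wP, add_sub_cancel_left]
      exact mul_le_mul w1 w2 (Real.rpow_nonneg (japPar_pos _ _).le _) (by positivity)
    have e : t ^ (ν - 1) * t ^ (d - ν) = t ^ d / t := by
      rw [← Real.rpow_add ht, ← Real.rpow_sub_one ht.ne']; ring_nf
    have b2 : t ^ d * ‖δ (z, μ)‖ ≤ K * (t ^ d / t) := by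
      refine b1.trans ((mul_le_mul_of_nonneg_left w3 hC).trans (le_of_eq ?_))
      rw [← e, hK]; ring
    have hd := Real.rpow_pos_of_pos ht d
    refine le_of_mul_le_mul_left (b2.trans (le_of_eq ?_)) hd
    ring
  have h3 : ‖δ (z, μ)‖ ≤ 0 := ge_of_tendsto (tendsto_const_nhds.div_atTop tendsto_id) key
  exact sub_eq_zero.1 (norm_le_zero_iff.1 h3)

theorem IsHomPrincipalSymbol.adjPar_eq (hbr : IsSmoothedLength br) (hχ : IsZeroExcision χ)
    (ha : Bold d ν fun p : Phase n × ℝ => a p.1 p.2) {h₀ h₁ : Phase n → ℝ → ℂ}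
    (hh : IsHomPrincipalSymbol χ br d ν a h₀) (hh' : IsHomPrincipalSymbol χ br d ν (adjPar a) h₁)
    {z : Phase n} (hz : z ≠ 0) {μ : ℝ} (hμ : 0 ≤ μ) : h₁ z μ = conj (h₀ z μ) := by
  obtain ⟨h, hh, rfl⟩ := hh
  obtain ⟨h', hh', rfl⟩ := hh'
  rw [← adjHom_zero]
  exact hh'.principal_unique hbr hχ (hh.adjPar hbr hχ ha) hz hμ

theorem IsAngularSymbol.conj_eq {h₀ h₁ : Phase n → ℝ → ℂ} {s s' : Phase n → ℂ}
    (hs : IsAngularSymbol ν h₀ s) (hs' : IsAngularSymbol ν h₁ s')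
    (h : ∀ z : Phase n, z ≠ 0 → ∀ μ : ℝ, 0 ≤ μ → h₁ z μ = conj (h₀ z μ)) {z : Phase n} (hz : z ≠ 0) :
    s' z = conj (s z) := by
  refine tendsto_nhds_unique (hs' z hz) (((Complex.continuous_conj.tendsto _).comp (hs z hz)).congr' ?_)
  filter_upwards [self_mem_nhdsWithin] with r hr
  have hz' : r • (‖z‖⁻¹ • z) ≠ 0 :=
    smul_ne_zero (ne_of_gt hr) (smul_ne_zero (inv_ne_zero (norm_ne_zero_iff.2 hz)) hz)
  simp [h _ hz' _ (Real.sqrt_nonneg _), Complex.conj_ofReal]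

end

end Shubin

end

/-! ### Assembly of the four statements -/

open Shubin in
theorem mainTheorem8 (n : ℕ) (d ν : ℝ)
    (br : Phase n → ℝ → ℝ) (hbr : IsSmoothedLength br)
    (χ : Phase n → ℝ) (hχ : IsZeroExcision χ)
    (a : Phase n → ℝ → ℂ) (ha : MemBold br d ν a) :
    -- for each parameter value, the adjoint symbol is the symbol of the formal adjoint
    (∀ μ : ℝ, 0 ≤ μ → IsFormalAdjointSymbol (fun z => a z μ) (fun z => adjPar a z μ)) ∧
    -- the class is preserved
    MemBold br d ν (adjPar a) ∧
    -- the principal limit symbol of the adjoint is the adjoint of the principal limit symbol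
    (∀ p q : Phase n → ℂ, IsLimitSymbol br d ν a p → IsLimitSymbol br d ν (adjPar a) q →
      q = adj p ∧ IsFormalAdjointSymbol p q) ∧
    -- poly-homogeneity is preserved, with conjugation of the principal symbols
    (MemBoldPoly χ br d ν a →
      MemBoldPoly χ br d ν (adjPar a) ∧
      (∀ h h' : Phase n → ℝ → ℂ, IsHomPrincipalSymbol χ br d ν a h →
        IsHomPrincipalSymbol χ br d ν (adjPar a) h' →
          ∀ z : Phase n, z ≠ 0 → ∀ μ : ℝ, 0 ≤ μ → h' z μ = (starRingEnd ℂ) (h z μ)) ∧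
      (∀ s s' : Phase n → ℂ, IsPrincipalAngularSymbol χ br d ν a s →
        IsPrincipalAngularSymbol χ br d ν (adjPar a) s' →
          ∀ z : Phase n, z ≠ 0 → s' z = (starRingEnd ℂ) (s z))) := by
  have ha' := (memBold_iff hbr).1 ha
  refine ⟨fun μ hμ => (ha'.symP.memS_slice hμ).isFormalAdjointSymbol,
    (memBold_iff hbr).2 (Bold.adjPar ha'), fun p q hp hq => ?_, fun ⟨_, h, hh⟩ => ⟨?_, ?_, ?_⟩⟩
  · obtain ⟨h1, rfl⟩ := eq_adj_of_isLimitSymbol hbr hp hq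
    exact ⟨rfl, h1.isFormalAdjointSymbol⟩
  · exact ⟨(memBold_iff hbr).2 (Bold.adjPar ha'), _, hh.adjPar hbr hχ ha'⟩
  · exact fun h₀ h₁ hh hh' z hz μ hμ => hh.adjPar_eq hbr hχ ha' hh' hz hμ
  · rintro s s' ⟨h₀, hh, hs⟩ ⟨h₁, hh', hs'⟩ z hz
    exact hs.conj_eq hs' (fun z hz μ hμ => hh.adjPar_eq hbr hχ ha' hh' hz hμ) hz
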